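/- Manifolds are smooth, finite-dimensional, Hausdorff and $\sigma$-compact, without boundary. Let $M,N$ be manifolds, let $I\subseteq\mathbb R$ be an open interval containing $0$ and $1$, and let $f:M\to N$, $g:N\to M$, $\eta:I\times M\to M$ and $\varphi:I\times N\to N$ be smooth maps with $\eta_0=\mathrm{id}_M$, $\eta_1=g\circ f$, $\varphi_0=\mathrm{id}_N$, $\varphi_1=f\circ g$ (a smooth homotopy equivalence). For a Lie algebroid $A\to Q$ with anchor $\rho$ and a smooth map $h:P\to Q$, we say that the pullback $h^{!!}A$ exists if the vector spaces $(h^{!!}A)_p=\{(v,a)\in T_pP\times A_{h(p)} : Th(v)=\rho(a)\}$ have locally constant dimension on $P$. Then $h^{!!}A\subseteq TP\oplus h^!A$ is a smooth subbundle and a Lie algebroid over $P$, with anchor $(v,a)\mapsto v$ and with the bracket determined by $$\Big[\big(X,\textstyle\sum_i u_i\,h^!a_i\big),\big(Y,\sum_j w_j\,h^!b_j\big)\Big]=\Big([X,Y],\ \sum_{i,j}u_iw_j\,h^![a_i,b_j]+\sum_j X(w_j)\,h^!b_j-\sum_i Y(u_i)\,h^!a_i\Big),$$ and $p_{A,h}:h^{!!}A\to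 A$, $(v,a)\mapsto a$, is a morphism of Lie algebroids. For a smooth map $\psi:I\times P\to Q$ we say that $(A,\psi)$ is liftable if $\psi^{!!}A$ exists and has a smooth section of the form $(t,x)\mapsto(\partial_t,0_x,y(t,x))$. For a Lie algebroid $A\to Q$ and a flat $A$-connection $\nabla$ on a vector bundle $E\to Q$ (a representation), let $\Omega^k(A,E)=\Gamma(\Lambda^kA^*\otimes E)$, $$(d_\nabla\omega)(a_0,\dots,a_k)=\sum_i(-1)^i\nabla_{a_i}\big(\omega(a_0,\dots,\hat a_i,\dots,a_k)\big)+\sum_{i<j}(-1)^{i+j}\omega([a_i,a_j],a_0,\dots,\hat a_i,\dots,\hat a_j,\dots,a_k),$$ and let $H^\bullet_\nabla(A,E)$ be the cohomology of $(\Omega^\bullet(A,E),d_\nabla)$. For the trivial line bundle with $\nabla_a u=\rho(a)(u)$ this is $H^\bullet(A)$. The exterior product makes $H^\bullet(A)$ a ring and $H^\bullet_\nabla(A,E)$ a module over it. **Theorem.** Let $B\to N$ be a Lie algebroid such that $f^{!!}B$ exists and such that $(B,\varphi)$ and $(f^{!!}B,\eta)$ are liftable. Let $\nabla$ be a flat $B$-connection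 on a vector bundle $E\to N$. Write $p=p_{B,f}$, and let $p^*\nabla$ be the pullback connection of $f^{!!}B$ on $f^!E$, determined by $$(p^*\nabla)_{(X,\sum_i u_i f^!b_i)}\big(\textstyle\sum_j w_j f^!e_j\big)=\sum_j X(w_j)\,f^!e_j+\sum_{i,j}u_iw_j\,f^!(\nabla_{b_i}e_j).$$ Then $p^*\nabla$ is flat. The pullback of forms $\omega\mapsto p^*\omega$, $(p^*\omega)_m(\sigma_1,\dots,\sigma_k)=\omega_{f(m)}(p\sigma_1,\dots,p\sigma_k)$, sends closed forms to closed forms and induces - an isomorphism of graded (unital) rings $H^\bullet(B)\to H^\bullet(f^{!!}B)$, and - an isomorphism $H^\bullet_\nabla(B,E)\to H^\bullet_{p^*\nabla}(f^{!!}B,f^!E)$ of graded modules over this ring isomorphism. The hypotheses on $B$ hold whenever $B$ is transitive, i.e. has surjective anchor: in that case $f^{!!}B$ exists and $(B,\varphi)$ and $(f^{!!}B,\eta)$ are liftable. -/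

import Mathlib

open scoped Manifold ContDiff Topology Bundle TensorProduct
open Set Filter

noncomputable section
set_option linter.unusedSectionVars false

section SmoothVectorBundles

variable {E : Type*} [NormedAddCommGroup E] [NormedSpace ℝ E]
  {H : Type*} [TopologicalSpace H] {I : ModelWithCorners ℝ E H}
  {M : Type*} [TopologicalSpace M] [ChartedSpace H M]

/-- The algebra of smooth real functions. -/
abbrev SmoothFun (I : ModelWithCorners ℝ E H) (M : Type*) [TopologicalSpace M]
    [ChartedSpace H M] := C^∞⟮I, M; 𝓘(ℝ, ℝ), ℝ⟯

/-- A smooth vector bundle of locally finite rank over `M`, with fibres `A x`, given by its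
`C^∞(M)`-module of smooth sections: the sections are closed under multiplication by smooth
functions, membership is a local condition, and around every point there is a frame of smooth
sections, in which every smooth section has smooth coefficients. -/
structure SmoothVectorBundle (I : ModelWithCorners ℝ E H) (M : Type*) [TopologicalSpace M]
    [ChartedSpace H M] (A : M → Type*) [∀ x, AddCommGroup (A x)] [∀ x, Module ℝ (A x)] where
  sections : Submodule ℝ (Π x, A x)
  smul_mem : ∀ (h : SmoothFun I M) (s : Π x, A x), s ∈ sections → (fun x => h x • s x) ∈ sections
  mem_of_locally : ∀ s : Π x, A x,
    (∀ x, ∃ t ∈ sections, ∀ᶠ y in 𝓝 x, s y = t y) → s ∈ sections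
  exists_frame : ∀ x, ∃ (n : ℕ) (e : Fin n → Π x, A x), (∀ i, e i ∈ sections) ∧
    (∀ᶠ y in 𝓝 x, LinearIndependent ℝ (fun i => e i y) ∧
      ⊤ ≤ Submodule.span ℝ (Set.range fun i => e i y)) ∧
    ∀ s ∈ sections, ∃ h : Fin n → SmoothFun I M, ∀ᶠ y in 𝓝 x, s y = ∑ i, h i y • e i y

theorem exists_cutoff [FiniteDimensional ℝ E] [IsManifold I ∞ M] [T2Space M]
    {x : M} {U : Set M} (hU : U ∈ 𝓝 x) :
    ∃ χ : SmoothFun I M, (∀ᶠ y in 𝓝 x, χ y = 1) ∧ tsupport χ ⊆ U := by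
  obtain ⟨f, hf⟩ := (SmoothBumpFunction.nhds_basis_tsupport (I := I) x).mem_iff.1 hU
  exact ⟨⟨f, f.contMDiff⟩, f.eventuallyEq_one, hf.2⟩

/-- Extending a function that is smooth near a point. -/
theorem exists_smoothFun_eventuallyEq [FiniteDimensional ℝ E] [IsManifold I ∞ M] [T2Space M]
    {F : Type*} [NormedAddCommGroup F] [NormedSpace ℝ F]
    {x : M} {u : M → F} {U : Set M} (hU : U ∈ 𝓝 x) (hu : ContMDiffOn I 𝓘(ℝ, F) ∞ u U) :
    ∃ v : C^∞⟮I, M; 𝓘(ℝ, F), F⟯, ∀ᶠ y in 𝓝 x, v y = u y := by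
  obtain ⟨χ, h1, h2⟩ := exists_cutoff (I := I) (interior_mem_nhds.2 hU)
  refine ⟨⟨fun y => χ y • u y, ?_⟩, ?_⟩
  · apply contMDiff_of_tsupport
    intro y hy
    have hy' := h2 (tsupport_smul_subset_left _ _ hy)
    exact χ.contMDiff.contMDiffAt.smul (hu.contMDiffAt (mem_interior_iff_mem_nhds.1 hy'))
  · filter_upwards [h1] with y hy
    simp [hy]

namespace SmoothVectorBundle

variable {A : M → Type*} [∀ x, AddCommGroup (A x)] [∀ x, Module ℝ (A x)]

instance (V : SmoothVectorBundle I M A) : SMul (SmoothFun I M) V.sections :=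
  ⟨fun h s => ⟨fun x => h x • s.1 x, V.smul_mem h _ s.2⟩⟩

@[simp] theorem fun_smul_apply (V : SmoothVectorBundle I M A) (h : SmoothFun I M) (s : V.sections)
    (x : M) : (h • s).1 x = h x • s.1 x := rfl

instance (V : SmoothVectorBundle I M A) : Module (SmoothFun I M) V.sections where
  one_smul s := by ext x; simp
  mul_smul a b s := by ext x; simp [mul_smul]
  smul_zero a := by ext x; simp
  smul_add a s t := by ext x; simp
  add_smul a b s := by ext x; simp [add_smul]
  zero_smul s := by ext x; simp

theorem sections_sum_apply (V : SmoothVectorBundle I M A) {ι : Type*} (t : Finset ι) (s : ι → V.sections)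
    (x : M) : (∑ i ∈ t, s i).1 x = ∑ i ∈ t, (s i).1 x := by
  simp

theorem frame (V : SmoothVectorBundle I M A) (x : M) : ∃ (n : ℕ) (e : Fin n → V.sections),
    (∀ᶠ y in 𝓝 x, LinearIndependent ℝ (fun i => (e i).1 y) ∧
      ⊤ ≤ Submodule.span ℝ (Set.range fun i => (e i).1 y)) ∧
    ∀ s : V.sections, ∃ h : Fin n → SmoothFun I M,
      ∀ᶠ y in 𝓝 x, s.1 y = ∑ i, h i y • (e i).1 y := by
  obtain ⟨n, e, h1, h2, h3⟩ := V.exists_frame x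
  exact ⟨n, fun i => ⟨e i, h1 i⟩, h2, fun s => h3 s.1 s.2⟩

theorem exists_section (V : SmoothVectorBundle I M A) (x : M) (a : A x) :
    ∃ s : V.sections, s.1 x = a := by
  obtain ⟨n, e, h1, -⟩ := V.frame x
  have := h1.self_of_nhds.2 (Submodule.mem_top (x := a))
  obtain ⟨c, rfl⟩ := (Submodule.mem_span_range_iff_exists_fun ℝ).1 this
  exact ⟨∑ i, c i • e i, by simp⟩

variable (I M) in
/-- The bundle of rank one with fibre `ℝ`. -/
def trivialLine : SmoothVectorBundle I M (fun _ => ℝ) where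
  sections :=
    { carrier := {s | ContMDiff I 𝓘(ℝ, ℝ) ∞ s}
      add_mem' := fun h h' => h.add h'
      zero_mem' := contMDiff_const
      smul_mem' := fun c _ h => contMDiff_const.mul h }
  smul_mem h s hs := h.contMDiff.mul hs
  mem_of_locally s hs x := by
    obtain ⟨t, ht, h⟩ := hs x
    exact (ht x).congr_of_eventuallyEq h
  exists_frame x := by
    refine ⟨1, fun _ _ => 1, fun _ => contMDiff_const, .of_forall fun y => ⟨?_, ?_⟩, ?_⟩
    · exact linearIndependent_unique_iff.2 (by simp)
    · intro c _
      exact (Submodule.mem_span_range_iff_exists_fun ℝ).2 ⟨fun _ => c, by simp⟩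
    · intro s hs
      exact ⟨fun _ => ⟨s, hs⟩, .of_forall fun y => by simp⟩

variable (I) in
/-- The smooth sections of a vector bundle in the sense of Mathlib. -/
def ofBundle [FiniteDimensional ℝ E] [IsManifold I ∞ M] [T2Space M]
    (F : Type*) [NormedAddCommGroup F] [NormedSpace ℝ F] [FiniteDimensional ℝ F]
    (B : M → Type*) [∀ x, AddCommGroup (B x)] [∀ x, Module ℝ (B x)]
    [TopologicalSpace (Bundle.TotalSpace F B)] [∀ x, TopologicalSpace (B x)]
    [FiberBundle F B] [VectorBundle ℝ F B] [ContMDiffVectorBundle ∞ F B I] :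
    SmoothVectorBundle I M B where
  sections :=
    { carrier := {s | ContMDiff I (I.prod 𝓘(ℝ, F)) ∞ fun x => Bundle.TotalSpace.mk' F x (s x)}
      add_mem' := fun h h' => h.add_section h'
      zero_mem' := Bundle.contMDiff_zeroSection ℝ B
      smul_mem' := fun c _ h => h.const_smul_section }
  smul_mem h s hs := h.contMDiff.smul_section hs
  mem_of_locally s hs x := by
    obtain ⟨t, ht, h⟩ := hs x
    exact (ht x).congr_of_eventuallyEq (h.mono fun y hy => by simp [hy])
  exists_frame x := by
    let b := Module.finBasis ℝ F
    let e := trivializationAt F B x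
    have : ContMDiffVectorBundle 1 F B I := ContMDiffVectorBundle.of_le (n := ∞) (by norm_cast)
    have hx : x ∈ e.baseSet := FiberBundle.mem_baseSet_trivializationAt' x
    have hb : e.baseSet ∈ 𝓝 x := e.open_baseSet.mem_nhds hx
    obtain ⟨χ, h1, h2⟩ := exists_cutoff (I := I) hb
    have hfr := e.isLocalFrameOn_localFrame_baseSet I ∞ b
    refine ⟨_, fun i y => χ y • e.localFrame b i y, fun i => ?_, ?_, ?_⟩
    · exact ContMDiffOn.smul_section_of_tsupport χ.contMDiff.contMDiffOn e.open_baseSet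
        h2 (hfr.contMDiffOn i)
    · filter_upwards [h1, hb] with y hy hyb
      simp only [hy, one_smul]
      exact ⟨hfr.linearIndependent hyb, hfr.generating hyb⟩
    · intro s hs
      have h3 : ∀ i, ∃ v : SmoothFun I M, ∀ᶠ y in 𝓝 x, v y =
          e.localFrameCoeff I b i y (s y) := fun i =>
        exists_smoothFun_eventuallyEq hb fun y hy =>
          (contMDiffAt_localFrameCoeff (I := I) b hy hs.contMDiffAt i).contMDiffWithinAt
      choose v hv using h3
      refine ⟨v, ?_⟩
      filter_upwards [eventually_all.2 hv, h1, hb] with y hy hy1 hyb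
      simp only [hy, hy1, one_smul]
      exact Bundle.Trivialization.eq_sum_localFrameCoeff_smul (I := I) (b := b) hyb

/-- The tangent bundle. -/
abbrev tangent (I : ModelWithCorners ℝ E H) (M : Type*) [TopologicalSpace M] [ChartedSpace H M]
    [FiniteDimensional ℝ E] [IsManifold I ∞ M] [T2Space M] :
    SmoothVectorBundle I M (fun x : M => TangentSpace I x) :=
  ofBundle I E (fun x : M => TangentSpace I x)

end SmoothVectorBundle
end SmoothVectorBundles

open SmoothVectorBundle

section Derivatives

variable {E : Type*} [NormedAddCommGroup E] [NormedSpace ℝ E]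
  {H : Type*} [TopologicalSpace H] {I : ModelWithCorners ℝ E H}
  {M : Type*} [TopologicalSpace M] [ChartedSpace H M]
  {E' : Type*} [NormedAddCommGroup E'] [NormedSpace ℝ E']
  {H' : Type*} [TopologicalSpace H'] {I' : ModelWithCorners ℝ E' H'}
  {N : Type*} [TopologicalSpace N] [ChartedSpace H' N]

theorem SmoothFun.mdifferentiableAt (h : SmoothFun I M) (x : M) :
    MDifferentiableAt I 𝓘(ℝ, ℝ) h x :=
  h.contMDiff.contMDiffAt.mdifferentiableAt (by simp)

/-- The differential of a smooth function at a point, as a function of the tangent vector. -/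
def SmoothFun.d (h : SmoothFun I M) (x : M) : TangentSpace I x →ₗ[ℝ] ℝ := mvfderiv I h x

@[simp] theorem SmoothFun.d_add (h k : SmoothFun I M) (x : M) : (h + k).d x = h.d x + k.d x := by
  ext v
  exact congrArg (fun L => L v) (mvfderiv_add (h.mdifferentiableAt x) (k.mdifferentiableAt x))

@[simp] theorem SmoothFun.d_mul (h k : SmoothFun I M) (x : M) :
    (h * k).d x = h x • k.d x + k x • h.d x := by
  ext v
  exact congrArg (fun L => L v) (mvfderiv_mul (h.mdifferentiableAt x) (k.mdifferentiableAt x))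

theorem SmoothFun.d_congr {h k : SmoothFun I M} {x : M} (e : ∀ᶠ y in 𝓝 x, h y = k y) :
    h.d x = k.d x := by
  ext v
  have e' : (h : M → ℝ) =ᶠ[𝓝 x] k := e
  exact congrArg (fun L : E →L[ℝ] ℝ => L v) (e'.mfderiv_eq (I := I) (I' := 𝓘(ℝ, ℝ)))

theorem SmoothFun.d_const (c : ℝ) {h : SmoothFun I M} {x : M} (e : ∀ᶠ y in 𝓝 x, h y = c) :
    h.d x = 0 := by
  rw [SmoothFun.d_congr (k := ⟨fun _ => c, contMDiff_const⟩) e]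
  ext v
  exact congrArg (fun L => L v) (mvfderiv_const c)

@[simp] theorem SmoothFun.d_smul (c : ℝ) (h : SmoothFun I M) (x : M) :
    (c • h).d x = c • h.d x := by
  have : c • h = (show SmoothFun I M from ⟨fun _ => c, contMDiff_const⟩) * h := by ext; rfl
  rw [this, SmoothFun.d_mul, SmoothFun.d_const c (h := ⟨fun _ => c, contMDiff_const⟩)
    (.of_forall fun _ => rfl)]
  simp

/-- Composition of a smooth function with a smooth map. -/
abbrev SmoothFun.pullback (u : SmoothFun I' N) (f : C^∞⟮I, M; I', N⟯) : SmoothFun I M := u.comp f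

theorem SmoothFun.d_pullback (u : SmoothFun I' N) (f : C^∞⟮I, M; I', N⟯) (x : M)
    (v : TangentSpace I x) : (u.pullback f).d x v = u.d (f x) (mfderiv I I' f x v) :=
  mvfderiv_comp_apply x (u.mdifferentiableAt (f x))
    (f.contMDiff.contMDiffAt.mdifferentiableAt (by simp)) v

variable [FiniteDimensional ℝ E] [IsManifold I ∞ M] [T2Space M]

/-- Smooth functions separate tangent vectors. -/
theorem exists_local_coordinates (x : M) : ∃ s : C^∞⟮I, M; 𝓘(ℝ, E), E⟯,
    ∀ᶠ y in 𝓝 x, Function.Injective (mvfderiv I s y) := by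
  have hU := extChartAt_source_mem_nhds (I := I) x
  obtain ⟨s, hs⟩ := exists_smoothFun_eventuallyEq (I := I) hU
    (by simpa using contMDiffOn_extChartAt (I := I) (n := ∞) (x := x))
  refine ⟨s, ?_⟩
  filter_upwards [hs.eventually_nhds, hU] with y hy hyU
  have hy' : (s : M → E) =ᶠ[𝓝 y] extChartAt I x := hy
  have h2 : Function.Injective (mfderiv I 𝓘(ℝ, E) (extChartAt I x) y) :=
    (isInvertible_mfderiv_extChartAt (I := I) hyU).injective
  rw [← hy'.mfderiv_eq] at h2
  exact h2

/-- Smooth functions separate tangent vectors. -/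
theorem tangent_ext {x : M} {v w : TangentSpace I x}
    (h : ∀ u : SmoothFun I M, u.d x v = u.d x w) : v = w := by
  obtain ⟨s, hs⟩ := exists_local_coordinates (I := I) x
  apply hs.self_of_nhds
  apply (Module.finBasis ℝ E).ext_elem
  intro i
  let l : E →L[ℝ] ℝ := ((Module.finBasis ℝ E).coord i).toContinuousLinearMap
  have h1 := h ⟨fun y => l (s y), l.contMDiff.comp s.contMDiff⟩
  have h3 : ∀ v : TangentSpace I x,
      SmoothFun.d (⟨fun y => l (s y), l.contMDiff.comp s.contMDiff⟩ : SmoothFun I M) x v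
        = l (mvfderiv I s x v) := by
    intro v
    have h4 := mfderiv_comp_apply (I := I) (I' := 𝓘(ℝ, E)) (I'' := 𝓘(ℝ, ℝ)) (g := l) (f := s) x
      l.differentiableAt.mdifferentiableAt
      (s.contMDiff.contMDiffAt.mdifferentiableAt (by simp)) v
    rw [ContinuousLinearMap.mfderiv_eq] at h4
    exact h4
  rw [h3, h3] at h1
  exact h1

open SmoothVectorBundle

/-- The derivative of a smooth function along a smooth vector field. -/
def lieDer (X : (tangent I M).sections) : SmoothFun I M →ₗ[ℝ] SmoothFun I M where
  toFun u := ⟨fun x => u.d x (X.1 x), by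
    have h1 : ContMDiff I I.tangent ∞ (fun x => (⟨x, X.1 x⟩ : TangentBundle I M)) := X.2
    have h2 := (u.contMDiff.contMDiff_tangentMap (m := ∞) (by simp)).comp h1
    exact contMDiff_snd_tangentBundle_modelSpace ℝ 𝓘(ℝ, ℝ) |>.comp h2⟩
  map_add' u v := by ext x; exact congrArg (fun L => L (X.1 x)) (SmoothFun.d_add u v x)
  map_smul' c u := by ext x; exact congrArg (fun L => L (X.1 x)) (SmoothFun.d_smul c u x)

@[simp] theorem lieDer_apply (X : (tangent I M).sections) (u : SmoothFun I M) (x : M) :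
    lieDer X u x = u.d x (X.1 x) := rfl

theorem lieDer_mul (X : (tangent I M).sections) (u v : SmoothFun I M) :
    lieDer X (u * v) = u * lieDer X v + v * lieDer X u := by
  ext x; exact congrArg (fun L => L (X.1 x)) (SmoothFun.d_mul u v x)

end Derivatives

section Pullback

variable {E : Type*} [NormedAddCommGroup E] [NormedSpace ℝ E]
  {H : Type*} [TopologicalSpace H] {I : ModelWithCorners ℝ E H}
  {M : Type*} [TopologicalSpace M] [ChartedSpace H M]
  {E' : Type*} [NormedAddCommGroup E'] [NormedSpace ℝ E']
  {H' : Type*} [TopologicalSpace H'] {I' : ModelWithCorners ℝ E' H'}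
  {N : Type*} [TopologicalSpace N] [ChartedSpace H' N]
  {A : N → Type*} [∀ x, AddCommGroup (A x)] [∀ x, Module ℝ (A x)]

namespace SmoothVectorBundle

/-- The value at `m` of the formal sum `∑ hᵢ ⊗ bᵢ`, understood as the section `∑ hᵢ f^!bᵢ` of the
pullback bundle `f^!V`, where `(f^!b)(m) = b (f m)`. -/
def ev (V : SmoothVectorBundle I' N A) (f : C^∞⟮I, M; I', N⟯) (m : M) :
    SmoothFun I M ⊗[ℝ] V.sections →ₗ[ℝ] A (f m) :=
  TensorProduct.lift (LinearMap.mk₂ ℝ (fun h b => h m • b.1 (f m))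
    (fun h k b => by simp [add_smul]) (fun c h b => by simp [mul_smul])
    (fun h b c => by simp) (fun c h b => smul_comm (h m) c (b.1 (f m))))

@[simp] theorem ev_tmul (V : SmoothVectorBundle I' N A) (f : C^∞⟮I, M; I', N⟯) (m : M)
    (h : SmoothFun I M) (b : V.sections) : V.ev f m (h ⊗ₜ b) = h m • b.1 (f m) := rfl

@[simp] theorem ev_smul (V : SmoothVectorBundle I' N A) (f : C^∞⟮I, M; I', N⟯) (m : M)
    (k : SmoothFun I M) (t : SmoothFun I M ⊗[ℝ] V.sections) :
    V.ev f m (k • t) = k m • V.ev f m t := by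
  induction t with
  | zero => simp
  | tmul h b => simp [TensorProduct.smul_tmul', mul_smul]
  | add s t hs ht => simp [hs, ht]

theorem ev_coeff (V : SmoothVectorBundle I' N A) (f : C^∞⟮I, M; I', N⟯) (m₀ : M) {n : ℕ}
    {e : Fin n → V.sections} (he : ∀ s : V.sections, ∃ h : Fin n → SmoothFun I' N,
      ∀ᶠ y in 𝓝 (f m₀), s.1 y = ∑ i, h i y • (e i).1 y)
    (t : SmoothFun I M ⊗[ℝ] V.sections) :
    ∃ c : Fin n → SmoothFun I M, ∀ᶠ m in 𝓝 m₀, V.ev f m t = ∑ i, c i m • (e i).1 (f m) := by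
  induction t with
  | zero => exact ⟨0, .of_forall fun m => by simp⟩
  | tmul h b =>
    obtain ⟨u, hu⟩ := he b
    refine ⟨fun i => h * (u i).pullback f, ?_⟩
    filter_upwards [f.contMDiff.continuous.continuousAt.eventually hu] with m hm
    simp [hm, Finset.smul_sum, mul_smul]
  | add s t hs ht =>
    obtain ⟨c, hc⟩ := hs
    obtain ⟨c', hc'⟩ := ht
    refine ⟨c + c', ?_⟩
    filter_upwards [hc, hc'] with m h1 h2
    simp [h1, h2, add_smul, Finset.sum_add_distrib]

/-- The pullback bundle `f^!V`, with fibres `A (f m)`; its smooth sections are locally of the form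
`∑ hᵢ f^!bᵢ` with `hᵢ` smooth functions on `M` and `bᵢ` smooth sections of `V`. -/
def pullback (V : SmoothVectorBundle I' N A) (f : C^∞⟮I, M; I', N⟯) :
    SmoothVectorBundle I M (fun m => A (f m)) where
  sections :=
    { carrier := {s | ∀ m₀, ∃ t : SmoothFun I M ⊗[ℝ] V.sections,
        ∀ᶠ m in 𝓝 m₀, s m = V.ev f m t}
      add_mem' := by
        intro s s' hs hs' m₀
        obtain ⟨t, ht⟩ := hs m₀
        obtain ⟨t', ht'⟩ := hs' m₀
        exact ⟨t + t', by filter_upwards [ht, ht'] with m h h'; simp [h, h']⟩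
      zero_mem' := fun m₀ => ⟨0, by simp⟩
      smul_mem' := by
        intro c s hs m₀
        obtain ⟨t, ht⟩ := hs m₀
        exact ⟨c • t, by filter_upwards [ht] with m h; simp [h]⟩ }
  smul_mem h s hs m₀ := by
    obtain ⟨t, ht⟩ := hs m₀
    exact ⟨h • t, by filter_upwards [ht] with m h; simp [h]⟩
  mem_of_locally s hs m₀ := by
    obtain ⟨s', h', hs'⟩ := hs m₀
    obtain ⟨t, ht⟩ := h' m₀
    exact ⟨t, by filter_upwards [ht, hs'] with m h h'; rw [h', h]⟩
  exists_frame m₀ := by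
    obtain ⟨n, e, h1, h2⟩ := V.frame (f m₀)
    refine ⟨n, fun i m => (e i).1 (f m), fun i m₁ => ⟨1 ⊗ₜ e i, by simp⟩,
      f.contMDiff.continuous.continuousAt.eventually h1, ?_⟩
    intro s hs
    obtain ⟨t, ht⟩ := hs m₀
    obtain ⟨c, hc⟩ := V.ev_coeff f m₀ h2 t
    exact ⟨c, by filter_upwards [ht, hc] with m h h'; rw [h, h']⟩

theorem pullback_exists (V : SmoothVectorBundle I' N A) (f : C^∞⟮I, M; I', N⟯)
    (s : (V.pullback f).sections) (m₀ : M) : ∃ t : SmoothFun I M ⊗[ℝ] V.sections,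
      ∀ᶠ m in 𝓝 m₀, s.1 m = V.ev f m t := s.2 m₀

/-- The section `f^!b`. -/
def pullSection (V : SmoothVectorBundle I' N A) (f : C^∞⟮I, M; I', N⟯) (b : V.sections) :
    (V.pullback f).sections := ⟨fun m => b.1 (f m), fun _ => ⟨1 ⊗ₜ b, by simp⟩⟩

/-- A derivation of sections at a point over a tangent vector `z`. -/
structure PointDerivation (V : SmoothVectorBundle I' N A) (x : N) (z : TangentSpace I' x) where
  toFun : V.sections →ₗ[ℝ] A x
  leibniz : ∀ (h : SmoothFun I' N) (s : V.sections),
    toFun (h • s) = h x • toFun s + h.d x z • s.1 x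

namespace PointDerivation

variable {V : SmoothVectorBundle I' N A}

theorem eq_zero_of_eventually [FiniteDimensional ℝ E'] [IsManifold I' ∞ N] [T2Space N]
    {x : N} {z : TangentSpace I' x} (D : V.PointDerivation x z)
    {s : V.sections} (hs : ∀ᶠ y in 𝓝 x, s.1 y = 0) : D.toFun s = 0 := by
  obtain ⟨χ, h1, h2⟩ := exists_cutoff (I := I') hs
  have h3 : χ • s = 0 := by
    ext y
    by_cases hy : y ∈ tsupport χ
    · have := h2 hy
      simp only [Set.mem_ofPred_eq] at this
      simp [this]
    · simp [image_eq_zero_of_notMem_tsupport hy]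
  have h4 := D.leibniz χ s
  rw [h3, map_zero, SmoothFun.d_const 1 h1, h1.self_of_nhds] at h4
  simpa using h4.symm

theorem congr [FiniteDimensional ℝ E'] [IsManifold I' ∞ N] [T2Space N]
    {x : N} {z : TangentSpace I' x} (D : V.PointDerivation x z)
    {s t : V.sections} (hs : ∀ᶠ y in 𝓝 x, s.1 y = t.1 y) : D.toFun s = D.toFun t := by
  rw [← sub_eq_zero, ← map_sub]
  exact D.eq_zero_of_eventually (by filter_upwards [hs] with y hy; simp [hy])

variable (f : C^∞⟮I, M; I', N⟯) {m₀ : M} {v : TangentSpace I m₀} {z : TangentSpace I' (f m₀)}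

/-- `∑ hᵢ ⊗ bᵢ ↦ ∑ hᵢ(m₀) D bᵢ + dhᵢ(v) bᵢ(f m₀)`. -/
def evD (D : V.PointDerivation (f m₀) z) (v : TangentSpace I m₀) :
    SmoothFun I M ⊗[ℝ] V.sections →ₗ[ℝ] A (f m₀) :=
  TensorProduct.lift (LinearMap.mk₂ ℝ (fun h b => h m₀ • D.toFun b + h.d m₀ v • b.1 (f m₀))
    (fun h k b => by simp [add_smul]; abel) (fun c h b => by simp [mul_smul])
    (fun h b c => by simp; abel) (fun c h b => by simp [smul_comm c]))

@[simp] theorem evD_tmul (D : V.PointDerivation (f m₀) z) (v : TangentSpace I m₀)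
    (h : SmoothFun I M) (b : V.sections) :
    D.evD f v (h ⊗ₜ b) = h m₀ • D.toFun b + h.d m₀ v • b.1 (f m₀) := rfl

theorem evD_smul (D : V.PointDerivation (f m₀) z) (v : TangentSpace I m₀)
    (k : SmoothFun I M) (t : SmoothFun I M ⊗[ℝ] V.sections) :
    D.evD f v (k • t) = k m₀ • D.evD f v t + k.d m₀ v • V.ev f m₀ t := by
  induction t with
  | zero => simp
  | tmul h b => simp [TensorProduct.smul_tmul', mul_smul, add_smul]; module
  | add s t hs ht => simp only [smul_add, map_add, hs, ht]; abel

variable [FiniteDimensional ℝ E'] [IsManifold I' ∞ N] [T2Space N]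

theorem evD_eq_zero (D : V.PointDerivation (f m₀) z) (hv : mfderiv I I' f m₀ v = z)
    {t : SmoothFun I M ⊗[ℝ] V.sections} (ht : ∀ᶠ m in 𝓝 m₀, V.ev f m t = 0) :
    D.evD f v t = 0 := by
  obtain ⟨n, e, h1, h2⟩ := V.frame (f m₀)
  have key : ∃ c : Fin n → SmoothFun I M,
      (∀ᶠ m in 𝓝 m₀, V.ev f m t = ∑ i, c i m • (e i).1 (f m)) ∧
      D.evD f v t = ∑ i, (c i m₀ • D.toFun (e i) + (c i).d m₀ v • (e i).1 (f m₀)) := by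
    clear ht
    induction t with
    | zero => exact ⟨0, .of_forall fun m => by simp, by
        simp [show (0 : SmoothFun I M).d m₀ = 0 from
          SmoothFun.d_const 0 (.of_forall fun _ => rfl)]⟩
    | tmul h b =>
      obtain ⟨u, hu⟩ := h2 b
      refine ⟨fun i => h * (u i).pullback f, ?_, ?_⟩
      · filter_upwards [f.contMDiff.continuous.continuousAt.eventually hu] with m hm
        simp [hm, Finset.smul_sum, mul_smul]
      · have h3 : D.toFun b = D.toFun (∑ i, u i • e i) :=
          D.congr (by filter_upwards [hu] with y hy; simp [hy])
        rw [evD_tmul, h3, map_sum, hu.self_of_nhds]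
        simp only [D.leibniz, Finset.smul_sum, ← Finset.sum_add_distrib, SmoothFun.d_mul,
          LinearMap.add_apply, LinearMap.smul_apply, SmoothFun.d_pullback, hv,
          ContMDiffMap.coe_mul, Pi.mul_apply, ContMDiffMap.comp_apply, smul_eq_mul]
        refine Finset.sum_congr rfl fun i _ => ?_
        module
    | add s t hs ht =>
      obtain ⟨c, hc, hd⟩ := hs
      obtain ⟨c', hc', hd'⟩ := ht
      refine ⟨c + c', ?_, ?_⟩
      · filter_upwards [hc, hc'] with m h1 h2
        simp [h1, h2, add_smul, Finset.sum_add_distrib]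
      · rw [map_add, hd, hd', ← Finset.sum_add_distrib]
        refine Finset.sum_congr rfl fun i _ => ?_
        simp only [Pi.add_apply, ContMDiffMap.coe_add, SmoothFun.d_add, LinearMap.add_apply]
        module
  obtain ⟨c, hc, hd⟩ := key
  have h4 : ∀ᶠ m in 𝓝 m₀, ∀ i, c i m = 0 := by
    filter_upwards [ht, hc, f.contMDiff.continuous.continuousAt.eventually h1] with m a b g
    exact Fintype.linearIndependent_iff.1 g.1 (fun i => c i m) (b ▸ a)
  rw [hd]
  refine Finset.sum_eq_zero fun i _ => ?_
  rw [SmoothFun.d_const 0 (h4.mono fun m h => h i), h4.self_of_nhds i]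
  simp

theorem evD_congr (D : V.PointDerivation (f m₀) z) (hv : mfderiv I I' f m₀ v = z)
    {t t' : SmoothFun I M ⊗[ℝ] V.sections} (ht : ∀ᶠ m in 𝓝 m₀, V.ev f m t = V.ev f m t') :
    D.evD f v t = D.evD f v t' := by
  rw [← sub_eq_zero, ← map_sub]
  exact D.evD_eq_zero f hv (by filter_upwards [ht] with y hy; simp [hy])

/-- The pullback of a derivation over `Tf v` to a derivation of the sections of `f^!V` over `v`,
given by `∑ hᵢ f^!bᵢ ↦ ∑ hᵢ(m₀) D bᵢ + dhᵢ(v) bᵢ(f m₀)`. -/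
def pullback (D : V.PointDerivation (f m₀) z) (hv : mfderiv I I' f m₀ v = z) :
    (V.pullback f).PointDerivation m₀ v where
  toFun :=
    { toFun := fun s => D.evD f v (V.pullback_exists f s m₀).choose
      map_add' := by
        intro s s'
        rw [← map_add]
        apply D.evD_congr f hv
        filter_upwards [(V.pullback_exists f s m₀).choose_spec,
          (V.pullback_exists f s' m₀).choose_spec,
          (V.pullback_exists f (s + s') m₀).choose_spec] with m h1 h2 h3
        rw [← h3, map_add, ← h1, ← h2]; rfl
      map_smul' := by
        intro c s
        rw [RingHom.id_apply, ← map_smul]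
        apply D.evD_congr f hv
        filter_upwards [(V.pullback_exists f s m₀).choose_spec,
          (V.pullback_exists f (c • s) m₀).choose_spec] with m h1 h3
        rw [← h3, map_smul, ← h1]; rfl }
  leibniz := by
    intro h s
    simp only [LinearMap.coe_mk, AddHom.coe_mk]
    have h1 := (V.pullback_exists f s m₀).choose_spec
    rw [D.evD_congr f hv (t' := h • (V.pullback_exists f s m₀).choose), evD_smul,
      ← h1.self_of_nhds]
    filter_upwards [h1, (V.pullback_exists f (h • s) m₀).choose_spec] with m h1 h3
    rw [← h3, ev_smul, ← h1]; rfl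

theorem pullback_eq (D : V.PointDerivation (f m₀) z) (hv : mfderiv I I' f m₀ v = z)
    {s : (V.pullback f).sections} {t : SmoothFun I M ⊗[ℝ] V.sections}
    (h : ∀ᶠ m in 𝓝 m₀, s.1 m = V.ev f m t) : (D.pullback f hv).toFun s = D.evD f v t := by
  apply D.evD_congr f hv
  filter_upwards [h, (V.pullback_exists f s m₀).choose_spec] with m h1 h2
  rw [← h1, h2]

end PointDerivation
end SmoothVectorBundle
end Pullback

section LieAlgebroids

variable {E : Type*} [NormedAddCommGroup E] [NormedSpace ℝ E] [FiniteDimensional ℝ E]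
  {H : Type*} [TopologicalSpace H] {I : ModelWithCorners ℝ E H}
  {M : Type*} [TopologicalSpace M] [ChartedSpace H M] [IsManifold I ∞ M] [T2Space M]
  {A : M → Type*} [∀ x, AddCommGroup (A x)] [∀ x, Module ℝ (A x)]

/-- A Lie algebroid structure on a vector bundle: an anchor `ρ : A → TM`, which is a smooth bundle
map, and a Lie bracket on the smooth sections with `[a, h b] = h [a, b] + ρ(a)(h) b`. -/
structure LieAlgebroid (V : SmoothVectorBundle I M A) where
  anchor : ∀ x, A x →ₗ[ℝ] TangentSpace I x
  anchor_mem : ∀ s : V.sections, (fun x => anchor x (s.1 x)) ∈ (tangent I M).sections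
  bracket : V.sections →ₗ[ℝ] V.sections →ₗ[ℝ] V.sections
  bracket_self : ∀ a, bracket a a = 0
  jacobi : ∀ a b c, bracket a (bracket b c) = bracket (bracket a b) c + bracket b (bracket a c)
  leibniz : ∀ (a b : V.sections) (h : SmoothFun I M) (x : M),
    (bracket a (h • b)).1 x = h x • (bracket a b).1 x + h.d x (anchor x (a.1 x)) • b.1 x

namespace LieAlgebroid

variable {V : SmoothVectorBundle I M A} (L : LieAlgebroid V)

/-- A Lie algebroid is transitive if its anchor is surjective. -/
def IsTransitive : Prop := ∀ x, Function.Surjective (L.anchor x)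

/-- The anchor on sections. -/
def anchorSection : V.sections →ₗ[ℝ] (tangent I M).sections where
  toFun a := ⟨fun x => L.anchor x (a.1 x), L.anchor_mem a⟩
  map_add' a b := by ext x; exact map_add (L.anchor x) _ _
  map_smul' c a := by ext x; exact map_smul (L.anchor x) c _

@[simp] theorem anchorSection_apply (a : V.sections) (x : M) :
    (L.anchorSection a).1 x = L.anchor x (a.1 x) := rfl

theorem bracket_skew (a b : V.sections) : L.bracket a b = -L.bracket b a := by
  have h := L.bracket_self (a + b)
  simp only [map_add, LinearMap.add_apply, L.bracket_self, zero_add, add_zero] at h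
  exact eq_neg_of_add_eq_zero_right h

theorem bracket_smul (a b : V.sections) (h : SmoothFun I M) :
    L.bracket a (h • b) = h • L.bracket a b + lieDer (L.anchorSection a) h • b := by
  ext x
  exact L.leibniz a b h x

theorem anchor_bracket (a b : V.sections) (u : SmoothFun I M) (x : M) :
    u.d x (L.anchor x ((L.bracket a b).1 x)) =
      (lieDer (L.anchorSection b) u).d x (L.anchor x (a.1 x)) -
      (lieDer (L.anchorSection a) u).d x (L.anchor x (b.1 x)) := by
  rcases subsingleton_or_nontrivial (A x) with hA | hA
  · simp [Subsingleton.elim _ (0 : A x)]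
  · obtain ⟨y, hy⟩ := exists_ne (0 : A x)
    obtain ⟨c, rfl⟩ := V.exists_section x y
    have h := congrArg (fun s : V.sections => s.1 x) (L.jacobi a b (u • c))
    simp only [bracket_smul, map_add, L.jacobi a b c] at h
    simp only [Submodule.coe_add, Pi.add_apply, fun_smul_apply, lieDer_apply, anchorSection_apply] at h
    rw [← sub_eq_zero]
    refine (smul_eq_zero.1 ?_).resolve_right hy
    rw [← sub_eq_zero] at h
    rw [← neg_eq_zero, ← h]
    module

/-- The bracket as a derivation at a point. -/
def derAt (a : V.sections) (x : M) : V.PointDerivation x (L.anchor x (a.1 x)) where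
  toFun :=
    { toFun := fun b => (L.bracket a b).1 x
      map_add' := fun b c => by simp
      map_smul' := fun r b => by simp }
  leibniz h b := L.leibniz a b h x

end LieAlgebroid

theorem mdifferentiableAt_of_mem_sections (X : (tangent I M).sections) (x : M) :
    MDifferentiableAt I I.tangent (fun x => (⟨x, X.1 x⟩ : TangentBundle I M)) x :=
  ContMDiffAt.mdifferentiableAt (n := ∞) (X.2 x) (by simp)

open VectorField in
variable (I M) in
/-- The tangent Lie algebroid: the identity anchor and the Lie bracket of vector fields. -/
def tangentAlgebroid : LieAlgebroid (tangent I M) where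
  anchor x := LinearMap.id
  anchor_mem s := s.2
  bracket := LinearMap.mk₂ ℝ
    (fun X Y => ⟨mlieBracket I X.1 Y.1, by
      have : IsManifold I (minSmoothness ℝ 2) M :=
        IsManifold.of_le (n := ∞) (by simp; norm_cast)
      have : IsManifold I (((⊤ : ℕ∞) : WithTop ℕ∞) + 1) M := by simpa using ‹IsManifold I ∞ M›
      intro x
      exact ContMDiffAt.mlieBracket_vectorField (m := ⊤) (n := ⊤) (X.2 x) (Y.2 x) (by simp)⟩)
    (fun X X' Y => by
      ext x
      exact mlieBracket_add_left (mdifferentiableAt_of_mem_sections X x)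
        (mdifferentiableAt_of_mem_sections X' x))
    (fun c X Y => by
      ext x
      exact mlieBracket_const_smul_left (mdifferentiableAt_of_mem_sections X x))
    (fun X Y Y' => by
      ext x
      exact mlieBracket_add_right (mdifferentiableAt_of_mem_sections Y x)
        (mdifferentiableAt_of_mem_sections Y' x))
    (fun c X Y => by
      ext x
      exact mlieBracket_const_smul_right (mdifferentiableAt_of_mem_sections Y x))
  bracket_self X := by ext x; simp
  jacobi X Y Z := by
    ext x
    have : IsManifold I (minSmoothness ℝ 3) M := IsManifold.of_le (n := ∞) (by simp; norm_cast)
    exact leibniz_identity_mlieBracket_apply ((X.2 x).of_le (by simp; norm_cast)) ((Y.2 x).of_le (by simp; norm_cast))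
      ((Z.2 x).of_le (by simp; norm_cast))
  leibniz X Y h x := by
    exact (mlieBracket_smul_right (h.mdifferentiableAt x)
      (mdifferentiableAt_of_mem_sections Y x)).trans (add_comm _ _)

/-- `[X, Y] u = X (Y u) - Y (X u)`. -/
theorem lieDer_bracket (X Y : (tangent I M).sections) (u : SmoothFun I M) :
    lieDer ((tangentAlgebroid I M).bracket X Y) u =
      lieDer X (lieDer Y u) - lieDer Y (lieDer X u) := by
  ext x
  exact (tangentAlgebroid I M).anchor_bracket X Y u x

end LieAlgebroids

section KernelFrame

variable {E : Type*} [NormedAddCommGroup E] [NormedSpace ℝ E] [FiniteDimensional ℝ E]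
  {H : Type*} [TopologicalSpace H] {I : ModelWithCorners ℝ E H}
  {M : Type*} [TopologicalSpace M] [ChartedSpace H M] [IsManifold I ∞ M] [T2Space M]

/-- A smooth family of linear maps whose kernels have locally constant rank has a smooth local
frame of the kernels, with smooth coefficients. -/
theorem exists_kernel_frame {W W' : Type*} [NormedAddCommGroup W] [NormedSpace ℝ W]
    [FiniteDimensional ℝ W] [NormedAddCommGroup W'] [NormedSpace ℝ W'] [FiniteDimensional ℝ W']
    (L : M → (W →L[ℝ] W')) (hL : ContMDiff I 𝓘(ℝ, W →L[ℝ] W') ∞ L) (m₀ : M)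
    (hr : ∀ᶠ m in 𝓝 m₀, Module.finrank ℝ (L m).ker = Module.finrank ℝ (L m₀).ker) :
    ∃ (n : ℕ) (κ : Fin n → C^∞⟮I, M; 𝓘(ℝ, W), W⟯) (P : W →L[ℝ] (Fin n → ℝ)),
      ∀ᶠ m in 𝓝 m₀, (∀ j, L m (κ j m) = 0) ∧ (∀ w, L m w = 0 → w = ∑ j, P w j • κ j m) ∧
        ∀ j, P (κ j m) = Pi.single j 1 := by
  obtain ⟨P₀, hP₀⟩ := (L m₀).ker.subtype.exists_leftInverse_of_injective (by simp)
  obtain ⟨Q₀, hQ₀⟩ := (L m₀).range.subtype.exists_leftInverse_of_injective (by simp)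
  let b := Module.finBasis ℝ (L m₀).ker
  let P : W →L[ℝ] (Fin (Module.finrank ℝ (L m₀).ker) → ℝ) :=
    (b.equivFun.toLinearMap ∘ₗ P₀).toContinuousLinearMap
  let Q : W' →L[ℝ] (L m₀).range := Q₀.toContinuousLinearMap
  let G : M → (W →L[ℝ] (Fin (Module.finrank ℝ (L m₀).ker) → ℝ) × (L m₀).range) :=
    fun m => P.prod (Q ∘L L m)
  have hG : ContMDiff I 𝓘(ℝ, W →L[ℝ] (Fin (Module.finrank ℝ (L m₀).ker) → ℝ) × (L m₀).range)
      ∞ G := by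
    have h1 : ContDiff ℝ ∞ (fun T : W →L[ℝ] W' => P.prod (Q ∘L T)) := by
      have h2 : (fun T : W →L[ℝ] W' => P.prod (Q ∘L T)) = fun T =>
          (ContinuousLinearMap.inl ℝ _ _) ∘L P + ((ContinuousLinearMap.inr ℝ _ _) ∘L Q) ∘L T := by
        ext T w <;> simp
      rw [h2]
      fun_prop
    exact h1.contMDiff.comp hL
  have hinj : Function.Injective (G m₀) := by
    rw [injective_iff_map_eq_zero]
    intro w hw
    have h1 : P w = 0 := congrArg Prod.fst hw
    have h2 : Q (L m₀ w) = 0 := congrArg Prod.snd hw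
    have h3 : Q₀ (L m₀ w) = ⟨L m₀ w, ⟨w, rfl⟩⟩ :=
      congrArg (fun T => T ⟨L m₀ w, ⟨w, rfl⟩⟩) hQ₀
    have h4 : L m₀ w = 0 := congrArg Subtype.val (h3.symm.trans h2)
    have h5 : P₀ w = ⟨w, h4⟩ := congrArg (fun T => T ⟨w, h4⟩) hP₀
    have h6 : P₀ w = 0 := by
      apply b.equivFun.injective
      rw [map_zero]; exact h1
    exact congrArg Subtype.val (h5.symm.trans h6)
  have hdim : Module.finrank ℝ W =
      Module.finrank ℝ ((Fin (Module.finrank ℝ (L m₀).ker) → ℝ) × (L m₀).range) := by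
    rw [Module.finrank_prod, Module.finrank_fin_fun, add_comm]
    exact ((L m₀).toLinearMap.finrank_range_add_finrank_ker).symm
  let e₀ := (LinearMap.linearEquivOfInjective (G m₀).toLinearMap hinj hdim).toContinuousLinearEquiv
  have he₀ : (e₀ : W →L[ℝ] _) = G m₀ := by ext w <;> rfl
  have hnear : ∀ᶠ m in 𝓝 m₀, ∃ e : W ≃L[ℝ] (Fin (Module.finrank ℝ (L m₀).ker) → ℝ) × (L m₀).range,
      (e : W →L[ℝ] _) = G m := by
    have := ContinuousLinearEquiv.nhds e₀
    rw [he₀] at this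
    exact hG.continuous.continuousAt.eventually this
  have hs : ∀ j, ∃ v : C^∞⟮I, M; 𝓘(ℝ, W), W⟯, ∀ᶠ m in 𝓝 m₀,
      v m = (G m).inverse (Pi.single j 1, 0) := by
    intro j
    apply exists_smoothFun_eventuallyEq (I := I) hnear
    rintro m ⟨e, he⟩
    apply ContMDiffAt.contMDiffWithinAt
    have h1 : ContDiffAt ℝ ∞ (fun T : W →L[ℝ] _ => T.inverse ((Pi.single j 1, 0) :
        (Fin (Module.finrank ℝ (L m₀).ker) → ℝ) × (L m₀).range)) (G m) := by
      have := contDiffAt_map_inverse (𝕜 := ℝ) (n := ∞) e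
      rw [he] at this
      exact this.clm_apply contDiffAt_const
    exact h1.contMDiffAt.comp m hG.contMDiffAt
  choose κ hκ using hs
  refine ⟨_, κ, P, ?_⟩
  filter_upwards [hnear, eventually_all.2 hκ, hr] with m ⟨e, he⟩ hm hrm
  have hGκ : ∀ j, G m (κ j m) = (Pi.single j 1, 0) := by
    intro j
    rw [hm j, ← he, ContinuousLinearMap.inverse_equiv]
    exact e.apply_symm_apply _
  have hGinj : Function.Injective (G m) := by rw [← he]; exact e.injective
  have hQL : ∀ w, Q (L m w) = 0 → L m w = 0 := by
    have hle : (L m).ker ≤ (Q ∘L L m).ker := by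
      intro w hw
      have : L m w = 0 := hw
      simp [this]
    have hsurj : Function.Surjective (Q ∘L L m) := by
      intro y
      refine ⟨e.symm (0, y), ?_⟩
      have : G m (e.symm (0, y)) = (0, y) := by rw [← he]; exact e.apply_symm_apply _
      exact congrArg Prod.snd this
    have h1 := (Q ∘L L m).toLinearMap.finrank_range_add_finrank_ker
    have h2 := (L m₀).toLinearMap.finrank_range_add_finrank_ker
    have h3 : (Q ∘L L m).range = ⊤ := LinearMap.range_eq_top.2 hsurj
    have h4 : Module.finrank ℝ (Q ∘L L m).range = Module.finrank ℝ (L m₀).range := by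
      rw [h3, finrank_top]
    have heq := Submodule.eq_of_le_of_finrank_eq hle (by
      change Module.finrank ℝ (L m).ker = Module.finrank ℝ (Q ∘L L m).ker
      change Module.finrank ℝ (Q ∘L L m).range + Module.finrank ℝ (Q ∘L L m).ker = _ at h1
      change Module.finrank ℝ (L m₀).range + Module.finrank ℝ (L m₀).ker = _ at h2
      omega)
    intro w hw
    have : w ∈ (Q ∘L L m).ker := hw
    rw [← heq] at this
    exact this
  refine ⟨fun j => hQL _ (congrArg Prod.snd (hGκ j)), fun w hw => ?_,
    fun j => congrArg Prod.fst (hGκ j)⟩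
  apply hGinj
  rw [map_sum]
  simp only [map_smul, hGκ]
  apply Prod.ext
  · simp only [Prod.fst_sum, Prod.smul_fst]
    ext i; simp [Pi.single_apply]; rfl
  · simp [Prod.snd_sum, G, hw]

end KernelFrame

section PullbackAlgebroid

variable {E : Type*} [NormedAddCommGroup E] [NormedSpace ℝ E] [FiniteDimensional ℝ E]
  {H : Type*} [TopologicalSpace H] {I : ModelWithCorners ℝ E H}
  {M : Type*} [TopologicalSpace M] [ChartedSpace H M] [IsManifold I ∞ M] [T2Space M]
  {E' : Type*} [NormedAddCommGroup E'] [NormedSpace ℝ E'] [FiniteDimensional ℝ E']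
  {H' : Type*} [TopologicalSpace H'] {I' : ModelWithCorners ℝ E' H'}
  {N : Type*} [TopologicalSpace N] [ChartedSpace H' N] [IsManifold I' ∞ N] [T2Space N]
  {A : N → Type*} [∀ x, AddCommGroup (A x)] [∀ x, Module ℝ (A x)]

theorem SmoothVectorBundle.pullback_frame_coeff (V : SmoothVectorBundle I' N A)
    (f : C^∞⟮I, M; I', N⟯) (m₀ : M) {n : ℕ}
    {e : Fin n → V.sections} (he : ∀ s : V.sections, ∃ h : Fin n → SmoothFun I' N,
      ∀ᶠ y in 𝓝 (f m₀), s.1 y = ∑ i, h i y • (e i).1 y) (s : (V.pullback f).sections) :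
    ∃ c : Fin n → SmoothFun I M, ∀ᶠ m in 𝓝 m₀, s.1 m = ∑ i, c i m • (e i).1 (f m) := by
  obtain ⟨t, ht⟩ := V.pullback_exists f s m₀
  obtain ⟨c, hc⟩ := V.ev_coeff f m₀ he t
  exact ⟨c, by filter_upwards [ht, hc] with m h h'; rw [h, h']⟩

theorem exists_separating_functions (x : M) : ∃ (q : ℕ) (s : Fin q → SmoothFun I M),
    ∀ᶠ y in 𝓝 x, ∀ v : TangentSpace I y, (∀ k, (s k).d y v = 0) → v = 0 := by
  obtain ⟨s, hs⟩ := exists_local_coordinates (I := I) x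
  let l : Fin (Module.finrank ℝ E) → (E →L[ℝ] ℝ) :=
    fun i => ((Module.finBasis ℝ E).coord i).toContinuousLinearMap
  refine ⟨_, fun i => ⟨fun y => l i (s y), (l i).contMDiff.comp s.contMDiff⟩, ?_⟩
  filter_upwards [hs] with y hy v hv
  apply hy
  rw [map_zero]
  apply (Module.finBasis ℝ E).ext_elem
  intro i
  have h4 := mfderiv_comp_apply (I := I) (I' := 𝓘(ℝ, E)) (I'' := 𝓘(ℝ, ℝ)) (g := l i) (f := s) y
    (l i).differentiableAt.mdifferentiableAt
    (s.contMDiff.contMDiffAt.mdifferentiableAt (by simp)) v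
  rw [ContinuousLinearMap.mfderiv_eq] at h4
  have h5 : l i (mvfderiv I s y v) = 0 := h4.symm.trans (hv i)
  rw [map_zero]; exact h5

namespace LieAlgebroid

variable {V : SmoothVectorBundle I' N A} (L : LieAlgebroid V) (f : C^∞⟮I, M; I', N⟯)

/-- The fibre `{(v, b) ∈ T_m M × A_{f(m)} | Tf(v) = ρ(b)}` of `f^{!!}A` at `m`. -/
def pullbackFiber (m : M) : Submodule ℝ (TangentSpace I m × A (f m)) where
  carrier := {p | mfderiv I I' f m p.1 = L.anchor (f m) p.2}
  add_mem' := by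
    intro p q hp hq
    simp only [Set.mem_ofPred_eq] at hp hq ⊢
    simp [hp, hq]
  zero_mem' := by simp
  smul_mem' := by
    intro c p hp
    simp only [Set.mem_ofPred_eq] at hp ⊢
    simp [hp]

theorem mem_pullbackFiber {m : M} {p : TangentSpace I m × A (f m)} :
    p ∈ L.pullbackFiber f m ↔ mfderiv I I' f m p.1 = L.anchor (f m) p.2 := Iff.rfl

/-- The pullback `f^{!!}A` exists if its fibres have (locally) constant rank. -/
def PullbackExists : Prop :=
  ∀ m₀, ∀ᶠ m in 𝓝 m₀,
    Module.finrank ℝ (L.pullbackFiber f m) = Module.finrank ℝ (L.pullbackFiber f m₀)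

variable {L f}

theorem pullback_frame (hf : L.PullbackExists f) (m₀ : M) :
    ∃ (n : ℕ) (e : Fin n → Π m, L.pullbackFiber f m),
      (∀ i, (fun m => (e i m).1.1) ∈ (tangent I M).sections ∧
        (fun m => (e i m).1.2) ∈ (V.pullback f).sections) ∧
      (∀ᶠ y in 𝓝 m₀, LinearIndependent ℝ (fun i => e i y) ∧
        ⊤ ≤ Submodule.span ℝ (Set.range fun i => e i y)) ∧
      ∀ s : Π m, L.pullbackFiber f m, ((fun m => (s m).1.1) ∈ (tangent I M).sections ∧
        (fun m => (s m).1.2) ∈ (V.pullback f).sections) →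
        ∃ h : Fin n → SmoothFun I M, ∀ᶠ y in 𝓝 m₀, s y = ∑ i, h i y • e i y := by
  obtain ⟨d, X, hX1, hX2⟩ := (tangent I M).frame m₀
  obtain ⟨r, b, hb1, hb2⟩ := V.frame (f m₀)
  obtain ⟨q, s, hs⟩ := exists_separating_functions (I := I') (f m₀)
  have hfc := f.contMDiff.continuous.continuousAt (x := m₀)
  let a : (Fin d ⊕ Fin r) × Fin q → SmoothFun I M := fun c => match c with
    | (Sum.inl i, k) => lieDer (X i) ((s k).pullback f)
    | (Sum.inr j, k) => -(lieDer (L.anchorSection (b j)) (s k)).pullback f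
  let T : (Fin d ⊕ Fin r) × Fin q → ((Fin d ⊕ Fin r → ℝ) →L[ℝ] (Fin q → ℝ)) := fun c =>
    (ContinuousLinearMap.proj c.1 : (Fin d ⊕ Fin r → ℝ) →L[ℝ] ℝ).smulRight (Pi.single c.2 1)
  let K : M → ((Fin d ⊕ Fin r → ℝ) →L[ℝ] (Fin q → ℝ)) := fun m => ∑ c, a c m • T c
  have hK : ContMDiff I 𝓘(ℝ, (Fin d ⊕ Fin r → ℝ) →L[ℝ] (Fin q → ℝ)) ∞ K :=
    contMDiff_finsetSum fun c _ => (a c).contMDiff.smul contMDiff_const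
  let ψ : ∀ m, (Fin d ⊕ Fin r → ℝ) →ₗ[ℝ] (TangentSpace I m × A (f m)) := fun m =>
    { toFun := fun w => (∑ i, w (Sum.inl i) • (X i).1 m, ∑ j, w (Sum.inr j) • (b j).1 (f m))
      map_add' := by intro w w'; simp [add_smul, Finset.sum_add_distrib]
      map_smul' := by intro c w; simp [mul_smul, Finset.smul_sum] }
  have hKapply : ∀ m w k, K m w k = (s k).d (f m) (mfderiv I I' f m (ψ m w).1) -
      (s k).d (f m) (L.anchor (f m) (ψ m w).2) := by
    intro m w k
    simp only [K, ψ, T, a, Fintype.sum_prod_type, Fintype.sum_sum_type, LinearMap.coe_mk,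
      AddHom.coe_mk, map_sum, map_smul, _root_.sum_apply,
      _root_.add_apply, _root_.smul_apply, Finset.sum_apply,
      ContinuousLinearMap.smulRight_apply, ContinuousLinearMap.proj_apply, Pi.add_apply,
      Pi.smul_apply, Pi.single_apply]
    simp [SmoothFun.d_pullback, Finset.sum_neg_distrib, sub_eq_add_neg, mul_comm]
  have hker : ∀ᶠ m in 𝓝 m₀, ∀ w, K m w = 0 ↔ ψ m w ∈ L.pullbackFiber f m := by
    filter_upwards [hfc.eventually hs] with m hm w
    rw [mem_pullbackFiber, ← sub_eq_zero (b := L.anchor _ _)]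
    constructor
    · intro h
      apply hm
      intro k
      have := congrFun h k
      rw [hKapply] at this
      rw [map_sub]; exact this
    · intro h
      ext k
      rw [hKapply, ← map_sub, h]; simp
  have hinj : ∀ᶠ m in 𝓝 m₀, Function.Injective (ψ m) := by
    filter_upwards [hX1, hfc.eventually hb1] with m h1 h2
    rw [injective_iff_map_eq_zero]
    intro w hw
    have e1 := Fintype.linearIndependent_iff.1 h1.1 (fun i => w (Sum.inl i)) (congrArg Prod.fst hw)
    have e2 := Fintype.linearIndependent_iff.1 h2.1 (fun i => w (Sum.inr i)) (congrArg Prod.snd hw)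
    ext (i | j)
    · exact e1 i
    · exact e2 j
  have hsurj : ∀ᶠ m in 𝓝 m₀, Function.Surjective (ψ m) := by
    filter_upwards [hX1, hfc.eventually hb1] with m h1 h2 p
    obtain ⟨c, hc⟩ := (Submodule.mem_span_range_iff_exists_fun ℝ).1 (h1.2 (x := p.1) trivial)
    obtain ⟨c', hc'⟩ := (Submodule.mem_span_range_iff_exists_fun ℝ).1 (h2.2 (x := p.2) trivial)
    exact ⟨Sum.elim c c', Prod.ext hc hc'⟩
  have hrank : ∀ᶠ m in 𝓝 m₀, Module.finrank ℝ (K m).ker =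
      Module.finrank ℝ (L.pullbackFiber f m) := by
    filter_upwards [hker, hinj, hsurj] with m h1 h2 h3
    have : (K m).ker.map (ψ m) = L.pullbackFiber f m := by
      ext p
      constructor
      · rintro ⟨w, hw, rfl⟩
        exact (h1 w).1 hw
      · intro hp
        obtain ⟨w, rfl⟩ := h3 p
        exact ⟨w, (h1 w).2 hp, rfl⟩
    rw [← this]
    exact (LinearEquiv.finrank_eq (Submodule.equivMapOfInjective (ψ m) h2 _))
  obtain ⟨n, κ, P, hκ⟩ := exists_kernel_frame K hK m₀ (by
    filter_upwards [hrank, hf m₀] with m h1 h2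
    rw [h1, h2, hrank.self_of_nhds])
  have hgood : ∀ᶠ m in 𝓝 m₀, ∀ j, ψ m (κ j m) ∈ L.pullbackFiber f m := by
    filter_upwards [hκ, hker] with m h1 h2 j
    exact (h2 _).1 (h1.1 j)
  obtain ⟨χ, hχ1, hχ2⟩ := exists_cutoff (I := I) hgood
  have hmem : ∀ m j, χ m • ψ m (κ j m) ∈ L.pullbackFiber f m := by
    intro m j
    by_cases hm : m ∈ tsupport χ
    · exact Submodule.smul_mem _ _ (hχ2 hm j)
    · rw [image_eq_zero_of_notMem_tsupport hm, zero_smul]; exact Submodule.zero_mem _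
  let κ' : Fin n → (Fin d ⊕ Fin r) → SmoothFun I M := fun j i =>
    ⟨fun m => κ j m i, (contMDiff_pi_space.1 (κ j).contMDiff) i⟩
  refine ⟨n, fun j m => ⟨χ m • ψ m (κ j m), hmem m j⟩, fun j => ⟨?_, ?_⟩, ?_, ?_⟩
  · have h : (fun m => (χ m • ψ m (κ j m)).1) =
        (∑ i, χ • κ' j (Sum.inl i) • X i : (tangent I M).sections).1 := by
      ext m
      simp [ψ, κ', Finset.smul_sum]
      rfl
    rw [h]
    exact Subtype.property _
  · have h : (fun m => (χ m • ψ m (κ j m)).2) =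
        (∑ i, χ • κ' j (Sum.inr i) • V.pullSection f (b i) : (V.pullback f).sections).1 := by
      ext m
      simp [ψ, κ', Finset.smul_sum, pullSection]
      rfl
    rw [h]
    exact Subtype.property _
  · filter_upwards [hχ1, hκ, hker, hinj, hsurj] with m h1 h2 h3 h4 h5
    constructor
    · rw [Fintype.linearIndependent_iff]
      intro c hc
      have hc' := congrArg Subtype.val hc
      simp only [h1, one_smul, Submodule.coe_sum, Submodule.coe_smul, Submodule.coe_zero] at hc'
      have h6 : ψ m (∑ i, c i • κ i m) = 0 := by simpa using hc'
      have h7 := congrArg P (h4 (h6.trans (map_zero _).symm))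
      rw [map_sum, map_zero] at h7
      simp only [map_smul, h2.2.2] at h7
      intro i
      have := congrFun h7 i
      simpa [Pi.single_apply] using this
    · rintro ⟨p, hp⟩ -
      obtain ⟨w, rfl⟩ := h5 p
      refine (Submodule.mem_span_range_iff_exists_fun ℝ).2 ⟨P w, Subtype.ext ?_⟩
      simp only [h1, one_smul, Submodule.coe_sum, Submodule.coe_smul]
      conv_rhs => rw [h2.2.1 w ((h3 w).2 hp)]
      simp
  · rintro σ ⟨hσ1, hσ2⟩
    obtain ⟨u, hu⟩ := hX2 ⟨_, hσ1⟩
    obtain ⟨u', hu'⟩ := V.pullback_frame_coeff f m₀ hb2 ⟨_, hσ2⟩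
    refine ⟨fun j => ∑ i, P (fun k => if i = k then 1 else 0) j • (Sum.elim u u' i : SmoothFun I M), ?_⟩
    filter_upwards [hχ1, hκ, hker, hu, hu'] with m h1 h2 h3 h4 h5
    have h6 : (σ m).1 = ψ m (fun i => (Sum.elim u u' i : SmoothFun I M) m) :=
      Prod.ext h4 h5
    apply Subtype.ext
    have h7 := h2.2.1 _ ((h3 _).2 (h6 ▸ (σ m).2))
    have h8 : ∀ j, (∑ i, P (fun k => if i = k then 1 else 0) j • (Sum.elim u u' i : SmoothFun I M)) m =
        P (fun i => (Sum.elim u u' i : SmoothFun I M) m) j := by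
      intro j
      have h9 := congrFun (P.toLinearMap.pi_apply_eq_sum_univ
        (fun i => (Sum.elim u u' i : SmoothFun I M) m)) j
      refine Eq.trans ?_ h9.symm
      rw [Finset.sum_apply, ← ContMDiffMap.coeFnAddMonoidHom_apply, map_sum, Finset.sum_apply]
      exact Finset.sum_congr rfl fun i _ => mul_comm _ _
    simp only [h1, one_smul, Submodule.coe_sum, Submodule.coe_smul, h8]
    rw [h6]
    conv_lhs => rw [h7]
    simp

/-- The vector bundle `f^{!!}A → M`, as a subbundle of `TM ⊕ f^!A`. -/
def pullbackBundle (hf : L.PullbackExists f) :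
    SmoothVectorBundle I M (fun m => L.pullbackFiber f m) where
  sections :=
    { carrier := {σ | (fun m => (σ m).1.1) ∈ (tangent I M).sections ∧
        (fun m => (σ m).1.2) ∈ (V.pullback f).sections}
      add_mem' := fun h h' => ⟨Submodule.add_mem _ h.1 h'.1, Submodule.add_mem _ h.2 h'.2⟩
      zero_mem' := ⟨Submodule.zero_mem _, Submodule.zero_mem _⟩
      smul_mem' := fun c _ h => ⟨Submodule.smul_mem _ c h.1, Submodule.smul_mem _ c h.2⟩ }
  smul_mem h σ hσ := ⟨(tangent I M).smul_mem h _ hσ.1, (V.pullback f).smul_mem h _ hσ.2⟩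
  mem_of_locally σ hσ := by
    constructor
    · apply mem_of_locally
      intro x
      obtain ⟨t, ht, h⟩ := hσ x
      exact ⟨_, ht.1, h.mono fun y hy => by rw [hy]⟩
    · apply mem_of_locally
      intro x
      obtain ⟨t, ht, h⟩ := hσ x
      exact ⟨_, ht.2, h.mono fun y hy => by rw [hy]⟩
  exists_frame m₀ := pullback_frame hf m₀

end LieAlgebroid
end PullbackAlgebroid

section PullbackBracket

variable {E : Type*} [NormedAddCommGroup E] [NormedSpace ℝ E] [FiniteDimensional ℝ E]
  {H : Type*} [TopologicalSpace H] {I : ModelWithCorners ℝ E H}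
  {M : Type*} [TopologicalSpace M] [ChartedSpace H M] [IsManifold I ∞ M] [T2Space M]
  {E' : Type*} [NormedAddCommGroup E'] [NormedSpace ℝ E'] [FiniteDimensional ℝ E']
  {H' : Type*} [TopologicalSpace H'] {I' : ModelWithCorners ℝ E' H'}
  {N : Type*} [TopologicalSpace N] [ChartedSpace H' N] [IsManifold I' ∞ N] [T2Space N]
  {A : N → Type*} [∀ x, AddCommGroup (A x)] [∀ x, Module ℝ (A x)]

theorem lieDer_add_left (X Y : (tangent I M).sections) (u : SmoothFun I M) :
    lieDer (X + Y) u = lieDer X u + lieDer Y u := by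
  ext x; exact map_add (u.d x) _ _

theorem lieDer_const_smul_left (c : ℝ) (X : (tangent I M).sections) (u : SmoothFun I M) :
    lieDer (c • X) u = c • lieDer X u := by
  ext x; exact map_smul (u.d x) c _

theorem lieDer_smul_left (h : SmoothFun I M) (X : (tangent I M).sections) (u : SmoothFun I M) :
    lieDer (h • X) u = h * lieDer X u := by
  ext x; exact map_smul (u.d x) (h x) _

namespace LieAlgebroid

variable {V : SmoothVectorBundle I' N A} (L : LieAlgebroid V) (f : C^∞⟮I, M; I', N⟯)

/-- The bilinear extension `(∑ hᵢ ⊗ bᵢ, ∑ gⱼ ⊗ cⱼ) ↦ ∑ hᵢ gⱼ ⊗ [bᵢ, cⱼ]`. -/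
def tensorBracket : SmoothFun I M ⊗[ℝ] V.sections →ₗ[ℝ] SmoothFun I M ⊗[ℝ] V.sections →ₗ[ℝ]
    SmoothFun I M ⊗[ℝ] V.sections :=
  TensorProduct.map₂ (LinearMap.mul ℝ (SmoothFun I M)) L.bracket

@[simp] theorem tensorBracket_tmul (h g : SmoothFun I M) (b c : V.sections) :
    L.tensorBracket (h ⊗ₜ[ℝ] b) (g ⊗ₜ[ℝ] c) = (h * g) ⊗ₜ[ℝ] L.bracket b c := rfl

/-- The derivation `∑ gⱼ ⊗ cⱼ ↦ ∑ X(gⱼ) ⊗ cⱼ`. -/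
def tensorDer (V : SmoothVectorBundle I' N A) (X : (tangent I M).sections) :
    SmoothFun I M ⊗[ℝ] V.sections →ₗ[ℝ] SmoothFun I M ⊗[ℝ] V.sections :=
  (lieDer X).rTensor V.sections

@[simp] theorem tensorDer_tmul (X : (tangent I M).sections) (g : SmoothFun I M)
    (c : V.sections) : tensorDer V X (g ⊗ₜ[ℝ] c) = lieDer X g ⊗ₜ[ℝ] c := rfl

theorem tensorBracket_skew (s t : SmoothFun I M ⊗[ℝ] V.sections) :
    L.tensorBracket s t = -L.tensorBracket t s := by
  induction s with
  | zero => simp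
  | add s s' h h' => simp only [map_add, LinearMap.add_apply, h, h', neg_add]
  | tmul h b =>
    induction t with
    | zero => simp
    | add s s' h h' => simp only [map_add, LinearMap.add_apply, h, h', neg_add]
    | tmul g c => rw [tensorBracket_tmul, tensorBracket_tmul, L.bracket_skew, mul_comm,
        TensorProduct.tmul_neg]

theorem tensorBracket_jacobi (s t u : SmoothFun I M ⊗[ℝ] V.sections) :
    L.tensorBracket s (L.tensorBracket t u) =
      L.tensorBracket (L.tensorBracket s t) u + L.tensorBracket t (L.tensorBracket s u) := by
  induction s with
  | zero => simp
  | add s s' h h' => simp only [map_add, LinearMap.add_apply, h, h']; abel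
  | tmul h b =>
    induction t with
    | zero => simp
    | add s s' h h' => simp only [map_add, LinearMap.add_apply, h, h']; abel
    | tmul g c =>
      induction u with
      | zero => simp
      | add s s' h h' => simp only [map_add, h, h']; abel
      | tmul k d =>
        simp only [tensorBracket_tmul]
        rw [L.jacobi, TensorProduct.tmul_add, mul_assoc, mul_left_comm g h k]

theorem tensorDer_bracket (X : (tangent I M).sections) (s t : SmoothFun I M ⊗[ℝ] V.sections) :
    tensorDer V X (L.tensorBracket s t) =
      L.tensorBracket (tensorDer V X s) t + L.tensorBracket s (tensorDer V X t) := by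
  induction s with
  | zero => simp
  | add s s' h h' => simp only [map_add, LinearMap.add_apply, h, h']; abel
  | tmul h b =>
    induction t with
    | zero => simp
    | add s s' h h' => simp only [map_add, h, h']; abel
    | tmul g c =>
      simp only [tensorBracket_tmul, tensorDer_tmul, lieDer_mul, TensorProduct.add_tmul]
      rw [add_comm, mul_comm g]

theorem tensorDer_lie (X Y : (tangent I M).sections) (t : SmoothFun I M ⊗[ℝ] V.sections) :
    tensorDer V ((tangentAlgebroid I M).bracket X Y) t =
      tensorDer V X (tensorDer V Y t) - tensorDer V Y (tensorDer V X t) := by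
  induction t with
  | zero => simp
  | add s s' h h' => simp only [map_add, h, h']; abel
  | tmul g c => simp only [tensorDer_tmul, lieDer_bracket, TensorProduct.sub_tmul]

/-- The second component
`∑ hᵢ gⱼ ⊗ [bᵢ, cⱼ] + ∑ X(gⱼ) ⊗ cⱼ - ∑ Y(hᵢ) ⊗ bᵢ` of the bracket of `(X, ∑ hᵢ ⊗ bᵢ)` and
`(Y, ∑ gⱼ ⊗ cⱼ)`. -/
def pullbackFormula (X : (tangent I M).sections) (s : SmoothFun I M ⊗[ℝ] V.sections)
    (Y : (tangent I M).sections) (t : SmoothFun I M ⊗[ℝ] V.sections) :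
    SmoothFun I M ⊗[ℝ] V.sections :=
  L.tensorBracket s t + tensorDer V X t - tensorDer V Y s

theorem pullbackFormula_skew (X : (tangent I M).sections) (s : SmoothFun I M ⊗[ℝ] V.sections)
    (Y : (tangent I M).sections) (t : SmoothFun I M ⊗[ℝ] V.sections) :
    L.pullbackFormula X s Y t = -L.pullbackFormula Y t X s := by
  rw [pullbackFormula, pullbackFormula, L.tensorBracket_skew s t]
  abel

theorem pullbackFormula_jacobi (X Y Z : (tangent I M).sections)
    (s t u : SmoothFun I M ⊗[ℝ] V.sections) :
    L.pullbackFormula X s ((tangentAlgebroid I M).bracket Y Z) (L.pullbackFormula Y t Z u) =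
      L.pullbackFormula ((tangentAlgebroid I M).bracket X Y) (L.pullbackFormula X s Y t) Z u +
      L.pullbackFormula Y t ((tangentAlgebroid I M).bracket X Z) (L.pullbackFormula X s Z u) := by
  simp only [pullbackFormula, map_add, map_sub, LinearMap.add_apply, LinearMap.sub_apply,
    tensorDer_bracket, tensorDer_lie, L.tensorBracket_jacobi s t u]
  rw [L.tensorBracket_skew (tensorDer V Z s) t]
  abel

theorem ev_tensorDer_smul (h : SmoothFun I M) (X : (tangent I M).sections)
    (t : SmoothFun I M ⊗[ℝ] V.sections) (m : M) :
    V.ev f m (tensorDer V (h • X) t) = h m • V.ev f m (tensorDer V X t) := by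
  induction t with
  | zero => simp
  | add s s' h h' => simp only [map_add, h, h', smul_add]
  | tmul g c => simp [lieDer_smul_left, mul_smul]

/-- The derivation `c ↦ ∑ hᵢ(m) [bᵢ, c](f m)`. -/
def tensorDerAt (m : M) (s : SmoothFun I M ⊗[ℝ] V.sections) :
    V.PointDerivation (f m) (L.anchor (f m) (V.ev f m s)) where
  toFun := V.ev f m ∘ₗ L.tensorBracket s ∘ₗ TensorProduct.mk ℝ (SmoothFun I M) V.sections 1
  leibniz k c := by
    induction s with
    | zero => simp
    | add s s' h h' =>
      simp only [map_add, LinearMap.coe_comp, Function.comp_apply, LinearMap.add_apply] at h h' ⊢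
      rw [h, h']
      module
    | tmul h b => simp [L.leibniz, smul_smul, mul_comm]

theorem ev_tensorBracket_tmul (m : M) (s : SmoothFun I M ⊗[ℝ] V.sections) (g : SmoothFun I M)
    (c : V.sections) : V.ev f m (L.tensorBracket s (g ⊗ₜ c)) =
      g m • V.ev f m (L.tensorBracket s (1 ⊗ₜ c)) := by
  induction s with
  | zero => simp
  | add s s' h h' => simp only [map_add, LinearMap.add_apply, h, h', smul_add]
  | tmul h b => simp [smul_smul, mul_comm]

theorem ev_bracket_add_der {m : M} (X : (tangent I M).sections)
    (s t : SmoothFun I M ⊗[ℝ] V.sections) :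
    V.ev f m (L.tensorBracket s t + tensorDer V X t) =
      (L.tensorDerAt f m s).evD f (X.1 m) t := by
  induction t with
  | zero => simp
  | add t t' h h' =>
    simp only [map_add] at h h' ⊢
    rw [← h, ← h']
    abel
  | tmul g c =>
    rw [map_add, ev_tensorBracket_tmul]
    rfl

theorem tensorDer_add_left (X Y : (tangent I M).sections) (t : SmoothFun I M ⊗[ℝ] V.sections) :
    tensorDer V (X + Y) t = tensorDer V X t + tensorDer V Y t := by
  induction t with
  | zero => simp
  | add s s' h h' => simp only [map_add, h, h']; abel
  | tmul g c => simp [lieDer_add_left, TensorProduct.add_tmul]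

theorem ev_formula_congr_right {m : M} {X : (tangent I M).sections}
    {s : SmoothFun I M ⊗[ℝ] V.sections}
    (hX : mfderiv I I' f m (X.1 m) = L.anchor (f m) (V.ev f m s)) (Y : (tangent I M).sections)
    {t t' : SmoothFun I M ⊗[ℝ] V.sections} (h : ∀ᶠ y in 𝓝 m, V.ev f y t = V.ev f y t') :
    V.ev f m (L.pullbackFormula X s Y t) = V.ev f m (L.pullbackFormula X s Y t') := by
  rw [pullbackFormula, pullbackFormula, map_sub, map_sub, ev_bracket_add_der, ev_bracket_add_der,
    (L.tensorDerAt f m s).evD_congr f hX h]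

theorem ev_formula_congr_left {m : M} {Y : (tangent I M).sections}
    {t : SmoothFun I M ⊗[ℝ] V.sections}
    (hY : mfderiv I I' f m (Y.1 m) = L.anchor (f m) (V.ev f m t)) (X : (tangent I M).sections)
    {s s' : SmoothFun I M ⊗[ℝ] V.sections} (h : ∀ᶠ y in 𝓝 m, V.ev f y s = V.ev f y s') :
    V.ev f m (L.pullbackFormula X s Y t) = V.ev f m (L.pullbackFormula X s' Y t) := by
  rw [pullbackFormula_skew, L.pullbackFormula_skew X s', map_neg, map_neg,
    L.ev_formula_congr_right f hY X h]

/-- `∑ gⱼ ⊗ cⱼ ↦ ∑ gⱼ (ρ(cⱼ) u) ∘ f`. -/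
def tensorAnchor (u : SmoothFun I' N) : SmoothFun I M ⊗[ℝ] V.sections →ₗ[ℝ] SmoothFun I M :=
  TensorProduct.lift (LinearMap.mk₂ ℝ
    (fun g c => g * (lieDer (L.anchorSection c) u).pullback f)
    (fun g g' c => add_mul _ _ _) (fun r g c => smul_mul_assoc _ _ _)
    (fun g c c' => by
      ext x
      simp [lieDer_add_left, mul_add])
    (fun r g c => by
      ext x
      simp [lieDer_const_smul_left]))

theorem tensorAnchor_apply (u : SmoothFun I' N) (t : SmoothFun I M ⊗[ℝ] V.sections) (m : M) :
    L.tensorAnchor f u t m = u.d (f m) (L.anchor (f m) (V.ev f m t)) := by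
  induction t with
  | zero => simp
  | add t t' h h' => simp [h, h']
  | tmul g c => simp [tensorAnchor]

/-- `∑ gⱼ ⊗ cⱼ ↦ ∑ gⱼ(m) z(ρ(cⱼ) u)`. -/
def tensorAnchor₂ (u : SmoothFun I' N) (m : M) (z : TangentSpace I' (f m)) :
    SmoothFun I M ⊗[ℝ] V.sections →ₗ[ℝ] ℝ :=
  TensorProduct.lift (LinearMap.mk₂ ℝ
    (fun g c => g m * (lieDer (L.anchorSection c) u).d (f m) z)
    (fun g g' c => add_mul _ _ _) (fun r g c => mul_assoc _ _ _)
    (fun g c c' => by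
      simp [lieDer_add_left, mul_add])
    (fun r g c => by
      simp [lieDer_const_smul_left, mul_left_comm]))

@[simp] theorem tensorAnchor₂_tmul (u : SmoothFun I' N) (m : M) (z : TangentSpace I' (f m))
    (g : SmoothFun I M) (c : V.sections) : L.tensorAnchor₂ f u m z (g ⊗ₜ c) =
      g m * (lieDer (L.anchorSection c) u).d (f m) z := rfl

theorem tensorAnchor₂_add (u : SmoothFun I' N) (m : M) (z z' : TangentSpace I' (f m))
    (t : SmoothFun I M ⊗[ℝ] V.sections) : L.tensorAnchor₂ f u m (z + z') t =
      L.tensorAnchor₂ f u m z t + L.tensorAnchor₂ f u m z' t := by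
  induction t with
  | zero => simp
  | add t t' h h' => simp only [map_add, h, h']; abel
  | tmul g c => simp [mul_add]

theorem tensorAnchor₂_zero (u : SmoothFun I' N) (m : M)
    (t : SmoothFun I M ⊗[ℝ] V.sections) : L.tensorAnchor₂ f u m 0 t = 0 := by
  induction t with
  | zero => simp
  | add t t' h h' => simp only [map_add, h, h', add_zero]
  | tmul g c => simp

theorem tensorAnchor_der {m : M} {X : (tangent I M).sections} {z : TangentSpace I' (f m)}
    (hX : mfderiv I I' f m (X.1 m) = z) (u : SmoothFun I' N)
    (t : SmoothFun I M ⊗[ℝ] V.sections) :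
    (L.tensorAnchor f u t).d m (X.1 m) =
      L.tensorAnchor f u (tensorDer V X t) m + L.tensorAnchor₂ f u m z t := by
  induction t with
  | zero => simp [show (0 : SmoothFun I M).d m = 0 from
      SmoothFun.d_const 0 (.of_forall fun _ => rfl)]
  | add t t' h h' =>
    simp only [map_add, SmoothFun.d_add, LinearMap.add_apply, h, h', ContMDiffMap.coe_add,
      Pi.add_apply]
    abel
  | tmul g c =>
    simp [tensorAnchor, SmoothFun.d_pullback, hX]
    ring

theorem tensorAnchor_bracket (m : M) (u : SmoothFun I' N)
    (s t : SmoothFun I M ⊗[ℝ] V.sections) :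
    L.tensorAnchor f u (L.tensorBracket s t) m =
      L.tensorAnchor₂ f u m (L.anchor (f m) (V.ev f m s)) t -
      L.tensorAnchor₂ f u m (L.anchor (f m) (V.ev f m t)) s := by
  induction s with
  | zero => simp [tensorAnchor₂_zero]
  | add s s' h h' =>
    simp only [map_add, LinearMap.add_apply, h, h', ContMDiffMap.coe_add, Pi.add_apply,
      tensorAnchor₂_add]
    ring
  | tmul h b =>
    induction t with
    | zero => simp
    | add s s' h h' =>
      simp only [map_add, h, h', ContMDiffMap.coe_add, Pi.add_apply, tensorAnchor₂_add]
      ring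
    | tmul g c =>
      rw [tensorAnchor_apply]
      simp [L.anchor_bracket]
      ring

theorem formula_mem {m : M} {X Y : (tangent I M).sections} {s t : SmoothFun I M ⊗[ℝ] V.sections}
    (hX : ∀ᶠ y in 𝓝 m, mfderiv I I' f y (X.1 y) = L.anchor (f y) (V.ev f y s))
    (hY : ∀ᶠ y in 𝓝 m, mfderiv I I' f y (Y.1 y) = L.anchor (f y) (V.ev f y t)) :
    mfderiv I I' f m (((tangentAlgebroid I M).bracket X Y).1 m) =
      L.anchor (f m) (V.ev f m (L.pullbackFormula X s Y t)) := by
  apply tangent_ext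
  intro u
  have hX' : ∀ᶠ y in 𝓝 m, lieDer X (u.pullback f) y = L.tensorAnchor f u s y := by
    filter_upwards [hX] with y hy
    rw [lieDer_apply, SmoothFun.d_pullback, hy, tensorAnchor_apply]
  have hY' : ∀ᶠ y in 𝓝 m, lieDer Y (u.pullback f) y = L.tensorAnchor f u t y := by
    filter_upwards [hY] with y hy
    rw [lieDer_apply, SmoothFun.d_pullback, hy, tensorAnchor_apply]
  rw [← SmoothFun.d_pullback, ← lieDer_apply, lieDer_bracket, ← tensorAnchor_apply]
  have h1 : lieDer X (lieDer Y (u.pullback f)) m = (L.tensorAnchor f u t).d m (X.1 m) := by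
    rw [lieDer_apply, SmoothFun.d_congr hY']
  have h2 : lieDer Y (lieDer X (u.pullback f)) m = (L.tensorAnchor f u s).d m (Y.1 m) := by
    rw [lieDer_apply, SmoothFun.d_congr hX']
  have h3 : ∀ a b : SmoothFun I M, (a - b) m = a m - b m := fun a b => rfl
  rw [h3, h1, h2, L.tensorAnchor_der f hX.self_of_nhds, L.tensorAnchor_der f hY.self_of_nhds,
    pullbackFormula, map_sub, map_add, h3, ContMDiffMap.coe_add, Pi.add_apply,
    tensorAnchor_bracket]
  ring

variable {f} (hf : L.PullbackExists f)

variable {L} in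
/-- The vector field underlying a section of `f^{!!}A`. -/
def fstSection (σ : (pullbackBundle hf).sections) : (tangent I M).sections := ⟨_, σ.2.1⟩

variable {L} in
/-- The section of `f^!A` underlying a section of `f^{!!}A`. -/
def sndSection (σ : (pullbackBundle hf).sections) : (V.pullback f).sections := ⟨_, σ.2.2⟩

variable {L} in
/-- `t` represents the section of `f^!A` underlying `σ` near `m`. -/
def Represents (σ : (pullbackBundle hf).sections) (m : M) (t : SmoothFun I M ⊗[ℝ] V.sections) :
    Prop := ∀ᶠ y in 𝓝 m, (σ.1 y).1.2 = V.ev f y t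

variable {L} in
theorem exists_represents (σ : (pullbackBundle hf).sections) (m : M) :
    ∃ t, Represents hf σ m t := V.pullback_exists f (sndSection hf σ) m

variable {L hf} in
theorem Represents.anchor_eq {σ : (pullbackBundle hf).sections} {m : M}
    {t : SmoothFun I M ⊗[ℝ] V.sections} (h : Represents hf σ m t) :
    ∀ᶠ y in 𝓝 m, mfderiv I I' f y ((fstSection hf σ).1 y) = L.anchor (f y) (V.ev f y t) := by
  filter_upwards [h] with y hy
  rw [← hy]
  exact (σ.1 y).2

variable {L} in
/-- The second component of the bracket of two sections of `f^{!!}A` at `m`. -/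
def sndBracket (σ τ : (pullbackBundle hf).sections) (m : M) : A (f m) :=
  V.ev f m (L.pullbackFormula (fstSection hf σ) (exists_represents hf σ m).choose
    (fstSection hf τ) (exists_represents hf τ m).choose)

variable {L hf} in
theorem sndBracket_eq {σ τ : (pullbackBundle hf).sections} {m : M}
    {s t : SmoothFun I M ⊗[ℝ] V.sections} (hs : Represents hf σ m s)
    (ht : Represents hf τ m t) :
    sndBracket hf σ τ m =
      V.ev f m (L.pullbackFormula (fstSection hf σ) s (fstSection hf τ) t) := by
  have hs' := (exists_represents hf σ m).choose_spec
  have ht' := (exists_represents hf τ m).choose_spec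
  rw [sndBracket, L.ev_formula_congr_right f hs'.anchor_eq.self_of_nhds _ (t' := t),
    L.ev_formula_congr_left f ht.anchor_eq.self_of_nhds _ (s' := s)]
  · filter_upwards [hs, hs'] with y h1 h2
    rw [← h1, h2]
  · filter_upwards [ht, ht'] with y h1 h2
    rw [← h1, h2]

variable {L hf} in
theorem sndBracket_eventually {σ τ : (pullbackBundle hf).sections} {m : M}
    {s t : SmoothFun I M ⊗[ℝ] V.sections} (hs : Represents hf σ m s)
    (ht : Represents hf τ m t) : ∀ᶠ y in 𝓝 m, sndBracket hf σ τ y =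
      V.ev f y (L.pullbackFormula (fstSection hf σ) s (fstSection hf τ) t) := by
  filter_upwards [eventually_eventually_nhds.2 hs, eventually_eventually_nhds.2 ht] with y h1 h2
  exact sndBracket_eq h1 h2

variable {L} in
/-- The bracket of two sections of `f^{!!}A`:
`[(X, ∑ hᵢ f^!bᵢ), (Y, ∑ gⱼ f^!cⱼ)] =
  ([X, Y], ∑ hᵢ gⱼ f^![bᵢ, cⱼ] + ∑ X(gⱼ) f^!cⱼ - ∑ Y(hᵢ) f^!bᵢ)`. -/
def pullbackBracket (σ τ : (pullbackBundle hf).sections) : (pullbackBundle hf).sections :=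
  ⟨fun m => ⟨(((tangentAlgebroid I M).bracket (fstSection hf σ) (fstSection hf τ)).1 m,
      sndBracket hf σ τ m), L.formula_mem f
        (exists_represents hf σ m).choose_spec.anchor_eq
        (exists_represents hf τ m).choose_spec.anchor_eq⟩,
    ((tangentAlgebroid I M).bracket (fstSection hf σ) (fstSection hf τ)).2, fun m => by
      obtain ⟨s, hs⟩ := exists_represents hf σ m
      obtain ⟨t, ht⟩ := exists_represents hf τ m
      exact ⟨_, sndBracket_eventually hs ht⟩⟩

variable {L hf} in
theorem pullbackSection_ext {σ τ : (pullbackBundle hf).sections}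
    (h1 : fstSection hf σ = fstSection hf τ) (h2 : ∀ m, (σ.1 m).1.2 = (τ.1 m).1.2) : σ = τ := by
  apply Subtype.ext
  funext m
  exact Subtype.ext (Prod.ext (congrFun (congrArg Subtype.val h1) m) (h2 m))

variable {L} in
theorem pullbackBracket_skew (σ τ : (pullbackBundle hf).sections) :
    pullbackBracket hf σ τ = -pullbackBracket hf τ σ := by
  apply pullbackSection_ext
  · exact (tangentAlgebroid I M).bracket_skew _ _
  · intro m
    obtain ⟨s, hs⟩ := exists_represents hf σ m
    obtain ⟨t, ht⟩ := exists_represents hf τ m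
    change sndBracket hf σ τ m = -sndBracket hf τ σ m
    rw [sndBracket_eq hs ht, sndBracket_eq ht hs, pullbackFormula_skew, map_neg]

variable {L} in
theorem pullbackBracket_self (σ : (pullbackBundle hf).sections) : pullbackBracket hf σ σ = 0 := by
  have h := pullbackBracket_skew hf σ σ
  apply Subtype.ext
  funext m
  have h1 : (pullbackBracket hf σ σ).1 m = -(pullbackBracket hf σ σ).1 m :=
    congrFun (congrArg Subtype.val h) m
  have h2 : (2 : ℝ) • (pullbackBracket hf σ σ).1 m = 0 := by
    rw [two_smul]
    exact eq_neg_iff_add_eq_zero.1 h1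
  exact (smul_eq_zero.1 h2).resolve_left two_ne_zero

variable {L} in
theorem pullbackBracket_add (σ τ τ' : (pullbackBundle hf).sections) :
    pullbackBracket hf σ (τ + τ') = pullbackBracket hf σ τ + pullbackBracket hf σ τ' := by
  apply pullbackSection_ext
  · exact map_add ((tangentAlgebroid I M).bracket _) (fstSection hf τ) (fstSection hf τ')
  · intro m
    obtain ⟨s, hs⟩ := exists_represents hf σ m
    obtain ⟨t, ht⟩ := exists_represents hf τ m
    obtain ⟨t', ht'⟩ := exists_represents hf τ' m
    have ht2 : Represents hf (τ + τ') m (t + t') := by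
      filter_upwards [ht, ht'] with y h h'
      rw [map_add, ← h, ← h']; rfl
    change sndBracket hf σ (τ + τ') m = sndBracket hf σ τ m + sndBracket hf σ τ' m
    rw [sndBracket_eq hs ht, sndBracket_eq hs ht', sndBracket_eq hs ht2]
    have h1 : fstSection hf (τ + τ') = fstSection hf τ + fstSection hf τ' := rfl
    rw [h1, pullbackFormula, tensorDer_add_left, ← map_add]
    congr 1
    simp only [pullbackFormula, map_add]
    abel

variable {L} in
theorem pullbackBracket_leibniz (σ τ : (pullbackBundle hf).sections) (h : SmoothFun I M) (m : M) :
    (pullbackBracket hf σ (h • τ)).1 m = h m • (pullbackBracket hf σ τ).1 m +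
      h.d m ((fstSection hf σ).1 m) • τ.1 m := by
  apply Subtype.ext
  apply Prod.ext
  · exact (tangentAlgebroid I M).leibniz (fstSection hf σ) (fstSection hf τ) h m
  · obtain ⟨s, hs⟩ := exists_represents hf σ m
    obtain ⟨t, ht⟩ := exists_represents hf τ m
    have ht2 : Represents hf (h • τ) m (h • t) := by
      filter_upwards [ht] with y hy
      rw [ev_smul, ← hy]; rfl
    change sndBracket hf σ (h • τ) m = h m • sndBracket hf σ τ m +
      h.d m ((fstSection hf σ).1 m) • (τ.1 m).1.2
    rw [sndBracket_eq hs ht, sndBracket_eq hs ht2, ht.self_of_nhds]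
    have h1 : fstSection hf (h • τ) = h • fstSection hf τ := rfl
    rw [pullbackFormula, pullbackFormula, map_sub, map_sub, ev_bracket_add_der,
      ev_bracket_add_der, PointDerivation.evD_smul, h1, ev_tensorDer_smul]
    module

variable {L} in
theorem pullbackBracket_smul (c : ℝ) (τ σ : (pullbackBundle hf).sections) :
    pullbackBracket hf τ (c • σ) = c • pullbackBracket hf τ σ := by
  have h := pullbackBracket_leibniz hf τ σ (show SmoothFun I M from ⟨fun _ => c, contMDiff_const⟩)
  apply Subtype.ext
  funext m
  refine (h m).trans ?_
  rw [SmoothFun.d_const c (.of_forall fun _ => rfl), LinearMap.zero_apply, zero_smul, add_zero]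
  rfl

variable {L} in
theorem pullbackBracket_jacobi (σ τ υ : (pullbackBundle hf).sections) :
    pullbackBracket hf σ (pullbackBracket hf τ υ) =
      pullbackBracket hf (pullbackBracket hf σ τ) υ +
      pullbackBracket hf τ (pullbackBracket hf σ υ) := by
  apply pullbackSection_ext
  · exact (tangentAlgebroid I M).jacobi (fstSection hf σ) (fstSection hf τ) (fstSection hf υ)
  · intro m
    obtain ⟨s, hs⟩ := exists_represents hf σ m
    obtain ⟨t, ht⟩ := exists_represents hf τ m
    obtain ⟨u, hu⟩ := exists_represents hf υ m
    have e1 : Represents hf (pullbackBracket hf τ υ) m _ := sndBracket_eventually ht hu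
    have e2 : Represents hf (pullbackBracket hf σ τ) m _ := sndBracket_eventually hs ht
    have e3 : Represents hf (pullbackBracket hf σ υ) m _ := sndBracket_eventually hs hu
    have h := congrArg (V.ev f m) (L.pullbackFormula_jacobi (fstSection hf σ) (fstSection hf τ)
      (fstSection hf υ) s t u)
    rw [map_add] at h
    exact (sndBracket_eq hs e1).trans (h.trans
      (congrArg₂ (· + ·) (sndBracket_eq e2 hu) (sndBracket_eq ht e3)).symm)

variable {L} in
/-- The pullback Lie algebroid `f^{!!}A → M`, with anchor `(v, b) ↦ v`. -/
def pullback : LieAlgebroid (pullbackBundle hf) where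
  anchor m := LinearMap.fst ℝ _ _ ∘ₗ (L.pullbackFiber f m).subtype
  anchor_mem σ := σ.2.1
  bracket := LinearMap.mk₂ ℝ (pullbackBracket hf)
    (fun σ σ' τ => (pullbackBracket_skew hf _ _).trans ((congrArg Neg.neg
      (pullbackBracket_add hf τ σ σ')).trans ((neg_add (pullbackBracket hf τ σ)
        (pullbackBracket hf τ σ')).trans (congrArg₂ (fun x y => x + y)
        (pullbackBracket_skew hf σ τ) (pullbackBracket_skew hf σ' τ)).symm)))
    (fun c σ τ => (pullbackBracket_skew hf _ _).trans ((congrArg Neg.neg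
      (pullbackBracket_smul hf c τ σ)).trans ((smul_neg c (pullbackBracket hf τ σ)).symm.trans
        (congrArg (fun x => c • x) (pullbackBracket_skew hf σ τ)).symm)))
    (fun σ τ τ' => pullbackBracket_add hf σ τ τ')
    (fun c τ σ => pullbackBracket_smul hf c τ σ)
  bracket_self σ := pullbackBracket_self hf σ
  jacobi σ τ υ := pullbackBracket_jacobi hf σ τ υ
  leibniz σ τ h m := pullbackBracket_leibniz hf σ τ h m

end LieAlgebroid
end PullbackBracket

section Connections

variable {E : Type*} [NormedAddCommGroup E] [NormedSpace ℝ E] [FiniteDimensional ℝ E]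
  {H : Type*} [TopologicalSpace H] {I : ModelWithCorners ℝ E H}
  {M : Type*} [TopologicalSpace M] [ChartedSpace H M] [IsManifold I ∞ M] [T2Space M]
  {E' : Type*} [NormedAddCommGroup E'] [NormedSpace ℝ E'] [FiniteDimensional ℝ E']
  {H' : Type*} [TopologicalSpace H'] {I' : ModelWithCorners ℝ E' H'}
  {N : Type*} [TopologicalSpace N] [ChartedSpace H' N] [IsManifold I' ∞ N] [T2Space N]
  {A : N → Type*} [∀ x, AddCommGroup (A x)] [∀ x, Module ℝ (A x)]
  {G : N → Type*} [∀ x, AddCommGroup (G x)] [∀ x, Module ℝ (G x)]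

/-- An `A`-connection on a vector bundle. -/
structure AlgebroidConnection {V : SmoothVectorBundle I' N A} (L : LieAlgebroid V)
    (W : SmoothVectorBundle I' N G) where
  toFun : V.sections →ₗ[ℝ] W.sections →ₗ[ℝ] W.sections
  smul_left : ∀ (h : SmoothFun I' N) a e, toFun (h • a) e = h • toFun a e
  leibniz : ∀ (a : V.sections) (e : W.sections) (h : SmoothFun I' N) (x : N),
    (toFun a (h • e)).1 x = h x • (toFun a e).1 x + h.d x (L.anchor x (a.1 x)) • e.1 x

namespace AlgebroidConnection

variable {V : SmoothVectorBundle I' N A} {L : LieAlgebroid V} {W : SmoothVectorBundle I' N G}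

/-- A connection is flat, i.e. a representation of the Lie algebroid, if its curvature vanishes. -/
def IsFlat (D : AlgebroidConnection L W) : Prop :=
  ∀ a b e, D.toFun a (D.toFun b e) - D.toFun b (D.toFun a e) - D.toFun (L.bracket a b) e = 0

/-- The canonical flat connection `∇_a h = ρ(a)(h)` on the trivial line bundle. -/
def canonical (L : LieAlgebroid V) : AlgebroidConnection L (trivialLine I' N) where
  toFun := LinearMap.mk₂ ℝ
    (fun a h => ⟨lieDer (L.anchorSection a) ⟨h.1, h.2⟩, ContMDiffMap.contMDiff _⟩)
    (fun a b h => by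
      ext x
      exact (congrArg (SmoothFun.d (⟨h.1, h.2⟩ : SmoothFun I' N) x)
        (map_add (L.anchor x) (a.1 x) (b.1 x))).trans (map_add _ _ _))
    (fun c a h => by
      ext x
      exact (congrArg (SmoothFun.d (⟨h.1, h.2⟩ : SmoothFun I' N) x)
        (map_smul (L.anchor x) c (a.1 x))).trans (map_smul _ _ _))
    (fun a h k => by
      ext x
      exact congrArg (fun l => l (L.anchor x (a.1 x)))
        (SmoothFun.d_add (⟨h.1, h.2⟩ : SmoothFun I' N) ⟨k.1, k.2⟩ x))
    (fun c a h => by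
      ext x
      exact congrArg (fun l => l (L.anchor x (a.1 x)))
        (SmoothFun.d_smul c (⟨h.1, h.2⟩ : SmoothFun I' N) x))
  smul_left h a e := by
    ext x
    exact map_smul (SmoothFun.d (⟨e.1, e.2⟩ : SmoothFun I' N) x ∘ₗ L.anchor x) (h x) (a.1 x)
  leibniz a e h x := by
    refine (congrArg (fun l => l (L.anchor x (a.1 x)))
      (SmoothFun.d_mul h (⟨e.1, e.2⟩ : SmoothFun I' N) x)).trans ?_
    simp only [LinearMap.add_apply, LinearMap.smul_apply, smul_eq_mul]
    congr 1
    exact mul_comm _ _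

variable (D : AlgebroidConnection L W)

/-- The covariant derivative at a point. -/
def derAt (a : V.sections) (x : N) : W.PointDerivation x (L.anchor x (a.1 x)) where
  toFun :=
    { toFun := fun e => (D.toFun a e).1 x
      map_add' := fun e e' => by simp
      map_smul' := fun r e => by simp }
  leibniz h e := D.leibniz a e h x

theorem eq_zero_of_apply_eq_zero {a : V.sections} {x : N} (ha : a.1 x = 0) (e : W.sections) :
    (D.toFun a e).1 x = 0 := by
  obtain ⟨n, b, h1, h2⟩ := V.frame x
  obtain ⟨u, hu⟩ := h2 a
  obtain ⟨χ, hχ1, hχ2⟩ := exists_cutoff (I := I') hu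
  have hz : ∀ i, u i x = 0 :=
    Fintype.linearIndependent_iff.1 h1.self_of_nhds.1 (fun i => u i x)
      (hu.self_of_nhds.symm.trans ha)
  have h3 : χ • a = ∑ i, χ • u i • b i := by
    ext y
    by_cases hy : y ∈ tsupport χ
    · have := hχ2 hy
      simp only [Set.mem_ofPred_eq] at this
      simp [this, Finset.smul_sum]
    · simp [image_eq_zero_of_notMem_tsupport hy]
  have h4 : (D.toFun (χ • a) e).1 x = (D.toFun a e).1 x := by
    rw [D.smul_left, fun_smul_apply, hχ1.self_of_nhds, one_smul]
  rw [← h4, h3, map_sum, LinearMap.sum_apply, sections_sum_apply]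
  refine Finset.sum_eq_zero fun i _ => ?_
  rw [D.smul_left, D.smul_left]
  simp [hz i]

theorem congr_left {a b : V.sections} {x : N} (h : a.1 x = b.1 x) (e : W.sections) :
    (D.toFun a e).1 x = (D.toFun b e).1 x := by
  rw [← sub_eq_zero]
  have := D.eq_zero_of_apply_eq_zero (a := a - b) (x := x) (by simp [h]) e
  simpa using this

variable {f : C^∞⟮I, M; I', N⟯} (hf : L.PullbackExists f)

/-- `(∇_σ s)(m)` for `σ = (X, ∑ hᵢ f^!bᵢ)` and `s = ∑ gⱼ f^!eⱼ`: the extension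
`∑ X(gⱼ) eⱼ + gⱼ ∇_b eⱼ` of the covariant derivative along `b = ∑ hᵢ(m) bᵢ ∈ A_{f(m)}`. -/
def pullbackValue (σ : (LieAlgebroid.pullbackBundle hf).sections) (m : M) :
    (W.pullback f).sections →ₗ[ℝ] G (f m) :=
  ((D.derAt (V.exists_section (f m) (σ.1 m).1.2).choose (f m)).pullback f (v := (σ.1 m).1.1) (by
    rw [(V.exists_section (f m) (σ.1 m).1.2).choose_spec]
    exact (σ.1 m).2)).toFun

/-- The bilinear extension `(∑ hᵢ ⊗ bᵢ, ∑ gⱼ ⊗ eⱼ) ↦ ∑ hᵢ gⱼ ⊗ ∇_{bᵢ} eⱼ`. -/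
def tensorConnection : SmoothFun I M ⊗[ℝ] V.sections →ₗ[ℝ] SmoothFun I M ⊗[ℝ] W.sections →ₗ[ℝ]
    SmoothFun I M ⊗[ℝ] W.sections :=
  TensorProduct.map₂ (LinearMap.mul ℝ (SmoothFun I M)) D.toFun

@[simp] theorem tensorConnection_tmul (h g : SmoothFun I M) (b : V.sections) (e : W.sections) :
    D.tensorConnection (h ⊗ₜ[ℝ] b) (g ⊗ₜ[ℝ] e) = (h * g) ⊗ₜ[ℝ] D.toFun b e := rfl

theorem ev_tensorConnection {m : M} (t : SmoothFun I M ⊗[ℝ] V.sections) (g : SmoothFun I M)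
    (e : W.sections) : ∀ a : V.sections, a.1 (f m) = V.ev f m t →
    W.ev f m (D.tensorConnection t (g ⊗ₜ e)) = g m • (D.toFun a e).1 (f m) := by
  induction t with
  | zero =>
    intro a ha
    rw [D.eq_zero_of_apply_eq_zero (ha.trans (map_zero _)) e]
    simp
  | add t t' h h' =>
    intro a ha
    obtain ⟨b, hb⟩ := V.exists_section (f m) (V.ev f m t)
    obtain ⟨b', hb'⟩ := V.exists_section (f m) (V.ev f m t')
    have h3 : a.1 (f m) = (b + b').1 (f m) := by rw [ha, map_add, ← hb, ← hb']; rfl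
    rw [map_add, LinearMap.add_apply, map_add, h b hb, h' b' hb', D.congr_left h3, map_add,
      LinearMap.add_apply, ← smul_add]
    rfl
  | tmul h b =>
    intro a ha
    have h3 : a.1 (f m) = (h m • b).1 (f m) := ha
    rw [D.congr_left h3]
    simp [smul_smul, mul_comm]

theorem pullbackValue_eq {σ : (LieAlgebroid.pullbackBundle hf).sections}
    {s : (W.pullback f).sections} {m : M} {t : SmoothFun I M ⊗[ℝ] V.sections}
    {w : SmoothFun I M ⊗[ℝ] W.sections} (ht : (σ.1 m).1.2 = V.ev f m t)
    (hw : ∀ᶠ y in 𝓝 m, s.1 y = W.ev f y w) :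
    D.pullbackValue hf σ m s = W.ev f m (D.tensorConnection t w +
      LieAlgebroid.tensorDer W (LieAlgebroid.fstSection hf σ) w) := by
  rw [pullbackValue, PointDerivation.pullback_eq f _ _ hw]
  have ha := (V.exists_section (f m) (σ.1 m).1.2).choose_spec
  generalize (V.exists_section (f m) (σ.1 m).1.2).choose = a at ha
  clear hw
  induction w with
  | zero => simp
  | add w w' h h' =>
    simp only [map_add] at h h' ⊢
    rw [h, h']
    abel
  | tmul g e =>
    rw [map_add, D.ev_tensorConnection t g e a (ha.trans ht)]
    rfl

theorem pullbackValue_mem (σ : (LieAlgebroid.pullbackBundle hf).sections)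
    (s : (W.pullback f).sections) :
    (fun m => D.pullbackValue hf σ m s) ∈ (W.pullback f).sections := fun m => by
  obtain ⟨t, ht⟩ := LieAlgebroid.exists_represents hf σ m
  obtain ⟨w, hw⟩ := W.pullback_exists f s m
  refine ⟨D.tensorConnection t w +
      LieAlgebroid.tensorDer W (LieAlgebroid.fstSection hf σ) w, ?_⟩
  filter_upwards [ht, eventually_eventually_nhds.2 hw] with y h1 h2
  exact D.pullbackValue_eq hf h1 h2

theorem pullbackValue_add_left (σ σ' : (LieAlgebroid.pullbackBundle hf).sections)
    (s : (W.pullback f).sections) (m : M) : D.pullbackValue hf (σ + σ') m s =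
      D.pullbackValue hf σ m s + D.pullbackValue hf σ' m s := by
  obtain ⟨t, ht⟩ := LieAlgebroid.exists_represents hf σ m
  obtain ⟨t', ht'⟩ := LieAlgebroid.exists_represents hf σ' m
  obtain ⟨w, hw⟩ := W.pullback_exists f s m
  have h1 : ((σ + σ').1 m).1.2 = V.ev f m (t + t') := by
    rw [map_add, ← ht.self_of_nhds, ← ht'.self_of_nhds]; rfl
  have h2 : LieAlgebroid.fstSection hf (σ + σ') =
    LieAlgebroid.fstSection hf σ + LieAlgebroid.fstSection hf σ' := rfl
  rw [D.pullbackValue_eq hf ht.self_of_nhds hw, D.pullbackValue_eq hf ht'.self_of_nhds hw,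
    D.pullbackValue_eq hf h1 hw, h2, LieAlgebroid.tensorDer_add_left, ← map_add,
    map_add D.tensorConnection, LinearMap.add_apply]
  congr 1
  abel

theorem pullbackValue_smul_left (h : SmoothFun I M)
    (σ : (LieAlgebroid.pullbackBundle hf).sections) (s : (W.pullback f).sections) (m : M) :
    D.pullbackValue hf (h • σ) m s = h m • D.pullbackValue hf σ m s := by
  obtain ⟨t, ht⟩ := LieAlgebroid.exists_represents hf σ m
  obtain ⟨w, hw⟩ := W.pullback_exists f s m
  have h1 : ((h • σ).1 m).1.2 = V.ev f m (h • t) := by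
    rw [ev_smul, ← ht.self_of_nhds]; rfl
  have h2 : LieAlgebroid.fstSection hf (h • σ) = h • LieAlgebroid.fstSection hf σ := rfl
  rw [D.pullbackValue_eq hf ht.self_of_nhds hw, D.pullbackValue_eq hf h1 hw, map_add, map_add,
    smul_add, h2, LieAlgebroid.ev_tensorDer_smul]
  congr 1
  clear hw
  induction w with
  | zero => simp
  | add w w' k k' => simp only [map_add, k, k', smul_add]
  | tmul g e =>
    obtain ⟨a, ha⟩ := V.exists_section (f m) (V.ev f m t)
    rw [D.ev_tensorConnection t g e a ha, D.ev_tensorConnection (h • t) g e (h m • a) (by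
      rw [ev_smul, ← ha]; rfl)]
    simp [smul_smul, mul_comm]

/-- The pullback connection `p^*∇` of `f^{!!}A` on `f^!W`. -/
def pullback : AlgebroidConnection (LieAlgebroid.pullback hf) (W.pullback f) where
  toFun := LinearMap.mk₂ ℝ
    (fun σ s => ⟨fun m => D.pullbackValue hf σ m s, D.pullbackValue_mem hf σ s⟩)
    (fun σ σ' s => Subtype.ext (funext fun m => D.pullbackValue_add_left hf σ σ' s m))
    (fun c σ s => Subtype.ext (funext fun m =>
      D.pullbackValue_smul_left hf ⟨fun _ => c, contMDiff_const⟩ σ s m))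
    (fun σ s s' => Subtype.ext (funext fun m => map_add (D.pullbackValue hf σ m) s s'))
    (fun c σ s => Subtype.ext (funext fun m => map_smul (D.pullbackValue hf σ m) c s))
  smul_left h σ s := Subtype.ext (funext fun m => D.pullbackValue_smul_left hf h σ s m)
  leibniz _ s h _ := (PointDerivation.pullback f _ _).leibniz h s

end AlgebroidConnection
end Connections

section Alternation

variable {X Y Y₁ Y₂ : Type*} [AddCommGroup X] [Module ℝ X] [AddCommGroup Y] [Module ℝ Y]
  [AddCommGroup Y₁] [Module ℝ Y₁] [AddCommGroup Y₂] [Module ℝ Y₂]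

/-- The signed sum over all permutations of the arguments. -/
def altSum {n : ℕ} (F : (Fin n → X) → Y) (a : Fin n → X) : Y :=
  ∑ σ : Equiv.Perm (Fin n), Equiv.Perm.sign σ • F (a ∘ σ)

theorem altSum_comp_perm {n : ℕ} (F : (Fin n → X) → Y) (τ : Equiv.Perm (Fin n)) (a : Fin n → X) :
    altSum (fun b => F (b ∘ τ)) a = Equiv.Perm.sign τ • altSum F a := by
  unfold altSum
  rw [Finset.smul_sum]
  refine Fintype.sum_equiv (Equiv.mulRight τ) _ _ fun σ => ?_
  rw [smul_smul, Equiv.coe_mulRight, Equiv.Perm.sign_mul, mul_comm (Equiv.Perm.sign σ), ← mul_assoc,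
    Int.units_mul_self, one_mul]
  rfl

theorem altSum_sum {n : ℕ} {ι : Type*} (t : Finset ι) (F : ι → (Fin n → X) → Y) (a : Fin n → X) :
    altSum (fun b => ∑ i ∈ t, F i b) a = ∑ i ∈ t, altSum (F i) a := by
  simp only [altSum, Finset.smul_sum]
  exact Finset.sum_comm

theorem altSum_unit_smul {n : ℕ} (u : ℤˣ) (F : (Fin n → X) → Y) (a : Fin n → X) :
    altSum (fun b => u • F b) a = u • altSum F a := by
  simp only [altSum, Finset.smul_sum, smul_smul, mul_comm]

theorem altSum_add {n : ℕ} (F F' : (Fin n → X) → Y) (a : Fin n → X) :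
    altSum (fun b => F b + F' b) a = altSum F a + altSum F' a := by
  simp only [altSum, smul_add, Finset.sum_add_distrib]

theorem altSum_smul {n : ℕ} (c : ℝ) (F : (Fin n → X) → Y) (a : Fin n → X) :
    altSum (fun b => c • F b) a = c • altSum F a := by
  simp only [altSum, Finset.smul_sum]
  exact Finset.sum_congr rfl fun σ _ => smul_comm _ _ _

/-- The alternation of `μ ⊗ ν` along a partition of the arguments into two blocks. -/
def altProd {p q n : ℕ} (e : Fin p ⊕ Fin q ≃ Fin n) (P : Y₁ →ₗ[ℝ] Y₂ →ₗ[ℝ] Y)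
    (μ : (Fin p → X) → Y₁) (ν : (Fin q → X) → Y₂) : (Fin n → X) → Y :=
  altSum fun a => P (μ (a ∘ e ∘ Sum.inl)) (ν (a ∘ e ∘ Sum.inr))

theorem altProd_trans {p q n : ℕ} (e e' : Fin p ⊕ Fin q ≃ Fin n) (P : Y₁ →ₗ[ℝ] Y₂ →ₗ[ℝ] Y)
    (μ : (Fin p → X) → Y₁) (ν : (Fin q → X) → Y₂) (a : Fin n → X) :
    altProd e' P μ ν a = Equiv.Perm.sign (e.symm.trans e') • altProd e P μ ν a := by
  rw [altProd, altProd, ← altSum_comp_perm]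
  congr 1
  funext b
  exact congrArg₂ (fun u v => P (μ u) (ν v)) (funext fun i => by simp) (funext fun i => by simp)

theorem altProd_altSum_left {p q n : ℕ} (e : Fin p ⊕ Fin q ≃ Fin n) (P : Y₁ →ₗ[ℝ] Y₂ →ₗ[ℝ] Y)
    (μ : (Fin p → X) → Y₁) (ν : (Fin q → X) → Y₂) (a : Fin n → X) :
    altProd e P (altSum μ) ν a = (p.factorial : ℝ) • altProd e P μ ν a := by
  have h (τ : Equiv.Perm (Fin p)) : altSum (fun a => P (μ ((a ∘ e ∘ Sum.inl) ∘ τ))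
      (ν (a ∘ e ∘ Sum.inr))) a = Equiv.Perm.sign τ • altProd e P μ ν a := by
    have := altSum_comp_perm (fun a => P (μ (a ∘ e ∘ Sum.inl)) (ν (a ∘ e ∘ Sum.inr)))
      (e.permCongr (Equiv.Perm.sumCongr τ 1)) a
    rw [Equiv.Perm.sign_permCongr, Equiv.Perm.sign_sumCongr, Equiv.Perm.sign_one, mul_one] at this
    rw [altProd, ← this]
    congr 1
    funext b
    exact congrArg₂ (fun u v => P (μ u) (ν v)) (funext fun i => by simp) (funext fun i => by simp)
  have h2 : ∀ b : Fin n → X, P (altSum μ (b ∘ e ∘ Sum.inl)) (ν (b ∘ e ∘ Sum.inr)) =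
      ∑ τ : Equiv.Perm (Fin p), Equiv.Perm.sign τ • P (μ ((b ∘ e ∘ Sum.inl) ∘ τ))
        (ν (b ∘ e ∘ Sum.inr)) := fun b => by
    simp [altSum, Units.smul_def, LinearMap.sum_apply]
  rw [altProd, funext h2, altSum_sum]
  simp only [altSum_unit_smul, h, smul_smul, Int.units_mul_self, one_smul, Finset.sum_const,
    Finset.card_univ, Fintype.card_perm, Fintype.card_fin]
  exact (Nat.cast_smul_eq_nsmul ℝ _ _).symm

theorem altProd_altSum_right {p q n : ℕ} (e : Fin p ⊕ Fin q ≃ Fin n) (P : Y₁ →ₗ[ℝ] Y₂ →ₗ[ℝ] Y)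
    (μ : (Fin p → X) → Y₁) (ν : (Fin q → X) → Y₂) (a : Fin n → X) :
    altProd e P μ (altSum ν) a = (q.factorial : ℝ) • altProd e P μ ν a := by
  have h (τ : Equiv.Perm (Fin q)) : altSum (fun a => P (μ (a ∘ e ∘ Sum.inl))
      (ν ((a ∘ e ∘ Sum.inr) ∘ τ))) a = Equiv.Perm.sign τ • altProd e P μ ν a := by
    have := altSum_comp_perm (fun a => P (μ (a ∘ e ∘ Sum.inl)) (ν (a ∘ e ∘ Sum.inr)))
      (e.permCongr (Equiv.Perm.sumCongr 1 τ)) a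
    rw [Equiv.Perm.sign_permCongr, Equiv.Perm.sign_sumCongr, Equiv.Perm.sign_one, one_mul] at this
    rw [altProd, ← this]
    congr 1
    funext b
    exact congrArg₂ (fun u v => P (μ u) (ν v)) (funext fun i => by simp) (funext fun i => by simp)
  have h2 : ∀ b : Fin n → X, P (μ (b ∘ e ∘ Sum.inl)) (altSum ν (b ∘ e ∘ Sum.inr)) =
      ∑ τ : Equiv.Perm (Fin q), Equiv.Perm.sign τ • P (μ (b ∘ e ∘ Sum.inl))
        (ν ((b ∘ e ∘ Sum.inr) ∘ τ)) := fun b => by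
    simp [altSum, Units.smul_def]
  rw [altProd, funext h2, altSum_sum]
  simp only [altSum_unit_smul, h, smul_smul, Int.units_mul_self, one_smul, Finset.sum_const,
    Finset.card_univ, Fintype.card_perm, Fintype.card_fin]
  exact (Nat.cast_smul_eq_nsmul ℝ _ _).symm

/-- The summand `D_x ω(b) - ½ ∑_q ω(b₁, …, [x, b_q], …, b_k)` of the exterior derivative. -/
def derivTerm {k : ℕ} (br : X → X → X) (D : X → Y →ₗ[ℝ] Y) (μ : (Fin k → X) → Y) (x : X)
    (b : Fin k → X) : Y :=
  D x (μ b) - (2⁻¹ : ℝ) • ∑ q, μ (Function.update b q (br x (b q)))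

/-- `derivTerm` in the first argument. -/
def derivFirst {k : ℕ} (br : X → X → X) (D : X → Y →ₗ[ℝ] Y) (μ : (Fin k → X) → Y)
    (a : Fin (k + 1) → X) : Y := derivTerm br D μ (a 0) (Fin.tail a)

theorem derivTerm_comp_perm {k : ℕ} (br : X → X → X) (D : X → Y →ₗ[ℝ] Y) (μ : (Fin k → X) → Y)
    (τ : Equiv.Perm (Fin k)) (x : X) (b : Fin k → X) :
    derivTerm br D (fun b => μ (b ∘ τ)) x b = derivTerm br D μ x (b ∘ τ) := by
  simp only [derivTerm]
  congr 2
  refine (Fintype.sum_equiv τ _ _ fun q => ?_).symm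
  congr 1
  funext i
  simp only [Function.comp_apply, Function.update_apply, EmbeddingLike.apply_eq_iff_eq]

/-- Extend a permutation by fixing `0`. -/
def liftPerm {k : ℕ} (τ : Equiv.Perm (Fin k)) : Equiv.Perm (Fin (k + 1)) :=
  Equiv.Perm.decomposeFin.symm (0, τ)

theorem liftPerm_zero {k : ℕ} (τ : Equiv.Perm (Fin k)) : liftPerm τ 0 = 0 := by
  simp [liftPerm]

theorem liftPerm_succ {k : ℕ} (τ : Equiv.Perm (Fin k)) (i : Fin k) :
    liftPerm τ i.succ = (τ i).succ := by
  simp [liftPerm]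

theorem sign_liftPerm {k : ℕ} (τ : Equiv.Perm (Fin k)) :
    Equiv.Perm.sign (liftPerm τ) = Equiv.Perm.sign τ := by
  simp [liftPerm, Equiv.Perm.decomposeFin.symm_sign]

theorem derivFirst_comp_perm {k : ℕ} (br : X → X → X) (D : X → Y →ₗ[ℝ] Y) (μ : (Fin k → X) → Y)
    (τ : Equiv.Perm (Fin k)) (a : Fin (k + 1) → X) :
    derivFirst br D (fun b => μ (b ∘ τ)) a = derivFirst br D μ (a ∘ liftPerm τ) := by
  have h : Fin.tail (a ∘ liftPerm τ) = Fin.tail a ∘ τ := by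
    funext i
    simp [Fin.tail, liftPerm_succ]
  rw [derivFirst, derivFirst, derivTerm_comp_perm, h, Function.comp_apply, liftPerm_zero]

theorem altSum_derivFirst_altSum {k : ℕ} (br : X → X → X) (D : X → Y →ₗ[ℝ] Y)
    (μ : (Fin k → X) → Y) (a : Fin (k + 1) → X) :
    altSum (derivFirst br D (altSum μ)) a =
      (k.factorial : ℝ) • altSum (derivFirst br D μ) a := by
  have h : derivFirst br D (altSum μ) = fun a => ∑ τ : Equiv.Perm (Fin k), Equiv.Perm.sign τ •
      derivFirst br D μ (a ∘ liftPerm τ) := by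
    funext a
    simp only [← derivFirst_comp_perm]
    simp only [derivFirst, derivTerm, altSum, map_sum, smul_sub, Finset.sum_sub_distrib,
      Finset.smul_sum, Units.smul_def, map_zsmul]
    congr 1
    rw [Finset.sum_comm]
    refine Finset.sum_congr rfl fun τ _ => Finset.sum_congr rfl fun q _ => smul_comm _ _ _
  rw [h, altSum_sum]
  simp only [altSum_unit_smul, altSum_comp_perm, sign_liftPerm, smul_smul, Int.units_mul_self,
    one_smul, Finset.sum_const, Finset.card_univ, Fintype.card_perm, Fintype.card_fin]
  exact (Nat.cast_smul_eq_nsmul ℝ _ _).symm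

/-- The blocks `{0, …, k}`, `{k + 1, …, k + l}`. -/
def blockLeft (k l : ℕ) : Fin (k + 1) ⊕ Fin l ≃ Fin (k + l + 1) :=
  finSumFinEquiv.trans (finCongr (by omega))

/-- The blocks `{1, …, k}`, `{0, k + 1, …, k + l}`. -/
def blockRight (k l : ℕ) : Fin k ⊕ Fin (l + 1) ≃ Fin (k + l + 1) :=
  Equiv.ofBijective
    (Sum.elim (fun i => (Fin.castAdd l i).succ) (Fin.cons 0 fun j => (Fin.natAdd k j).succ)) (by
    rw [Fintype.bijective_iff_injective_and_card]
    refine ⟨?_, by simp; omega⟩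
    rintro (i | i) (j | j) h
    · simpa using h
    · cases j using Fin.cases with
      | zero => simp at h
      | succ j => simp [Fin.ext_iff] at h; omega
    · cases i using Fin.cases with
      | zero => simp [Fin.ext_iff] at h
      | succ j => simp [Fin.ext_iff] at h; omega
    · cases i using Fin.cases <;> cases j using Fin.cases <;> simp [Fin.ext_iff] at h ⊢ 
      omega)

theorem derivTerm_prod {k l : ℕ} (br : X → X → X) (D : X → Y →ₗ[ℝ] Y) (D₁ : X → Y₁ →ₗ[ℝ] Y₁)
    (D₂ : X → Y₂ →ₗ[ℝ] Y₂) (P : Y₁ →ₗ[ℝ] Y₂ →ₗ[ℝ] Y)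
    (hP : ∀ x u v, D x (P u v) = P (D₁ x u) v + P u (D₂ x v))
    (μ : (Fin k → X) → Y₁) (ν : (Fin l → X) → Y₂) (x : X) (b : Fin (k + l) → X) :
    derivTerm br D (fun b => P (μ (b ∘ Fin.castAdd l)) (ν (b ∘ Fin.natAdd k))) x b =
      P (derivTerm br D₁ μ x (b ∘ Fin.castAdd l)) (ν (b ∘ Fin.natAdd k)) +
      P (μ (b ∘ Fin.castAdd l)) (derivTerm br D₂ ν x (b ∘ Fin.natAdd k)) := by
  have h1 (i : Fin k) (v : X) : Function.update b (Fin.castAdd l i) v ∘ Fin.castAdd l =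
      Function.update (b ∘ Fin.castAdd l) i v :=
    Function.update_comp_eq_of_injective _ (Fin.castAdd_injective k l) _ _
  have h2 (i : Fin k) (v : X) : Function.update b (Fin.castAdd l i) v ∘ Fin.natAdd k =
      b ∘ Fin.natAdd k := Function.update_comp_eq_of_forall_ne _ _ fun j => by
        simp [Fin.ext_iff]; omega
  have h3 (i : Fin l) (v : X) : Function.update b (Fin.natAdd k i) v ∘ Fin.natAdd k =
      Function.update (b ∘ Fin.natAdd k) i v :=
    Function.update_comp_eq_of_injective _ (Fin.natAdd_injective l k) _ _
  have h4 (i : Fin l) (v : X) : Function.update b (Fin.natAdd k i) v ∘ Fin.castAdd l =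
      b ∘ Fin.castAdd l := Function.update_comp_eq_of_forall_ne _ _ fun j => by
        simp [Fin.ext_iff]; omega
  simp only [derivTerm, hP, Fin.sum_univ_add, h1, h2, h3, h4, map_sub, LinearMap.sub_apply,
    map_smul, LinearMap.smul_apply, map_sum, LinearMap.sum_apply, smul_add, Function.comp_apply]
  abel

theorem altSum_derivFirst_altProd {k l : ℕ} (br : X → X → X) (D : X → Y →ₗ[ℝ] Y)
    (D₁ : X → Y₁ →ₗ[ℝ] Y₁) (D₂ : X → Y₂ →ₗ[ℝ] Y₂) (P : Y₁ →ₗ[ℝ] Y₂ →ₗ[ℝ] Y)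
    (hP : ∀ x u v, D x (P u v) = P (D₁ x u) v + P u (D₂ x v))
    (μ : (Fin k → X) → Y₁) (ν : (Fin l → X) → Y₂) (a : Fin (k + l + 1) → X) :
    altSum (derivFirst br D (altProd finSumFinEquiv P μ ν)) a = ((k + l).factorial : ℝ) •
      (altProd (blockLeft k l) P (derivFirst br D₁ μ) ν a +
        altProd (blockRight k l) P μ (derivFirst br D₂ ν) a) := by
  rw [altProd, altSum_derivFirst_altSum, altProd, altProd, ← altSum_add]
  congr 2
  funext b
  have := derivTerm_prod br D D₁ D₂ P hP μ ν (b 0) (Fin.tail b)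
  rw [derivFirst]
  have e1 : b ∘ blockLeft k l ∘ Sum.inl = Fin.cons (b 0) (Fin.tail b ∘ Fin.castAdd l) := by
    funext i
    cases i using Fin.cases with
    | zero => simp [blockLeft]; rfl
    | succ i => simp [blockLeft, Fin.tail]; rfl
  have e2 : b ∘ blockLeft k l ∘ Sum.inr = Fin.tail b ∘ Fin.natAdd k := by
    funext i
    simp only [blockLeft, Fin.tail, Function.comp_apply]
    congr 1
    simp [Fin.ext_iff]; omega
  have e3 : b ∘ blockRight k l ∘ Sum.inl = Fin.tail b ∘ Fin.castAdd l := rfl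
  have e4 : b ∘ blockRight k l ∘ Sum.inr = Fin.cons (b 0) (Fin.tail b ∘ Fin.natAdd k) := by
    funext i
    cases i using Fin.cases <;> rfl
  rw [e1, e2, e3, e4, derivFirst, derivFirst]
  simp only [Fin.cons_zero, Fin.tail_cons]
  exact this

end Alternation

section Koszul

variable {X Y : Type*} [AddCommGroup X] [Module ℝ X] [AddCommGroup Y] [Module ℝ Y]

/-- The sum `∑_{i<j} (-1)^{i+j} μ([a_i, a_j], a_0, …, â_i, …, â_j, …, a_k)`. -/
def koszulBracket (br : X → X → X) : ∀ {k : ℕ}, (X [⋀^Fin k]→ₗ[ℝ] Y) → (Fin (k + 1) → X) → Y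
  | 0, _, _ => 0
  | k + 1, μ, a => ∑ j : Fin (k + 2), ∑ i : Fin (k + 1), if i.castSucc < j then
      (-1 : ℝ) ^ (i.val + j.val) •
        μ (Fin.cons (br (a i.castSucc) (a j)) (i.removeNth (j.removeNth a)))
      else 0

/-- The Koszul formula
`∑_i (-1)^i D_{a_i} μ(a_0, …, â_i, …, a_k) + ∑_{i<j} (-1)^{i+j} μ([a_i, a_j], …, â_i, …, â_j, …)`. -/
def koszul {k : ℕ} (br : X → X → X) (D : X → Y →ₗ[ℝ] Y) (μ : X [⋀^Fin k]→ₗ[ℝ] Y)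
    (a : Fin (k + 1) → X) : Y :=
  ∑ i : Fin (k + 1), (-1 : ℝ) ^ i.val • D (a i) (μ (i.removeNth a)) + koszulBracket br μ a

theorem derivFirst_liftPerm {k : ℕ} (br : X → X → X) (D : X → Y →ₗ[ℝ] Y)
    (μ : X [⋀^Fin k]→ₗ[ℝ] Y) (τ : Equiv.Perm (Fin k)) (a : Fin (k + 1) → X) :
    derivFirst br D μ (a ∘ liftPerm τ) = Equiv.Perm.sign τ • derivFirst br D μ a := by
  rw [← derivFirst_comp_perm]
  simp only [AlternatingMap.map_perm, derivFirst, derivTerm, Units.smul_def, map_zsmul, smul_sub,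
    Finset.smul_sum]
  congr 1
  exact Finset.sum_congr rfl fun q _ => smul_comm _ _ _

theorem eq_liftPerm {k : ℕ} (σ : Equiv.Perm (Fin (k + 1))) (h : σ 0 = 0) :
    ∃ τ, σ = liftPerm τ := by
  refine ⟨(Equiv.Perm.decomposeFin σ).2, ?_⟩
  have h1 : (Equiv.Perm.decomposeFin σ).1 = 0 := by
    rw [← h, ← Equiv.Perm.decomposeFin_symm_apply_zero (Equiv.Perm.decomposeFin σ).1
      (Equiv.Perm.decomposeFin σ).2]
    simp
  rw [liftPerm, ← h1]
  simp

theorem derivFirst_same_zero {k : ℕ} (br : X → X → X) (D : X → Y →ₗ[ℝ] Y)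
    (μ : X [⋀^Fin k]→ₗ[ℝ] Y) (σ σ' : Equiv.Perm (Fin (k + 1))) (h : σ 0 = σ' 0)
    (a : Fin (k + 1) → X) : Equiv.Perm.sign σ • derivFirst br D μ (a ∘ σ) =
      Equiv.Perm.sign σ' • derivFirst br D μ (a ∘ σ') := by
  obtain ⟨τ, hτ⟩ := eq_liftPerm (σ'⁻¹ * σ) (by simp [h])
  have h1 : σ = σ' * liftPerm τ := by rw [← hτ]; simp
  rw [h1, Equiv.Perm.sign_mul, sign_liftPerm, Equiv.Perm.coe_mul, ← Function.comp_assoc,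
    derivFirst_liftPerm, smul_smul, mul_assoc, Int.units_mul_self, mul_one]

theorem altSum_derivFirst {k : ℕ} (br : X → X → X) (D : X → Y →ₗ[ℝ] Y)
    (μ : X [⋀^Fin k]→ₗ[ℝ] Y) (a : Fin (k + 1) → X) :
    altSum (derivFirst br D μ) a = (k.factorial : ℝ) • ∑ p : Fin (k + 1), (-1 : ℝ) ^ p.val •
      derivTerm br D μ (a p) (p.removeNth a) := by
  rw [altSum, ← Equiv.sum_comp Equiv.Perm.decomposeFin.symm, Fintype.sum_prod_type,
    Finset.smul_sum]
  refine Finset.sum_congr rfl fun p _ => ?_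
  have h (e : Equiv.Perm (Fin k)) := derivFirst_same_zero br D μ
    (Equiv.Perm.decomposeFin.symm (p, e)) p.cycleRange.symm (by simp) a
  have h2 : Fin.tail (a ∘ p.cycleRange.symm) = p.removeNth a := by
    funext i
    simp [Fin.tail, Fin.removeNth, Fin.cycleRange_symm_succ]
  simp only [h, Finset.sum_const, Finset.card_univ, Fintype.card_perm, Fintype.card_fin]
  rw [Nat.cast_smul_eq_nsmul, derivFirst, h2, Equiv.Perm.sign_symm, Fin.sign_cycleRange]
  simp [Units.smul_def, Fin.cycleRange_symm_zero, ← Int.cast_smul_eq_zsmul ℝ]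

theorem koszul_eq {k : ℕ} (br : X → X → X) (hbr : ∀ x y, br x y = -br y x)
    (D : X → Y →ₗ[ℝ] Y) (μ : X [⋀^Fin k]→ₗ[ℝ] Y) (a : Fin (k + 1) → X) :
    koszul br D μ a = ∑ p : Fin (k + 1), (-1 : ℝ) ^ p.val •
      derivTerm br D μ (a p) (p.removeNth a) := by
  simp only [koszul, derivTerm, smul_sub]
  rw [Finset.sum_sub_distrib, sub_eq_add_neg]
  congr 1
  cases k with
  | zero => simp [koszulBracket]
  | succ k =>
    set T : Fin (k + 2) → Fin (k + 1) → Y := fun p q => (-1 : ℝ) ^ (q.val + p.val) •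
      μ (Fin.cons (br (a (p.succAbove q)) (a p)) (q.removeNth (p.removeNth a))) with hT
    have h1 : ∀ p q, (-1 : ℝ) ^ p.val • (2⁻¹ : ℝ) •
        μ (Function.update (p.removeNth a) q (br (a p) (p.removeNth a q))) =
        -((2⁻¹ : ℝ) • T p q) := fun p q => by
      have h2 : Function.update (p.removeNth a) q (br (a p) (p.removeNth a q)) =
          q.insertNth (br (a p) (p.removeNth a q)) (q.removeNth (p.removeNth a)) := by
        simp
      have h3 : (Fin.cons (br (a p) (p.removeNth a q)) (q.removeNth (p.removeNth a)) : Fin (k + 1) → X)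
          = Fin.cons ((-1 : ℝ) • br (a (p.succAbove q)) (a p)) (q.removeNth (p.removeNth a)) := by
        rw [hbr]; simp [Fin.removeNth]
      have h4 : μ (Fin.cons ((-1 : ℝ) • br (a (p.succAbove q)) (a p)) (q.removeNth (p.removeNth a)))
          = (-1 : ℝ) • μ (Fin.cons (br (a (p.succAbove q)) (a p)) (q.removeNth (p.removeNth a))) :=
        μ.toMultilinearMap.cons_smul _ _ _
      rw [h2, AlternatingMap.map_insertNth]
      change (-1 : ℝ) ^ p.val • (2⁻¹ : ℝ) • (-1) ^ q.val •
        μ (Fin.cons (br (a p) (p.removeNth a q)) (q.removeNth (p.removeNth a))) = _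
      rw [h3, h4, hT]
      simp only [← Int.cast_smul_eq_zsmul ℝ, smul_smul, ← neg_smul]
      congr 1
      push_cast
      ring
    have h5 : ∀ (i q : Fin (k + 1)), i ≤ q → T i.castSucc q = T q.succ i := fun i q h => by
      have e1 : (i.castSucc).succAbove q = q.succ :=
        Fin.succAbove_of_le_castSucc _ _ (Fin.castSucc_le_castSucc_iff.2 h)
      have e2 : (q.succ).succAbove i = i.castSucc :=
        Fin.succAbove_of_castSucc_lt _ _ (Fin.castSucc_lt_succ_iff.2 h)
      have e3 : q.removeNth (i.castSucc.removeNth a) = i.removeNth (q.succ.removeNth a) := by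
        rw [Fin.removeNth_removeNth_eq_swap, e1]
        congr 1
        exact Fin.predAbove_of_le_castSucc _ _ (Fin.castSucc_le_castSucc_iff.2 h)
      have h4 : μ (Fin.cons ((-1 : ℝ) • br (a i.castSucc) (a q.succ))
          (i.removeNth (q.succ.removeNth a))) = (-1 : ℝ) • μ (Fin.cons
          (br (a i.castSucc) (a q.succ)) (i.removeNth (q.succ.removeNth a))) :=
        μ.toMultilinearMap.cons_smul _ _ _
      simp only [hT, e1, e2, e3]
      rw [hbr, ← neg_one_smul ℝ (br _ _), h4, smul_smul]
      congr 1
      rw [Fin.val_succ, Fin.val_castSucc]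
      ring
    have h6 : ∑ p, ∑ q, (if q.castSucc < p then 0 else T p q) =
        ∑ p, ∑ q, (if q.castSucc < p then T p q else 0) := by
      rw [Finset.sum_comm, Fin.sum_univ_succ (fun p => ∑ q, if q.castSucc < p then T p q else 0)]
      simp only [Fin.not_lt_zero, if_false, Finset.sum_const_zero, zero_add]
      refine Finset.sum_congr rfl fun q _ => ?_
      rw [Fin.sum_univ_castSucc]
      simp only [Fin.castSucc_lt_last, if_true, add_zero]
      refine Finset.sum_congr rfl fun i _ => ?_
      by_cases h : i ≤ q
      · rw [if_neg (by simpa using h), if_pos (Fin.castSucc_lt_succ_iff.2 h), h5 i q h]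
      · rw [if_pos (by simpa using h), if_neg (by simpa [Fin.castSucc_lt_succ_iff] using h)]
    have h7 : koszulBracket br μ a = ∑ p, ∑ q, (if q.castSucc < p then T p q else 0) := by
      rw [koszulBracket]
      refine Finset.sum_congr rfl fun p _ => Finset.sum_congr rfl fun q _ => ?_
      split_ifs with h
      · simp only [hT, Fin.succAbove_of_castSucc_lt _ _ h]
      · rfl
    have h8 : ∑ p, ∑ q, T p q = (2 : ℝ) • koszulBracket br μ a := by
      rw [two_smul, h7]
      nth_rewrite 2 [← h6]
      simp only [← Finset.sum_add_distrib]
      refine Finset.sum_congr rfl fun p _ => Finset.sum_congr rfl fun q _ => ?_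
      split_ifs <;> simp
    simp only [Finset.smul_sum, h1]
    simp only [Finset.sum_neg_distrib, neg_neg, ← Finset.smul_sum, h8, smul_smul]
    norm_num

theorem altSum_derivFirst_eq {k : ℕ} (br : X → X → X) (hbr : ∀ x y, br x y = -br y x)
    (D : X → Y →ₗ[ℝ] Y) (μ : X [⋀^Fin k]→ₗ[ℝ] Y) (a : Fin (k + 1) → X) :
    altSum (derivFirst br D μ) a = (k.factorial : ℝ) • koszul br D μ a := by
  rw [altSum_derivFirst, koszul_eq br hbr]

end Koszul

section Forms

variable {E : Type*} [NormedAddCommGroup E] [NormedSpace ℝ E] [FiniteDimensional ℝ E]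
  {H : Type*} [TopologicalSpace H] {I : ModelWithCorners ℝ E H}
  {M : Type*} [TopologicalSpace M] [ChartedSpace H M] [IsManifold I ∞ M] [T2Space M]
  {A : M → Type*} [∀ x, AddCommGroup (A x)] [∀ x, Module ℝ (A x)]
  {G : M → Type*} [∀ x, AddCommGroup (G x)] [∀ x, Module ℝ (G x)]

/-- The space `Ω^k(A, G)` of `k`-forms on `A` with values in `G`, i.e. of smooth sections of
`Λ^k A^* ⊗ G`: families of alternating maps that send smooth sections to smooth sections. -/
def Form (V : SmoothVectorBundle I M A) (W : SmoothVectorBundle I M G) (k : ℕ) :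
    Submodule ℝ (Π x, A x [⋀^Fin k]→ₗ[ℝ] G x) where
  carrier := {μ | ∀ a : Fin k → V.sections, (fun x => μ x fun i => (a i).1 x) ∈ W.sections}
  add_mem' h h' a := W.sections.add_mem (h a) (h' a)
  zero_mem' _ := W.sections.zero_mem
  smul_mem' c _ h a := W.sections.smul_mem c (h a)

namespace Form

variable {V : SmoothVectorBundle I M A} {W : SmoothVectorBundle I M G}

/-- The value of a form on sections. -/
def eval {k : ℕ} (μ : Form V W k) : V.sections [⋀^Fin k]→ₗ[ℝ] W.sections where
  toFun a := ⟨fun x => μ.1 x fun i => (a i).1 x, μ.2 a⟩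
  map_update_add' a i s t := by
    ext x
    have h (u : V.sections) : (fun j => (Function.update a i u j).1 x) =
        Function.update (fun j => (a j).1 x) i (u.1 x) := by
      funext j
      rcases eq_or_ne j i with rfl | hj <;> simp [*]
    change μ.1 x _ = μ.1 x _ + μ.1 x _
    rw [h, h, h]
    exact (μ.1 x).map_update_add _ _ _ _
  map_update_smul' a i c s := by
    ext x
    have h (u : V.sections) : (fun j => (Function.update a i u j).1 x) =
        Function.update (fun j => (a j).1 x) i (u.1 x) := by
      funext j
      rcases eq_or_ne j i with rfl | hj <;> simp [*]
    change μ.1 x _ = c • μ.1 x _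
    rw [h, h]
    exact (μ.1 x).map_update_smul _ _ _ _
  map_eq_zero_of_eq' a i j h hij := by
    ext x
    exact (μ.1 x).map_eq_zero_of_eq _ (by simp [h]) hij

@[simp] theorem eval_add {k : ℕ} (μ ν : Form V W k) : eval (μ + ν) = (eval μ) + (eval ν) := rfl

@[simp] theorem eval_smul {k : ℕ} (c : ℝ) (μ : Form V W k) : eval (c • μ) = c • (eval μ) := rfl

@[simp] theorem eval_zero {k : ℕ} : eval (0 : Form V W k) = 0 := rfl

/-- The exterior product of a scalar and a vector valued alternating map,
`(α ∧ β)(a) = 1/(k! l!) ∑_σ sgn(σ) α(a_{σ(1)}, …, a_{σ(k)}) β(a_{σ(k+1)}, …, a_{σ(k+l)})`. -/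
def wedgeAt {A G : Type*} [AddCommGroup A] [Module ℝ A] [AddCommGroup G] [Module ℝ G] {k l : ℕ}
    (α : A [⋀^Fin k]→ₗ[ℝ] ℝ) (β : A [⋀^Fin l]→ₗ[ℝ] G) : A [⋀^Fin (k + l)]→ₗ[ℝ] G :=
  ((k.factorial * l.factorial : ℝ)⁻¹) • MultilinearMap.alternatization
    (((TensorProduct.lid ℝ G).toLinearMap.compMultilinearMap
      (α.toMultilinearMap.domCoprod β.toMultilinearMap)).domDomCongr finSumFinEquiv)

theorem wedgeAt_apply {A G : Type*} [AddCommGroup A] [Module ℝ A] [AddCommGroup G] [Module ℝ G]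
    {k l : ℕ} (α : A [⋀^Fin k]→ₗ[ℝ] ℝ) (β : A [⋀^Fin l]→ₗ[ℝ] G) (a : Fin (k + l) → A) :
    wedgeAt α β a = ((k.factorial * l.factorial : ℝ)⁻¹) • ∑ σ : Equiv.Perm (Fin (k + l)),
      Equiv.Perm.sign σ • (α (fun i => a (σ (Fin.castAdd l i))) •
        β (fun j => a (σ (Fin.natAdd k j)))) := by
  rw [wedgeAt, AlternatingMap.smul_apply, MultilinearMap.alternatization_apply]
  rfl

/-- A section of the trivial line bundle as a smooth function. -/
def toFun (h : (trivialLine I M).sections) : SmoothFun I M := ⟨h.1, h.2⟩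

/-- The product of a smooth function and a smooth section. -/
def funMul (W : SmoothVectorBundle I M G) :
    (trivialLine I M).sections →ₗ[ℝ] W.sections →ₗ[ℝ] W.sections :=
  LinearMap.mk₂ ℝ (fun h e => toFun h • e)
    (fun h h' e => by ext x; exact add_smul (h.1 x) (h'.1 x) (e.1 x))
    (fun c h e => by ext x; exact mul_smul c (h.1 x) (e.1 x))
    (fun h e e' => by ext x; exact smul_add (h.1 x) (e.1 x) (e'.1 x))
    (fun c h e => by ext x; exact smul_comm (h.1 x) c (e.1 x))

theorem wedge_aux {k l : ℕ} (μ : Form V (trivialLine I M) k) (ν : Form V W l)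
    (a : Fin (k + l) → V.sections) (x : M) :
    wedgeAt (μ.1 x) (ν.1 x) (fun i => (a i).1 x) = (((k.factorial * l.factorial : ℝ)⁻¹) •
      altProd finSumFinEquiv (funMul W) (eval μ) (eval ν) a).1 x := by
  rw [wedgeAt_apply]
  have h : ((altProd finSumFinEquiv (funMul W) (eval μ) (eval ν) a : W.sections) : Π x, G x) x =
      ∑ σ : Equiv.Perm (Fin (k + l)), Equiv.Perm.sign σ •
        (μ.1 x (fun i => (a (σ (Fin.castAdd l i))).1 x) •
          ν.1 x (fun j => (a (σ (Fin.natAdd k j))).1 x)) := by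
    rw [altProd, altSum]
    refine (sections_sum_apply W _ _ x).trans ?_
    refine Finset.sum_congr rfl fun σ _ => ?_
    rcases Int.units_eq_one_or (Equiv.Perm.sign σ) with h | h <;> rw [h]
    · simp only [one_smul]
      rfl
    · simp only [Units.neg_smul, one_smul]
      rfl
  rw [← h]
  rfl

/-- The exterior product `Ω^k(A) × Ω^l(A, G) → Ω^{k+l}(A, G)`. -/
def wedge {k l : ℕ} (μ : Form V (trivialLine I M) k) (ν : Form V W l) : Form V W (k + l) :=
  ⟨fun x => wedgeAt (μ.1 x) (ν.1 x), fun a => by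
    exact (funext fun x => wedge_aux μ ν a x) ▸ Subtype.property _⟩

theorem eval_wedge {k l : ℕ} (μ : Form V (trivialLine I M) k) (ν : Form V W l)
    (a : Fin (k + l) → V.sections) : eval (wedge μ ν) a =
      ((k.factorial * l.factorial : ℝ)⁻¹) •
        altProd finSumFinEquiv (funMul W) (eval μ) (eval ν) a :=
  Subtype.ext (funext fun x => wedge_aux μ ν a x)

theorem ext_eval {k : ℕ} {μ ν : Form V W k} (h : ∀ a, (eval μ) a = (eval ν) a) : μ = ν := by
  ext x v
  choose a ha using fun i => V.exists_section x (v i)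
  have := congrArg (fun s : W.sections => s.1 x) (h a)
  rw [← funext ha]
  exact this

theorem wedge_add_left {k l : ℕ} (μ μ' : Form V (trivialLine I M) k) (ν : Form V W l) :
    wedge (μ + μ') ν = wedge μ ν + wedge μ' ν := ext_eval fun a => by
  simp only [eval_add, AlternatingMap.add_apply, eval_wedge, ← smul_add]
  congr 1
  simp [altProd, altSum_add]

theorem wedge_add_right {k l : ℕ} (μ : Form V (trivialLine I M) k) (ν ν' : Form V W l) :
    wedge μ (ν + ν') = wedge μ ν + wedge μ ν' := ext_eval fun a => by
  simp only [eval_add, AlternatingMap.add_apply, eval_wedge, ← smul_add]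
  congr 1
  simp [altProd, altSum_add]

theorem wedge_smul_left {k l : ℕ} (c : ℝ) (μ : Form V (trivialLine I M) k) (ν : Form V W l) :
    wedge (c • μ) ν = c • wedge μ ν := ext_eval fun a => by
  simp only [eval_smul, AlternatingMap.smul_apply, eval_wedge]
  rw [smul_comm]
  congr 1
  simp [altProd, altSum_smul]

theorem wedge_smul_right {k l : ℕ} (c : ℝ) (μ : Form V (trivialLine I M) k) (ν : Form V W l) :
    wedge μ (c • ν) = c • wedge μ ν := ext_eval fun a => by
  simp only [eval_smul, AlternatingMap.smul_apply, eval_wedge]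
  rw [smul_comm]
  congr 1
  simp [altProd, altSum_smul]

end Form

namespace AlgebroidConnection

open Form

variable {V : SmoothVectorBundle I M A} {L : LieAlgebroid V} {W : SmoothVectorBundle I M G}
  (D : AlgebroidConnection L W)

/-- The exterior derivative `d_∇ μ`, evaluated on sections `a_0, …, a_k`. -/
def d {k : ℕ} (μ : Form V W k) (a : Fin (k + 1) → V.sections) : W.sections :=
  koszul (fun a b => L.bracket a b) (fun a => D.toFun a) (eval μ) a

theorem d_add {k : ℕ} (μ ν : Form V W k) (a : Fin (k + 1) → V.sections) :
    D.d (μ + ν) a = D.d μ a + D.d ν a := by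
  simp only [d, koszul_eq _ L.bracket_skew, derivTerm, eval_add, AlternatingMap.add_apply, map_add,
    Finset.sum_add_distrib]
  rw [← Finset.sum_add_distrib]
  refine Finset.sum_congr rfl fun i _ => ?_
  rw [← smul_add]
  congr 1
  rw [smul_add]
  abel

theorem d_smul {k : ℕ} (c : ℝ) (μ : Form V W k) (a : Fin (k + 1) → V.sections) :
    D.d (c • μ) a = c • D.d μ a := by
  simp only [d, koszul_eq _ L.bracket_skew, derivTerm, eval_smul, AlternatingMap.smul_apply,
    map_smul, ← Finset.smul_sum]
  rw [Finset.smul_sum]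
  refine Finset.sum_congr rfl fun i _ => ?_
  rw [smul_comm c ((-1 : ℝ) ^ _), smul_comm (2⁻¹ : ℝ) c, smul_sub c]

theorem d_zero {k : ℕ} (a : Fin (k + 1) → V.sections) : D.d (0 : Form V W k) a = 0 := by
  simpa using D.d_smul 0 (0 : Form V W k) a

/-- The closed `k`-forms. -/
def closed (k : ℕ) : Submodule ℝ (Form V W k) where
  carrier := {μ | ∀ a, D.d μ a = 0}
  add_mem' h h' a := by rw [d_add, h, h', add_zero]
  zero_mem' a := D.d_zero a
  smul_mem' c _ h a := by rw [d_smul, h, smul_zero]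

/-- The exact `k`-forms. -/
def exact : ∀ k : ℕ, Submodule ℝ (Form V W k)
  | 0 => ⊥
  | k + 1 =>
    { carrier := {μ | ∃ θ : Form V W k, ∀ a, eval μ a = D.d θ a}
      add_mem' := by
        rintro μ μ' ⟨θ, h⟩ ⟨θ', h'⟩
        exact ⟨θ + θ', fun a => by rw [eval_add, AlternatingMap.add_apply, h, h', d_add]⟩
      zero_mem' := ⟨0, fun a => (D.d_zero a).symm⟩
      smul_mem' := by
        rintro c μ ⟨θ, h⟩
        exact ⟨c • θ, fun a => by rw [eval_smul, AlternatingMap.smul_apply, h, d_smul]⟩ }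

theorem mem_exact_of_cast {j k : ℕ} (h : j + 1 = k) {μ : Form V W k} (θ : Form V W j)
    (hμ : ∀ a : Fin k → V.sections, eval μ a = D.d θ (a ∘ Fin.cast h)) : μ ∈ D.exact k := by
  subst h
  exact ⟨θ, hμ⟩

theorem funMul_leibniz (a : V.sections) (u : (trivialLine I M).sections) (e : W.sections) :
    D.toFun a (funMul W u e) = funMul W ((canonical L).toFun a u) e +
      funMul W u (D.toFun a e) := by
  ext x
  rw [add_comm]
  exact D.leibniz a e (Form.toFun u) x

theorem d_wedge {k l : ℕ} (μ : Form V (trivialLine I M) k) (ν : Form V W l)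
    (a : Fin (k + l + 1) → V.sections) :
    D.d (wedge μ ν) a = (k.factorial * l.factorial : ℝ)⁻¹ •
      ((k + 1 : ℝ)⁻¹ • altProd (blockLeft k l) (funMul W) ((canonical L).d μ) (eval ν) a +
        (l + 1 : ℝ)⁻¹ • altProd (blockRight k l) (funMul W) (eval μ) (D.d ν) a) := by
  have h0 : ((k + l).factorial : ℝ) ≠ 0 := by positivity
  have h1 := altSum_derivFirst_eq (fun a b => L.bracket a b) L.bracket_skew (fun a => D.toFun a)
    (eval (wedge μ ν)) a
  have h2 : (eval (wedge μ ν) : (Fin (k + l) → V.sections) → W.sections) = fun b =>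
      ((k.factorial * l.factorial : ℝ)⁻¹) •
        altProd finSumFinEquiv (funMul W) (eval μ) (eval ν) b := funext fun b => eval_wedge μ ν b
  have h3 : derivFirst (fun a b => L.bracket a b) (fun a => D.toFun a) (eval (wedge μ ν)) =
      fun b => ((k.factorial * l.factorial : ℝ)⁻¹) •
        derivFirst (fun a b => L.bracket a b) (fun a => D.toFun a)
          (altProd finSumFinEquiv (funMul W) (eval μ) (eval ν)) b := by
    funext b
    rw [h2]
    simp only [derivFirst, derivTerm, map_smul, ← Finset.smul_sum]
    rw [smul_sub, smul_comm (2⁻¹ : ℝ)]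
  rw [h3, altSum_smul, altSum_derivFirst_altProd (hP := D.funMul_leibniz)] at h1
  have e1 : ((canonical L).d μ) = fun b => (k.factorial : ℝ)⁻¹ • altSum (derivFirst
      (fun a b => L.bracket a b) (fun a => (canonical L).toFun a) (eval μ)) b := by
    funext b
    rw [altSum_derivFirst_eq _ L.bracket_skew, smul_smul, inv_mul_cancel₀ (by positivity), one_smul]
    rfl
  have e2 : (D.d ν) = fun b => (l.factorial : ℝ)⁻¹ • altSum (derivFirst
      (fun a b => L.bracket a b) (fun a => D.toFun a) (eval ν)) b := by
    funext b
    rw [altSum_derivFirst_eq _ L.bracket_skew, smul_smul, inv_mul_cancel₀ (by positivity), one_smul]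
    rfl
  have e3 : altProd (blockLeft k l) (funMul W) ((canonical L).d μ) (eval ν) a = (k + 1 : ℝ) •
      altProd (blockLeft k l) (funMul W) (derivFirst
      (fun a b => L.bracket a b) (fun a => (canonical L).toFun a) (eval μ)) (eval ν) a := by
    rw [e1]
    have : altProd (blockLeft k l) (funMul W) (fun b => (k.factorial : ℝ)⁻¹ • altSum (derivFirst
      (fun a b => L.bracket a b) (fun a => (canonical L).toFun a) (eval μ)) b) (eval ν) a =
      (k.factorial : ℝ)⁻¹ • altProd (blockLeft k l) (funMul W) (altSum (derivFirst
      (fun a b => L.bracket a b) (fun a => (canonical L).toFun a) (eval μ))) (eval ν) a := by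
      rw [altProd, altProd, ← altSum_smul]
      simp
    rw [this, altProd_altSum_left, smul_smul, Nat.factorial_succ]
    congr 1
    push_cast
    field_simp
  have e4 : altProd (blockRight k l) (funMul W) (eval μ) (D.d ν) a = (l + 1 : ℝ) •
      altProd (blockRight k l) (funMul W) (eval μ) (derivFirst
      (fun a b => L.bracket a b) (fun a => D.toFun a) (eval ν)) a := by
    rw [e2]
    have : altProd (blockRight k l) (funMul W) (eval μ) (fun b => (l.factorial : ℝ)⁻¹ • altSum
      (derivFirst (fun a b => L.bracket a b) (fun a => D.toFun a) (eval ν)) b) a =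
      (l.factorial : ℝ)⁻¹ • altProd (blockRight k l) (funMul W) (eval μ) (altSum (derivFirst
      (fun a b => L.bracket a b) (fun a => D.toFun a) (eval ν))) a := by
      rw [altProd, altProd, ← altSum_smul]
      simp
    rw [this, altProd_altSum_right, smul_smul, Nat.factorial_succ]
    congr 1
    push_cast
    field_simp
  have h5 : (k + 1 : ℝ) ≠ 0 := by positivity
  have h6 : (l + 1 : ℝ) ≠ 0 := by positivity
  rw [e3, e4, smul_smul, smul_smul, inv_mul_cancel₀ h5, inv_mul_cancel₀ h6, one_smul, one_smul]
  rw [smul_comm] at h1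
  exact (smul_right_injective _ h0 h1).symm

theorem wedge_mem_closed {k l : ℕ} {μ : Form V (trivialLine I M) k} {ν : Form V W l}
    (hμ : μ ∈ (canonical L).closed k) (hν : ν ∈ D.closed l) : wedge μ ν ∈ D.closed (k + l) := by
  intro a
  rw [d_wedge, show (canonical L).d μ = fun _ => 0 from funext hμ, show D.d ν = fun _ => 0 from
    funext hν]
  simp [altProd, altSum]

theorem altProd_cast {X Y Y₁ Y₂ : Type*} [AddCommGroup X] [Module ℝ X] [AddCommGroup Y]
    [Module ℝ Y] [AddCommGroup Y₁] [Module ℝ Y₁] [AddCommGroup Y₂] [Module ℝ Y₂] {p q n n' : ℕ}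
    (h : n = n') (e : Fin p ⊕ Fin q ≃ Fin n) (P : Y₁ →ₗ[ℝ] Y₂ →ₗ[ℝ] Y)
    (μ : (Fin p → X) → Y₁) (ν : (Fin q → X) → Y₂) (a : Fin n' → X) :
    altProd (e.trans (finCongr h)) P μ ν a = altProd e P μ ν (a ∘ Fin.cast h) := by
  subst h
  rfl

theorem wedge_exact_left {k l : ℕ} {μ : Form V (trivialLine I M) k} {ν : Form V W l}
    (hμ : μ ∈ (canonical L).exact k) (hν : ν ∈ D.closed l) : wedge μ ν ∈ D.exact (k + l) := by
  cases k with
  | zero =>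
    rw [show μ = 0 from hμ]
    have : wedge (0 : Form V (trivialLine I M) 0) ν = 0 := by
      simpa using wedge_smul_left 0 (0 : Form V (trivialLine I M) 0) ν
    rw [this]
    exact zero_mem _
  | succ k =>
    obtain ⟨θ, hθ⟩ := hμ
    refine D.mem_exact_of_cast (j := k + l) (by omega) (wedge θ ν) fun a => ?_
    rw [d_wedge, show D.d ν = fun _ => 0 from funext hν, ← funext hθ, blockLeft, altProd_cast,
      eval_wedge, smul_add, smul_smul, Nat.factorial_succ]
    have h2 : altProd (blockRight k l) (funMul W) (eval θ) (fun _ => 0)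
        (a ∘ Fin.cast (by omega)) = 0 := by simp [altProd, altSum]
    rw [h2, smul_zero, smul_zero, add_zero]
    congr 1
    push_cast
    field_simp

theorem wedge_exact_right {k l : ℕ} {μ : Form V (trivialLine I M) k} {ν : Form V W l}
    (hμ : μ ∈ (canonical L).closed k) (hν : ν ∈ D.exact l) : wedge μ ν ∈ D.exact (k + l) := by
  cases l with
  | zero =>
    rw [show ν = 0 from hν]
    have : wedge μ (0 : Form V W 0) = 0 := by
      simpa using wedge_smul_right 0 μ (0 : Form V W 0)
    rw [this]
    exact zero_mem _
  | succ l =>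
    obtain ⟨θ, hθ⟩ := hν
    set s : ℤˣ := Equiv.Perm.sign ((blockRight k l).symm.trans finSumFinEquiv) with hs
    have h1 : ∀ a, eval (wedge μ ν) a = s • D.d (wedge μ θ) a := fun a => by
      rw [d_wedge, show (canonical L).d μ = fun _ => 0 from funext hμ, ← funext hθ,
        eval_wedge, altProd_trans (blockRight k l) finSumFinEquiv, smul_add, smul_smul,
        Nat.factorial_succ]
      have h2 : altProd (blockLeft k l) (funMul W) (fun _ => 0) (eval θ) a = 0 := by
        simp [altProd, altSum]
      rw [h2, smul_zero, zero_add, smul_comm _ (Equiv.Perm.sign _), smul_smul]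
      congr 2
      push_cast
      field_simp
    rcases Int.units_eq_one_or s with h | h <;> rw [h] at h1
    · exact ⟨wedge μ θ, fun a => by simpa using h1 a⟩
    · exact ⟨(-1 : ℝ) • wedge μ θ, fun a => by rw [d_smul, h1]; simp [Units.smul_def, neg_one_smul ℝ (D.d (wedge μ θ) a)]⟩

instance (k : ℕ) : AddCommGroup (D.closed k) := Submodule.addCommGroup _

/-- The cohomology `H^k_∇(A, G)`. -/
def Cohomology (k : ℕ) : Type _ :=
  D.closed k ⧸ (D.exact k).comap (D.closed k).subtype

instance (k : ℕ) : AddCommGroup (D.Cohomology k) :=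
  inferInstanceAs (AddCommGroup (D.closed k ⧸ (D.exact k).comap (D.closed k).subtype))

instance (k : ℕ) : Module ℝ (D.Cohomology k) :=
  inferInstanceAs (Module ℝ (D.closed k ⧸ (D.exact k).comap (D.closed k).subtype))

/-- The cohomology class of a closed form. -/
def toCohomology (k : ℕ) : D.closed k →ₗ[ℝ] D.Cohomology k := Submodule.mkQ _

/-- The exterior product of closed forms, as a class. -/
def closedCup (k l : ℕ) :
    (canonical L).closed k →ₗ[ℝ] D.closed l →ₗ[ℝ] D.Cohomology (k + l) :=
  LinearMap.mk₂ ℝ (fun μ ν => D.toCohomology _ ⟨wedge μ.1 ν.1, D.wedge_mem_closed μ.2 ν.2⟩)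
    (fun _ _ _ => (congrArg _ (Subtype.ext (wedge_add_left _ _ _))).trans (map_add _ _ _))
    (fun _ _ _ => (congrArg _ (Subtype.ext (wedge_smul_left _ _ _))).trans (map_smul _ _ _))
    (fun _ _ _ => (congrArg _ (Subtype.ext (wedge_add_right _ _ _))).trans (map_add _ _ _))
    (fun _ _ _ => (congrArg _ (Subtype.ext (wedge_smul_right _ _ _))).trans (map_smul _ _ _))

/-- The product `H^k(A) × H^l_∇(A, G) → H^{k+l}_∇(A, G)` induced by the exterior product. For the
canonical connection this is the product of the cohomology ring of `A`. -/
def cup (k l : ℕ) : (canonical L).Cohomology k →ₗ[ℝ] D.Cohomology l →ₗ[ℝ] D.Cohomology (k + l) :=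
  Submodule.liftQ _ (LinearMap.flip (Submodule.liftQ _ (LinearMap.flip (D.closedCup k l)) (by
    intro ν hν
    ext μ
    exact (Submodule.Quotient.mk_eq_zero _).2 (D.wedge_exact_right μ.2 hν)))) (by
    intro μ hμ
    refine LinearMap.ext fun y => ?_
    obtain ⟨ν, rfl⟩ := Submodule.Quotient.mk_surjective _ y
    exact (Submodule.Quotient.mk_eq_zero _).2 (D.wedge_exact_left hμ ν.2))

theorem cup_toCohomology {k l : ℕ} (μ : (canonical L).closed k) (ν : D.closed l) :
    D.cup k l ((canonical L).toCohomology k μ) (D.toCohomology l ν) =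
      D.toCohomology (k + l) ⟨wedge μ.1 ν.1, D.wedge_mem_closed μ.2 ν.2⟩ := rfl

/-- The unit of the cohomology ring, the class of the constant function `1`. -/
def unit (L : LieAlgebroid V) : (canonical L).Cohomology 0 :=
  (canonical L).toCohomology 0 ⟨⟨fun x => AlternatingMap.constOfIsEmpty ℝ (A x) (Fin 0) (1 : ℝ),
    fun _ => contMDiff_const⟩, fun a => by
      ext x
      have h : (1 : SmoothFun I M).d x = 0 := SmoothFun.d_const 1 (.of_forall fun _ => rfl)
      have h2 : (((canonical L).toFun (a 0) ⟨fun _ => 1, contMDiff_const⟩).1 x : ℝ) = 0 :=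
        congrArg (fun l => l (L.anchor x ((a 0).1 x))) h
      rw [d, koszul, koszulBracket, add_zero, Fin.sum_univ_one, Fin.val_zero, pow_zero, one_smul]
      exact h2⟩

end AlgebroidConnection
end Forms

section PullbackForms

variable {E : Type*} [NormedAddCommGroup E] [NormedSpace ℝ E] [FiniteDimensional ℝ E]
  {H : Type*} [TopologicalSpace H] {I : ModelWithCorners ℝ E H}
  {M : Type*} [TopologicalSpace M] [ChartedSpace H M] [IsManifold I ∞ M] [T2Space M]
  {E' : Type*} [NormedAddCommGroup E'] [NormedSpace ℝ E'] [FiniteDimensional ℝ E']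
  {H' : Type*} [TopologicalSpace H'] {I' : ModelWithCorners ℝ E' H'}
  {N : Type*} [TopologicalSpace N] [ChartedSpace H' N] [IsManifold I' ∞ N] [T2Space N]
  {A : N → Type*} [∀ x, AddCommGroup (A x)] [∀ x, Module ℝ (A x)]
  {G : N → Type*} [∀ x, AddCommGroup (G x)] [∀ x, Module ℝ (G x)]
  {V : SmoothVectorBundle I' N A} {L : LieAlgebroid V} {f : C^∞⟮I, M; I', N⟯}

theorem trivialLine_pullback_smooth {s : M → ℝ}
    (hs : s ∈ ((trivialLine I' N).pullback f).sections) : s ∈ (trivialLine I M).sections := by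
  intro m₀
  obtain ⟨t, ht⟩ := hs m₀
  refine ContMDiffAt.congr_of_eventuallyEq ?_ ht
  clear ht
  induction t with
  | zero => simpa using contMDiffAt_const
  | add t t' h h' => exact (h.add h').congr_of_eventuallyEq (.of_forall fun m => map_add _ t t')
  | tmul h u => exact h.contMDiff.contMDiffAt.mul ((u.2.comp f.contMDiff).contMDiffAt)

namespace LieAlgebroid

variable (L f) in
/-- The bundle map `p : f^{!!}A → A` over `f` at a point. -/
def projection (m : M) : L.pullbackFiber f m →ₗ[ℝ] A (f m) :=
  LinearMap.snd ℝ (TangentSpace I m) (A (f m)) ∘ₗ (L.pullbackFiber f m).subtype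

variable (hf : L.PullbackExists f)

theorem pullbackForm_mem {W : SmoothVectorBundle I' N G} {k : ℕ} (μ : Form V W k) :
    (fun m => (μ.1 (f m)).compLinearMap (L.projection f m)) ∈
      Form (pullbackBundle hf) (W.pullback f) k := by
  intro σ m₀
  obtain ⟨n, e, -, he⟩ := V.frame (f m₀)
  choose c hc using fun i => V.pullback_frame_coeff f m₀ he (sndSection hf (σ i))
  refine ⟨∑ J : Fin k → Fin n, (∏ i, c i (J i)) ⊗ₜ[ℝ] Form.eval μ (fun i => e (J i)), ?_⟩
  filter_upwards [eventually_all.2 hc] with m hm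
  have h : (fun i => L.projection f m ((σ i).1 m)) = fun i => ∑ j, c i j m • (e j).1 (f m) :=
    funext hm
  rw [map_sum]
  change (μ.1 (f m)).toMultilinearMap (fun i => L.projection f m ((σ i).1 m)) = _
  rw [h, MultilinearMap.map_sum]
  refine Finset.sum_congr rfl fun J _ => ?_
  rw [MultilinearMap.map_smul_univ, ev_tmul]
  congr 1
  exact (map_prod (ContMDiffMap.evalRingHom (I := I) (N := M) m) (fun i => c i (J i)) Finset.univ).symm

/-- The pullback `p^* : Ω^k(A, G) → Ω^k(f^{!!}A, f^!G)`,
`(p^*μ)_m(σ_1, …, σ_k) = μ_{f(m)}(p σ_1, …, p σ_k)`. -/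
def pullbackForm (W : SmoothVectorBundle I' N G) (k : ℕ) :
    Form V W k →ₗ[ℝ] Form (pullbackBundle hf) (W.pullback f) k where
  toFun μ := ⟨_, pullbackForm_mem hf μ⟩
  map_add' _ _ := rfl
  map_smul' _ _ := rfl

/-- The pullback `p^* : Ω^k(A) → Ω^k(f^{!!}A)` of scalar forms. -/
def pullbackScalarForm (k : ℕ) :
    Form V (trivialLine I' N) k →ₗ[ℝ] Form (pullbackBundle hf) (trivialLine I M) k where
  toFun μ := ⟨fun m => (μ.1 (f m)).compLinearMap (L.projection f m), fun σ =>
    trivialLine_pullback_smooth (pullbackForm_mem hf μ σ)⟩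
  map_add' _ _ := rfl
  map_smul' _ _ := rfl

end LieAlgebroid

/-- For a smooth map `φ : J × N → N`, with `J ⊆ ℝ` open: the pullback `φ^{!!}A` exists and has a
smooth section of the form `(∂_t, 0, y)`. -/
def LieAlgebroid.LiftsHomotopy (L : LieAlgebroid V) {J : TopologicalSpace.Opens ℝ}
    (φ : C^∞⟮𝓘(ℝ, ℝ).prod I', ↥J × N; I', N⟯) : Prop :=
  ∃ hφ : L.PullbackExists φ, ∃ σ ∈ (LieAlgebroid.pullbackBundle hφ).sections,
    ∀ p : ↥J × N, (σ p).1.1 = ((1 : ℝ), (0 : E'))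

end PullbackForms

end

/-!
The theorem says that `p^*` is a quasi-isomorphism of complexes of forms, for every representation;
ring and module structures come for free, because `p^*` is multiplicative (`map_cup`).
The proof is the one for de Rham cohomology: homotopy invariance, and then a formal argument with
the two homotopies.

*Homotopy invariance.* Let `A` be a Lie algebroid over `J × P` with a section `σ` over `∂_t`.
The operators `[σ, ·]` and `∇_σ` differentiate in the direction of `∂_t` only, so on every line
`J × {x}` they are linear ordinary differential operators, and since the equations are linear, their
solutions exist over all of `J`. Hence `∇_σ s = r` has a unique smooth global solution with given
values on a slice (`LineConnection.exists_transport`). Smooth dependence on parameters is obtained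
by solving the integral equation in the Banach space of continuous functions on `[0, 1]`, by a
Neumann series, which depends smoothly on the coefficients (`exists_linear_ode_solution`).
A form is determined by its values on sections that are parallel for `[σ, ·]`
(`LineConnection.exists_form`, `LineConnection.form_ext`); on these, the Lie derivative along `σ` is
just `∇_σ`, which commutes with the Koszul differential because `∇` is flat (`toFun_koszul`).
The basic forms, those annihilated by `ι_σ` and by the Lie derivative along `σ`, are a subcomplex
which restricts isomorphically to the forms on a slice (`IsBasic.eq_zero`, `exists_isBasic`).
For a closed form `μ`, integrating `ι_σ μ` in time from the slice on gives a form `ξ` that vanishes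
on the slice and for which `μ - dξ` is basic (`exists_primitive`). So the restriction to each slice
is a quasi-isomorphism (`isQuasiIso_slice`).

*The formal part.* Pullbacks compose, `g^{!!}(f^{!!}A) ≅ (f ∘ g)^{!!}A`, with all structure
(`isQuasiIso_iterated_iff`), and `id^{!!}A ≅ A` (`isQuasiIso_pullback_id`). For a liftable homotopy
`φ` with `φ₀ = id`, the slice theorem at `t = 0` shows that `φ^*` is a quasi-isomorphism, and at
`t = 1` that `φ₁^*` is one (`exists_isQuasiIso_of_liftsHomotopy`). Applied to `B` and `φ` this makes
`(f ∘ g)^*` a quasi-isomorphism, and applied to `f^{!!}B` and `η` it makes `(g ∘ f)^*` one. The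
latter shows that the pullback along `g` from `f^{!!}B` is injective in cohomology, and then `f^*`
is bijective in cohomology (`isQuasiIso_of_homotopyInverse`).

That `p^*` is a chain map (`dForm_pullbackForm`) is proved by induction on the degree with Cartan's
formula `ι_x d = L_x - d ι_x`: a section of `f^{!!}A` is locally a combination of pulled back
sections with smooth coefficients, and the derivatives of the coefficients cancel.
The scalar case is the case of the canonical connection, whose pullback along `f` is the canonical
connection of `f^{!!}A` (`canonical_pullback_toFun`).

If `B` is transitive, the fibres of `f^{!!}B` have constant dimension locally by rank-nullity, and a
partition of unity lifts `∂_t` through the anchor (`IsTransitive.exists_lift`).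
-/

open SmoothVectorBundle

noncomputable section

set_option linter.unusedSectionVars false

/-! ### Smooth inverses and local frames -/

section Frames

variable {E : Type*} [NormedAddCommGroup E] [NormedSpace ℝ E] [FiniteDimensional ℝ E]
  {H : Type*} [TopologicalSpace H] {I : ModelWithCorners ℝ E H}
  {M : Type*} [TopologicalSpace M] [ChartedSpace H M] [IsManifold I ∞ M] [T2Space M]

@[simp] theorem SmoothFun.sum_apply {ι : Type*} (s : Finset ι) (h : ι → SmoothFun I M) (x : M) :
    (∑ i ∈ s, h i) x = ∑ i ∈ s, h i x :=
  map_sum (ContMDiffMap.evalRingHom (I := I) (N := M) x) h s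

@[simp] theorem SmoothFun.prod_apply {ι : Type*} (s : Finset ι) (h : ι → SmoothFun I M) (x : M) :
    (∏ i ∈ s, h i) x = ∏ i ∈ s, h i x :=
  map_prod (ContMDiffMap.evalRingHom (I := I) (N := M) x) h s

/-- The constant smooth function. -/
def SmoothFun.const (I : ModelWithCorners ℝ E H) (M : Type*) [TopologicalSpace M]
    [ChartedSpace H M] (c : ℝ) : SmoothFun I M := ⟨fun _ => c, contMDiff_const⟩

/-- A matrix of smooth functions that is injective at a point has a smooth left inverse nearby. -/
theorem exists_smooth_left_inverse {ι κ : Type*} [Fintype ι] [Fintype κ] [DecidableEq ι]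
    (m : κ → ι → SmoothFun I M) (x₀ : M)
    (hm : ∀ c : ι → ℝ, (∀ k, ∑ i, m k i x₀ * c i = 0) → c = 0) :
    ∃ L : ι → κ → SmoothFun I M, ∀ᶠ x in 𝓝 x₀, ∀ i j,
      ∑ k, L i k x * m k j x = if i = j then 1 else 0 := by
  classical
  let ev : M → SmoothFun I M →+* ℝ := fun x => ContMDiffMap.evalRingHom (I := I) (N := M) x
  have hev : ∀ x (h : SmoothFun I M), ev x h = h x := fun _ _ => rfl
  let m₀ : Matrix κ ι (SmoothFun I M) := Matrix.of m
  obtain ⟨q, hq⟩ := (m₀.map (ev x₀)).mulVecLin.exists_leftInverse_of_injective (by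
    rw [LinearMap.ker_eq_bot']
    exact fun c hc => hm c fun k => congrFun hc k)
  let Q : Matrix ι κ (SmoothFun I M) := (LinearMap.toMatrix' q).map (SmoothFun.const I M)
  have hQ : (Q * m₀).map (ev x₀) = 1 := by
    rw [Matrix.map_mul]
    have h1 : Q.map (ev x₀) = LinearMap.toMatrix' q := by ext i j; rfl
    have h2 : LinearMap.toMatrix' (m₀.map (ev x₀)).mulVecLin = m₀.map (ev x₀) :=
      LinearMap.toMatrix'_toLin' _
    rw [h1, ← h2, ← LinearMap.toMatrix'_comp, hq, LinearMap.toMatrix'_id]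
  have hd : (Q * m₀).det x₀ = 1 := by
    rw [← hev, RingHom.map_det, RingHom.mapMatrix_apply, hQ, Matrix.det_one]
  have hU : {x | (Q * m₀).det x ≠ 0} ∈ 𝓝 x₀ :=
    (Q * m₀).det.contMDiff.continuous.continuousAt.eventually_ne (by rw [hd]; exact one_ne_zero)
  obtain ⟨f, hf⟩ := exists_smoothFun_eventuallyEq (I := I) (u := fun x => ((Q * m₀).det x)⁻¹) hU
    (fun x hx => ((Q * m₀).det.contMDiff.contMDiffAt.inv₀ hx).contMDiffWithinAt)
  refine ⟨fun i k => (f • (Matrix.adjugate (Q * m₀) * Q)) i k, ?_⟩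
  filter_upwards [hf, hU] with x hx hxU i j
  have h2 : (f • (Matrix.adjugate (Q * m₀) * Q)) * m₀ = (f * (Q * m₀).det) • 1 := by
    rw [Matrix.smul_mul, Matrix.mul_assoc, Matrix.adjugate_mul, smul_smul]
  have h3 := congrArg (ev x) (congrFun (congrFun h2 i) j)
  rw [Matrix.mul_apply, map_sum] at h3
  simp only [hev] at h3
  refine h3.trans ?_
  rw [Matrix.smul_apply, smul_eq_mul, ← hev, map_mul, map_mul, hev, hev, hx,
    inv_mul_cancel₀ hxU, one_mul, Matrix.one_apply]
  split_ifs <;> simp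

/-- Functions that solve a linear system with smooth coefficients which is injective at a point
are smooth near that point. -/
theorem exists_smooth_solution {ι κ : Type*} [Fintype ι] [Fintype κ]
    (m : κ → ι → SmoothFun I M) (w : κ → SmoothFun I M) (u : M → ι → ℝ) (x₀ : M)
    (hm : ∀ c : ι → ℝ, (∀ k, ∑ i, m k i x₀ * c i = 0) → c = 0)
    (h : ∀ᶠ x in 𝓝 x₀, ∀ k, ∑ i, m k i x * u x i = w k x) :
    ∃ v : ι → SmoothFun I M, ∀ᶠ x in 𝓝 x₀, ∀ i, u x i = v i x := by
  classical
  obtain ⟨L, hL⟩ := exists_smooth_left_inverse m x₀ hm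
  refine ⟨fun i => ∑ k, L i k * w k, ?_⟩
  filter_upwards [hL, h] with x h1 h2 i
  simp only [SmoothFun.sum_apply, ContMDiffMap.coe_mul, Pi.mul_apply, ← h2, Finset.mul_sum]
  rw [Finset.sum_comm]
  simp only [← mul_assoc, ← Finset.sum_mul, h1]
  simp

namespace SmoothVectorBundle

variable {A : M → Type*} [∀ x, AddCommGroup (A x)] [∀ x, Module ℝ (A x)]
  {V : SmoothVectorBundle I M A}

/-- The value of a section at a point. -/
def evalAt (V : SmoothVectorBundle I M A) (x : M) : V.sections →ₗ[ℝ] A x :=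
  LinearMap.proj x ∘ₗ V.sections.subtype

@[simp] theorem evalAt_apply (x : M) (s : V.sections) : V.evalAt x s = s.1 x := rfl

theorem exists_extension (V : SmoothVectorBundle I M A) (x : M) :
    ∃ q : A x →ₗ[ℝ] V.sections, V.evalAt x ∘ₗ q = LinearMap.id :=
  (V.evalAt x).exists_rightInverse_of_surjective
    (LinearMap.range_eq_top.2 fun a => V.exists_section x a)

/-- A section through a given vector, depending linearly on the vector. -/
def extend (V : SmoothVectorBundle I M A) (x : M) : A x →ₗ[ℝ] V.sections :=
  (V.exists_extension x).choose

@[simp] theorem extend_apply (x : M) (a : A x) : (V.extend x a).1 x = a :=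
  congrArg (fun l => l a) (V.exists_extension x).choose_spec

/-- Sections that form a basis of the fibre at a point form a frame near that point. -/
theorem frame_of_basis (V : SmoothVectorBundle I M A) {ι : Type*} [Fintype ι]
    (s : ι → V.sections) (x₀ : M)
    (hli : LinearIndependent ℝ fun i => (s i).1 x₀)
    (hsp : ⊤ ≤ Submodule.span ℝ (Set.range fun i => (s i).1 x₀)) :
    (∀ᶠ y in 𝓝 x₀, LinearIndependent ℝ (fun i => (s i).1 y) ∧
      ⊤ ≤ Submodule.span ℝ (Set.range fun i => (s i).1 y)) ∧
    ∀ r : V.sections, ∃ h : ι → SmoothFun I M, ∀ᶠ y in 𝓝 x₀, r.1 y = ∑ i, h i y • (s i).1 y := by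
  classical
  obtain ⟨n, e, he, hc⟩ := V.frame x₀
  choose m hm using fun i => hc (s i)
  have hinj : ∀ c : ι → ℝ, (∀ k, ∑ i, m i k x₀ * c i = 0) → c = 0 := by
    intro c h
    have h1 : ∑ i, c i • (s i).1 x₀ = 0 := by
      simp only [(hm _).self_of_nhds, Finset.smul_sum]
      rw [Finset.sum_comm]
      refine Finset.sum_eq_zero fun k _ => ?_
      simp only [smul_smul, ← Finset.sum_smul]
      rw [show ∑ i, c i * m i k x₀ = 0 from by rw [← h k]; simp only [mul_comm], zero_smul]
    exact funext (Fintype.linearIndependent_iff.1 hli c h1)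
  obtain ⟨L, hL⟩ := exists_smooth_left_inverse (fun k i => m i k) x₀ hinj
  have h1 : ∀ᶠ y in 𝓝 x₀, LinearIndependent ℝ (fun i => (s i).1 y) ∧
      ⊤ ≤ Submodule.span ℝ (Set.range fun i => (s i).1 y) := by
    filter_upwards [hL, he, eventually_all.2 hm] with y h1 h2 h3
    have h4 : LinearIndependent ℝ (fun i => (s i).1 y) := by
      rw [Fintype.linearIndependent_iff]
      intro c h i
      have h5 : ∀ k, ∑ i, m i k y * c i = 0 := by
        refine Fintype.linearIndependent_iff.1 h2.1 (fun k => ∑ i, m i k y * c i) ?_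
        rw [← h]
        simp only [h3, Finset.smul_sum, Finset.sum_smul]
        rw [Finset.sum_comm]
        simp only [smul_smul, mul_comm]
      have h6 : ∑ k, L i k y * ∑ j, m j k y * c j = 0 := by simp [h5]
      simp only [Finset.mul_sum] at h6
      rw [Finset.sum_comm] at h6
      simp only [← mul_assoc, ← Finset.sum_mul, h1] at h6
      simpa using h6
    refine ⟨h4, ?_⟩
    let b₀ := Module.Basis.mk hli hsp
    let b₁ := Module.Basis.mk he.self_of_nhds.1 he.self_of_nhds.2
    let b := Module.Basis.mk h2.1 h2.2
    have hcard : Fintype.card ι = Fintype.card (Fin n) := by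
      rw [← Module.finrank_eq_card_basis b₀, ← Module.finrank_eq_card_basis b₁]
    have : Module.Finite ℝ (A y) := b.finiteDimensional_of_finite
    exact (h4.span_eq_top_of_card_eq_finrank' (by
      rw [hcard, ← Module.finrank_eq_card_basis b])).ge
  refine ⟨h1, fun r => ?_⟩
  obtain ⟨w, hw⟩ := hc r
  have h2 : ∃ u : M → ι → ℝ, ∀ᶠ y in 𝓝 x₀, r.1 y = ∑ i, u y i • (s i).1 y := by
    have h3 : ∀ y, ∃ u : ι → ℝ, ⊤ ≤ Submodule.span ℝ (Set.range fun i => (s i).1 y) →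
        r.1 y = ∑ i, u i • (s i).1 y := fun y => by
      by_cases h : ⊤ ≤ Submodule.span ℝ (Set.range fun i => (s i).1 y)
      · obtain ⟨c, hc⟩ := (Submodule.mem_span_range_iff_exists_fun ℝ).1 (h (x := r.1 y) trivial)
        exact ⟨c, fun _ => hc.symm⟩
      · exact ⟨0, fun h' => absurd h' h⟩
    choose u hu using h3
    exact ⟨u, h1.mono fun y hy => hu y hy.2⟩
  obtain ⟨u, hu⟩ := h2
  obtain ⟨v, hv⟩ := exists_smooth_solution (fun k i => m i k) w u x₀ hinj (by
    filter_upwards [hu, hw, he, eventually_all.2 hm] with y h3 h4 h5 h6 k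
    rw [← sub_eq_zero]
    refine Fintype.linearIndependent_iff.1 h5.1
      (fun k => ∑ i, m i k y * u y i - w k y) ?_ k
    simp only [sub_smul, Finset.sum_sub_distrib, ← h4, h3, h6, Finset.smul_sum, Finset.sum_smul]
    rw [sub_eq_zero, Finset.sum_comm]
    simp only [smul_smul, mul_comm])
  exact ⟨v, by filter_upwards [hu, hv] with y h3 h4; simp only [h3, h4]⟩

theorem finiteDimensional_fiber (V : SmoothVectorBundle I M A) (x : M) :
    FiniteDimensional ℝ (A x) := by
  obtain ⟨n, e, h, -⟩ := V.frame x
  exact (Module.Basis.mk h.self_of_nhds.1 h.self_of_nhds.2).finiteDimensional_of_finite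

theorem eventually_finrank_eq (V : SmoothVectorBundle I M A) (x : M) :
    ∀ᶠ y in 𝓝 x, Module.finrank ℝ (A y) = Module.finrank ℝ (A x) := by
  obtain ⟨n, e, h, -⟩ := V.frame x
  filter_upwards [h] with y hy
  rw [Module.finrank_eq_card_basis (Module.Basis.mk hy.1 hy.2),
    Module.finrank_eq_card_basis (Module.Basis.mk h.self_of_nhds.1 h.self_of_nhds.2)]

end SmoothVectorBundle
end Frames

/-! ### Cartan calculus of the Koszul formula -/

section Cartan

variable {X Y : Type*} [AddCommGroup X] [Module ℝ X] [AddCommGroup Y] [Module ℝ Y]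

/-- The Lie derivative `(L_x μ)(b) = D_x (μ(b)) - ∑_q μ(b_1, …, [x, b_q], …, b_k)`. -/
def lieForm {k : ℕ} (br : X → X → X) (D : X → Y →ₗ[ℝ] Y) (μ : (Fin k → X) → Y) (x : X)
    (b : Fin k → X) : Y :=
  D x (μ b) - ∑ q, μ (Function.update b q (br x (b q)))

/-- Cartan's formula `ι_x d = L_x - d ι_x`. -/
theorem koszul_cons {k : ℕ} (br : X → X → X) (hbr : ∀ x y, br x y = -br y x)
    (D : X → Y →ₗ[ℝ] Y) (μ : X [⋀^Fin (k + 1)]→ₗ[ℝ] Y) (x : X) (b : Fin (k + 1) → X) :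
    koszul br D μ (Fin.cons x b) = lieForm br D μ x b - koszul br D (μ.curryLeft x) b := by
  rw [koszul_eq br hbr, koszul_eq br hbr, Fin.sum_univ_succ]
  have h0 : Fin.removeNth 0 (Fin.cons x b : Fin (k + 2) → X) = b := by
    funext i; simp [Fin.removeNth]
  have h1 (i : Fin (k + 1)) : (i.succ).removeNth (Fin.cons x b : Fin (k + 2) → X) =
      Fin.cons x (i.removeNth b) := by
    funext j
    cases j using Fin.cases with
    | zero => simp [Fin.removeNth]
    | succ j => simp [Fin.removeNth]
  have h2 (i : Fin (k + 1)) : derivTerm br D μ (b i) (Fin.cons x (i.removeNth b)) =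
      derivTerm br D (μ.curryLeft x) (b i) (i.removeNth b) -
        (2⁻¹ : ℝ) • μ (Fin.cons (br (b i) x) (i.removeNth b)) := by
    simp only [derivTerm, Fin.sum_univ_succ, Fin.cons_zero, Fin.cons_succ, Fin.update_cons_zero,
      ← Fin.cons_update, smul_add]
    change _ = D (b i) (μ (Fin.cons x (i.removeNth b))) -
      (2⁻¹ : ℝ) • ∑ q, μ (Fin.cons x (Function.update (i.removeNth b) q _)) - _
    abel
  have h3 (i : Fin (k + 1)) : (-1 : ℝ) ^ (i.val + 1) • μ (Fin.cons (br (b i) x) (i.removeNth b)) =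
      μ (Function.update b i (br x (b i))) := by
    have h4 : Function.update b i (br x (b i)) = i.insertNth (br x (b i)) (i.removeNth b) := by
      simp
    have h5 : μ (Fin.cons ((-1 : ℝ) • br x (b i)) (i.removeNth b)) =
        (-1 : ℝ) • μ (Fin.cons (br x (b i)) (i.removeNth b)) :=
      μ.toMultilinearMap.cons_smul _ _ _
    rw [h4, AlternatingMap.map_insertNth, hbr, ← neg_one_smul ℝ (br x (b i)), h5, smul_smul,
      ← pow_succ]
    change _ = (-1) ^ i.val • μ (Fin.cons _ _)
    rw [← Int.cast_smul_eq_zsmul ℝ]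
    congr 1
    push_cast
    rw [pow_succ, pow_succ]
    ring
  simp only [h0, h1, h2, Fin.cons_zero, Fin.cons_succ, Fin.val_zero, pow_zero, one_smul, smul_sub,
    Finset.sum_sub_distrib, Fin.val_succ]
  have h6 : ∑ i : Fin (k + 1), (-1 : ℝ) ^ (i.val + 1) • (2⁻¹ : ℝ) •
      μ (Fin.cons (br (b i) x) (i.removeNth b)) =
      (2⁻¹ : ℝ) • ∑ i, μ (Function.update b i (br x (b i))) := by
    rw [Finset.smul_sum]
    exact Finset.sum_congr rfl fun i _ => by rw [smul_comm, h3]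
  rw [h6, lieForm, derivTerm]
  simp only [pow_succ, mul_neg, mul_one, neg_smul, Finset.sum_neg_distrib]
  module

/-- The Koszul formula as an alternating map. -/
def koszulAlt (br : X →ₗ[ℝ] X →ₗ[ℝ] X) (D : X →ₗ[ℝ] Y →ₗ[ℝ] Y) : ∀ {k : ℕ},
    (X [⋀^Fin k]→ₗ[ℝ] Y) → X [⋀^Fin (k + 1)]→ₗ[ℝ] Y
  | 0, μ => AlternatingMap.alternatizeUncurryFin
      { toFun := fun x => (D x).compAlternatingMap μ
        map_add' := fun x y => by ext; simp
        map_smul' := fun c x => by ext; simp }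
  | _ + 1, μ => AlternatingMap.alternatizeUncurryFin
      { toFun := fun x => (D x).compAlternatingMap μ
        map_add' := fun x y => by ext; simp
        map_smul' := fun c x => by ext; simp } +
      (2⁻¹ : ℝ) • AlternatingMap.alternatizeUncurryFin
        (AlternatingMap.alternatizeUncurryFinLM ∘ₗ
          { toFun := fun x => μ.curryLeft ∘ₗ br.flip x
            map_add' := fun x y => by ext; simp
            map_smul' := fun c x => by ext; simp })

theorem koszulAlt_apply {k : ℕ} (br : X →ₗ[ℝ] X →ₗ[ℝ] X) (hbr : ∀ x y, br x y = -br y x)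
    (D : X →ₗ[ℝ] Y →ₗ[ℝ] Y) (μ : X [⋀^Fin k]→ₗ[ℝ] Y) (a : Fin (k + 1) → X) :
    koszulAlt br D μ a = koszul (fun x y => br x y) (fun x => D x) μ a := by
  rw [koszul_eq _ hbr]
  have e : ∀ (n : ℕ) (y : Y), ((-1 : ℤ) ^ n) • y = ((-1 : ℝ) ^ n) • y := fun n y => by
    rw [← Int.cast_smul_eq_zsmul ℝ]; push_cast; rfl
  cases k with
  | zero =>
    rw [koszulAlt, AlternatingMap.alternatizeUncurryFin_apply]
    simp [derivTerm]
  | succ k =>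
    rw [koszulAlt, AlternatingMap.add_apply, AlternatingMap.smul_apply,
      AlternatingMap.alternatizeUncurryFin_apply, AlternatingMap.alternatizeUncurryFin_apply]
    simp only [derivTerm, smul_sub, Finset.sum_sub_distrib]
    rw [sub_eq_add_neg, ← Finset.sum_neg_distrib, Finset.smul_sum]
    congr 1
    · exact Finset.sum_congr rfl fun i _ => e _ _
    refine Finset.sum_congr rfl fun p _ => ?_
    change (2⁻¹ : ℝ) • (-1 : ℤ) ^ p.val • (AlternatingMap.alternatizeUncurryFin
      (μ.curryLeft ∘ₗ br.flip (a p))) (p.removeNth a) = _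
    rw [AlternatingMap.alternatizeUncurryFin_apply, e, smul_comm (2⁻¹ : ℝ) ((-1 : ℝ) ^ _),
      ← smul_neg, ← smul_neg, ← Finset.sum_neg_distrib]
    congr 2
    refine Finset.sum_congr rfl fun q _ => ?_
    have h2 : Function.update (p.removeNth a) q (br (a p) (p.removeNth a q)) =
        q.insertNth (br (a p) (p.removeNth a q)) (q.removeNth (p.removeNth a)) := by
      simp
    have h5 : μ (Fin.cons ((-1 : ℝ) • br (p.removeNth a q) (a p)) (q.removeNth (p.removeNth a))) =
        (-1 : ℝ) • μ (Fin.cons (br (p.removeNth a q) (a p)) (q.removeNth (p.removeNth a))) :=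
      μ.toMultilinearMap.cons_smul _ _ _
    rw [h2, AlternatingMap.map_insertNth, hbr (a p), ← neg_one_smul ℝ (br _ (a p))]
    change _ = -((-1) ^ q.val • μ (Fin.cons _ _))
    rw [h5, e, e, smul_comm, neg_one_smul ℝ, neg_neg]
    rfl

end Cartan

/-! ### The exterior derivative as a form -/

section ExteriorDerivative

variable {E : Type*} [NormedAddCommGroup E] [NormedSpace ℝ E] [FiniteDimensional ℝ E]
  {H : Type*} [TopologicalSpace H] {I : ModelWithCorners ℝ E H}
  {M : Type*} [TopologicalSpace M] [ChartedSpace H M] [IsManifold I ∞ M] [T2Space M]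
  {A : M → Type*} [∀ x, AddCommGroup (A x)] [∀ x, Module ℝ (A x)]
  {G : M → Type*} [∀ x, AddCommGroup (G x)] [∀ x, Module ℝ (G x)]
  {V : SmoothVectorBundle I M A} {W : SmoothVectorBundle I M G}

/-- Maps of sections that are linear over the smooth functions act pointwise. -/
theorem eq_zero_of_smul_linear {l : V.sections →ₗ[ℝ] W.sections}
    (hl : ∀ (h : SmoothFun I M) s, l (h • s) = h • l s) {s : V.sections} {x : M}
    (hs : s.1 x = 0) : (l s).1 x = 0 := by
  obtain ⟨n, b, h1, h2⟩ := V.frame x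
  obtain ⟨u, hu⟩ := h2 s
  obtain ⟨χ, hχ1, hχ2⟩ := exists_cutoff (I := I) hu
  have hz : ∀ i, u i x = 0 :=
    Fintype.linearIndependent_iff.1 h1.self_of_nhds.1 (fun i => u i x)
      (hu.self_of_nhds.symm.trans hs)
  have h3 : χ • s = ∑ i, χ • u i • b i := by
    ext y
    by_cases hy : y ∈ tsupport χ
    · have := hχ2 hy
      simp only [Set.mem_ofPred_eq] at this
      simp [this, Finset.smul_sum]
    · simp [image_eq_zero_of_notMem_tsupport hy]
  have h4 : (l (χ • s)).1 x = (l s).1 x := by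
    rw [hl, fun_smul_apply, hχ1.self_of_nhds, one_smul]
  rw [← h4, h3, map_sum, sections_sum_apply]
  refine Finset.sum_eq_zero fun i _ => ?_
  rw [hl, hl]
  simp [hz i]

/-- An alternating map of sections whose value at a point depends only on the values of the
arguments at that point. -/
def IsPointwise {k : ℕ} (Φ : V.sections [⋀^Fin k]→ₗ[ℝ] W.sections) : Prop :=
  ∀ (a b : Fin k → V.sections) (x : M), (∀ i, (a i).1 x = (b i).1 x) → (Φ a).1 x = (Φ b).1 x

/-- It suffices that the value at a point vanishes as soon as one argument vanishes there. -/
theorem isPointwise_of_update {k : ℕ} {Φ : V.sections [⋀^Fin k]→ₗ[ℝ] W.sections}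
    (h : ∀ (a : Fin k → V.sections) i x (s : V.sections), s.1 x = 0 →
      (Φ (Function.update a i s)).1 x = 0) : IsPointwise Φ := by
  intro a b x hab
  have key : ∀ t : Finset (Fin k), (Φ (t.piecewise b a)).1 x = (Φ a).1 x := by
    intro t
    induction t using Finset.induction_on with
    | empty => simp
    | insert i t hi ih =>
      rw [Finset.piecewise_insert, ← ih]
      have h1 := h (t.piecewise b a) i x (b i - a i) (by simp [hab i])
      have h2 : Function.update (t.piecewise b a) i (a i) = t.piecewise b a := by
        rw [Function.update_eq_self_iff]; simp [hi]
      rw [AlternatingMap.map_update_sub, h2] at h1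
      exact sub_eq_zero.1 h1
  have := key Finset.univ
  rw [Finset.piecewise_univ] at this
  exact this.symm

/-- For alternating maps it suffices to consider the first argument. -/
theorem isPointwise_of_cons {k : ℕ} {Φ : V.sections [⋀^Fin (k + 1)]→ₗ[ℝ] W.sections}
    (h : ∀ (u : SmoothFun I M) (s : V.sections) (b : Fin k → V.sections),
      Φ (Fin.cons (u • s) b) = u • Φ (Fin.cons s b)) : IsPointwise Φ := by
  refine isPointwise_of_update fun a i x s hs => ?_
  have h1 : Function.update a i s = i.insertNth s (i.removeNth a) := by simp
  have h2 : (Φ (Fin.cons s (i.removeNth a))).1 x = 0 :=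
    eq_zero_of_smul_linear (l := LinearMap.mk ⟨fun s => Φ (Fin.cons s (i.removeNth a)),
      fun s t => Φ.toMultilinearMap.cons_add _ _ _⟩ fun c s => Φ.toMultilinearMap.cons_smul _ _ _)
      (fun u s => h u s _) hs
  rw [h1, AlternatingMap.map_insertNth]
  change ((-1 : ℤ) ^ i.val • Φ (Fin.cons s (i.removeNth a))).1 x = 0
  rcases neg_one_pow_eq_or ℤ i.val with h3 | h3 <;> rw [h3] <;> simp [h2]

/-- The form with given values on sections. -/
def formOf {k : ℕ} (Φ : V.sections [⋀^Fin k]→ₗ[ℝ] W.sections) (hΦ : IsPointwise Φ) : Form V W k :=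
  ⟨fun x => ((W.evalAt x).compAlternatingMap Φ).compLinearMap (V.extend x), fun a => by
    have h : (fun x => ((W.evalAt x).compAlternatingMap Φ).compLinearMap (V.extend x)
        fun i => (a i).1 x) = (Φ a).1 := by
      funext x
      exact hΦ _ _ x fun i => V.extend_apply x _
    rw [h]
    exact (Φ a).2⟩

@[simp] theorem eval_formOf {k : ℕ} (Φ : V.sections [⋀^Fin k]→ₗ[ℝ] W.sections)
    (hΦ : IsPointwise Φ) : Form.eval (formOf Φ hΦ) = Φ := by
  ext a x
  exact hΦ _ _ x fun i => V.extend_apply x _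

namespace Form

theorem eval_apply {k : ℕ} (μ : Form V W k) (a : Fin k → V.sections) (x : M) :
    (eval μ a).1 x = μ.1 x fun i => (a i).1 x := rfl

theorem isPointwise_eval {k : ℕ} (μ : Form V W k) : IsPointwise (eval μ) := fun a b x h => by
  rw [eval_apply, eval_apply, funext h]

/-- The contraction `ι_c μ`. -/
def contract {k : ℕ} (c : V.sections) (μ : Form V W (k + 1)) : Form V W k :=
  ⟨fun x => (μ.1 x).curryLeft (c.1 x), fun a => by
    have h : (fun x => (μ.1 x).curryLeft (c.1 x) fun i => (a i).1 x) =
        (eval μ (Fin.cons c a)).1 := by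
      funext x
      rw [eval_apply]
      change μ.1 x (Fin.cons _ _) = _
      congr 1
      funext i
      cases i using Fin.cases <;> rfl
    rw [h]
    exact Subtype.property _⟩

theorem eval_contract {k : ℕ} (c : V.sections) (μ : Form V W (k + 1)) :
    eval (contract c μ) = (eval μ).curryLeft c := by
  ext a x
  change μ.1 x (Fin.cons _ _) = μ.1 x _
  congr 1
  funext i
  cases i using Fin.cases <;> rfl

theorem eval_cons_smul {k : ℕ} (μ : Form V W (k + 1)) (u : SmoothFun I M) (s : V.sections)
    (b : Fin k → V.sections) : eval μ (Fin.cons (u • s) b) = u • eval μ (Fin.cons s b) := by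
  ext x
  have h : ∀ s : V.sections, (fun i => ((Fin.cons s b : Fin (k + 1) → V.sections) i).1 x) =
      Fin.cons (s.1 x) fun i => (b i).1 x := fun s => by
    funext i; cases i using Fin.cases <;> rfl
  rw [fun_smul_apply, eval_apply, eval_apply, h, h, fun_smul_apply]
  exact (μ.1 x).toMultilinearMap.cons_smul _ _ _

theorem eval_update_smul {k : ℕ} (μ : Form V W k) (u : SmoothFun I M) (s : V.sections)
    (b : Fin k → V.sections) (q : Fin k) :
    eval μ (Function.update b q (u • s)) = u • eval μ (Function.update b q s) := by
  ext x
  have h : ∀ s : V.sections, (fun i => (Function.update b q s i).1 x) =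
      Function.update (fun i => (b i).1 x) q (s.1 x) := fun s => by
    funext i; rcases eq_or_ne i q with rfl | hi <;> simp [*]
  rw [fun_smul_apply, eval_apply, eval_apply, h, h, fun_smul_apply]
  exact (μ.1 x).map_update_smul _ _ _ _

end Form

namespace AlgebroidConnection

variable {L : LieAlgebroid V} (D : AlgebroidConnection L W)

theorem toFun_smul (a : V.sections) (h : SmoothFun I M) (e : W.sections) :
    D.toFun a (h • e) = h • D.toFun a e + lieDer (L.anchorSection a) h • e :=
  Subtype.ext (funext fun x => D.leibniz a e h x)

theorem toFun_congr (a : V.sections) {e e' : W.sections} {x : M}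
    (h : ∀ᶠ y in 𝓝 x, e.1 y = e'.1 y) : (D.toFun a e).1 x = (D.toFun a e').1 x :=
  (D.derAt a x).congr h

/-- `d(h Φ) = h dΦ + dh ∧ Φ`. -/
theorem koszul_fun_smul {k : ℕ} (h : SmoothFun I M)
    {Φ Φ' : V.sections [⋀^Fin k]→ₗ[ℝ] W.sections} (hΦ : ∀ a, Φ' a = h • Φ a)
    (a : Fin (k + 1) → V.sections) :
    koszul (fun a b => L.bracket a b) (fun a => D.toFun a) Φ' a =
      h • koszul (fun a b => L.bracket a b) (fun a => D.toFun a) Φ a +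
      ∑ i : Fin (k + 1), (-1 : ℝ) ^ i.val •
        lieDer (L.anchorSection (a i)) h • Φ (i.removeNth a) := by
  have hc : ∀ (c : ℝ) (s : W.sections), c • h • s = h • c • s := fun c s => by
    ext x; exact smul_comm _ _ _
  have h1 : koszulBracket (fun a b => L.bracket a b) Φ' a =
      h • koszulBracket (fun a b => L.bracket a b) Φ a := by
    cases k with
    | zero => simp [koszulBracket]
    | succ k =>
      simp only [koszulBracket, Finset.smul_sum, smul_ite, smul_zero, hΦ, hc]
  rw [koszul, koszul, h1]
  simp only [hΦ, toFun_smul, smul_add, Finset.sum_add_distrib, Finset.smul_sum, hc]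
  abel

/-- Cartan's formula `ι_x d = L_x - d ι_x` for forms. -/
theorem d_cons {k : ℕ} (μ : Form V W (k + 1)) (x : V.sections) (b : Fin (k + 1) → V.sections) :
    D.d μ (Fin.cons x b) =
      lieForm (fun a b => L.bracket a b) (fun a => D.toFun a) (Form.eval μ) x b -
        D.d (Form.contract x μ) b := by
  rw [d, koszul_cons _ L.bracket_skew, d, Form.eval_contract]

theorem bracket_smul_left (a b : V.sections) (h : SmoothFun I M) :
    L.bracket (h • a) b = h • L.bracket a b - lieDer (L.anchorSection b) h • a := by
  rw [L.bracket_skew, L.bracket_smul, L.bracket_skew b a]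
  simp only [smul_neg, neg_add, neg_neg, sub_eq_add_neg]

theorem d_degree_zero (μ : Form V W 0) (a : Fin 1 → V.sections) (b : Fin 0 → V.sections) :
    D.d μ a = D.toFun (a 0) (Form.eval μ b) := by
  rw [d, koszul, koszulBracket, add_zero, Fin.sum_univ_one, Fin.val_zero, pow_zero, one_smul]
  congr 2
  exact Subsingleton.elim _ _

/-- The exterior derivative is linear over the smooth functions in the first argument: the two
terms of Cartan's formula are not, and their defects cancel. -/
theorem d_cons_smul {k : ℕ} (μ : Form V W k) (h : SmoothFun I M) (x : V.sections)
    (b : Fin k → V.sections) : D.d μ (Fin.cons (h • x) b) = h • D.d μ (Fin.cons x b) := by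
  cases k with
  | zero =>
    rw [D.d_degree_zero μ _ b, D.d_degree_zero μ _ b]
    exact D.smul_left h x _
  | succ k =>
    have h1 := D.koszul_fun_smul h (Φ := (Form.eval μ).curryLeft x)
      (Φ' := (Form.eval μ).curryLeft (h • x)) (fun v => Form.eval_cons_smul μ h x v) b
    rw [d, d, koszul_cons _ L.bracket_skew, koszul_cons _ L.bracket_skew, h1, lieForm, lieForm,
      smul_sub, smul_sub, D.smul_left]
    have h2 : ∀ q, (Form.eval μ) (Function.update b q (L.bracket (h • x) (b q))) =
        h • Form.eval μ (Function.update b q (L.bracket x (b q))) -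
        (-1 : ℝ) ^ q.val • lieDer (L.anchorSection (b q)) h •
          (Form.eval μ).curryLeft x (q.removeNth b) := fun q => by
      have h4 : Function.update b q x = q.insertNth x (q.removeNth b) := by simp
      rw [bracket_smul_left, AlternatingMap.map_update_sub, Form.eval_update_smul,
        Form.eval_update_smul, h4, AlternatingMap.map_insertNth]
      congr 1
      change _ • (-1 : ℤ) ^ q.val • (Form.eval μ).curryLeft x (q.removeNth b) = _
      rcases neg_one_pow_eq_or ℤ q.val with h3 | h3
      · rw [h3, show (-1 : ℝ) ^ q.val = 1 by exact_mod_cast h3, one_smul, one_smul]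
      · rw [h3, show (-1 : ℝ) ^ q.val = -1 by exact_mod_cast h3]
        ext y
        simp
    simp only [h2, Finset.sum_sub_distrib, Finset.smul_sum]
    abel

/-- The exterior derivative as a form. -/
def dForm {k : ℕ} (μ : Form V W k) : Form V W (k + 1) :=
  formOf (koszulAlt L.bracket D.toFun (Form.eval μ)) (isPointwise_of_cons fun u s b => by
    rw [koszulAlt_apply _ L.bracket_skew, koszulAlt_apply _ L.bracket_skew]
    exact D.d_cons_smul μ u s b)

theorem eval_dForm {k : ℕ} (μ : Form V W k) (a : Fin (k + 1) → V.sections) :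
    Form.eval (D.dForm μ) a = D.d μ a := by
  rw [dForm, eval_formOf, koszulAlt_apply _ L.bracket_skew]
  rfl

theorem dForm_apply {k : ℕ} (μ : Form V W k) (a : Fin (k + 1) → V.sections) (x : M) :
    (D.dForm μ).1 x (fun i => (a i).1 x) = (D.d μ a).1 x := by
  rw [← D.eval_dForm, Form.eval_apply]

/-- The exterior derivative is local. -/
theorem d_congr {k : ℕ} {Φ Φ' : V.sections [⋀^Fin k]→ₗ[ℝ] W.sections} {x : M}
    (h : ∀ a, ∀ᶠ y in 𝓝 x, (Φ a).1 y = (Φ' a).1 y) (a : Fin (k + 1) → V.sections) :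
    (koszul (fun a b => L.bracket a b) (fun a => D.toFun a) Φ a).1 x =
      (koszul (fun a b => L.bracket a b) (fun a => D.toFun a) Φ' a).1 x := by
  rw [koszul, koszul, Submodule.coe_add, Submodule.coe_add, Pi.add_apply, Pi.add_apply,
    sections_sum_apply, sections_sum_apply]
  congr 1
  · refine Finset.sum_congr rfl fun i _ => ?_
    exact congrArg (fun v => (-1 : ℝ) ^ i.val • v) (D.toFun_congr _ (h _))
  · cases k with
    | zero => rfl
    | succ k =>
      rw [koszulBracket, koszulBracket, sections_sum_apply, sections_sum_apply]
      refine Finset.sum_congr rfl fun i _ => ?_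
      rw [sections_sum_apply, sections_sum_apply]
      refine Finset.sum_congr rfl fun j _ => ?_
      split_ifs
      · exact congrArg (fun v => (-1 : ℝ) ^ (j.val + i.val) • v) (h _).self_of_nhds
      · rfl

theorem mem_closed_iff {k : ℕ} {μ : Form V W k} : μ ∈ D.closed k ↔ D.dForm μ = 0 := by
  constructor
  · intro h
    exact Form.ext_eval fun a => (D.eval_dForm μ a).trans (h a)
  · intro h a
    rw [← D.eval_dForm μ a, h]
    rfl

theorem mem_exact_succ_iff {k : ℕ} {μ : Form V W (k + 1)} :
    μ ∈ D.exact (k + 1) ↔ ∃ θ : Form V W k, μ = D.dForm θ := by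
  constructor
  · rintro ⟨θ, h⟩
    exact ⟨θ, Form.ext_eval fun a => (h a).trans (D.eval_dForm θ a).symm⟩
  · rintro ⟨θ, rfl⟩
    exact ⟨θ, D.eval_dForm θ⟩

end AlgebroidConnection
end ExteriorDerivative

/-! ### Functions, forms and the exterior derivative -/

section FormModule

variable {E : Type*} [NormedAddCommGroup E] [NormedSpace ℝ E] [FiniteDimensional ℝ E]
  {H : Type*} [TopologicalSpace H] {I : ModelWithCorners ℝ E H}
  {M : Type*} [TopologicalSpace M] [ChartedSpace H M] [IsManifold I ∞ M] [T2Space M]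
  {A : M → Type*} [∀ x, AddCommGroup (A x)] [∀ x, Module ℝ (A x)]
  {G : M → Type*} [∀ x, AddCommGroup (G x)] [∀ x, Module ℝ (G x)]
  {V : SmoothVectorBundle I M A} {W : SmoothVectorBundle I M G}

theorem AlternatingMap.finsetSum_apply {X Y κ ι : Type*} [AddCommGroup X] [Module ℝ X]
    [AddCommGroup Y] [Module ℝ Y] (s : Finset κ) (φ : κ → X [⋀^ι]→ₗ[ℝ] Y) (v : ι → X) :
    (∑ j ∈ s, φ j) v = ∑ j ∈ s, φ j v := by
  classical
  induction s using Finset.induction_on with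
  | empty => simp
  | insert j s hj ih =>
    rw [Finset.sum_insert hj, Finset.sum_insert hj, AlternatingMap.add_apply, ih]

/-- Linear maps out of the sections which are linear over the evaluation of functions at a point
factor through the fibre. -/
theorem eq_zero_of_smul_linear_at {Y : Type*} [AddCommGroup Y] [Module ℝ Y] {x : M}
    {l : V.sections →ₗ[ℝ] Y} (hl : ∀ (h : SmoothFun I M) s, l (h • s) = h x • l s)
    {s : V.sections} (hs : s.1 x = 0) : l s = 0 := by
  obtain ⟨n, b, h1, h2⟩ := V.frame x
  obtain ⟨u, hu⟩ := h2 s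
  obtain ⟨χ, hχ1, hχ2⟩ := exists_cutoff (I := I) hu
  have hz : ∀ i, u i x = 0 :=
    Fintype.linearIndependent_iff.1 h1.self_of_nhds.1 (fun i => u i x)
      (hu.self_of_nhds.symm.trans hs)
  have h3 : χ • s = ∑ i, χ • u i • b i := by
    ext y
    by_cases hy : y ∈ tsupport χ
    · have := hχ2 hy
      simp only [Set.mem_ofPred_eq] at this
      simp [this, Finset.smul_sum]
    · simp [image_eq_zero_of_notMem_tsupport hy]
  have h4 : l (χ • s) = l s := by rw [hl, hχ1.self_of_nhds, one_smul]
  rw [← h4, h3, map_sum]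
  refine Finset.sum_eq_zero fun i _ => ?_
  rw [hl, hl, hz i, zero_smul, smul_zero]

namespace Form

instance {k : ℕ} : SMul (SmoothFun I M) (Form V W k) :=
  ⟨fun h μ => ⟨fun x => h x • μ.1 x, fun a => W.smul_mem h _ (μ.2 a)⟩⟩

theorem eval_fun_smul {k : ℕ} (h : SmoothFun I M) (μ : Form V W k) (a : Fin k → V.sections) :
    eval (h • μ) a = h • eval μ a := rfl

theorem sum_apply {k : ℕ} {ι : Type*} (s : Finset ι) (μ : ι → Form V W k) (x : M) :
    (∑ i ∈ s, μ i).1 x = ∑ i ∈ s, (μ i).1 x := by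
  rw [AddSubmonoidClass.coe_finsetSum, Finset.sum_apply]

/-- The Lie derivative of a form along point derivations `δV`, `δW` over the same tangent vector. -/
def lieAt {k : ℕ} (μ : Form V W k) {x : M} {v : TangentSpace I x} (δV : V.PointDerivation x v)
    (δW : W.PointDerivation x v) (B : Fin k → V.sections) : G x :=
  δW.toFun (eval μ B) - ∑ q, μ.1 x (Function.update (fun i => (B i).1 x) q (δV.toFun (B q)))

/-- The Lie derivative of a form is tensorial. -/
theorem lieAt_congr {k : ℕ} (μ : Form V W k) {x : M} {v : TangentSpace I x}
    (δV : V.PointDerivation x v) (δW : W.PointDerivation x v) {B B' : Fin k → V.sections}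
    (h : ∀ i, (B i).1 x = (B' i).1 x) : Form.lieAt μ δV δW B = Form.lieAt μ δV δW B' := by
  have hval : ∀ (C : Fin k → V.sections) q (s : V.sections),
      (fun i => (Function.update C q s i).1 x) =
        Function.update (fun i => (C i).1 x) q (s.1 x) := fun C q s => by
    funext i; rcases eq_or_ne i q with rfl | hi <;> simp [*]
  have step : ∀ (C : Fin k → V.sections) q (s : V.sections), s.1 x = (C q).1 x →
      Form.lieAt μ δV δW (Function.update C q s) = Form.lieAt μ δV δW C := by
    intro C q s hs
    let c : Fin k → A x := fun i => (C i).1 x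
    let l : V.sections →ₗ[ℝ] G x :=
      δW.toFun ∘ₗ (eval μ).toMultilinearMap.toLinearMap C q -
        (μ.1 x).toMultilinearMap.toLinearMap c q ∘ₗ δV.toFun -
        ∑ p ∈ Finset.univ.erase q, (μ.1 x).toMultilinearMap.toLinearMap
          (Function.update c p (δV.toFun (C p))) q ∘ₗ V.evalAt x
    have hl : ∀ r, l r = Form.lieAt μ δV δW (Function.update C q r) := by
      intro r
      rw [lieAt, ← Finset.add_sum_erase _ _ (Finset.mem_univ q), sub_add_eq_sub_sub]
      simp only [l, LinearMap.sub_apply, LinearMap.sum_apply, LinearMap.comp_apply]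
      congr 1
      · congr 1
        rw [hval, Function.update_self, Function.update_idem]
        rfl
      · refine Finset.sum_congr rfl fun p hp => ?_
        have hpq : p ≠ q := Finset.ne_of_mem_erase hp
        rw [hval, Function.update_of_ne hpq, Function.update_comm hpq.symm]
        rfl
    have hsm : ∀ (u : SmoothFun I M) r, l (u • r) = u x • l r := by
      intro u r
      have e1 : eval μ (Function.update C q (u • r)) = u • eval μ (Function.update C q r) :=
        eval_update_smul μ u r C q
      simp only [l, LinearMap.sub_apply, LinearMap.sum_apply, LinearMap.comp_apply,
        smul_sub, Finset.smul_sum, V.evalAt_apply, SmoothVectorBundle.fun_smul_apply, map_smul]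
      have e2 : (eval μ).toMultilinearMap.toLinearMap C q (u • r) =
        u • (eval μ).toMultilinearMap.toLinearMap C q r := e1
      have e3 : ((eval μ).toMultilinearMap.toLinearMap C q r).1 x =
          (μ.1 x).toMultilinearMap.toLinearMap c q (r.1 x) := by
        change μ.1 x _ = μ.1 x _
        rw [hval]
      rw [e2, δW.leibniz, δV.leibniz, map_add, map_smul, map_smul, e3]
      abel
    -- `l` is linear over the functions, so that it only depends on the value of `r` at `x`
    have h0 := eq_zero_of_smul_linear_at hsm (s := s - C q) (by simp [hs])
    rw [map_sub, sub_eq_zero, hl, hl, Function.update_eq_self] at h0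
    exact h0
  have key : ∀ t : Finset (Fin k), Form.lieAt μ δV δW (t.piecewise B' B) =
      Form.lieAt μ δV δW B := by
    intro t
    induction t using Finset.induction_on with
    | empty => simp
    | insert i t hi ih =>
      rw [Finset.piecewise_insert, step, ih]
      simp [hi, h i]
  have := key Finset.univ
  rw [Finset.piecewise_univ] at this
  exact this.symm

end Form

namespace AlgebroidConnection

variable {L : LieAlgebroid V} (D : AlgebroidConnection L W)

/-- The exterior derivative as a linear map. -/
def dLinear (k : ℕ) : Form V W k →ₗ[ℝ] Form V W (k + 1) where
  toFun := D.dForm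
  map_add' μ ν := Form.ext_eval fun a => by
    rw [D.eval_dForm, D.d_add, ← D.eval_dForm, ← D.eval_dForm]; rfl
  map_smul' c μ := Form.ext_eval fun a => by
    rw [D.eval_dForm, D.d_smul, ← D.eval_dForm]; rfl

theorem dForm_sum {k : ℕ} {ι : Type*} (s : Finset ι) (μ : ι → Form V W k) :
    D.dForm (∑ i ∈ s, μ i) = ∑ i ∈ s, D.dForm (μ i) := map_sum (D.dLinear k) μ s

theorem dForm_add {k : ℕ} (μ ν : Form V W k) : D.dForm (μ + ν) = D.dForm μ + D.dForm ν :=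
  map_add (D.dLinear k) μ ν

theorem d_fun_smul {k : ℕ} (h : SmoothFun I M) (μ : Form V W k) (a : Fin (k + 1) → V.sections) :
    D.d (h • μ) a = h • D.d μ a + ∑ i : Fin (k + 1), (-1 : ℝ) ^ i.val •
        lieDer (L.anchorSection (a i)) h • Form.eval μ (i.removeNth a) :=
  D.koszul_fun_smul h (fun a => Form.eval_fun_smul h μ a) a

theorem dForm_congr {k : ℕ} {μ ν : Form V W k} {x : M} (h : ∀ᶠ y in 𝓝 x, μ.1 y = ν.1 y) :
    (D.dForm μ).1 x = (D.dForm ν).1 x := by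
  ext v
  choose a ha using fun i => V.exists_section x (v i)
  obtain rfl : (fun i => (a i).1 x) = v := funext ha
  rw [D.dForm_apply, D.dForm_apply]
  refine D.d_congr (fun b => ?_) a
  filter_upwards [h] with y hy
  rw [Form.eval_apply, Form.eval_apply, hy]

theorem lieForm_apply {k : ℕ} (μ : Form V W k) (c : V.sections) (b : Fin k → V.sections) (x : M) :
    (lieForm (fun a b => L.bracket a b) (fun a => D.toFun a) (Form.eval μ) c b).1 x =
      Form.lieAt μ (L.derAt c x) (D.derAt c x) b := by
  have hval : ∀ q (s : V.sections), (fun i => (Function.update b q s i).1 x) =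
        Function.update (fun i => (b i).1 x) q (s.1 x) := fun q s => by
    funext i; rcases eq_or_ne i q with rfl | hi <;> simp [*]
  rw [lieForm, Form.lieAt, Submodule.coe_sub, Pi.sub_apply, sections_sum_apply]
  congr 1
  refine Finset.sum_congr rfl fun q _ => ?_
  rw [Form.eval_apply, hval]
  rfl

theorem Form.contract_apply {k : ℕ} (c : V.sections) (μ : Form V W (k + 1)) (x : M)
    (v : Fin k → A x) : (Form.contract c μ).1 x v = μ.1 x (Fin.cons (c.1 x) v) := rfl

theorem Form.contract_sum {k : ℕ} {ι : Type*} [Fintype ι] (r : ι → ℝ) (c : ι → V.sections)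
    (μ : Form V W (k + 1)) :
    Form.contract (∑ j, r j • c j) μ = ∑ j, r j • Form.contract (c j) μ := by
  apply Subtype.ext
  funext x
  rw [Form.sum_apply]
  change (μ.1 x).curryLeft _ = ∑ j, r j • (μ.1 x).curryLeft ((c j).1 x)
  rw [sections_sum_apply, map_sum]
  exact Finset.sum_congr rfl fun j _ => map_smul _ _ _

/-- Cartan's formula at a point, for a linear combination in the first argument. -/
theorem dForm_cons_apply {k : ℕ} {ι : Type*} [Fintype ι] (r : ι → ℝ) (c : ι → V.sections)
    (μ : Form V W (k + 1)) {a : V.sections} (ha : a = ∑ j, r j • c j)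
    (b : Fin (k + 1) → V.sections) (x : M) :
    (D.dForm μ).1 x (Fin.cons (a.1 x) fun i => (b i).1 x) =
      Form.lieAt μ (L.derAt a x) (D.derAt a x) b -
        ∑ j, r j • (D.dForm (Form.contract (c j) μ)).1 x (fun i => (b i).1 x) := by
  have h1 := D.dForm_apply μ (Fin.cons a b) x
  rw [D.d_cons, Submodule.coe_sub, Pi.sub_apply, D.lieForm_apply, ← D.dForm_apply] at h1
  have h5 : (D.dForm (Form.contract a μ)).1 x (fun i => (b i).1 x) =
      ∑ j, r j • (D.dForm (Form.contract (c j) μ)).1 x (fun i => (b i).1 x) := by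
    rw [ha, Form.contract_sum, D.dForm_sum, Form.sum_apply, AlternatingMap.finsetSum_apply]
    refine Finset.sum_congr rfl fun j _ => ?_
    have := (D.dLinear _).map_smul (r j) (Form.contract (c j) μ)
    exact congrArg (fun ν : Form V W (k + 1) => ν.1 x fun i => (b i).1 x) this
  rw [h5] at h1
  rw [← h1]
  congr 1
  funext i
  cases i using Fin.cases <;> rfl

end AlgebroidConnection
end FormModule

/-! ### The pullback of forms along `f^{!!}A → A` -/

section Projection

variable {E : Type*} [NormedAddCommGroup E] [NormedSpace ℝ E] [FiniteDimensional ℝ E]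
  {H : Type*} [TopologicalSpace H] {I : ModelWithCorners ℝ E H}
  {M : Type*} [TopologicalSpace M] [ChartedSpace H M] [IsManifold I ∞ M] [T2Space M]
  {E' : Type*} [NormedAddCommGroup E'] [NormedSpace ℝ E'] [FiniteDimensional ℝ E']
  {H' : Type*} [TopologicalSpace H'] {I' : ModelWithCorners ℝ E' H'}
  {N : Type*} [TopologicalSpace N] [ChartedSpace H' N] [IsManifold I' ∞ N] [T2Space N]
  {A : N → Type*} [∀ x, AddCommGroup (A x)] [∀ x, Module ℝ (A x)]
  {G : N → Type*} [∀ x, AddCommGroup (G x)] [∀ x, Module ℝ (G x)]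
  {V : SmoothVectorBundle I' N A} {W : SmoothVectorBundle I' N G} {f : C^∞⟮I, M; I', N⟯}

/-- The pullback of a form to a form on the pullback bundle `f^!A`. -/
def Form.along {k : ℕ} (μ : Form V W k) (f : C^∞⟮I, M; I', N⟯) :
    Form (V.pullback f) (W.pullback f) k :=
  ⟨fun m => μ.1 (f m), fun s m₀ => by
    obtain ⟨n, e, -, he⟩ := V.frame (f m₀)
    choose c hc using fun i => V.pullback_frame_coeff f m₀ he (s i)
    refine ⟨∑ J : Fin k → Fin n, (∏ i, c i (J i)) ⊗ₜ[ℝ] Form.eval μ (fun i => e (J i)), ?_⟩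
    filter_upwards [eventually_all.2 hc] with m hm
    rw [map_sum]
    change (μ.1 (f m)).toMultilinearMap (fun i => (s i).1 m) = _
    rw [funext hm, MultilinearMap.map_sum]
    refine Finset.sum_congr rfl fun J _ => ?_
    rw [MultilinearMap.map_smul_univ, ev_tmul, SmoothFun.prod_apply]
    rfl⟩

theorem SmoothVectorBundle.PointDerivation.pullback_pullSection {m : M} {v : TangentSpace I m}
    {z : TangentSpace I' (f m)} (δ : V.PointDerivation (f m) z) (hv : mfderiv I I' f m v = z)
    (b : V.sections) : (δ.pullback f hv).toFun (V.pullSection f b) = δ.toFun b := by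
  rw [δ.pullback_eq f hv (t := 1 ⊗ₜ b) (.of_forall fun y => by simp [pullSection]),
    PointDerivation.evD_tmul, SmoothFun.d_const 1 (.of_forall fun _ => rfl)]
  simp

/-- A point derivation of the pullback bundle on local expressions `∑ uⱼ f^!bⱼ`. -/
theorem SmoothVectorBundle.PointDerivation.pullback_sum {m : M} {v : TangentSpace I m}
    {z : TangentSpace I' (f m)} (δ : V.PointDerivation (f m) z) (hv : mfderiv I I' f m v = z)
    {ι : Type*} [Fintype ι] {u : ι → SmoothFun I M} {b : ι → V.sections}
    {s : (V.pullback f).sections} (h : ∀ᶠ y in 𝓝 m, s.1 y = ∑ j, u j y • (b j).1 (f y)) :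
    (δ.pullback f hv).toFun s =
      ∑ j, (u j m • δ.toFun (b j) + (u j).d m v • (b j).1 (f m)) := by
  rw [δ.pullback_eq f hv (t := ∑ j, u j ⊗ₜ b j) (by simpa using h), map_sum]
  rfl

variable {L : LieAlgebroid V} (D : AlgebroidConnection L W)

/-- The Lie derivative of the pullback of a form is the pullback of the Lie derivative. -/
theorem Form.lieAt_along {k : ℕ} (μ : Form V W k) {m : M} {v : TangentSpace I m}
    {c : V.sections} (hv : mfderiv I I' f m v = L.anchor (f m) (c.1 (f m)))
    {B : Fin k → (V.pullback f).sections} {b : Fin k → V.sections}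
    (h : ∀ i, (B i).1 m = (b i).1 (f m)) :
    Form.lieAt (Form.along μ f) ((L.derAt c (f m)).pullback f hv) ((D.derAt c (f m)).pullback f hv)
        B =
      Form.lieAt μ (L.derAt c (f m)) (D.derAt c (f m)) b := by
  rw [Form.lieAt_congr (B' := fun i => V.pullSection f (b i)) _ _ _ h, Form.lieAt, Form.lieAt]
  have h1 : Form.eval (Form.along μ f) (fun i => V.pullSection f (b i)) =
      W.pullSection f (Form.eval μ b) := rfl
  rw [h1, PointDerivation.pullback_pullSection]
  simp only [PointDerivation.pullback_pullSection]
  rfl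

variable (hf : L.PullbackExists f)

namespace LieAlgebroid

/-- The second component of `[σ, τ]` for `σ = (X, ∑ uⱼ f^!cⱼ)` near `m`. -/
theorem bracket_snd {ι : Type*} [Fintype ι] {m : M} {σ τ : (pullbackBundle hf).sections}
    {u : ι → SmoothFun I M} {c : ι → V.sections}
    (h : ∀ᶠ y in 𝓝 m, (σ.1 y).1.2 = ∑ j, u j y • (c j).1 (f y)) {a : V.sections}
    (ha : a = ∑ j, u j m • c j)
    (hv : mfderiv I I' f m (σ.1 m).1.1 = L.anchor (f m) (a.1 (f m))) :
    (((LieAlgebroid.pullback hf).bracket σ τ).1 m).1.2 =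
      ((L.derAt a (f m)).pullback f hv).toFun (sndSection hf τ) -
        ∑ j, (u j).d m (τ.1 m).1.1 • (c j).1 (f m) := by
  obtain ⟨t, ht⟩ := exists_represents hf τ m
  have hs : Represents hf σ m (∑ j, u j ⊗ₜ c j) := by
    filter_upwards [h] with y hy
    rw [hy, map_sum]; rfl
  change sndBracket hf σ τ m = _
  rw [sndBracket_eq hs ht, pullbackFormula, map_sub, ev_bracket_add_der,
    PointDerivation.pullback_eq (f := f) _ hv (s := sndSection hf τ) (t := t) ht]
  congr 1
  · clear ht
    induction t with
    | zero => simp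
    | add t t' h h' => rw [map_add, map_add, h, h']
    | tmul g b =>
      rw [PointDerivation.evD_tmul, PointDerivation.evD_tmul]
      congr 2
      change V.ev f m (L.tensorBracket (∑ j, u j ⊗ₜ c j) (1 ⊗ₜ b)) = (L.bracket a b).1 (f m)
      rw [ha, map_sum, LinearMap.sum_apply, map_sum, map_sum, LinearMap.sum_apply,
        sections_sum_apply]
      refine Finset.sum_congr rfl fun j _ => ?_
      simp
  · rw [map_sum, map_sum]
    rfl

end LieAlgebroid

namespace AlgebroidConnection

/-- The pullback connection at a point as a pullback of derivations. -/
theorem pullback_toFun_apply {m : M} {σ : (LieAlgebroid.pullbackBundle hf).sections}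
    {a : V.sections} (ha : a.1 (f m) = (σ.1 m).1.2)
    (hv : mfderiv I I' f m (σ.1 m).1.1 = L.anchor (f m) (a.1 (f m)))
    (s : (W.pullback f).sections) :
    ((D.pullback hf).toFun σ s).1 m = ((D.derAt a (f m)).pullback f hv).toFun s := by
  obtain ⟨w, hw⟩ := W.pullback_exists f s m
  obtain ⟨t, ht⟩ := LieAlgebroid.exists_represents hf σ m
  change D.pullbackValue hf σ m s = _
  rw [D.pullbackValue_eq hf ht.self_of_nhds hw, PointDerivation.pullback_eq (f := f) _ hv hw]
  clear hw
  induction w with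
  | zero => simp
  | add w w' h h' =>
    simp only [map_add] at h h' ⊢
    rw [← h, ← h']
    abel
  | tmul g e =>
    rw [map_add, D.ev_tensorConnection t g e a (ha.trans ht.self_of_nhds)]
    rfl

open LieAlgebroid in
theorem _root_.LieAlgebroid.pullbackForm_apply {k : ℕ} (μ : Form V W k) (m : M)
    (v : Fin k → L.pullbackFiber f m) :
    (pullbackForm hf W k μ).1 m v = μ.1 (f m) (fun i => (v i).1.2) := rfl

open LieAlgebroid in
/-- The term `d ι_σ` of Cartan's formula for `p^*μ`, with `σ = (X, ∑ uⱼ f^!cⱼ)` near `m`: up to the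
terms with `duⱼ`, it is the pullback of the corresponding terms for the `cⱼ`. -/
theorem dForm_contract_pullbackForm {k : ℕ} (μ : Form V W (k + 1))
    (ih : ∀ ν : Form V W k,
      (D.pullback hf).dForm (pullbackForm hf W k ν) = pullbackForm hf W (k + 1) (D.dForm ν))
    {ι : Type*} [Fintype ι] {m : M} {σ : (pullbackBundle hf).sections}
    {u : ι → SmoothFun I M} {c : ι → V.sections}
    (h : ∀ᶠ y in 𝓝 m, (σ.1 y).1.2 = ∑ j, u j y • (c j).1 (f y))
    (τ : Fin (k + 1) → (pullbackBundle hf).sections) :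
    ((D.pullback hf).dForm (Form.contract σ (pullbackForm hf W (k + 1) μ))).1 m
          (fun i => (τ i).1 m) =
        ∑ j, u j m • (D.dForm (Form.contract (c j) μ)).1 (f m) (fun i => ((τ i).1 m).1.2) +
        ∑ j, ∑ i : Fin (k + 1), (-1 : ℝ) ^ i.val • (u j).d m ((τ i).1 m).1.1 •
          μ.1 (f m) (Fin.cons ((c j).1 (f m)) (i.removeNth fun i => ((τ i).1 m).1.2)) := by
  have hc : ∀ᶠ y in 𝓝 m, (Form.contract σ (pullbackForm hf W (k + 1) μ)).1 y =
      (∑ j, u j • pullbackForm hf W k (Form.contract (c j) μ)).1 y := by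
    filter_upwards [h] with y hy
    ext v
    rw [Form.sum_apply, AlternatingMap.finsetSum_apply, Form.contract_apply, pullbackForm_apply]
    have e : (fun i => ((Fin.cons (σ.1 y) v : Fin (k + 1) → L.pullbackFiber f y) i).1.2) =
        Fin.cons (σ.1 y).1.2 (fun i => (v i).1.2) := by
      funext i; cases i using Fin.cases <;> rfl
    rw [e]
    change (μ.1 (f y)).curryLeft ((σ.1 y).1.2) _ = _
    rw [hy, map_sum, AlternatingMap.finsetSum_apply]
    refine Finset.sum_congr rfl fun j _ => ?_
    rw [map_smul]
    rfl
  rw [dForm_congr _ hc, dForm_sum, Form.sum_apply, AlternatingMap.finsetSum_apply,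
    ← Finset.sum_add_distrib]
  refine Finset.sum_congr rfl fun j _ => ?_
  rw [dForm_apply, d_fun_smul, Submodule.coe_add, Pi.add_apply, ← eval_dForm, ih,
    sections_sum_apply]
  congr 1

open LieAlgebroid in
/-- The term `L_σ` of Cartan's formula for `p^*μ`, with `σ = (X, ∑ uⱼ f^!cⱼ)` near `m`. The terms
with `duⱼ` are those of `dForm_contract_pullbackForm`, so they cancel in `L_σ - d ι_σ`. -/
theorem lieForm_pullbackForm {k : ℕ} (μ : Form V W (k + 1)) {ι : Type*} [Fintype ι] {m : M}
    {σ : (pullbackBundle hf).sections}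
    {u : ι → SmoothFun I M} {c : ι → V.sections}
    (h : ∀ᶠ y in 𝓝 m, (σ.1 y).1.2 = ∑ j, u j y • (c j).1 (f y)) {a : V.sections}
    (ha : a = ∑ j, u j m • c j) (ha' : a.1 (f m) = (σ.1 m).1.2)
    (hv : mfderiv I I' f m (σ.1 m).1.1 = L.anchor (f m) (a.1 (f m)))
    (τ : Fin (k + 1) → (pullbackBundle hf).sections) (b : Fin (k + 1) → V.sections)
    (hb : ∀ i, (b i).1 (f m) = ((τ i).1 m).1.2) :
    (lieForm (fun a b => (LieAlgebroid.pullback hf).bracket a b)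
          (fun a => (D.pullback hf).toFun a) (Form.eval (pullbackForm hf W (k + 1) μ)) σ τ).1 m =
        Form.lieAt μ (L.derAt a (f m)) (D.derAt a (f m)) b +
        ∑ j, ∑ i : Fin (k + 1), (-1 : ℝ) ^ i.val • (u j).d m ((τ i).1 m).1.1 •
          μ.1 (f m) (Fin.cons ((c j).1 (f m)) (i.removeNth fun i => ((τ i).1 m).1.2)) := by
  rw [← Form.lieAt_along D μ hv (B := fun i => sndSection hf (τ i)) (fun i => (hb i).symm),
    lieForm, Form.lieAt, Submodule.coe_sub, Pi.sub_apply, sections_sum_apply,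
    D.pullback_toFun_apply hf ha' hv]
  have e1 : Form.eval (pullbackForm hf W (k + 1) μ) τ =
      Form.eval (Form.along μ f) fun i => sndSection hf (τ i) := rfl
  have e2 : ∀ q, (Form.eval (pullbackForm hf W (k + 1) μ)
      (Function.update τ q ((LieAlgebroid.pullback hf).bracket σ (τ q)))).1 m =
      (Form.along μ f).1 m (Function.update (fun i => (sndSection hf (τ i)).1 m) q
        (((L.derAt a (f m)).pullback f hv).toFun (sndSection hf (τ q)))) -
      ∑ j, (-1 : ℝ) ^ q.val • (u j).d m ((τ q).1 m).1.1 •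
      μ.1 (f m) (Fin.cons ((c j).1 (f m)) (q.removeNth fun i => ((τ i).1 m).1.2)) := by
    intro q
    have e3 : (fun i => ((Function.update τ q
        ((LieAlgebroid.pullback hf).bracket σ (τ q)) i).1 m).1.2) =
        Function.update (fun i => (sndSection hf (τ i)).1 m) q
          (((LieAlgebroid.pullback hf).bracket σ (τ q)).1 m).1.2 := by
      funext i
      rcases eq_or_ne i q with rfl | hi
      · simp only [Function.update_self]
      · simp only [Function.update_of_ne hi]; rfl
    rw [Form.eval_apply, pullbackForm_apply, e3, bracket_snd hf h ha hv,
      AlternatingMap.map_update_sub, AlternatingMap.map_update_sum]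
    congr 1
    refine Finset.sum_congr rfl fun j _ => ?_
    rw [AlternatingMap.map_update_smul, smul_comm]
    congr 1
    have e4 : Function.update (fun i => (sndSection hf (τ i)).1 m) q ((c j).1 (f m)) =
        q.insertNth ((c j).1 (f m)) (q.removeNth fun i => (sndSection hf (τ i)).1 m) := by
      simp
    rw [e4, AlternatingMap.map_insertNth, ← Int.cast_smul_eq_zsmul ℝ]
    push_cast
    rfl
  simp only [e1, e2, Finset.sum_sub_distrib]
  rw [Finset.sum_comm (s := Finset.univ (α := ι))]
  abel

open LieAlgebroid in
/-- The pullback of forms along `f^{!!}A → A` commutes with the exterior derivatives. -/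
theorem dForm_pullbackForm {k : ℕ} (μ : Form V W k) :
    (D.pullback hf).dForm (pullbackForm hf W k μ) = pullbackForm hf W (k + 1) (D.dForm μ) := by
  induction k with
  | zero =>
    refine Form.ext_eval fun σ => Subtype.ext (funext fun m => ?_)
    obtain ⟨a, ha⟩ := V.exists_section (f m) ((σ 0).1 m).1.2
    have hv : mfderiv I I' f m ((σ 0).1 m).1.1 = L.anchor (f m) (a.1 (f m)) := by
      rw [ha]; exact ((σ 0).1 m).2
    rw [eval_dForm, d_degree_zero _ _ _ Fin.elim0, D.pullback_toFun_apply hf ha hv]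
    have h1 : Form.eval (pullbackForm hf W 0 μ) Fin.elim0 =
        W.pullSection f (Form.eval μ Fin.elim0) := by
      ext y
      change μ.1 (f y) _ = μ.1 (f y) _
      congr 1
      exact Subsingleton.elim _ _
    rw [h1, PointDerivation.pullback_pullSection]
    have h2 := D.dForm_apply μ (fun _ => a) (f m)
    rw [D.d_degree_zero _ _ Fin.elim0] at h2
    change (D.toFun a _).1 (f m) = (D.dForm μ).1 (f m) (fun i => ((σ i).1 m).1.2)
    rw [← h2]
    congr 1
    funext i
    rw [Subsingleton.elim (α := Fin 1) i 0]
    exact ha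
  | succ k ih =>
    refine Form.ext_eval fun σ => Subtype.ext (funext fun m => ?_)
    obtain ⟨σ₀, τ, rfl⟩ : ∃ σ₀ τ, σ = Fin.cons σ₀ τ :=
      ⟨σ 0, Fin.tail σ, (Fin.cons_self_tail σ).symm⟩
    obtain ⟨n, c, -, hc⟩ := V.frame (f m)
    obtain ⟨u, hu⟩ := V.pullback_frame_coeff f m hc (sndSection hf σ₀)
    have hu' : ∀ᶠ y in 𝓝 m, (σ₀.1 y).1.2 = ∑ j, u j y • (c j).1 (f y) := hu
    obtain ⟨a, ha⟩ : ∃ a : V.sections, a = ∑ j, u j m • c j := ⟨_, rfl⟩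
    have ha' : a.1 (f m) = (σ₀.1 m).1.2 := by
      rw [hu'.self_of_nhds, ha, sections_sum_apply]; rfl
    have hv : mfderiv I I' f m (σ₀.1 m).1.1 = L.anchor (f m) (a.1 (f m)) := by
      rw [ha']; exact (σ₀.1 m).2
    choose b hb using fun i => V.exists_section (f m) ((τ i).1 m).1.2
    have hcons : (fun i => (((Fin.cons σ₀ τ : Fin (k + 2) → (pullbackBundle hf).sections) i).1
        m).1.2) = Fin.cons (a.1 (f m)) (fun i => (b i).1 (f m)) := by
      funext i
      cases i using Fin.cases with
      | zero => exact ha'.symm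
      | succ i => exact (hb i).symm
    rw [Form.eval_apply (pullbackForm hf W (k + 2) (D.dForm μ)), pullbackForm_apply, hcons,
      D.dForm_cons_apply _ c μ ha b, eval_dForm, d_cons, Submodule.coe_sub, Pi.sub_apply,
      ← dForm_apply, D.lieForm_pullbackForm hf μ hu' ha ha' hv τ b hb,
      D.dForm_contract_pullbackForm hf μ ih hu' τ, funext hb]
    abel

/-- Flatness on representatives `∑ hᵢ ⊗ bᵢ`, without derivatives of the coefficients. -/
theorem tensorConnection_flat (hD : D.IsFlat) (s t : SmoothFun I M ⊗[ℝ] V.sections)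
    (w : SmoothFun I M ⊗[ℝ] W.sections) :
    D.tensorConnection s (D.tensorConnection t w) =
      D.tensorConnection t (D.tensorConnection s w) +
        D.tensorConnection (L.tensorBracket s t) w := by
  induction s with
  | zero => simp
  | add s s' h h' => simp only [map_add, LinearMap.add_apply, h, h']; abel
  | tmul h b =>
    induction t with
    | zero => simp
    | add s s' h h' => simp only [map_add, LinearMap.add_apply, h, h']; abel
    | tmul g c =>
      induction w with
      | zero => simp
      | add s s' h h' => simp only [map_add, h, h']; abel
      | tmul k d =>
        simp only [tensorConnection_tmul, LieAlgebroid.tensorBracket_tmul]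
        have h1 : D.toFun b (D.toFun c d) =
            D.toFun c (D.toFun b d) + D.toFun (L.bracket b c) d := by
          rw [← sub_eq_zero, ← sub_sub]; exact hD b c d
        rw [h1, TensorProduct.tmul_add, mul_assoc, mul_left_comm g h k]

/-- Differentiating the coefficients is compatible with the connection on representatives. -/
theorem tensorDer_connection (X : (tangent I M).sections) (t : SmoothFun I M ⊗[ℝ] V.sections)
    (w : SmoothFun I M ⊗[ℝ] W.sections) :
    LieAlgebroid.tensorDer W X (D.tensorConnection t w) =
      D.tensorConnection (LieAlgebroid.tensorDer V X t) w +
        D.tensorConnection t (LieAlgebroid.tensorDer W X w) := by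
  induction t with
  | zero => simp
  | add s s' h h' => simp only [map_add, LinearMap.add_apply, h, h']; abel
  | tmul h b =>
    induction w with
    | zero => simp
    | add s s' h h' => simp only [map_add, h, h']; abel
    | tmul g c =>
      simp only [tensorConnection_tmul, LieAlgebroid.tensorDer_tmul, lieDer_mul,
        TensorProduct.add_tmul]
      rw [add_comm, mul_comm g]

/-- The pullback of a flat connection is flat. -/
theorem isFlat_pullback (hD : D.IsFlat) : (D.pullback hf).IsFlat := by
  intro σ τ e
  apply Subtype.ext
  funext m
  obtain ⟨s, hs⟩ := LieAlgebroid.exists_represents hf σ m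
  obtain ⟨t, ht⟩ := LieAlgebroid.exists_represents hf τ m
  obtain ⟨w, hw⟩ := W.pullback_exists f e m
  have key : ∀ {ρ : (LieAlgebroid.pullbackBundle hf).sections} {r : SmoothFun I M ⊗[ℝ] V.sections}
      {x : (W.pullback f).sections} {y : SmoothFun I M ⊗[ℝ] W.sections},
      LieAlgebroid.Represents hf ρ m r → (∀ᶠ z in 𝓝 m, x.1 z = W.ev f z y) →
      ∀ᶠ z in 𝓝 m, ((D.pullback hf).toFun ρ x).1 z = W.ev f z (D.tensorConnection r y +
        LieAlgebroid.tensorDer W (LieAlgebroid.fstSection hf ρ) y) := fun hr hy => by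
    filter_upwards [hr, eventually_eventually_nhds.2 hy] with z h1 h2
    exact D.pullbackValue_eq hf h1 h2
  have h1 := (key hs (key ht hw)).self_of_nhds
  have h2 := (key ht (key hs hw)).self_of_nhds
  have h3 := (key (ρ := (LieAlgebroid.pullback hf).bracket σ τ)
    (LieAlgebroid.sndBracket_eventually hs ht) hw).self_of_nhds
  have h4 : LieAlgebroid.fstSection hf ((LieAlgebroid.pullback hf).bracket σ τ) =
    (tangentAlgebroid I M).bracket (LieAlgebroid.fstSection hf σ)
      (LieAlgebroid.fstSection hf τ) := rfl
  rw [h4] at h3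
  change ((D.pullback hf).toFun σ ((D.pullback hf).toFun τ e)).1 m -
    ((D.pullback hf).toFun τ ((D.pullback hf).toFun σ e)).1 m -
    ((D.pullback hf).toFun ((LieAlgebroid.pullback hf).bracket σ τ) e).1 m = 0
  rw [h1, h2, h3, ← map_sub, ← map_sub]
  convert map_zero (W.ev f m)
  simp only [map_add, map_sub, LinearMap.add_apply, LinearMap.sub_apply, tensorDer_connection,
    LieAlgebroid.pullbackFormula, LieAlgebroid.tensorDer_lie, D.tensorConnection_flat hD s t w]
  abel

end AlgebroidConnection
end Projection

/-! ### Quasi-isomorphisms of form complexes -/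

section QuasiIso

variable {E₁ : Type*} [NormedAddCommGroup E₁] [NormedSpace ℝ E₁] [FiniteDimensional ℝ E₁]
  {H₁ : Type*} [TopologicalSpace H₁] {I₁ : ModelWithCorners ℝ E₁ H₁}
  {M₁ : Type*} [TopologicalSpace M₁] [ChartedSpace H₁ M₁] [IsManifold I₁ ∞ M₁] [T2Space M₁]
  {A₁ : M₁ → Type*} [∀ x, AddCommGroup (A₁ x)] [∀ x, Module ℝ (A₁ x)]
  {G₁ : M₁ → Type*} [∀ x, AddCommGroup (G₁ x)] [∀ x, Module ℝ (G₁ x)]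
  {V₁ : SmoothVectorBundle I₁ M₁ A₁} {W₁ : SmoothVectorBundle I₁ M₁ G₁}
  {L₁ : LieAlgebroid V₁} {D₁ : AlgebroidConnection L₁ W₁}
  {E₂ : Type*} [NormedAddCommGroup E₂] [NormedSpace ℝ E₂] [FiniteDimensional ℝ E₂]
  {H₂ : Type*} [TopologicalSpace H₂] {I₂ : ModelWithCorners ℝ E₂ H₂}
  {M₂ : Type*} [TopologicalSpace M₂] [ChartedSpace H₂ M₂] [IsManifold I₂ ∞ M₂] [T2Space M₂]
  {A₂ : M₂ → Type*} [∀ x, AddCommGroup (A₂ x)] [∀ x, Module ℝ (A₂ x)]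
  {G₂ : M₂ → Type*} [∀ x, AddCommGroup (G₂ x)] [∀ x, Module ℝ (G₂ x)]
  {V₂ : SmoothVectorBundle I₂ M₂ A₂} {W₂ : SmoothVectorBundle I₂ M₂ G₂}
  {L₂ : LieAlgebroid V₂} {D₂ : AlgebroidConnection L₂ W₂}
  {E₃ : Type*} [NormedAddCommGroup E₃] [NormedSpace ℝ E₃] [FiniteDimensional ℝ E₃]
  {H₃ : Type*} [TopologicalSpace H₃] {I₃ : ModelWithCorners ℝ E₃ H₃}
  {M₃ : Type*} [TopologicalSpace M₃] [ChartedSpace H₃ M₃] [IsManifold I₃ ∞ M₃] [T2Space M₃]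
  {A₃ : M₃ → Type*} [∀ x, AddCommGroup (A₃ x)] [∀ x, Module ℝ (A₃ x)]
  {G₃ : M₃ → Type*} [∀ x, AddCommGroup (G₃ x)] [∀ x, Module ℝ (G₃ x)]
  {V₃ : SmoothVectorBundle I₃ M₃ A₃} {W₃ : SmoothVectorBundle I₃ M₃ G₃}
  {L₃ : LieAlgebroid V₃} {D₃ : AlgebroidConnection L₃ W₃}

/-- A morphism of the complexes of forms with values in two representations. -/
def IsChainMap (D₁ : AlgebroidConnection L₁ W₁) (D₂ : AlgebroidConnection L₂ W₂)
    (P : ∀ k, Form V₁ W₁ k →ₗ[ℝ] Form V₂ W₂ k) : Prop :=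
  ∀ k (μ : Form V₁ W₁ k), D₂.dForm (P k μ) = P (k + 1) (D₁.dForm μ)

/-- A morphism of the complexes of forms which is bijective in cohomology. -/
structure IsQuasiIso (D₁ : AlgebroidConnection L₁ W₁) (D₂ : AlgebroidConnection L₂ W₂)
    (P : ∀ k, Form V₁ W₁ k →ₗ[ℝ] Form V₂ W₂ k) : Prop where
  chain : IsChainMap D₁ D₂ P
  injective : ∀ k, ∀ μ ∈ D₁.closed k, P k μ ∈ D₂.exact k → μ ∈ D₁.exact k
  surjective : ∀ k, ∀ ν ∈ D₂.closed k, ∃ μ ∈ D₁.closed k, ν - P k μ ∈ D₂.exact k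

variable {P : ∀ k, Form V₁ W₁ k →ₗ[ℝ] Form V₂ W₂ k} {Q : ∀ k, Form V₂ W₂ k →ₗ[ℝ] Form V₃ W₃ k}

theorem IsChainMap.closed (h : IsChainMap D₁ D₂ P) {k : ℕ} {μ : Form V₁ W₁ k}
    (hμ : μ ∈ D₁.closed k) : P k μ ∈ D₂.closed k := by
  rw [D₂.mem_closed_iff, h, D₁.mem_closed_iff.1 hμ, map_zero]

theorem IsChainMap.exact (h : IsChainMap D₁ D₂ P) {k : ℕ} {μ : Form V₁ W₁ k}
    (hμ : μ ∈ D₁.exact k) : P k μ ∈ D₂.exact k := by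
  cases k with
  | zero =>
    have h0 : μ = 0 := hμ
    rw [h0, map_zero]
    exact Submodule.zero_mem _
  | succ k =>
    obtain ⟨θ, rfl⟩ := D₁.mem_exact_succ_iff.1 hμ
    exact D₂.mem_exact_succ_iff.2 ⟨P k θ, (h k θ).symm⟩

theorem IsChainMap.comp (hQ : IsChainMap D₂ D₃ Q) (hP : IsChainMap D₁ D₂ P) :
    IsChainMap D₁ D₃ fun k => Q k ∘ₗ P k := fun k μ => by
  rw [LinearMap.comp_apply, hQ, hP]; rfl

theorem IsQuasiIso.comp (hQ : IsQuasiIso D₂ D₃ Q) (hP : IsQuasiIso D₁ D₂ P) :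
    IsQuasiIso D₁ D₃ fun k => Q k ∘ₗ P k where
  chain := hQ.chain.comp hP.chain
  injective k μ hμ h := hP.injective k μ hμ (hQ.injective k _ (hP.chain.closed hμ) h)
  surjective k ν hν := by
    obtain ⟨μ, hμ, h1⟩ := hQ.surjective k ν hν
    obtain ⟨θ, hθ, h2⟩ := hP.surjective k μ hμ
    refine ⟨θ, hθ, ?_⟩
    have h3 := Submodule.add_mem _ h1 (hQ.chain.exact h2)
    rwa [map_sub, sub_add_sub_cancel] at h3

/-- If `Q ∘ P` is a quasi-isomorphism and `Q` is injective in cohomology, then `P` is a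
quasi-isomorphism. -/
theorem IsQuasiIso.of_comp_of_injective (hP : IsChainMap D₁ D₂ P) (hQ : IsChainMap D₂ D₃ Q)
    (hQ' : ∀ k, ∀ μ ∈ D₂.closed k, Q k μ ∈ D₃.exact k → μ ∈ D₂.exact k)
    (hQP : IsQuasiIso D₁ D₃ fun k => Q k ∘ₗ P k) : IsQuasiIso D₁ D₂ P where
  chain := hP
  injective k μ hμ h := hQP.injective k μ hμ (hQ.exact h)
  surjective k ν hν := by
    obtain ⟨μ, hμ, h1⟩ := hQP.surjective k _ (hQ.closed hν)
    refine ⟨μ, hμ, hQ' k _ (Submodule.sub_mem _ hν (hP.closed hμ)) ?_⟩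
    rwa [map_sub]

theorem IsQuasiIso.of_comp (hQ : IsQuasiIso D₂ D₃ Q)
    (hQP : IsQuasiIso D₁ D₃ fun k => Q k ∘ₗ P k) (hP : IsChainMap D₁ D₂ P) :
    IsQuasiIso D₁ D₂ P := .of_comp_of_injective hP hQ.chain hQ.injective hQP

theorem IsQuasiIso.of_bijective (hP : IsChainMap D₁ D₂ P)
    (h : ∀ k, Function.Bijective (P k)) : IsQuasiIso D₁ D₂ P where
  chain := hP
  injective k μ hμ hx := by
    cases k with
    | zero => exact (h 0).1 ((show P 0 μ = 0 from hx).trans (map_zero _).symm)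
    | succ k =>
      obtain ⟨θ, hθ⟩ := D₂.mem_exact_succ_iff.1 hx
      obtain ⟨θ', rfl⟩ := (h k).2 θ
      exact D₁.mem_exact_succ_iff.2 ⟨θ', (h _).1 (hθ.trans (hP k θ'))⟩
  surjective k ν hν := by
    obtain ⟨μ, rfl⟩ := (h k).2 ν
    refine ⟨μ, D₁.mem_closed_iff.2 ((h _).1 ?_), by rw [sub_self]; exact Submodule.zero_mem _⟩
    rw [← hP, D₂.mem_closed_iff.1 hν, map_zero]

/-- A chain map is a quasi-isomorphism if it is bijective on a subcomplex and if every closed form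
differs from an element of the subcomplex by a coboundary `dξ`, with `ξ` in the kernel. -/
theorem IsQuasiIso.of_subcomplex (hP : IsChainMap D₁ D₂ P) {S : ∀ k, Form V₁ W₁ k → Prop}
    (hsub : ∀ k (μ ν : Form V₁ W₁ k), S k μ → S k ν → S k (μ - ν))
    (hd : ∀ k (μ : Form V₁ W₁ k), S k μ → S (k + 1) (D₁.dForm μ))
    (hinj : ∀ k (μ : Form V₁ W₁ k), S k μ → P k μ = 0 → μ = 0)
    (hsurj : ∀ k (ν : Form V₂ W₂ k), ∃ μ, S k μ ∧ P k μ = ν)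
    (h0 : ∀ μ ∈ D₁.closed 0, S 0 μ)
    (h1 : ∀ k, ∀ μ ∈ D₁.closed (k + 1), ∃ ξ, P k ξ = 0 ∧ S (k + 1) (μ - D₁.dForm ξ)) :
    IsQuasiIso D₁ D₂ P where
  chain := hP
  injective k μ hμ h := by
    cases k with
    | zero => exact hinj 0 μ (h0 μ hμ) h
    | succ k =>
      obtain ⟨θ, hθ⟩ := D₂.mem_exact_succ_iff.1 h
      obtain ⟨ξ, hξ, hb⟩ := h1 k μ hμ
      obtain ⟨τ, hτ, rfl⟩ := hsurj k θ
      have h4 : μ - D₁.dForm ξ - D₁.dForm τ = 0 := by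
        refine hinj _ _ (hsub _ _ _ hb (hd _ _ hτ)) ?_
        rw [map_sub, map_sub, hθ, ← hP, ← hP, hξ,
          show D₂.dForm (0 : Form V₂ W₂ k) = 0 from map_zero (D₂.dLinear k), sub_zero, sub_self]
      refine D₁.mem_exact_succ_iff.2 ⟨ξ + τ, ?_⟩
      rw [D₁.dForm_add, ← sub_eq_zero, ← sub_sub, h4]
  surjective k ν hν := by
    obtain ⟨μ, hμ, rfl⟩ := hsurj k ν
    refine ⟨μ, D₁.mem_closed_iff.2 (hinj _ _ (hd _ _ hμ) ?_), ?_⟩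
    · rw [← hP, D₂.mem_closed_iff.1 hν]
    · rw [sub_self]
      exact Submodule.zero_mem _

/-- A quasi-isomorphism induces isomorphisms in cohomology. -/
theorem IsQuasiIso.exists_equiv (h : IsQuasiIso D₁ D₂ P) :
    ∃ Φ : ∀ k, D₁.Cohomology k ≃ₗ[ℝ] D₂.Cohomology k,
      ∀ k (μ : D₁.closed k), ∃ hμ : P k μ.1 ∈ D₂.closed k,
        Φ k (D₁.toCohomology k μ) = D₂.toCohomology k ⟨_, hμ⟩ := by
  let Pc : ∀ k, D₁.closed k →ₗ[ℝ] D₂.closed k := fun k =>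
    (P k).restrict fun μ hμ => h.chain.closed hμ
  have hle : ∀ k, (D₁.exact k).comap (D₁.closed k).subtype ≤
      ((D₂.exact k).comap (D₂.closed k).subtype).comap (Pc k) := fun k μ hμ => h.chain.exact hμ
  let Φ : ∀ k, D₁.Cohomology k →ₗ[ℝ] D₂.Cohomology k := fun k => Submodule.mapQ _ _ (Pc k) (hle k)
  have hΦ : ∀ k μ, Φ k (D₁.toCohomology k μ) = D₂.toCohomology k (Pc k μ) := fun k μ => rfl
  refine ⟨fun k => LinearEquiv.ofBijective (Φ k) ⟨?_, ?_⟩, fun k μ => ⟨h.chain.closed μ.2, rfl⟩⟩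
  · rw [injective_iff_map_eq_zero]
    intro x hx
    obtain ⟨μ, rfl⟩ := Submodule.Quotient.mk_surjective _ x
    have h1 : Pc k μ ∈ (D₂.exact k).comap (D₂.closed k).subtype :=
      (Submodule.Quotient.mk_eq_zero _).1 hx
    exact (Submodule.Quotient.mk_eq_zero _).2 (h.injective k μ.1 μ.2 h1)
  · intro y
    obtain ⟨ν, rfl⟩ := Submodule.Quotient.mk_surjective _ y
    obtain ⟨μ, hμ, h1⟩ := h.surjective k ν.1 ν.2
    refine ⟨D₁.toCohomology k ⟨μ, hμ⟩, ?_⟩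
    refine Eq.symm ((Submodule.Quotient.eq _).2 ?_)
    exact h1

end QuasiIso

/-! ### Isomorphisms of representations over the identity -/

section Isomorphism

variable {E : Type*} [NormedAddCommGroup E] [NormedSpace ℝ E] [FiniteDimensional ℝ E]
  {H : Type*} [TopologicalSpace H] {I : ModelWithCorners ℝ E H}
  {M : Type*} [TopologicalSpace M] [ChartedSpace H M] [IsManifold I ∞ M] [T2Space M]
  {A : M → Type*} [∀ x, AddCommGroup (A x)] [∀ x, Module ℝ (A x)]
  {A' : M → Type*} [∀ x, AddCommGroup (A' x)] [∀ x, Module ℝ (A' x)]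
  {G : M → Type*} [∀ x, AddCommGroup (G x)] [∀ x, Module ℝ (G x)]
  {V : SmoothVectorBundle I M A} {V' : SmoothVectorBundle I M A'}
  {W W' : SmoothVectorBundle I M G}

theorem SmoothVectorBundle.ext_sections (h : W.sections = W'.sections) : W = W' := by
  cases W; cases W'; cases h; rfl

/-- A fibrewise isomorphism that maps smooth sections to smooth sections has a smooth inverse. -/
theorem SmoothVectorBundle.symm_mem {R : ∀ x, A' x ≃ₗ[ℝ] A x}
    (hR : ∀ a : V'.sections, (fun x => R x (a.1 x)) ∈ V.sections) (b : V.sections) :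
    (fun x => (R x).symm (b.1 x)) ∈ V'.sections := by
  apply V'.mem_of_locally
  intro x₀
  obtain ⟨n, e, he, -⟩ := V'.frame x₀
  have h1 := he.self_of_nhds
  obtain ⟨h, hh⟩ := (V.frame_of_basis (fun i => ⟨_, hR (e i)⟩) x₀
    (h1.1.map' (R x₀).toLinearMap (R x₀).ker) (by
      have h2 : (fun i => R x₀ ((e i).1 x₀)) = (R x₀) ∘ fun i => (e i).1 x₀ := rfl
      change ⊤ ≤ Submodule.span ℝ (Set.range fun i => R x₀ ((e i).1 x₀))
      rw [h2, Set.range_comp, ← LinearEquiv.coe_coe, Submodule.span_image,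
        top_le_iff.1 h1.2, Submodule.map_top, LinearEquiv.range])).2 b
  refine ⟨(∑ i, h i • e i : V'.sections).1, Subtype.property _, ?_⟩
  filter_upwards [hh] with y hy
  rw [hy, map_sum, sections_sum_apply]
  refine Finset.sum_congr rfl fun i _ => ?_
  rw [map_smul]
  exact congrArg _ ((R y).symm_apply_apply _)

/-- The pullback of forms along a morphism of vector bundles over the identity. -/
def Form.compMap {R : ∀ x, A' x →ₗ[ℝ] A x}
    (hR : ∀ a : V'.sections, (fun x => R x (a.1 x)) ∈ V.sections) (hW : W' = W) (k : ℕ) :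
    Form V W k →ₗ[ℝ] Form V' W' k where
  toFun μ := ⟨fun x => (μ.1 x).compLinearMap (R x), fun a => by
    rw [hW]
    exact μ.2 fun i => ⟨_, hR (a i)⟩⟩
  map_add' μ ν := rfl
  map_smul' c μ := rfl

/-- The Koszul formula is natural for maps that preserve brackets and derivations. -/
theorem koszul_comp {X Y X' : Type*} [AddCommGroup X] [Module ℝ X] [AddCommGroup Y] [Module ℝ Y]
    [AddCommGroup X'] [Module ℝ X'] {br : X → X → X} {D : X → Y →ₗ[ℝ] Y} {br' : X' → X' → X'}
    {D' : X' → Y →ₗ[ℝ] Y} (r : X' →ₗ[ℝ] X) (hb : ∀ x y, r (br' x y) = br (r x) (r y))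
    (hD : ∀ x, D' x = D (r x)) {k : ℕ} (μ : X [⋀^Fin k]→ₗ[ℝ] Y) (a : Fin (k + 1) → X') :
    koszul br' D' (μ.compLinearMap r) a = koszul br D μ (fun i => r (a i)) := by
  rw [koszul, koszul]
  congr 1
  · refine Finset.sum_congr rfl fun i _ => ?_
    rw [hD]; rfl
  · cases k with
    | zero => rfl
    | succ k =>
      rw [koszulBracket, koszulBracket]
      refine Finset.sum_congr rfl fun j _ => Finset.sum_congr rfl fun i _ => ?_
      split_ifs
      · congr 1
        change μ _ = μ _
        congr 1
        funext q
        cases q using Fin.cases with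
        | zero => exact hb _ _
        | succ q => rfl
      · rfl

/-- A fibrewise isomorphism of Lie algebroids which matches the connections induces a
quasi-isomorphism. The bundles `W` and `W'` are related by an equality, because the fibres of an
iterated pullback are definitionally those of the pullback along the composition. -/
theorem isQuasiIso_compMap {L : LieAlgebroid V} {L' : LieAlgebroid V'}
    {D : AlgebroidConnection L W} {D' : AlgebroidConnection L' W'} {R : ∀ x, A' x ≃ₗ[ℝ] A x}
    (hR : ∀ a : V'.sections, (fun x => R x (a.1 x)) ∈ V.sections) (hW : W' = W)
    (hb : ∀ (a b : V'.sections) x, R x ((L'.bracket a b).1 x) =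
      (L.bracket ⟨_, hR a⟩ ⟨_, hR b⟩).1 x)
    (hD : ∀ (a : V'.sections) (s' : W'.sections) (s : W.sections), s'.1 = s.1 →
      ∀ x, (D'.toFun a s').1 x = (D.toFun ⟨_, hR a⟩ s).1 x) :
    IsQuasiIso D D' (Form.compMap (R := fun x => (R x).toLinearMap) hR hW) := by
  subst hW
  refine IsQuasiIso.of_bijective (fun k μ => ?_) fun k => ⟨fun μ ν h => ?_, fun ν => ?_⟩
  · let r : V'.sections →ₗ[ℝ] V.sections :=
      { toFun := fun a => ⟨_, hR a⟩
        map_add' := fun a b => by ext x; exact map_add (R x) _ _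
        map_smul' := fun c a => by ext x; exact map_smul (R x) c _ }
    refine Form.ext_eval fun a => ?_
    have h1 : Form.eval (Form.compMap (R := fun x => (R x).toLinearMap) hR rfl (k + 1)
        (D.dForm μ)) a = Form.eval (D.dForm μ) fun i => r (a i) := rfl
    have h2 : Form.eval (Form.compMap (R := fun x => (R x).toLinearMap) hR rfl k μ) =
        (Form.eval μ).compLinearMap r := rfl
    rw [h1, D'.eval_dForm, D.eval_dForm, AlgebroidConnection.d, AlgebroidConnection.d, h2]
    refine koszul_comp r (fun x y => ?_) (fun x => ?_) _ _
    · ext z; exact hb x y z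
    · ext s z; exact hD x s s rfl z
  · apply Subtype.ext
    funext x
    ext v
    have h1 : μ.1 x (fun i => R x ((R x).symm (v i))) = ν.1 x (fun i => R x ((R x).symm (v i))) :=
      congrArg (fun θ : Form V' W' k => θ.1 x fun i => (R x).symm (v i)) h
    simpa using h1
  · refine ⟨⟨fun x => (ν.1 x).compLinearMap (R x).symm.toLinearMap, fun a =>
      ν.2 fun i => ⟨_, symm_mem hR (a i)⟩⟩, ?_⟩
    apply Subtype.ext
    funext x
    ext v
    change ν.1 x (fun i => (R x).symm (R x (v i))) = ν.1 x v
    simp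

end Isomorphism

/-! ### Iterated pullbacks -/

section Iterated

variable {E₁ : Type*} [NormedAddCommGroup E₁] [NormedSpace ℝ E₁] [FiniteDimensional ℝ E₁]
  {H₁ : Type*} [TopologicalSpace H₁] {I₁ : ModelWithCorners ℝ E₁ H₁}
  {P : Type*} [TopologicalSpace P] [ChartedSpace H₁ P] [IsManifold I₁ ∞ P] [T2Space P]
  {E : Type*} [NormedAddCommGroup E] [NormedSpace ℝ E] [FiniteDimensional ℝ E]
  {H : Type*} [TopologicalSpace H] {I : ModelWithCorners ℝ E H}
  {M : Type*} [TopologicalSpace M] [ChartedSpace H M] [IsManifold I ∞ M] [T2Space M]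
  {E' : Type*} [NormedAddCommGroup E'] [NormedSpace ℝ E'] [FiniteDimensional ℝ E']
  {H' : Type*} [TopologicalSpace H'] {I' : ModelWithCorners ℝ E' H'}
  {N : Type*} [TopologicalSpace N] [ChartedSpace H' N] [IsManifold I' ∞ N] [T2Space N]
  {A : N → Type*} [∀ x, AddCommGroup (A x)] [∀ x, Module ℝ (A x)]
  {G : N → Type*} [∀ x, AddCommGroup (G x)] [∀ x, Module ℝ (G x)]
  {V : SmoothVectorBundle I' N A} {W : SmoothVectorBundle I' N G} {L : LieAlgebroid V}
  {f : C^∞⟮I, M; I', N⟯} {g : C^∞⟮I₁, P; I, M⟯}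

/-- `∑ hᵢ ⊗ bᵢ ↦ ∑ (hᵢ ∘ g) ⊗ bᵢ`. -/
def tensorPull (V : SmoothVectorBundle I' N A) (g : C^∞⟮I₁, P; I, M⟯) :
    SmoothFun I M ⊗[ℝ] V.sections →ₗ[ℝ] SmoothFun I₁ P ⊗[ℝ] V.sections :=
  LinearMap.rTensor V.sections
    { toFun := fun h => SmoothFun.pullback h g
      map_add' := fun _ _ => rfl
      map_smul' := fun _ _ => rfl }

@[simp] theorem tensorPull_tmul (h : SmoothFun I M) (b : V.sections) :
    tensorPull V g (h ⊗ₜ b) = h.pullback g ⊗ₜ b := rfl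

/-- Evaluation of tensors over `f ∘ g`, with values in the fibre written as `A (f (g x))`. -/
def evComp (V : SmoothVectorBundle I' N A) (f : C^∞⟮I, M; I', N⟯) (g : C^∞⟮I₁, P; I, M⟯) (x : P) :
    SmoothFun I₁ P ⊗[ℝ] V.sections →ₗ[ℝ] A (f (g x)) := V.ev (f.comp g) x

theorem evComp_tmul (x : P) (h : SmoothFun I₁ P) (b : V.sections) :
    evComp V f g x (h ⊗ₜ b) = h x • b.1 (f (g x)) := rfl

theorem evComp_smul (x : P) (u : SmoothFun I₁ P) (t : SmoothFun I₁ P ⊗[ℝ] V.sections) :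
    evComp V f g x (u • t) = u x • evComp V f g x t := V.ev_smul (f.comp g) x u t

theorem evComp_tensorPull (t : SmoothFun I M ⊗[ℝ] V.sections) (x : P) :
    evComp V f g x (tensorPull V g t) = V.ev f (g x) t := by
  induction t with
  | zero => simp
  | add t t' h h' => rw [map_add, map_add, map_add, ← h, ← h']
  | tmul h b => rfl

theorem evComp_tensorBracket_tensorPull (u w : SmoothFun I₁ P)
    (s t : SmoothFun I M ⊗[ℝ] V.sections) (x : P) :
    evComp V f g x (L.tensorBracket (u • tensorPull V g s) (w • tensorPull V g t)) =
      (u x * w x) • V.ev f (g x) (L.tensorBracket s t) := by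
  induction s with
  | zero => simp
  | add s s' h h' => simp only [map_add, smul_add, LinearMap.add_apply, h, h']
  | tmul h b =>
    induction t with
    | zero => simp
    | add s s' h h' => simp only [map_add, smul_add, h, h']
    | tmul k c =>
      simp only [tensorPull_tmul, TensorProduct.smul_tmul', LieAlgebroid.tensorBracket_tmul,
        ev_tmul, evComp_tmul, smul_smul]
      change ((u x * h (g x)) * (w x * k (g x))) • _ = (u x * w x * (h (g x) * k (g x))) • _
      congr 1
      ring

theorem evComp_tensorDer_tensorPull {X : (tangent I₁ P).sections} {Z : (tangent I M).sections}
    {x : P} (h : mfderiv I₁ I g x (X.1 x) = Z.1 (g x)) (u : SmoothFun I₁ P)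
    (t : SmoothFun I M ⊗[ℝ] V.sections) :
    evComp V f g x (LieAlgebroid.tensorDer V X (u • tensorPull V g t)) =
      u x • V.ev f (g x) (LieAlgebroid.tensorDer V Z t) +
        u.d x (X.1 x) • V.ev f (g x) t := by
  induction t with
  | zero => simp
  | add s s' h h' => simp only [map_add, smul_add, h, h']; abel
  | tmul k c =>
    simp only [tensorPull_tmul, TensorProduct.smul_tmul', LieAlgebroid.tensorDer_tmul,
      ev_tmul, evComp_tmul, smul_smul, lieDer_apply, smul_eq_mul, SmoothFun.d_mul,
      LinearMap.add_apply, LinearMap.smul_apply, SmoothFun.d_pullback, h, add_smul]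
    rw [mul_comm (u.d x (X.1 x))]
    rfl

/-- The fibres on both sides are definitionally equal, so that the smooth sections can be compared.
-/
theorem pullback_pullback_eq (W : SmoothVectorBundle I' N G) (f : C^∞⟮I, M; I', N⟯)
    (g : C^∞⟮I₁, P; I, M⟯) : (W.pullback f).pullback g = W.pullback (f.comp g) := by
  apply SmoothVectorBundle.ext_sections
  ext s
  constructor
  · intro hs x₀
    obtain ⟨n, e, -, he⟩ := W.frame (f (g x₀))
    obtain ⟨c, hc⟩ := (W.pullback f).pullback_frame_coeff g x₀ (e := fun i => W.pullSection f (e i))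
      (fun r => W.pullback_frame_coeff f (g x₀) he r) ⟨s, hs⟩
    refine ⟨∑ i, c i ⊗ₜ e i, ?_⟩
    filter_upwards [hc] with y hy
    rw [map_sum]
    exact hy
  · intro hs x₀
    obtain ⟨n, e, -, he⟩ := W.frame (f (g x₀))
    obtain ⟨c, hc⟩ := W.pullback_frame_coeff (f.comp g) x₀ he ⟨s, hs⟩
    refine ⟨∑ i, c i ⊗ₜ W.pullSection f (e i), ?_⟩
    filter_upwards [hc] with y hy
    rw [map_sum]
    exact hy

/-- The second component of a bracket in local expressions over a common frame. -/
theorem LieAlgebroid.bracket_snd_sum (hf : L.PullbackExists f) {ι : Type*} [Fintype ι] {m : M}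
    {σ τ : (pullbackBundle hf).sections} {u w : ι → SmoothFun I M} {c : ι → V.sections}
    (h : ∀ᶠ y in 𝓝 m, (σ.1 y).1.2 = ∑ j, u j y • (c j).1 (f y))
    (h' : ∀ᶠ y in 𝓝 m, (τ.1 y).1.2 = ∑ j, w j y • (c j).1 (f y)) :
    (((LieAlgebroid.pullback hf).bracket σ τ).1 m).1.2 =
      ∑ j, (w j m • (L.bracket (∑ i, u i m • c i) (c j)).1 (f m) +
        (w j).d m (σ.1 m).1.1 • (c j).1 (f m)) -
        ∑ j, (u j).d m (τ.1 m).1.1 • (c j).1 (f m) := by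
  have hv : mfderiv I I' f m (σ.1 m).1.1 =
      L.anchor (f m) ((∑ i, u i m • c i : V.sections).1 (f m)) := by
    refine (σ.1 m).2.trans (congrArg (L.anchor (f m)) ?_)
    rw [sections_sum_apply]
    exact h.self_of_nhds
  rw [bracket_snd hf h rfl hv, PointDerivation.pullback_sum (f := f) _ hv (s := sndSection hf τ) h']
  rfl

theorem AlgebroidConnection.pullback_toFun_sum (D : AlgebroidConnection L W)
    (hf : L.PullbackExists f) {ι : Type*} [Fintype ι] {m : M}
    {σ : (LieAlgebroid.pullbackBundle hf).sections} {a : V.sections}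
    (ha : a.1 (f m) = (σ.1 m).1.2) {s : (W.pullback f).sections} {w : ι → SmoothFun I M}
    {c : ι → W.sections} (h : ∀ᶠ y in 𝓝 m, s.1 y = ∑ j, w j y • (c j).1 (f y)) :
    ((D.pullback hf).toFun σ s).1 m =
      ∑ j, (w j m • (D.toFun a (c j)).1 (f m) + (w j).d m (σ.1 m).1.1 • (c j).1 (f m)) := by
  have hv : mfderiv I I' f m (σ.1 m).1.1 = L.anchor (f m) (a.1 (f m)) :=
    (σ.1 m).2.trans (congrArg (L.anchor (f m)) ha.symm)
  rw [D.pullback_toFun_apply hf ha hv, PointDerivation.pullback_sum (f := f) _ hv h]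
  rfl

theorem AlgebroidConnection.pullback_toFun_pullSection (D : AlgebroidConnection L W)
    (hf : L.PullbackExists f) {m : M}
    {σ : (LieAlgebroid.pullbackBundle hf).sections} {a : V.sections}
    (ha : a.1 (f m) = (σ.1 m).1.2) (e : W.sections) :
    ((D.pullback hf).toFun σ (W.pullSection f e)).1 m = (D.toFun a e).1 (f m) := by
  have hv : mfderiv I I' f m (σ.1 m).1.1 = L.anchor (f m) (a.1 (f m)) :=
    (σ.1 m).2.trans (congrArg (L.anchor (f m)) ha.symm)
  rw [D.pullback_toFun_apply hf ha hv, PointDerivation.pullback_pullSection (f := f) _ hv]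
  rfl

namespace LieAlgebroid

variable (hf : L.PullbackExists f)

/-- The fibres of `g^{!!}(f^{!!}A)` and of `(f ∘ g)^{!!}A` are isomorphic. -/
def iteratedEquiv (g : C^∞⟮I₁, P; I, M⟯) (x : P) :
    (LieAlgebroid.pullback hf).pullbackFiber g x ≃ₗ[ℝ] L.pullbackFiber (f.comp g) x :=
  have hc : ∀ v, mfderiv I₁ I' (f.comp g) x v = mfderiv I I' f (g x) (mfderiv I₁ I g x v) :=
    fun v => mfderiv_comp_apply x (f.contMDiff.contMDiffAt.mdifferentiableAt (by simp))
      (g.contMDiff.contMDiffAt.mdifferentiableAt (by simp)) v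
  { toFun := fun p => ⟨(p.1.1, p.1.2.1.2), by
      rw [mem_pullbackFiber, hc, show mfderiv I₁ I g x p.1.1 = p.1.2.1.1 from p.2]
      exact p.1.2.2⟩
    map_add' := fun _ _ => rfl
    map_smul' := fun _ _ => rfl
    invFun := fun p => ⟨(p.1.1, ⟨(mfderiv I₁ I g x p.1.1, p.1.2), by
      rw [mem_pullbackFiber, ← hc]
      exact p.2⟩), rfl⟩
    left_inv := fun p => Subtype.ext (Prod.ext rfl (Subtype.ext (Prod.ext p.2 rfl)))
    right_inv := fun p => rfl }

/-- The pullback along `g` of `f^{!!}A` exists if and only if the pullback of `A` along `f ∘ g`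
does. -/
theorem pullbackExists_iterated_iff :
    (LieAlgebroid.pullback hf).PullbackExists g ↔ L.PullbackExists (f.comp g) := by
  simp only [PullbackExists, (iteratedEquiv hf g _).finrank_eq]

variable (hg : (LieAlgebroid.pullback hf).PullbackExists g) (hk : L.PullbackExists (f.comp g))

/-- Local expressions for the sections of `g^{!!}(f^{!!}A)`. -/
theorem exists_iterated_represents {n : ℕ} {x : P} {e : Fin n → (pullbackBundle hf).sections}
    (he : ∀ s : (pullbackBundle hf).sections, ∃ h : Fin n → SmoothFun I M,
      ∀ᶠ y in 𝓝 (g x), s.1 y = ∑ i, h i y • (e i).1 y)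
    {q : Fin n → SmoothFun I M ⊗[ℝ] V.sections} (hq : ∀ i, Represents hf (e i) (g x) (q i))
    (σ : (pullbackBundle hg).sections) : ∃ u : Fin n → SmoothFun I₁ P,
      (∀ᶠ y in 𝓝 x, (σ.1 y).1.2 = ∑ i, u i y • (e i).1 (g y)) ∧
      ∀ᶠ y in 𝓝 x, (σ.1 y).1.2.1.2 = evComp V f g y (∑ i, u i • tensorPull V g (q i)) := by
  obtain ⟨u, hu⟩ := (pullbackBundle hf).pullback_frame_coeff g x he (sndSection hg σ)
  refine ⟨u, hu, ?_⟩
  filter_upwards [hu, g.contMDiff.continuous.continuousAt.eventually (eventually_all.2 hq)]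
    with y h1 h2
  have h3 : (σ.1 y).1.2 = ∑ i, u i y • (e i).1 (g y) := h1
  have h4 := congrArg (L.projection f (g y)) h3
  simp only [map_sum, map_smul] at h4
  rw [map_sum]
  simp only [evComp_smul, evComp_tensorPull, ← h2]
  exact h4

theorem iteratedEquiv_mem (σ : (pullbackBundle hg).sections) :
    (fun x => iteratedEquiv hf g x (σ.1 x)) ∈ (pullbackBundle hk).sections := by
  refine ⟨σ.2.1, fun x => ?_⟩
  obtain ⟨n, e, -, he⟩ := (pullbackBundle hf).frame (g x)
  choose q hq using fun i => exists_represents hf (e i) (g x)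
  obtain ⟨u, -, hu⟩ := exists_iterated_represents hf hg he hq σ
  exact ⟨_, hu⟩

theorem tensorDer_eq_sum {ι : Type*} [Fintype ι] (r : ι → ℝ) (X : ι → (tangent I M).sections)
    (t : SmoothFun I M ⊗[ℝ] V.sections) :
    tensorDer V (∑ i, r i • X i) t = ∑ i, r i • tensorDer V (X i) t := by
  classical
  have h1 : ∀ (c : ℝ) (Y : (tangent I M).sections),
      tensorDer V (c • Y) t = c • tensorDer V Y t := by
    intro c Y
    induction t with
    | zero => simp
    | add s s' h h' => simp only [map_add, h, h', smul_add]
    | tmul g b => simp [lieDer_const_smul_left, TensorProduct.smul_tmul']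
  have h2 : ∀ s : Finset ι, tensorDer V (∑ i ∈ s, r i • X i) t =
      ∑ i ∈ s, r i • tensorDer V (X i) t := by
    intro s
    induction s using Finset.induction_on with
    | empty =>
      have := h1 0 0
      simpa using this
    | insert i s hi ih =>
      rw [Finset.sum_insert hi, Finset.sum_insert hi, tensorDer_add_left, ih, h1]
  exact h2 _

theorem sum_bracket_eq {Y ι : Type*} [AddCommGroup Y] [Module ℝ Y] [Fintype ι]
    (T d : ι → ι → Y) (Q : ι → Y) (u w du dw : ι → ℝ) :
    ∑ j, (w j • ∑ i, u i • (T i j + d i j - d j i) + dw j • Q j) - ∑ j, du j • Q j =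
      ∑ i, ∑ j, (u i * w j) • T i j + ∑ j, (w j • ∑ i, u i • d i j + dw j • Q j) -
        ∑ j, (u j • ∑ i, w i • d i j + du j • Q j) := by
  simp only [smul_add, smul_sub, Finset.sum_add_distrib, Finset.sum_sub_distrib, Finset.smul_sum,
    smul_smul]
  rw [Finset.sum_comm (f := fun i j => (u i * w j) • T i j),
    Finset.sum_comm (f := fun j i => (u j * w i) • d i j)]
  simp only [mul_comm (u _) (w _)]
  abel

theorem mfderiv_eq_sum {n : ℕ} {x : P} {e : Fin n → (pullbackBundle hf).sections}
    {u : Fin n → SmoothFun I₁ P} {σ : (pullbackBundle hg).sections}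
    (hu : ∀ᶠ y in 𝓝 x, (σ.1 y).1.2 = ∑ i, u i y • (e i).1 (g y)) :
    mfderiv I₁ I g x (σ.1 x).1.1 =
      (∑ i, u i x • fstSection hf (e i) : (tangent I M).sections).1 (g x) := by
  have hfst : ((∑ i, u i x • (e i).1 (g x) : L.pullbackFiber f (g x))).1.1 =
      (∑ i, u i x • fstSection hf (e i) : (tangent I M).sections).1 (g x) := by
    rw [sections_sum_apply, Submodule.coe_sum, Prod.fst_sum]
    rfl
  rw [← hfst, ← hu.self_of_nhds]
  exact (σ.1 x).2

/-- The bracket of `(f ∘ g)^{!!}A` in terms of local expressions over `M`. -/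
theorem sndBracket_iterated {n : ℕ} {x : P} {e : Fin n → (pullbackBundle hf).sections}
    {q : Fin n → SmoothFun I M ⊗[ℝ] V.sections} {u w : Fin n → SmoothFun I₁ P}
    {X Y : (tangent I₁ P).sections}
    (hX : mfderiv I₁ I g x (X.1 x) =
      (∑ i, u i x • fstSection hf (e i) : (tangent I M).sections).1 (g x))
    (hY : mfderiv I₁ I g x (Y.1 x) =
      (∑ i, w i x • fstSection hf (e i) : (tangent I M).sections).1 (g x)) :
    evComp V f g x (L.pullbackFormula X (∑ i, u i • tensorPull V g (q i))
        Y (∑ i, w i • tensorPull V g (q i))) =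
      ∑ i, ∑ j, (u i x * w j x) • V.ev f (g x) (L.tensorBracket (q i) (q j)) +
      ∑ j, (w j x • ∑ i, u i x • V.ev f (g x) (tensorDer V (fstSection hf (e i)) (q j)) +
        (w j).d x (X.1 x) • V.ev f (g x) (q j)) -
      ∑ j, (u j x • ∑ i, w i x • V.ev f (g x) (tensorDer V (fstSection hf (e i)) (q j)) +
        (u j).d x (Y.1 x) • V.ev f (g x) (q j)) := by
  have hder : ∀ (r : Fin n → ℝ) j, V.ev f (g x) (tensorDer V (∑ i, r i • fstSection hf (e i))
      (q j)) = ∑ i, r i • V.ev f (g x) (tensorDer V (fstSection hf (e i)) (q j)) := fun r j => by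
    rw [tensorDer_eq_sum, map_sum]
    simp only [map_smul]
  simp only [pullbackFormula, map_sum, LinearMap.sum_apply, map_add, map_sub,
    evComp_tensorBracket_tensorPull, evComp_tensorDer_tensorPull hX,
    evComp_tensorDer_tensorPull hY, hder]
  rw [Finset.sum_comm]

theorem projection_bracket_frame {n : ℕ} {y : M} {e : Fin n → (pullbackBundle hf).sections}
    {q : Fin n → SmoothFun I M ⊗[ℝ] V.sections} (hq : ∀ i, Represents hf (e i) y (q i))
    (r : Fin n → ℝ) (j : Fin n) :
    L.projection f y (((LieAlgebroid.pullback hf).bracket (∑ i, r i • e i) (e j)).1 y) =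
      ∑ i, r i • (V.ev f y (L.tensorBracket (q i) (q j)) +
      V.ev f y (tensorDer V (fstSection hf (e i)) (q j)) -
      V.ev f y (tensorDer V (fstSection hf (e j)) (q i))) := by
  rw [map_sum, LinearMap.sum_apply, sections_sum_apply, map_sum]
  refine Finset.sum_congr rfl fun i _ => ?_
  rw [← map_add, ← map_sub]
  refine Eq.trans ?_ (congrArg (fun z => r i • z) (sndBracket_eq (hq i) (hq j)))
  rw [map_smul]
  rfl

theorem map_sum_bracket {Y Z ι : Type*} [AddCommGroup Y] [Module ℝ Y] [AddCommGroup Z] [Module ℝ Z]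
    [Fintype ι] (R : Y →ₗ[ℝ] Z) (w d c : ι → ℝ) (T Q : ι → Y) :
    R (∑ j, (w j • T j + d j • Q j) - ∑ j, c j • Q j) =
      ∑ j, (w j • R (T j) + d j • R (Q j)) - ∑ j, c j • R (Q j) := by
  simp only [map_sub, map_sum, map_add, map_smul]

theorem projection_bracket {n : ℕ} {x : P} {e : Fin n → (pullbackBundle hf).sections}
    {u w : Fin n → SmoothFun I₁ P} {σ τ : (pullbackBundle hg).sections}
    (hu : ∀ᶠ y in 𝓝 x, (σ.1 y).1.2 = ∑ i, u i y • (e i).1 (g y))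
    (hw : ∀ᶠ y in 𝓝 x, (τ.1 y).1.2 = ∑ i, w i y • (e i).1 (g y)) :
    L.projection f (g x) ((LieAlgebroid.pullback hf).projection g x
      (((LieAlgebroid.pullback hg).bracket σ τ).1 x)) =
    ∑ j, (w j x • L.projection f (g x)
        (((LieAlgebroid.pullback hf).bracket (∑ i, u i x • e i) (e j)).1 (g x)) +
      (w j).d x (σ.1 x).1.1 • L.projection f (g x) ((e j).1 (g x))) -
    ∑ j, (u j).d x (τ.1 x).1.1 • L.projection f (g x) ((e j).1 (g x)) := by
  exact (congrArg (L.projection f (g x)) (bracket_snd_sum hg hu hw)).trans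
    (map_sum_bracket (L.projection f (g x)) (fun j => w j x)
      (fun j => (w j).d x (σ.1 x).1.1) (fun j => (u j).d x (τ.1 x).1.1)
      (fun j => ((LieAlgebroid.pullback hf).bracket (∑ i, u i x • e i) (e j)).1 (g x))
      fun j => (e j).1 (g x))

theorem sndBracket_comp {n : ℕ} {x : P} {e : Fin n → (pullbackBundle hf).sections}
    {q : Fin n → SmoothFun I M ⊗[ℝ] V.sections}
    {u w : Fin n → SmoothFun I₁ P} {σ τ : (pullbackBundle hg).sections}
    (hu : ∀ᶠ y in 𝓝 x, (σ.1 y).1.2 = ∑ i, u i y • (e i).1 (g y))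
    (hw : ∀ᶠ y in 𝓝 x, (τ.1 y).1.2 = ∑ i, w i y • (e i).1 (g y))
    (hu' : ∀ᶠ y in 𝓝 x, (σ.1 y).1.2.1.2 = evComp V f g y (∑ i, u i • tensorPull V g (q i)))
    (hw' : ∀ᶠ y in 𝓝 x, (τ.1 y).1.2.1.2 = evComp V f g y (∑ i, w i • tensorPull V g (q i))) :
    sndBracket hk ⟨_, iteratedEquiv_mem hf hg hk σ⟩ ⟨_, iteratedEquiv_mem hf hg hk τ⟩ x =
      ∑ i, ∑ j, (u i x * w j x) • V.ev f (g x) (L.tensorBracket (q i) (q j)) +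
      ∑ j, (w j x • ∑ i, u i x • V.ev f (g x) (tensorDer V (fstSection hf (e i)) (q j)) +
        (w j).d x (σ.1 x).1.1 • V.ev f (g x) (q j)) -
      ∑ j, (u j x • ∑ i, w i x • V.ev f (g x) (tensorDer V (fstSection hf (e i)) (q j)) +
        (u j).d x (τ.1 x).1.1 • V.ev f (g x) (q j)) :=
  (sndBracket_eq (hf := hk) (σ := ⟨_, iteratedEquiv_mem hf hg hk σ⟩)
      (τ := ⟨_, iteratedEquiv_mem hf hg hk τ⟩) (m := x) hu' hw').trans
    (sndBracket_iterated hf (X := fstSection hg σ) (Y := fstSection hg τ) (q := q)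
      (mfderiv_eq_sum hf hg hu) (mfderiv_eq_sum hf hg hw))

theorem projection_projection_bracket_sum {n : ℕ} {x : P} {e : Fin n → (pullbackBundle hf).sections}
    {q : Fin n → SmoothFun I M ⊗[ℝ] V.sections} (hq : ∀ i, Represents hf (e i) (g x) (q i))
    {u w : Fin n → SmoothFun I₁ P} {σ τ : (pullbackBundle hg).sections}
    (hu : ∀ᶠ y in 𝓝 x, (σ.1 y).1.2 = ∑ i, u i y • (e i).1 (g y))
    (hw : ∀ᶠ y in 𝓝 x, (τ.1 y).1.2 = ∑ i, w i y • (e i).1 (g y)) :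
    L.projection f (g x) ((LieAlgebroid.pullback hf).projection g x
      (((LieAlgebroid.pullback hg).bracket σ τ).1 x)) =
      ∑ i, ∑ j, (u i x * w j x) • V.ev f (g x) (L.tensorBracket (q i) (q j)) +
      ∑ j, (w j x • ∑ i, u i x • V.ev f (g x) (tensorDer V (fstSection hf (e i)) (q j)) +
        (w j).d x (σ.1 x).1.1 • V.ev f (g x) (q j)) -
      ∑ j, (u j x • ∑ i, w i x • V.ev f (g x) (tensorDer V (fstSection hf (e i)) (q j)) +
        (u j).d x (τ.1 x).1.1 • V.ev f (g x) (q j)) := by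
  have hL := projection_bracket hf hg hu hw
  have hq' : ∀ i, L.projection f (g x) ((e i).1 (g x)) = V.ev f (g x) (q i) :=
    fun i => (hq i).self_of_nhds
  simp only [projection_bracket_frame hf hq, hq'] at hL
  have hS := sum_bracket_eq (fun i j => V.ev f (g x) (L.tensorBracket (q i) (q j)))
    (fun i j => V.ev f (g x) (tensorDer V (fstSection hf (e i)) (q j)))
    (fun j => V.ev f (g x) (q j)) (fun i => u i x) (fun i => w i x)
    (fun i => (u i).d x (τ.1 x).1.1) (fun i => (w i).d x (σ.1 x).1.1)
  exact hL.trans hS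

theorem projection_projection_bracket (σ τ : (pullbackBundle hg).sections) (x : P) :
    L.projection f (g x) ((LieAlgebroid.pullback hf).projection g x
      (((LieAlgebroid.pullback hg).bracket σ τ).1 x)) =
    sndBracket hk ⟨_, iteratedEquiv_mem hf hg hk σ⟩ ⟨_, iteratedEquiv_mem hf hg hk τ⟩ x := by
  have h1 := (pullbackBundle hf).frame (g x)
  have h2 : ∀ (n : ℕ) (e : Fin n → (pullbackBundle hf).sections),
      ∃ q : Fin n → SmoothFun I M ⊗[ℝ] V.sections, ∀ i,
      Represents hf (e i) (g x) (q i) := fun n e =>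
    ⟨_, fun i => (exists_represents hf (e i) (g x)).choose_spec⟩
  exact h1.elim fun n h1 => h1.elim fun e he => (h2 n e).elim fun q hq =>
    (exists_iterated_represents hf hg he.2 hq σ).elim fun u hu =>
    (exists_iterated_represents hf hg he.2 hq τ).elim fun w hw =>
    (projection_projection_bracket_sum hf hg hq hu.1 hw.1).trans
      (sndBracket_comp hf hg hk hu.1 hw.1 hu.2 hw.2).symm

/-- The isomorphism of `g^{!!}(f^{!!}A)` and `(f ∘ g)^{!!}A` preserves brackets. The vector
components agree by definition, the components in `A` are compared in local expressions. -/
theorem iteratedEquiv_bracket (σ τ : (pullbackBundle hg).sections) (x : P) :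
    iteratedEquiv hf g x (((LieAlgebroid.pullback hg).bracket σ τ).1 x) =
      ((LieAlgebroid.pullback hk).bracket ⟨_, iteratedEquiv_mem hf hg hk σ⟩
        ⟨_, iteratedEquiv_mem hf hg hk τ⟩).1 x :=
  Subtype.ext (Prod.ext rfl (projection_projection_bracket hf hg hk σ τ x))

end LieAlgebroid

namespace AlgebroidConnection

variable (D : AlgebroidConnection L W) (hf : L.PullbackExists f)
  (hg : (LieAlgebroid.pullback hf).PullbackExists g) (hk : L.PullbackExists (f.comp g))

theorem pullback_pullback_toFun_sum (σ : (LieAlgebroid.pullbackBundle hg).sections)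
    {s' : ((W.pullback f).pullback g).sections} {n : ℕ} {ε : Fin n → W.sections} {x : P}
    {w : Fin n → SmoothFun I₁ P}
    (hw : ∀ᶠ y in 𝓝 x, s'.1 y = ∑ l, w l y • (W.pullSection f (ε l)).1 (g y))
    {a : (LieAlgebroid.pullbackBundle hf).sections} (ha : a.1 (g x) = (σ.1 x).1.2)
    {b : V.sections} (hb : b.1 (f (g x)) = (a.1 (g x)).1.2) :
    (((D.pullback hf).pullback hg).toFun σ s').1 x =
      ∑ l, (w l x • (D.toFun b (ε l)).1 (f (g x)) +
        (w l).d x (σ.1 x).1.1 • (ε l).1 (f (g x))) := by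
  refine ((D.pullback hf).pullback_toFun_sum hg ha hw).trans ?_
  refine Finset.sum_congr rfl fun l _ => ?_
  have e3 := D.pullback_toFun_pullSection hf hb (ε l)
  have e4 : ∀ y z : G (f (g x)), y = z → w l x • y + (w l).d x (σ.1 x).1.1 • (ε l).1 (f (g x)) =
    w l x • z + (w l).d x (σ.1 x).1.1 • (ε l).1 (f (g x)) := fun y z h => by rw [h]
  exact e4 _ _ e3

/-- The isomorphism of `g^{!!}(f^{!!}A)` and `(f ∘ g)^{!!}A` matches the pulled back connections. -/
theorem pullback_pullback_toFun (σ : (LieAlgebroid.pullbackBundle hg).sections)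
    (s' : ((W.pullback f).pullback g).sections) (s : (W.pullback (f.comp g)).sections)
    (hs : s'.1 = s.1) (x : P) : (((D.pullback hf).pullback hg).toFun σ s').1 x =
      ((D.pullback hk).toFun ⟨_, LieAlgebroid.iteratedEquiv_mem hf hg hk σ⟩ s).1 x := by
  have h1 := W.frame (f (g x))
  have h2 := (LieAlgebroid.pullbackBundle hf).exists_section (g x) (σ.1 x).1.2
  exact h1.elim fun n h1 => h1.elim fun ε hε =>
    (W.pullback_frame_coeff (f.comp g) x hε.2 s).elim fun w hw => h2.elim fun a ha =>
    (V.exists_section (f (g x)) (a.1 (g x)).1.2).elim fun b hb =>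
    (D.pullback_pullback_toFun_sum hf hg σ (s' := s') (hw.mono fun y hy => (congrFun hs y).trans hy)
      ha hb).trans
      (D.pullback_toFun_sum hk (σ := ⟨_, LieAlgebroid.iteratedEquiv_mem hf hg hk σ⟩) (a := b)
        (hb.trans (congrArg (fun z => z.1.2) ha)) hw).symm

open LieAlgebroid in
/-- The pullback along `f ∘ g` is a quasi-isomorphism if and only if the composition of the
pullbacks along `f` and `g` is. -/
theorem isQuasiIso_iterated_iff {k : C^∞⟮I₁, P; I', N⟯} (h : f.comp g = k)
    (hk : L.PullbackExists k) :
    IsQuasiIso D ((D.pullback hf).pullback hg)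
      (fun n => pullbackForm hg (W.pullback f) n ∘ₗ pullbackForm hf W n) ↔
    IsQuasiIso D (D.pullback hk) (pullbackForm hk W) := by
  subst h
  have h1 : IsQuasiIso (D.pullback hk) ((D.pullback hf).pullback hg)
      (Form.compMap (R := fun x => (iteratedEquiv hf g x).toLinearMap)
        (iteratedEquiv_mem hf hg hk) (pullback_pullback_eq W f g)) :=
    isQuasiIso_compMap _ _ (iteratedEquiv_bracket hf hg hk) (D.pullback_pullback_toFun hf hg hk)
  have h2 : (fun n => pullbackForm hg (W.pullback f) n ∘ₗ pullbackForm hf W n) =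
      fun n => Form.compMap (R := fun x => (iteratedEquiv hf g x).toLinearMap)
        (iteratedEquiv_mem hf hg hk) (pullback_pullback_eq W f g) n ∘ₗ
        pullbackForm hk W n := rfl
  rw [h2]
  exact ⟨fun h => h1.of_comp h fun _ => D.dForm_pullbackForm hk, fun h => h1.comp h⟩

end AlgebroidConnection
end Iterated

/-! ### The pullback along the identity -/

section Identity

variable {E' : Type*} [NormedAddCommGroup E'] [NormedSpace ℝ E'] [FiniteDimensional ℝ E']
  {H' : Type*} [TopologicalSpace H'] {I' : ModelWithCorners ℝ E' H'}
  {N : Type*} [TopologicalSpace N] [ChartedSpace H' N] [IsManifold I' ∞ N] [T2Space N]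
  {A : N → Type*} [∀ x, AddCommGroup (A x)] [∀ x, Module ℝ (A x)]
  {G : N → Type*} [∀ x, AddCommGroup (G x)] [∀ x, Module ℝ (G x)]
  {V : SmoothVectorBundle I' N A} {W : SmoothVectorBundle I' N G} {L : LieAlgebroid V}

theorem pullback_id_eq (W : SmoothVectorBundle I' N G) : W.pullback ContMDiffMap.id = W := by
  apply SmoothVectorBundle.ext_sections
  ext s
  constructor
  · intro hs
    apply W.mem_of_locally
    intro x₀
    obtain ⟨t, ht⟩ := hs x₀
    have h : ∀ t : SmoothFun I' N ⊗[ℝ] W.sections,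
        (fun y => (W.ev ContMDiffMap.id y t : G y)) ∈ W.sections := by
      intro t
      induction t with
      | zero =>
        have h0 : (fun y => (W.ev ContMDiffMap.id y 0 : G y)) = 0 := funext fun y => map_zero _
        rw [h0]
        exact W.sections.zero_mem
      | add t t' h h' =>
        have h0 : (fun y => (W.ev ContMDiffMap.id y (t + t') : G y)) =
            (fun y => (W.ev ContMDiffMap.id y t : G y)) + fun y => W.ev ContMDiffMap.id y t' :=
          funext fun y => map_add _ t t'
        rw [h0]
        exact W.sections.add_mem h h'
      | tmul h b => exact W.smul_mem h b.1 b.2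
    exact ⟨_, h t, ht⟩
  · intro hs x₀
    exact ⟨1 ⊗ₜ ⟨s, hs⟩, .of_forall fun y => (one_smul ℝ (s y)).symm⟩

namespace LieAlgebroid

/-- The fibres of `id^{!!}A` and `A` are isomorphic. -/
def idEquiv (L : LieAlgebroid V) (x : N) :
    L.pullbackFiber (ContMDiffMap.id : C^∞⟮I', N; I', N⟯) x ≃ₗ[ℝ] A x where
  toFun p := p.1.2
  map_add' _ _ := rfl
  map_smul' _ _ := rfl
  invFun a := ⟨(L.anchor x a, a), by
    rw [mem_pullbackFiber]
    change mfderiv I' I' (id : N → N) x _ = _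
    rw [mfderiv_id]
    rfl⟩
  left_inv p := Subtype.ext (Prod.ext (by
    have h : mfderiv I' I' (id : N → N) x p.1.1 = L.anchor x p.1.2 := p.2
    rw [mfderiv_id] at h
    exact h.symm) rfl)
  right_inv _ := rfl

end LieAlgebroid

open LieAlgebroid in
theorem isQuasiIso_pullback_id (D : AlgebroidConnection L W)
    (h : L.PullbackExists (ContMDiffMap.id : C^∞⟮I', N; I', N⟯)) :
    IsQuasiIso D (D.pullback h) (pullbackForm h W) := by
  have hmem : ∀ a : (pullbackBundle h).sections, (fun x => L.idEquiv x (a.1 x)) ∈ V.sections :=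
    fun a => by
      have h1 := a.2.2
      have h2 := congrArg SmoothVectorBundle.sections (pullback_id_eq V)
      exact h2 ▸ h1
  have hv : ∀ (a : (pullbackBundle h).sections) x,
      mfderiv I' I' (ContMDiffMap.id : C^∞⟮I', N; I', N⟯) x (a.1 x).1.1 =
        L.anchor x ((⟨_, hmem a⟩ : V.sections).1 x) := fun a x => (a.1 x).2
  refine isQuasiIso_compMap (D := D) (D' := D.pullback h) (R := L.idEquiv) hmem
    (pullback_id_eq W) (fun a b x => ?_) (fun a s' s hs x => ?_)
  · have h1 := bracket_snd h (σ := a) (τ := b) (m := x) (u := fun _ : Fin 1 => 1)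
      (c := fun _ => ⟨_, hmem a⟩) (.of_forall fun y => by simp; rfl)
      (a := ⟨_, hmem a⟩) (by simp) (hv a x)
    have h2 : ∀ v, (1 : SmoothFun I' N).d x v = 0 := fun v => by
      rw [SmoothFun.d_const 1 (.of_forall fun _ => rfl)]; rfl
    simp only [h2, zero_smul, Finset.sum_const_zero, sub_zero] at h1
    refine h1.trans ?_
    exact PointDerivation.pullback_pullSection (f := ContMDiffMap.id) _ (hv a x) ⟨_, hmem b⟩
  · refine (D.pullback_toFun_apply h (σ := a) (a := ⟨_, hmem a⟩) rfl (hv a x) s').trans ?_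
    have h3 : s' = W.pullSection ContMDiffMap.id s := Subtype.ext hs
    rw [h3]
    exact PointDerivation.pullback_pullSection (f := ContMDiffMap.id) _ (hv a x) s

end Identity

/-! ### Linear differential equations depending smoothly on parameters -/

section LinearODE

variable {Z X F : Type*} [NormedAddCommGroup Z] [NormedSpace ℝ Z] [FiniteDimensional ℝ Z]
  [NormedAddCommGroup X] [NormedSpace ℝ X] [NormedAddCommGroup F] [NormedSpace ℝ F]

/-- A continuous function of `(z, r)` as a family of continuous functions of `r ∈ [0, 1]`. -/
def curryIcc (f : C(Z × ℝ, X)) : C(Z, C(Icc (0 : ℝ) 1, X)) :=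
  (f.comp ⟨fun p : Z × Icc (0 : ℝ) 1 => (p.1, (p.2 : ℝ)), by fun_prop⟩).curry

@[simp] theorem curryIcc_apply (f : C(Z × ℝ, X)) (z : Z) (r : Icc (0 : ℝ) 1) :
    curryIcc f z r = f (z, r) := rfl

/-- The derivative of a curried function is its partial derivative: the difference quotients
converge uniformly in `r`, because the partial derivative depends continuously on `z`, uniformly in
`r`. -/
theorem hasFDerivAt_curryIcc {f : C(Z × ℝ, X)} (hf : ContDiff ℝ 1 f)
    {f' : C(Z × ℝ, Z →L[ℝ] X)} (hf' : ∀ z r, f' (z, r) = (fderiv ℝ f (z, r)).comp (.inl ℝ Z ℝ))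
    (z : Z) {T : Z →L[ℝ] C(Icc (0 : ℝ) 1, X)} (hT : ∀ v r, T v r = f' (z, r) v) :
    HasFDerivAt (curryIcc f) T z := by
  have hd : ∀ (ξ : Z) (r : ℝ), HasFDerivAt (fun ξ => f (ξ, r)) (f' (ξ, r)) ξ := fun ξ r => by
    rw [hf']
    have h1 : HasFDerivAt (fun ξ : Z => (ξ, r)) (.inl ℝ Z ℝ) ξ := hasFDerivAt_prodMk_left ξ r
    exact ((hf.differentiable one_ne_zero (ξ, r)).hasFDerivAt).comp ξ h1
  rw [hasFDerivAt_iff_isLittleO_nhds_zero, Asymptotics.isLittleO_iff]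
  intro ε hε
  obtain ⟨δ, hδ, h⟩ := Metric.continuous_iff.1 (curryIcc f').continuous z ε hε
  filter_upwards [Metric.ball_mem_nhds (0 : Z) hδ] with w hw
  refine (ContinuousMap.norm_le _ (by positivity)).2 fun r => ?_
  have hb : ∀ ξ ∈ Metric.ball z δ, ‖f' (ξ, r) - f' (z, r)‖ ≤ ε := fun ξ hξ => by
    have h2 := (ContinuousMap.dist_apply_le_dist r).trans (h ξ hξ).le
    rwa [dist_eq_norm] at h2
  have h3 := Convex.norm_image_sub_le_of_norm_hasFDerivWithin_le' (𝕜 := ℝ)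
    (fun ξ _ => (hd ξ r).hasFDerivWithinAt) hb (convex_ball z δ) (Metric.mem_ball_self hδ)
    (y := z + w) (by simpa using hw)
  simpa [hT] using h3

/-- Currying preserves smoothness; by induction, since its derivatives are again curried functions.
-/
theorem contDiff_curryIcc (n : ℕ) : ∀ {f : C(Z × ℝ, X)}, ContDiff ℝ n f →
    ContDiff ℝ n (curryIcc f) := by
  induction n with
  | zero => intro f _; exact contDiff_zero.2 (curryIcc f).continuous
  | succ n ih =>
    intro f hf
    have hf1 : ContDiff ℝ n (fderiv ℝ f) := hf.fderiv_right (by norm_cast)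
    have hc : Continuous (fun p => (fderiv ℝ f p).comp (.inl ℝ Z ℝ)) :=
      hf1.continuous.clm_comp continuous_const
    let T : Z → Z →L[ℝ] C(Icc (0 : ℝ) 1, X) := fun z => LinearMap.toContinuousLinearMap
      { toFun := fun v => ⟨fun r => (fderiv ℝ f (z, r)).comp (.inl ℝ Z ℝ) v, by
          have : Continuous fun r : Icc (0 : ℝ) 1 => (z, (r : ℝ)) := by fun_prop
          exact (hc.comp this).clm_apply continuous_const⟩
        map_add' := fun v w => by ext r; simp [← map_add]
        map_smul' := fun c v => by ext r; simp [← map_smul] }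
    have hT : ∀ z, HasFDerivAt (curryIcc f) (T z) z := fun z =>
      hasFDerivAt_curryIcc (hf.of_le (by norm_cast; omega)) (f' := ⟨_, hc⟩) (fun _ _ => rfl) z
        fun _ _ => rfl
    have := contDiff_succ_iff_fderiv_apply (𝕜 := ℝ) (n := (n : ℕ)) (f := curryIcc f)
    rw [Nat.cast_succ]
    refine this.2 ⟨fun z => (hT z).differentiableAt, by simp, fun v => ?_⟩
    have h1 : ContDiff ℝ n fun p => (fderiv ℝ f p).comp (.inl ℝ Z ℝ) v :=
      (hf1.clm_comp contDiff_const).clm_apply contDiff_const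
    have h2 := ih (f := ⟨_, h1.continuous⟩) h1
    have h3 : (fun z => fderiv ℝ (curryIcc f) z v) = curryIcc ⟨_, h1.continuous⟩ := by
      funext z
      rw [(hT z).fderiv]
      rfl
    rw [h3]
    exact h2

/-- The primitive vanishing at `0` of a continuous function on `[0, 1]`. -/
def primitiveIcc (F : Type*) [NormedAddCommGroup F] [NormedSpace ℝ F] :
    C(Icc (0 : ℝ) 1, F) →ₗ[ℝ] C(Icc (0 : ℝ) 1, F) where
  toFun w := ⟨fun r => ∫ s in (0 : ℝ)..r, IccExtend zero_le_one w s, by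
    have h : Continuous (IccExtend (zero_le_one' ℝ) w) := w.continuous.Icc_extend'
    exact (intervalIntegral.continuous_primitive
      (fun a b => h.intervalIntegrable a b) 0).comp continuous_subtype_val⟩
  map_add' w w' := by
    ext r
    exact intervalIntegral.integral_add (w.continuous.Icc_extend'.intervalIntegrable _ _)
      (w'.continuous.Icc_extend'.intervalIntegrable _ _)
  map_smul' c w := by
    ext r
    exact intervalIntegral.integral_smul c _

theorem norm_primitiveIcc_le (w : C(Icc (0 : ℝ) 1, F)) : ‖primitiveIcc F w‖ ≤ ‖w‖ := by
  refine (ContinuousMap.norm_le _ (by positivity)).2 fun r => ?_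
  refine (intervalIntegral.norm_integral_le_of_norm_le_const (C := ‖w‖)
    fun s _ => w.norm_coe_le_norm _).trans ?_
  rw [sub_zero, abs_of_nonneg r.2.1]
  exact mul_le_of_le_one_right (norm_nonneg w) r.2.2

variable {Y : Type*} [NormedAddCommGroup Y] [NormedSpace ℝ Y]

/-- Pointwise application of a bilinear map to continuous functions. -/
def bilinIcc (m : Y →L[ℝ] F →L[ℝ] F) :
    C(Icc (0 : ℝ) 1, Y) →ₗ[ℝ] C(Icc (0 : ℝ) 1, F) →ₗ[ℝ] C(Icc (0 : ℝ) 1, F) :=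
  LinearMap.mk₂ ℝ
    (fun B u => ⟨fun r => m (B r) (u r), (m.continuous.comp B.continuous).clm_apply u.continuous⟩)
    (fun B B' u => by ext r; simp) (fun c B u => by ext r; simp)
    (fun B u v => by ext r; simp) (fun c B u => by ext r; simp)

theorem norm_bilinIcc_le (m : Y →L[ℝ] F →L[ℝ] F) (B : C(Icc (0 : ℝ) 1, Y))
    (u : C(Icc (0 : ℝ) 1, F)) : ‖bilinIcc m B u‖ ≤ ‖m‖ * ‖B‖ * ‖u‖ := by
  refine (ContinuousMap.norm_le _ (by positivity)).2 fun r => ?_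
  refine (m.le_opNorm₂ _ _).trans ?_
  gcongr
  exacts [B.norm_coe_le_norm r, u.norm_coe_le_norm r]

/-- The solution operator of `u = P (R(B, u) + w)`, for small `B`, by the Neumann series. -/
theorem exists_neumann_solution {U Q : Type*} [NormedAddCommGroup U] [NormedSpace ℝ U]
    [CompleteSpace U] [NormedAddCommGroup Q] [NormedSpace ℝ Q] (P : U →ₗ[ℝ] U)
    (R : Q →ₗ[ℝ] U →ₗ[ℝ] U) {c : ℝ} (hP : ∀ u, ‖P u‖ ≤ ‖u‖) (hc : 0 ≤ c)
    (hR : ∀ B u, ‖R B u‖ ≤ c * ‖B‖ * ‖u‖) : ∃ S : Q → U → U,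
      (∀ B w u, c * ‖B‖ < 1 → (u = S B w ↔ u = P (R B u + w))) ∧
      ∀ (B : Z → Q) (w : Z → U), ContDiff ℝ ∞ B → ContDiff ℝ ∞ w → ∀ z, c * ‖B z‖ < 1 →
        ContDiffAt ℝ ∞ (fun z => S (B z) (w z)) z := by
  let P' : U →L[ℝ] U := P.mkContinuous 1 fun u => (hP u).trans (one_mul _).ge
  let R' : Q →L[ℝ] U →L[ℝ] U := R.mkContinuous₂ c hR
  have hu : ∀ B, c * ‖B‖ < 1 → IsUnit (1 - P' ∘L R' B) := fun B hB => by
    refine isUnit_one_sub_of_norm_lt_one (R := U →L[ℝ] U) (lt_of_le_of_lt ?_ hB)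
    exact ContinuousLinearMap.opNorm_le_bound _ (by positivity) fun u => (hP _).trans (hR B u)
  refine ⟨fun B w => Ring.inverse (1 - P' ∘L R' B) (P' w), fun B w u hB => ?_,
    fun B w hB hw z hz => ?_⟩
  · rw [map_add]
    constructor
    · intro h
      have h3 : ((1 - P' ∘L R' B) * Ring.inverse (1 - P' ∘L R' B)) (P' w) = P' w := by
        rw [Ring.mul_inverse_cancel _ (hu B hB)]
        rfl
      rw [← sub_eq_iff_eq_add']
      have h4 : (1 - P' ∘L R' B) u = P' w := by rw [h]; exact h3
      exact h4
    · intro h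
      have h3 : (1 - P' ∘L R' B) u = P' w := sub_eq_iff_eq_add'.2 h
      have h4 : (Ring.inverse (1 - P' ∘L R' B) * (1 - P' ∘L R' B)) u = u := by
        rw [Ring.inverse_mul_cancel _ (hu B hB)]
        rfl
      change u = Ring.inverse (1 - P' ∘L R' B) (P' w)
      rw [← h3]
      exact h4.symm
  · have hK : ContDiff ℝ ∞ fun z => P' ∘L R' (B z) :=
      contDiff_const.clm_comp (R'.contDiff.comp hB)
    obtain ⟨T, hT⟩ := hu _ hz
    have h2 : ContDiffAt ℝ ∞ (fun z => Ring.inverse (1 - P' ∘L R' (B z))) z := by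
      refine ContDiffAt.comp (g := Ring.inverse) (f := fun z => 1 - P' ∘L R' (B z)) z ?_
        (contDiff_const.sub hK).contDiffAt
      rw [← hT]
      exact contDiffAt_ringInverse ℝ T
    exact h2.clm_apply (P'.contDiff.comp hw).contDiffAt

variable [CompleteSpace F]

variable {E : Type*} [NormedAddCommGroup E] [NormedSpace ℝ E] [FiniteDimensional ℝ E]

/-- Local solutions of inhomogeneous linear equations, depending smoothly on parameters, on a
neighbourhood that depends neither on the inhomogeneity nor on the initial time. -/
theorem exists_linear_ode_solution (m : Y →L[ℝ] F →L[ℝ] F) {A : ℝ × E → Y} (hA : ContDiff ℝ ∞ A)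
    (p : ℝ × E) :
    ∃ ε > 0, ∀ t₂ ∈ Metric.ball p.1 ε, ∀ b : ℝ × E → F, ContDiff ℝ ∞ b →
      ∃ c : ℝ × E → F, ContDiffOn ℝ ∞ c (Metric.ball p ε) ∧
        (∀ y ∈ Metric.ball p.2 ε, c (t₂, y) = 0) ∧ ∀ q ∈ Metric.ball p ε,
          HasDerivAt (fun t => c (t, q.2)) (m (A q) (c q) + b q) q.1 := by
  obtain ⟨C, hC0, ε₀, hε₀, hC⟩ : ∃ C > 0, ∃ ε₀ > 0, ∀ q ∈ Metric.ball p ε₀, ‖m‖ * ‖A q‖ ≤ C := by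
    obtain ⟨ε₀, hε₀, h⟩ := Metric.continuous_iff.1 hA.continuous p 1 one_pos
    refine ⟨‖m‖ * (‖A p‖ + 1) + 1, by positivity, ε₀, hε₀, fun q hq => ?_⟩
    have h1 := h q hq
    rw [dist_eq_norm] at h1
    have h2 := norm_sub_norm_le (A q) (A p)
    have h3 : ‖A q‖ ≤ ‖A p‖ + 1 := by linarith
    calc _ ≤ ‖m‖ * (‖A p‖ + 1) := by gcongr
      _ ≤ _ := by simp
  -- times in the ball differ by at most `2 ε`, so that the norm in the Neumann series is at most
  -- `2 ε C ≤ 1 / 2`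
  refine ⟨min ε₀ (1 / (4 * C)), by positivity, fun t₂ ht₂ b hb => ?_⟩
  set ε := min ε₀ (1 / (4 * C)) with hε
  have hε4 : 4 * C * ε ≤ 1 := by
    have := min_le_right ε₀ (1 / (4 * C))
    calc 4 * C * ε ≤ 4 * C * (1 / (4 * C)) := by gcongr
      _ = 1 := by field_simp
  -- rescaling of the time interval from `t₂` to `t`
  have hθ : ContDiff ℝ ∞ fun q : (ℝ × E) × ℝ => (t₂ + q.2 * (q.1.1 - t₂), q.1.2) :=
    ContDiff.prodMk (by fun_prop) (by fun_prop)
  have hB0 : ContDiff ℝ ∞ fun q : (ℝ × E) × ℝ =>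
      (q.1.1 - t₂) • A (t₂ + q.2 * (q.1.1 - t₂), q.1.2) :=
    ContDiff.smul (by fun_prop) (hA.comp hθ)
  have hβ0 : ContDiff ℝ ∞ fun q : (ℝ × E) × ℝ =>
      (q.1.1 - t₂) • b (t₂ + q.2 * (q.1.1 - t₂), q.1.2) :=
    ContDiff.smul (by fun_prop) (hb.comp hθ)
  let B := curryIcc ⟨_, hB0.continuous⟩
  let β := curryIcc ⟨_, hβ0.continuous⟩
  have hBs : ContDiff ℝ ∞ B :=
    contDiff_infty.2 fun n => contDiff_curryIcc n (contDiff_infty.1 hB0 n)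
  have hβs : ContDiff ℝ ∞ β :=
    contDiff_infty.2 fun n => contDiff_curryIcc n (contDiff_infty.1 hβ0 n)
  have hball : ∀ q : ℝ × E, q ∈ Metric.ball p ε ↔
      q.1 ∈ Metric.ball p.1 ε ∧ q.2 ∈ Metric.ball p.2 ε :=
    fun q => by simp [Metric.mem_ball, Prod.dist_eq]
  have hseg : ∀ q ∈ Metric.ball p ε, ∀ r : Icc (0 : ℝ) 1,
      (t₂ + r * (q.1 - t₂), q.2) ∈ Metric.ball p ε := by
    intro q hq r
    rw [hball] at hq ⊢
    refine ⟨?_, hq.2⟩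
    have := (convex_ball p.1 ε).add_smul_sub_mem ht₂ hq.1 r.2
    simpa using this
  have hBn : ∀ q ∈ Metric.ball p ε, ‖m‖ * ‖B q‖ < 1 := by
    intro q hq
    have h2 : ‖q.1 - t₂‖ ≤ 2 * ε := by
      have h3 := Metric.mem_ball.1 ((hball q).1 hq).1
      have h4 := Metric.mem_ball'.1 ht₂
      have h5 := dist_triangle q.1 p.1 t₂
      rw [← dist_eq_norm]
      linarith
    have h1 : ‖m‖ * ‖B q‖ ≤ 2 * ε * C := by
      rw [← norm_smul_of_nonneg (norm_nonneg m)]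
      refine (ContinuousMap.norm_le _ (by positivity)).2 fun r => ?_
      have h1 : ‖m‖ * ‖A (t₂ + r * (q.1 - t₂), q.2)‖ ≤ C :=
        hC _ (Metric.ball_subset_ball (min_le_left _ _) (hseg q hq r))
      change ‖‖m‖ • (q.1 - t₂) • A (t₂ + r * (q.1 - t₂), q.2)‖ ≤ _
      rw [norm_smul_of_nonneg (norm_nonneg m), norm_smul, mul_left_comm]
      gcongr
    linarith
  obtain ⟨S, hS, hSs⟩ := exists_neumann_solution (Z := ℝ × E) (primitiveIcc F) (bilinIcc m)
    norm_primitiveIcc_le (norm_nonneg m) (norm_bilinIcc_le m)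
  have hS' : ∀ B β u, ‖m‖ * ‖B‖ < 1 → (u = S B β ↔ ∀ r : Icc (0 : ℝ) 1, u r =
      ∫ s in (0 : ℝ)..r, IccExtend zero_le_one (fun s => m (B s) (u s) + β s) s) :=
    fun B β u hB => (hS B β u hB).trans ContinuousMap.ext_iff
  let u : ℝ × E → C(Icc (0 : ℝ) 1, F) := fun q => S (B q) (β q)
  have hu : ∀ q ∈ Metric.ball p ε, ∀ r : Icc (0 : ℝ) 1, u q r =
      ∫ s in (0 : ℝ)..r, IccExtend zero_le_one (fun s => m (B q s) (u q s) + β q s) s := fun q hq =>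
    (hS' _ _ _ (hBn q hq)).1 rfl
  let c : ℝ × E → F := fun q => u q ⟨1, by simp⟩
  have hcs : ContDiffOn ℝ ∞ c (Metric.ball p ε) := fun q hq =>
    ((ContinuousMap.evalCLM ℝ (M := F) (⟨1, by simp⟩ : Icc (0 : ℝ) 1)).contDiff.contDiffAt.comp q
      (hSs B β hBs hβs q (hBn q hq))).contDiffWithinAt
  have hIcc : ∀ (q : ℝ × E) (s : ℝ) (hs : s ∈ Icc (0 : ℝ) 1),
      IccExtend (zero_le_one' ℝ) (fun s => m (B q s) (u q s) + β q s) s =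
      (q.1 - t₂) • (m (A (t₂ + s * (q.1 - t₂), q.2)) (u q ⟨s, hs⟩) +
        b (t₂ + s * (q.1 - t₂), q.2)) := by
    intro q s hs
    rw [IccExtend_of_mem _ _ hs, smul_add]
    congr 1
    change m ((q.1 - t₂) • A (t₂ + s * (q.1 - t₂), q.2)) _ = _
    rw [map_smul]
    rfl
  -- by uniqueness, the solution up to time `t`, stopped early, is the solution up to the earlier
  -- time
  have hsc : ∀ q ∈ Metric.ball p ε, ∀ r : Icc (0 : ℝ) 1,
      u q r = c (t₂ + r * (q.1 - t₂), q.2) := by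
    intro q hq r
    let q' : ℝ × E := (t₂ + r * (q.1 - t₂), q.2)
    have hq' : q' ∈ Metric.ball p ε := hseg q hq r
    let ψ : Icc (0 : ℝ) 1 → Icc (0 : ℝ) 1 := fun s => ⟨r * s, unitInterval.mul_mem r.2 s.2⟩
    have hψ : Continuous ψ := by fun_prop
    have hv : (u q).comp ⟨ψ, hψ⟩ = u q' := by
      refine (hS' _ _ _ (hBn q' hq')).2 fun s => ?_
      change u q (ψ s) = _
      rw [hu q hq (ψ s)]
      change ∫ s in (0 : ℝ)..(r * s), _ = _
      have h1 := intervalIntegral.smul_integral_comp_mul_left (a := 0) (b := s)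
        (IccExtend (zero_le_one' ℝ) (fun s => m (B q s) (u q s) + β q s)) r
      rw [mul_zero] at h1
      rw [← h1, ← intervalIntegral.integral_smul]
      refine intervalIntegral.integral_congr fun ρ hρ => ?_
      rw [uIcc_of_le s.2.1] at hρ
      have hρ' : ρ ∈ Icc (0 : ℝ) 1 := ⟨hρ.1, hρ.2.trans s.2.2⟩
      have h2 : (r : ℝ) * ρ ∈ Icc (0 : ℝ) 1 := unitInterval.mul_mem r.2 hρ'
      change (r : ℝ) • IccExtend _ _ (r * ρ) = IccExtend _ _ ρ
      rw [hIcc q _ h2, IccExtend_of_mem _ _ hρ']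
      change _ = m ((q'.1 - t₂) • A (t₂ + ρ * (q'.1 - t₂), q.2)) (u q ⟨r * ρ, h2⟩) +
        (q'.1 - t₂) • b (t₂ + ρ * (q'.1 - t₂), q.2)
      have h3 : q'.1 - t₂ = r * (q.1 - t₂) := by simp [q']
      rw [h3, smul_add, smul_add, smul_smul, smul_smul, map_smul,
        show ρ * (r * (q.1 - t₂)) = r * ρ * (q.1 - t₂) by ring]
      rfl
    have h1 := congrArg (fun w => w ⟨1, by simp⟩) hv
    change u q (ψ ⟨1, _⟩) = c q' at h1
    rw [← h1]
    congr 1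
    exact Subtype.ext (mul_one _).symm
  have hint : ∀ q ∈ Metric.ball p ε, c q =
      ∫ s in t₂..q.1, (m (A (s, q.2)) (c (s, q.2)) + b (s, q.2)) := by
    intro q hq
    have h1 := intervalIntegral.smul_integral_comp_mul_add (a := 0) (b := 1)
      (fun s => m (A (s, q.2)) (c (s, q.2)) + b (s, q.2)) (q.1 - t₂) t₂
    rw [mul_zero, zero_add, mul_one, sub_add_cancel] at h1
    rw [← h1, ← intervalIntegral.integral_smul]
    refine (hu q hq ⟨1, by simp⟩).trans (intervalIntegral.integral_congr fun s hs => ?_)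
    rw [uIcc_of_le zero_le_one] at hs
    change IccExtend _ _ s = (q.1 - t₂) • (m (A ((q.1 - t₂) * s + t₂, q.2))
      (c ((q.1 - t₂) * s + t₂, q.2)) + b ((q.1 - t₂) * s + t₂, q.2))
    rw [hIcc q s hs, hsc q hq ⟨s, hs⟩, mul_comm (q.1 - t₂) s, add_comm _ t₂]
  refine ⟨c, hcs, fun y hy => ?_, fun q hq => ?_⟩
  · rw [hint (t₂, y) ((hball _).2 ⟨ht₂, hy⟩), intervalIntegral.integral_same]
  · have hcont : ContinuousOn (fun s => m (A (s, q.2)) (c (s, q.2)) + b (s, q.2))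
        (Metric.ball p.1 ε) := by
      have h0 : ContinuousOn (fun s : ℝ => (s, q.2)) (Metric.ball p.1 ε) := by fun_prop
      have h1 : MapsTo (fun s : ℝ => (s, q.2)) (Metric.ball p.1 ε) (Metric.ball p ε) :=
        fun s hs => (hball _).2 ⟨hs, ((hball q).1 hq).2⟩
      exact ((m.continuous.comp_continuousOn (hA.continuous.comp_continuousOn h0)).clm_apply
        (hcs.continuousOn.comp h0 h1)).add (hb.continuous.comp_continuousOn h0)
    have hq1 := ((hball q).1 hq).1
    have h1 : HasDerivAt (fun t => ∫ s in t₂..t, (m (A (s, q.2)) (c (s, q.2)) + b (s, q.2)))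
        (m (A q) (c q) + b q) q.1 := by
      refine intervalIntegral.integral_hasDerivAt_right ?_ ?_ ?_
      · exact (hcont.mono ((convex_ball p.1 ε).ordConnected.uIcc_subset ht₂ hq1)).intervalIntegrable
      · exact hcont.stronglyMeasurableAtFilter Metric.isOpen_ball _ hq1
      · exact hcont.continuousAt (Metric.isOpen_ball.mem_nhds hq1)
    refine h1.congr_of_eventuallyEq ?_
    filter_upwards [Metric.isOpen_ball.mem_nhds hq1] with t ht
    exact hint (t, q.2) ((hball _).2 ⟨ht, ((hball q).1 hq).2⟩)

end LinearODE

/-! ### Sections that are parallel in the time direction -/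

section Lines

variable {EP : Type*} [NormedAddCommGroup EP] [NormedSpace ℝ EP] [FiniteDimensional ℝ EP]
  {P : Type*} [TopologicalSpace P] [ChartedSpace EP P] [IsManifold 𝓘(ℝ, EP) ∞ P] [T2Space P]
  {J : TopologicalSpace.Opens ℝ}
  {G : ↥J × P → Type*} [∀ p, AddCommGroup (G p)] [∀ p, Module ℝ (G p)]
  {W : SmoothVectorBundle (𝓘(ℝ, ℝ).prod 𝓘(ℝ, EP)) (↥J × P) G}

/-- The tangent vector `∂_t` of `J × P`. -/
def timeVec (p : ↥J × P) : TangentSpace (𝓘(ℝ, ℝ).prod 𝓘(ℝ, EP)) p := ((1 : ℝ), (0 : EP))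

/-- On `J`, the manifold derivative is the derivative. -/
theorem SmoothFun.hasDerivAt {k : SmoothFun 𝓘(ℝ, ℝ) ↥J} {t : ↥J} {u : ℝ → ℝ}
    (h : ∀ᶠ s : ↥J in 𝓝 t, u s = k s) : HasDerivAt u (k.d t (1 : ℝ)) t := by
  have h1 := (k.mdifferentiableAt t).mfderiv
  have h2 := (k.mdifferentiableAt t).differentiableWithinAt_writtenInExtChartAt
  rw [ModelWithCorners.range_eq_univ] at h1 h2
  rw [fderivWithin_univ] at h1
  rw [differentiableWithinAt_univ] at h2
  have h3 : writtenInExtChartAt 𝓘(ℝ, ℝ) 𝓘(ℝ, ℝ) t k =ᶠ[𝓝 (t : ℝ)] u := by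
    have h4 : Tendsto (extChartAt 𝓘(ℝ, ℝ) t).symm (𝓝 (t : ℝ)) (𝓝 t) := by
      have h5 := continuousAt_extChartAt_symm (I := 𝓘(ℝ, ℝ)) t
      rw [ContinuousAt, extChartAt_to_inv] at h5
      exact h5
    filter_upwards [h4.eventually h, extChartAt_target_mem_nhds (I := 𝓘(ℝ, ℝ)) t] with s hs hs'
    change k ((extChartAt 𝓘(ℝ, ℝ) t).symm s) = _
    rw [← hs]
    exact congrArg u ((extChartAt 𝓘(ℝ, ℝ) t).right_inv hs')
  have h6 := h2.hasFDerivAt.congr_of_eventuallyEq h3.symm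
  have h7 := h6.hasDerivAt
  refine h7.congr_deriv ?_
  rw [← h1]
  rfl

/-- The inclusion of the line `J × {x}`. -/
def lineMap (J : TopologicalSpace.Opens ℝ) (x : P) :
    C^∞⟮𝓘(ℝ, ℝ), ↥J; 𝓘(ℝ, ℝ).prod 𝓘(ℝ, EP), ↥J × P⟯ :=
  ⟨fun t => (t, x), contMDiff_id.prodMk contMDiff_const⟩

theorem SmoothFun.d_lineMap (h : SmoothFun (𝓘(ℝ, ℝ).prod 𝓘(ℝ, EP)) (↥J × P)) (p : ↥J × P) :
    (h.pullback (lineMap J p.2)).d p.1 (1 : ℝ) = h.d p (timeVec p) := by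
  refine (SmoothFun.d_pullback h (lineMap J p.2) p.1 (1 : ℝ)).trans (congrArg (h.d p) ?_)
  have h1 := congrArg (fun l => l (1 : ℝ)) (mfderiv_prod_left (𝕜 := ℝ) (I := 𝓘(ℝ, ℝ))
    (I' := 𝓘(ℝ, EP)) (x₀ := p.1) (y₀ := p.2))
  exact h1

/-- The derivative of a function in the direction of `∂_t` is its derivative along the line through
the point. -/
theorem SmoothFun.hasDerivAt_line {h : SmoothFun (𝓘(ℝ, ℝ).prod 𝓘(ℝ, EP)) (↥J × P)} {p : ↥J × P}
    {u : ℝ → ℝ} (hu : ∀ᶠ q in 𝓝 p, q.2 = p.2 → u q.1 = h q) :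
    HasDerivAt u (h.d p (timeVec p)) p.1 := by
  rw [← SmoothFun.d_lineMap]
  refine SmoothFun.hasDerivAt ?_
  have h1 : Tendsto (lineMap (EP := EP) J p.2) (𝓝 p.1) (𝓝 p) :=
    (lineMap (EP := EP) J p.2).contMDiff.continuous.tendsto p.1
  filter_upwards [h1.eventually hu] with s hs
  exact hs rfl

/-- In a chart, a smooth function agrees near a point with a smooth function on the model space. -/
theorem exists_contDiff_chart (p : ↥J × P) (u : SmoothFun (𝓘(ℝ, ℝ).prod 𝓘(ℝ, EP)) (↥J × P)) :
    ∃ v : ℝ × EP → ℝ, ContDiff ℝ ∞ v ∧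
      ∀ᶠ q in 𝓝 p, v (extChartAt (𝓘(ℝ, ℝ).prod 𝓘(ℝ, EP)) p q) = u q := by
  have h1 : ContMDiffOn 𝓘(ℝ, ℝ × EP) 𝓘(ℝ, ℝ) ∞
      (fun z => u ((extChartAt (𝓘(ℝ, ℝ).prod 𝓘(ℝ, EP)) p).symm z))
      (extChartAt (𝓘(ℝ, ℝ).prod 𝓘(ℝ, EP)) p).target :=
    u.contMDiff.comp_contMDiffOn (contMDiffOn_extChartAt_symm p)
  obtain ⟨v, hv⟩ := exists_smoothFun_eventuallyEq (I := 𝓘(ℝ, ℝ × EP))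
    (extChartAt_target_mem_nhds (I := 𝓘(ℝ, ℝ).prod 𝓘(ℝ, EP)) p) h1
  refine ⟨v, v.contMDiff.contDiff, ?_⟩
  filter_upwards [(continuousAt_extChartAt p).eventually hv, extChartAt_source_mem_nhds
    (I := 𝓘(ℝ, ℝ).prod 𝓘(ℝ, EP)) p] with q hq hq'
  rw [hq, (extChartAt _ p).left_inv hq']

/-- A connection in the direction of `∂_t`. -/
structure LineConnection (W : SmoothVectorBundle (𝓘(ℝ, ℝ).prod 𝓘(ℝ, EP)) (↥J × P) G) where
  toFun : W.sections →ₗ[ℝ] W.sections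
  leibniz : ∀ (h : SmoothFun (𝓘(ℝ, ℝ).prod 𝓘(ℝ, EP)) (↥J × P)) (s : W.sections) p,
    (toFun (h • s)).1 p = h p • (toFun s).1 p + h.d p (timeVec p) • s.1 p

namespace LineConnection

variable (C : LineConnection W)

/-- The derivative at a point. -/
def derAt (p : ↥J × P) : W.PointDerivation p (timeVec p) where
  toFun := W.evalAt p ∘ₗ C.toFun
  leibniz h s := C.leibniz h s p

theorem congr {s s' : W.sections} {p : ↥J × P} (h : ∀ᶠ q in 𝓝 p, s.1 q = s'.1 q) :
    (C.toFun s).1 p = (C.toFun s').1 p := by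
  have h1 : (C.derAt p).toFun (s - s') = 0 := (C.derAt p).eq_zero_of_eventually (by
    filter_upwards [h] with q hq
    exact sub_eq_zero.2 hq)
  rw [map_sub, sub_eq_zero] at h1
  exact h1

theorem sum_smul {ι : Type*} [Fintype ι] (h : ι → SmoothFun (𝓘(ℝ, ℝ).prod 𝓘(ℝ, EP)) (↥J × P))
    (e : ι → W.sections) (p : ↥J × P) : (C.toFun (∑ i, h i • e i)).1 p =
      ∑ i, (h i p • (C.toFun (e i)).1 p + (h i).d p (timeVec p) • (e i).1 p) := by
  rw [map_sum, sections_sum_apply]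
  exact Finset.sum_congr rfl fun i _ => C.leibniz _ _ _

/-- Matrix-vector multiplication as a bilinear map. -/
def mulVecBilin (n : ℕ) : (Fin n → Fin n → ℝ) →L[ℝ] (Fin n → ℝ) →L[ℝ] Fin n → ℝ :=
  LinearMap.toContinuousLinearMap (LinearMap.toContinuousLinearMap.toLinearMap ∘ₗ
    LinearMap.mk₂ ℝ (fun M c i => ∑ j, M i j * c j)
      (fun M M' c => by ext i; simp [add_mul, Finset.sum_add_distrib])
      (fun r M c => by ext i; simp [mul_assoc, Finset.mul_sum])
      (fun M c c' => by ext i; simp [mul_add, Finset.sum_add_distrib])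
      (fun r M c => by ext i; simp [mul_left_comm, Finset.mul_sum]))

theorem mulVecBilin_apply {n : ℕ} (M : Fin n → Fin n → ℝ) (c : Fin n → ℝ) (i : Fin n) :
    mulVecBilin n M c i = ∑ j, M i j * c j := rfl

/-- The equation `∇s = r` with vanishing initial values has local solutions. -/
theorem exists_local_solution (r : W.sections) (p : ↥J × P) : ∃ S : W.sections,
    (∀ᶠ q in 𝓝 p, (C.toFun S).1 q = r.1 q) ∧ ∀ᶠ x in 𝓝 p.2, S.1 (p.1, x) = 0 := by
  obtain ⟨n, e, -, hfr⟩ := W.frame p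
  choose Γ hΓ using fun j => hfr (C.toFun (e j))
  obtain ⟨ρ, hρ⟩ := hfr r
  set Θ := extChartAt (𝓘(ℝ, ℝ).prod 𝓘(ℝ, EP)) p with hΘ
  have hΘ1 : ∀ q, (Θ q).1 = q.1 := fun q => rfl
  have hΘ2 : ∀ q, (Θ q).2 = extChartAt 𝓘(ℝ, EP) p.2 q.2 := fun q => rfl
  choose a ha haΓ using fun j i => exists_contDiff_chart p (Γ j i)
  choose b hb hbρ using fun i => exists_contDiff_chart p (ρ i)
  simp only [← hΘ] at haΓ hbρ
  have hA : ContDiff ℝ ∞ fun z => (fun i j => -a j i z : Fin n → Fin n → ℝ) :=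
    contDiff_pi.2 fun i => contDiff_pi.2 fun j => (ha j i).neg
  obtain ⟨ε, hε, hsol⟩ := exists_linear_ode_solution (mulVecBilin n) hA (Θ p)
  obtain ⟨c, hcs, hc0, hode⟩ := hsol _ (Metric.mem_ball_self hε) (fun z i => b i z)
    (contDiff_pi.2 hb)
  have hΘc : ContinuousAt Θ p := continuousAt_extChartAt p
  have hU : Θ ⁻¹' Metric.ball (Θ p) ε ∈ 𝓝 p := hΘc (Metric.ball_mem_nhds _ hε)
  have hU' := extChartAt_source_mem_nhds (I := 𝓘(ℝ, ℝ).prod 𝓘(ℝ, EP)) p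
  have hcm : ∀ i, ContMDiffOn (𝓘(ℝ, ℝ).prod 𝓘(ℝ, EP)) 𝓘(ℝ, ℝ) ∞ (fun q => c (Θ q) i)
      (Θ.source ∩ Θ ⁻¹' Metric.ball (Θ p) ε) := fun i => by
    have h1 : ContDiffOn ℝ ∞ (fun z => c z i) (Metric.ball (Θ p) ε) := contDiffOn_pi.1 hcs i
    have h2 : ContMDiffOn (𝓘(ℝ, ℝ).prod 𝓘(ℝ, EP)) 𝓘(ℝ, ℝ × EP) ∞ Θ Θ.source := by
      rw [hΘ, extChartAt_source]
      exact contMDiffOn_extChartAt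
    exact h1.contMDiffOn.comp (h2.mono inter_subset_left) fun q hq => hq.2
  choose K hK using fun i => exists_smoothFun_eventuallyEq (inter_mem hU' hU) (hcm i)
  refine ⟨∑ i, K i • e i, ?_, ?_⟩
  · filter_upwards [eventually_all.2 fun i => (hK i).eventually_nhds, eventually_all.2 hΓ, hρ, hU,
      eventually_all.2 fun j => eventually_all.2 (haΓ j), eventually_all.2 hbρ]
      with q h1 h2 h3 h4 h5 h6
    have h7 : ∀ i, SmoothFun.d (K i) q (timeVec q) = -(∑ j, Γ j i q * K j q) + ρ i q := fun i => by
      have h8 : HasDerivAt (fun t => c (t, (Θ q).2) i) (SmoothFun.d (K i) q (timeVec q)) q.1 := by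
        refine SmoothFun.hasDerivAt_line ?_
        filter_upwards [h1 i] with q' hq' h
        rw [hq', hΘ2, ← h]
        rfl
      have h9 := hasDerivAt_pi.1 (hode (Θ q) h4) i
      rw [hΘ1] at h9
      rw [h8.unique h9]
      simp only [Pi.add_apply, mulVecBilin_apply, h5, h6, neg_mul, Finset.sum_neg_distrib,
        (h1 _).self_of_nhds]
    rw [C.sum_smul, h3]
    simp only [h2, h7, add_smul, neg_smul, Finset.smul_sum, Finset.sum_add_distrib, Finset.sum_smul,
      smul_smul, Finset.sum_neg_distrib]
    rw [Finset.sum_comm, ← add_assoc]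
    simp only [mul_comm, add_neg_cancel, zero_add]
  · have h1 : Tendsto (fun x => (p.1, x)) (𝓝 p.2) (𝓝 p) :=
      (Continuous.prodMk_right p.1).tendsto p.2
    filter_upwards [h1.eventually (eventually_all.2 hK), h1.eventually hU] with x h2 h3
    rw [sections_sum_apply]
    refine Finset.sum_eq_zero fun i _ => ?_
    have h4 : c (Θ (p.1, x)) = 0 := hc0 _ (by
      have h5 : Θ (p.1, x) ∈ Metric.ball (Θ p) ε := h3
      rw [Metric.mem_ball, Prod.dist_eq] at h5
      exact Metric.mem_ball.2 ((le_max_right _ _).trans_lt h5))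
    rw [fun_smul_apply, h2 i, h4, Pi.zero_apply, zero_smul]

/-- Around every point there is a parallel frame. -/
theorem exists_flat_frame (p : ↥J × P) : ∃ (n : ℕ) (f : Fin n → W.sections),
    LinearIndependent ℝ (fun i => (f i).1 p) ∧
    ⊤ ≤ Submodule.span ℝ (Set.range fun i => (f i).1 p) ∧
    ∀ᶠ q in 𝓝 p, ∀ i, (C.toFun (f i)).1 q = 0 := by
  obtain ⟨n, e, he, -⟩ := W.frame p
  choose S hS hS0 using fun i => C.exists_local_solution (C.toFun (e i)) p
  have h1 : (fun i => (e i - S i).1 p) = fun i => (e i).1 p := funext fun i => by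
    change (e i).1 p - (S i).1 p = _
    rw [show (S i).1 p = 0 from (hS0 i).self_of_nhds, sub_zero]
  refine ⟨n, fun i => e i - S i, ?_, ?_, ?_⟩
  · rw [h1]; exact he.self_of_nhds.1
  · rw [h1]; exact he.self_of_nhds.2
  · filter_upwards [eventually_all.2 hS] with q hq i
    rw [map_sub]
    exact sub_eq_zero.2 (hq i).symm

/-- Functions whose time derivative vanishes on a line are locally constant on the line. -/
theorem eventually_eq_of_d_eq_zero {h : SmoothFun (𝓘(ℝ, ℝ).prod 𝓘(ℝ, EP)) (↥J × P)} {p : ↥J × P}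
    (hd : ∀ᶠ t in 𝓝 p.1, h.d (t, p.2) (timeVec (t, p.2)) = 0) :
    ∀ᶠ t in 𝓝 p.1, h (t, p.2) = h p := by
  classical
  obtain ⟨ε, hε, hb⟩ := Metric.eventually_nhds_iff_ball.1 hd
  obtain ⟨ε', hε', hb'⟩ := Metric.isOpen_iff.1 J.isOpen p.1 p.1.2
  let u : ℝ → ℝ := fun s => if hs : s ∈ J then h (⟨s, hs⟩, p.2) else 0
  have hu : ∀ t : ↥J, u t = h (t, p.2) := fun t => dif_pos t.2
  have hder : ∀ s ∈ Metric.ball (p.1 : ℝ) (min ε ε'), HasDerivAt u 0 s := by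
    intro s hs
    have hsJ : s ∈ J := hb' (Metric.ball_subset_ball (min_le_right _ _) hs)
    have h1 := hb ⟨s, hsJ⟩ (Metric.ball_subset_ball (min_le_left _ _) hs)
    have h2 := SmoothFun.hasDerivAt_line (h := h) (p := (⟨s, hsJ⟩, p.2)) (u := u)
      (.of_forall fun q hq => by rw [hu, ← hq])
    rwa [h1] at h2
  filter_upwards [Metric.ball_mem_nhds p.1 (lt_min hε hε')] with t ht
  rw [← hu]
  refine Eq.trans ?_ (hu p.1)
  exact Metric.isOpen_ball.is_const_of_deriv_eq_zero (convex_ball _ _).isPreconnected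
    (fun s hs => (hder s hs).differentiableAt.differentiableWithinAt)
    (fun s hs => (hder s hs).deriv) ht (Metric.mem_ball_self (lt_min hε hε'))

/-- A not necessarily smooth section `s` is near the point `p` a smooth section, and satisfies
`∇s = r` at `p`. -/
def IsSolAt (s : Π p, G p) (r : W.sections) (p : ↥J × P) : Prop :=
  ∃ S : W.sections, (∀ᶠ q in 𝓝 p, s q = S.1 q) ∧ (C.toFun S).1 p = r.1 p

variable {C} in
theorem IsSolAt.congr_of_eventuallyEq {s s' : Π p, G p} {r : W.sections} {p : ↥J × P}
    (h : C.IsSolAt s r p) (h' : ∀ᶠ q in 𝓝 p, s' q = s q) : C.IsSolAt s' r p := by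
  obtain ⟨S, h1, h2⟩ := h
  exact ⟨S, by filter_upwards [h1, h'] with q h3 h4; rw [h4, h3], h2⟩

variable {C} in
theorem IsSolAt.sub {s s' : Π p, G p} {r r' : W.sections} {p : ↥J × P}
    (h : C.IsSolAt s r p) (h' : C.IsSolAt s' r' p) : C.IsSolAt (s - s') (r - r') p := by
  obtain ⟨S, h1, h2⟩ := h
  obtain ⟨S', h1', h2'⟩ := h'
  refine ⟨S - S', by filter_upwards [h1, h1'] with q h3 h4; simp [h3, h4], ?_⟩
  rw [map_sub]
  exact congrArg₂ (· - ·) h2 h2'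

theorem isSolAt_self (s : W.sections) (p : ↥J × P) : C.IsSolAt s.1 (C.toFun s) p :=
  ⟨s, .of_forall fun _ => rfl, rfl⟩

/-- Along a line, vanishing of a parallel section is locally constant: the coefficients in a
parallel frame are constant in time. -/
theorem eventually_eq_zero_iff {s : Π p, G p} {p : ↥J × P}
    (h : ∀ᶠ t in 𝓝 p.1, C.IsSolAt s 0 (t, p.2)) :
    ∀ᶠ t in 𝓝 p.1, (s p = 0 ↔ s (t, p.2) = 0) := by
  obtain ⟨S, hS, -⟩ : C.IsSolAt s 0 p := h.self_of_nhds
  obtain ⟨n, f, hli, hsp, hf⟩ := C.exists_flat_frame p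
  obtain ⟨hfr, hco⟩ := W.frame_of_basis f p hli hsp
  obtain ⟨k, hk⟩ := hco S
  have hline : Tendsto (fun t => (t, p.2)) (𝓝 p.1) (𝓝 p) :=
    (Continuous.prodMk_left p.2).tendsto p.1
  have hd : ∀ i, ∀ᶠ t in 𝓝 p.1, (k i).d (t, p.2) (timeVec (t, p.2)) = 0 := by
    refine eventually_all.1 ?_
    filter_upwards [h, hline.eventually hS.eventually_nhds, hline.eventually hk.eventually_nhds,
      hline.eventually hfr, hline.eventually hf] with t h1 h2 h3 h4 h5
    obtain ⟨S', h6, h7⟩ := h1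
    have h8 : (C.toFun (∑ i, k i • f i)).1 (t, p.2) = 0 := by
      rw [← show (C.toFun S').1 (t, p.2) = 0 from h7]
      refine C.congr ?_
      filter_upwards [h2, h3, h6] with q h9 h10 h11
      rw [sections_sum_apply, ← h11, h9, h10]
      rfl
    rw [C.sum_smul] at h8
    simp only [h5, smul_zero, zero_add] at h8
    exact Fintype.linearIndependent_iff.1 h4.1 _ h8
  filter_upwards [eventually_all.2 fun i => eventually_eq_of_d_eq_zero (hd i),
    hline.eventually hS, hline.eventually hk, hline.eventually hfr] with t h1 h2 h3 h4
  have h5 : ∀ q, LinearIndependent ℝ (fun i => (f i).1 q) → s q = ∑ i, k i q • (f i).1 q →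
      (s q = 0 ↔ ∀ i, k i q = 0) := fun q hq hs => by
    rw [hs]
    exact ⟨Fintype.linearIndependent_iff.1 hq _, fun h => by simp [h]⟩
  rw [h5 p hli (hS.self_of_nhds.trans hk.self_of_nhds), h5 _ h4.1 (h2.trans h3)]
  simp only [h1]

/-- Solutions are determined on a line by their value at one point of the line. -/
theorem IsSolAt.eq_on_line {I : Set ↥J} (hI : IsPreconnected I) (hI' : IsOpen I)
    {s s' : Π p, G p} {r : W.sections} {x : P} (h : ∀ t ∈ I, C.IsSolAt s r (t, x))
    (h' : ∀ t ∈ I, C.IsSolAt s' r (t, x)) {t₀ : ↥J} (ht₀ : t₀ ∈ I) (h0 : s (t₀, x) = s' (t₀, x))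
    {t : ↥J} (ht : t ∈ I) : s (t, x) = s' (t, x) := by
  have h1 : (s - s') (t₀, x) = 0 ↔ (s - s') (t, x) = 0 := by
    refine hI.induction₂ (fun t t' => (s - s') (t, x) = 0 ↔ (s - s') (t', x) = 0) ?_
      (fun _ _ _ _ _ _ => Iff.trans) (fun _ _ _ _ => Iff.symm) ht₀ ht
    intro t ht
    rw [hI'.nhdsWithin_eq ht]
    refine C.eventually_eq_zero_iff (p := (t, x)) ?_
    filter_upwards [hI'.mem_nhds ht] with t' ht'
    have := (h t' ht').sub (h' t' ht')
    rwa [sub_self] at this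
  exact sub_eq_zero.1 (h1.1 (sub_eq_zero.2 h0))

theorem isPreconnected_preimage_val (hJ : (J : Set ℝ).OrdConnected) {O : Set ℝ}
    (hO : O.OrdConnected) : IsPreconnected ((Subtype.val : ↥J → ℝ) ⁻¹' O) := by
  have h : (Subtype.val : ↥J → ℝ) '' (Subtype.val ⁻¹' O) = (J : Set ℝ) ∩ O :=
    Subtype.image_preimage_coe (J : Set ℝ) O
  refine Topology.IsInducing.subtypeVal.isPreconnected_image.1 ?_
  have h' := isPreconnected_iff_ordConnected.2 (hJ.inter hO)
  rw [← h] at h'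
  exact h'

/-- Sections with the same derivative along a line that agree at one point of the line agree on it.
-/
theorem line_unique (hJ : (J : Set ℝ).OrdConnected) {s s' : W.sections} {x : P}
    (h : ∀ t, (C.toFun s).1 (t, x) = (C.toFun s').1 (t, x)) {t₀ : ↥J}
    (h0 : s.1 (t₀, x) = s'.1 (t₀, x)) (t : ↥J) : s.1 (t, x) = s'.1 (t, x) := by
  have hI := isPreconnected_preimage_val hJ (O := univ) ordConnected_univ
  exact IsSolAt.eq_on_line C hI isOpen_univ (r := C.toFun s)
    (fun t _ => C.isSolAt_self s _)
    (fun t _ => ⟨s', .of_forall fun _ => rfl, (h t).symm⟩) (mem_univ _) h0 (mem_univ _)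

/-- The map `(t, x) ↦ (t₀, x)`. -/
def collapse (P : Type*) [TopologicalSpace P] [ChartedSpace EP P] (t₀ : ↥J) :
    C^∞⟮𝓘(ℝ, ℝ).prod 𝓘(ℝ, EP), ↥J × P; 𝓘(ℝ, ℝ).prod 𝓘(ℝ, EP), ↥J × P⟯ :=
  ⟨fun p => (t₀, p.2), contMDiff_const.prodMk contMDiff_snd⟩

theorem d_collapse (h : SmoothFun (𝓘(ℝ, ℝ).prod 𝓘(ℝ, EP)) (↥J × P)) (t₀ : ↥J) (p : ↥J × P) :
    (h.pullback (collapse P t₀)).d p (timeVec p) = 0 := by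
  have h1 := SmoothFun.hasDerivAt_line (h := h.pullback (collapse P t₀)) (p := p)
    (u := fun _ => h (t₀, p.2)) (.of_forall fun q hq => by rw [← hq]; rfl)
  exact h1.unique (hasDerivAt_const _ _)

/-- Near every point, solutions exist with arbitrary initial values at arbitrary nearby times; the
neighbourhood of the initial time does not depend on the initial values. -/
theorem exists_solution_through (r : W.sections) (p : ↥J × P) :
    ∃ O : Set ℝ, IsOpen O ∧ O.OrdConnected ∧ (p.1 : ℝ) ∈ O ∧ ∃ U ∈ 𝓝 p.2,
      ∀ t₀ : ↥J, (t₀ : ℝ) ∈ O → ∀ w : W.sections, ∃ S : W.sections,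
        (∀ t : ↥J, (t : ℝ) ∈ O → ∀ x ∈ U, (C.toFun S).1 (t, x) = r.1 (t, x)) ∧
        ∀ᶠ x in 𝓝 p.2, S.1 (t₀, x) = w.1 (t₀, x) := by
  obtain ⟨n, f, hli, hsp, hf⟩ := C.exists_flat_frame p
  obtain ⟨hfr, -⟩ := W.frame_of_basis f p hli hsp
  obtain ⟨R, hR, -⟩ := C.exists_local_solution r p
  have h1 := (hf.and hR).and hfr
  rw [show p = (p.1, p.2) from rfl, nhds_prod_eq, eventually_prod_iff] at h1
  obtain ⟨p1, hp1, p2, hp2, h2⟩ := h1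
  obtain ⟨ε, hε, hb⟩ := Metric.eventually_nhds_iff_ball.1 hp1
  refine ⟨Metric.ball p.1 ε, Metric.isOpen_ball, (convex_ball _ _).ordConnected,
    Metric.mem_ball_self hε, {x | p2 x}, hp2, fun t₀ ht₀ w => ?_⟩
  have h3 := (h2 (hb t₀ ht₀) hp2.self_of_nhds).2
  obtain ⟨k, hk⟩ := (W.frame_of_basis f (t₀, p.2) h3.1 h3.2).2 (w - R)
  -- correct a particular solution by a parallel section: the coefficients of the initial values in
  -- a parallel frame, extended constantly in time
  refine ⟨R + ∑ i, (k i).pullback (collapse P t₀) • f i, fun t ht x hx => ?_, ?_⟩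
  · obtain ⟨⟨h4, h5⟩, -⟩ := h2 (hb t ht) hx
    rw [map_add]
    change (C.toFun R).1 (t, x) + (C.toFun (∑ i, (k i).pullback (collapse P t₀) • f i)).1 (t, x) = _
    rw [C.sum_smul, h5]
    simp [h4, d_collapse]
  · have h4 : Tendsto (fun x => (t₀, x)) (𝓝 p.2) (𝓝 (t₀, p.2)) :=
      (Continuous.prodMk_right t₀).tendsto p.2
    filter_upwards [h4.eventually hk] with x hx
    change R.1 (t₀, x) + (∑ i, (k i).pullback (collapse P t₀) • f i : W.sections).1 (t₀, x) = _
    rw [sections_sum_apply]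
    exact (sub_eq_iff_eq_add'.1 hx).symm

/-- There is a solution with the given initial values near the segment `[t₀, t] × {x₁}`. -/
def Solvable (r : W.sections) {t₀ : ↥J} (s₀ : ∀ x, G (t₀, x)) (x₁ : P) (t : ↥J) : Prop :=
  ∃ s : Π p, G p, ∃ U ∈ 𝓝 x₁, ∃ O : Set ℝ, IsOpen O ∧ O.OrdConnected ∧ (t₀ : ℝ) ∈ O ∧
    (t : ℝ) ∈ O ∧ (∀ t' : ↥J, (t' : ℝ) ∈ O → ∀ x ∈ U, C.IsSolAt s r (t', x)) ∧
    ∀ x ∈ U, s (t₀, x) = s₀ x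

/-- Solvability up to time `t` is open and closed in `t`. -/
theorem eventually_solvable (hJ : (J : Set ℝ).OrdConnected) {r : W.sections} {t₀ : ↥J}
    {s₀ : ∀ x, G (t₀, x)} {x₁ : P} (t₁ : ↥J) : ∀ᶠ t in 𝓝 t₁,
      (C.Solvable r s₀ x₁ t₁ ↔ C.Solvable r s₀ x₁ t) := by
  classical
  obtain ⟨O', hO', hO'c, hO't, U', hU', hsol⟩ := C.exists_solution_through r (t₁, x₁)
  have key : ∀ t₂ t₃ : ↥J, (t₂ : ℝ) ∈ O' → (t₃ : ℝ) ∈ O' → C.Solvable r s₀ x₁ t₂ →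
      C.Solvable r s₀ x₁ t₃ := by
    rintro t₂ t₃ ht₂ ht₃ ⟨s, U, hU, O, hO, hOc, hOt₀, hOt₂, hs, hs0⟩
    obtain ⟨w, hw, -⟩ := hs t₂ hOt₂ x₁ (mem_of_mem_nhds hU)
    obtain ⟨S, hS, hS0⟩ := hsol t₂ ht₂ w
    have hline : Tendsto (fun x => (t₂, x)) (𝓝 x₁) (𝓝 (t₂, x₁)) :=
      (Continuous.prodMk_right t₂).tendsto x₁
    obtain ⟨U₂, hU₂, hU₂o, hU₂x⟩ := mem_nhds_iff.1 (inter_mem (inter_mem hU hU')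
      (inter_mem hS0 (hline.eventually hw)))
    -- both solutions agree where both are defined, since they agree at time `t₂`
    have heq : ∀ t : ↥J, (t : ℝ) ∈ O → (t : ℝ) ∈ O' → ∀ x ∈ U₂, s (t, x) = S.1 (t, x) := by
      intro t ht ht' x hx
      refine IsSolAt.eq_on_line C (I := Subtype.val ⁻¹' (O ∩ O'))
        (isPreconnected_preimage_val hJ (hOc.inter hO'c))
        ((hO.inter hO').preimage continuous_subtype_val) (r := r)
        (fun t' ht' => hs t' ht'.1 x (hU₂ hx).1.1)
        (fun t' ht' => ⟨S, .of_forall fun _ => rfl, hS t' ht'.2 x (hU₂ hx).1.2⟩)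
        (t₀ := t₂) ⟨hOt₂, ht₂⟩ ?_ ⟨ht, ht'⟩
      exact (hU₂ hx).2.2.trans (hU₂ hx).2.1.symm
    refine ⟨fun q => if (q.1 : ℝ) ∈ O then s q else S.1 q, U₂, hU₂o.mem_nhds hU₂x, O ∪ O',
      hO.union hO', ?_, .inl hOt₀, .inr ht₃, fun t ht x hx => ?_, fun x hx => ?_⟩
    · exact isPreconnected_iff_ordConnected.1 (IsPreconnected.union (t₂ : ℝ) hOt₂ ht₂
        hOc.isPreconnected hO'c.isPreconnected)
    · by_cases h : (t : ℝ) ∈ O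
      · refine (hs t h x (hU₂ hx).1.1).congr_of_eventuallyEq ?_
        have h1 : ∀ᶠ q : ↥J × P in 𝓝 (t, x), (q.1 : ℝ) ∈ O :=
          (continuous_subtype_val.comp continuous_fst).continuousAt.eventually (hO.mem_nhds h)
        filter_upwards [h1] with q hq
        exact if_pos hq
      · have h' : (t : ℝ) ∈ O' := ht.resolve_left h
        refine ⟨S, ?_, hS t h' x (hU₂ hx).1.2⟩
        have h1 : ∀ᶠ q : ↥J × P in 𝓝 (t, x), (q.1 : ℝ) ∈ O' :=
          (continuous_subtype_val.comp continuous_fst).continuousAt.eventually (hO'.mem_nhds h')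
        have h2 : ∀ᶠ q : ↥J × P in 𝓝 (t, x), q.2 ∈ U₂ :=
          continuous_snd.continuousAt.eventually (hU₂o.mem_nhds hx)
        filter_upwards [h1, h2] with q hq hq'
        split_ifs with hqO
        · exact heq q.1 hqO hq q.2 hq'
        · rfl
    · exact (if_pos hOt₀).trans (hs0 x (hU₂ hx).1.1)
  filter_upwards [(hO'.preimage continuous_subtype_val).mem_nhds hO't] with t ht
  exact ⟨key t₁ t hO't ht, key t t₁ ht hO't⟩

/-- The equation `∇s = r` has a global solution with given initial values. -/
theorem exists_transport (hJ : (J : Set ℝ).OrdConnected) (r : W.sections) (t₀ : ↥J)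
    (s₀ : ∀ x, G (t₀, x))
    (hs₀ : ∀ x₁, ∃ w : W.sections, ∀ᶠ x in 𝓝 x₁, s₀ x = w.1 (t₀, x)) :
    ∃ s : W.sections, C.toFun s = r ∧ ∀ x, s.1 (t₀, x) = s₀ x := by
  have hsol : ∀ x₁ t, C.Solvable r s₀ x₁ t := by
    intro x₁ t
    have h0 : C.Solvable r s₀ x₁ t₀ := by
      obtain ⟨O, hO, hOc, hOt, U, hU, h⟩ := C.exists_solution_through r (t₀, x₁)
      obtain ⟨w, hw⟩ := hs₀ x₁
      obtain ⟨S, hS, hS0⟩ := h t₀ hOt w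
      refine ⟨S.1, _, inter_mem hU (inter_mem hw hS0), O, hO, hOc, hOt, hOt, fun t ht x hx =>
        ⟨S, .of_forall fun _ => rfl, hS t ht x hx.1⟩, fun x hx => ?_⟩
      exact hx.2.2.trans hx.2.1.symm
    have hI := isPreconnected_preimage_val hJ (O := univ) ordConnected_univ
    exact (hI.induction₂ (fun t t' => C.Solvable r s₀ x₁ t ↔ C.Solvable r s₀ x₁ t')
      (fun t _ => (C.eventually_solvable hJ t).filter_mono inf_le_left)
      (fun _ _ _ _ _ _ => Iff.trans) (fun _ _ _ _ => Iff.symm) (mem_univ t₀) (mem_univ t)).1 h0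
  -- at `(t, x)` take the solution that was found for `x` and `t`; by uniqueness on lines, it is
  -- near each point equal to a single local solution
  choose s U hU O hO hOc hOt₀ hOt hs hs0 using hsol
  have heq : ∀ (t : ↥J) (x₁ : P) (t' : ↥J), (t' : ℝ) ∈ O x₁ t → ∀ x ∈ U x₁ t,
      s x t' (t', x) = s x₁ t (t', x) := by
    intro t x₁ t' ht' x hx
    have hx' := mem_of_mem_nhds (hU x t')
    refine IsSolAt.eq_on_line C (I := Subtype.val ⁻¹' (O x t' ∩ O x₁ t))
      (isPreconnected_preimage_val hJ ((hOc _ _).inter (hOc _ _)))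
      (((hO _ _).inter (hO _ _)).preimage continuous_subtype_val) (r := r)
      (fun t'' h => hs x t' t'' h.1 x hx') (fun t'' h => hs x₁ t t'' h.2 x hx)
      (t₀ := t₀) ⟨hOt₀ _ _, hOt₀ _ _⟩ ?_ ⟨hOt _ _, ht'⟩
    rw [hs0 x t' x hx', hs0 x₁ t x hx]
  have hev : ∀ p : ↥J × P, ∀ᶠ q in 𝓝 p, s q.2 q.1 q = s p.2 p.1 q := by
    intro p
    have h1 : ∀ᶠ q : ↥J × P in 𝓝 p, (q.1 : ℝ) ∈ O p.2 p.1 :=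
      (continuous_subtype_val.comp continuous_fst).continuousAt.eventually
        ((hO p.2 p.1).mem_nhds (hOt p.2 p.1))
    have h2 : ∀ᶠ q : ↥J × P in 𝓝 p, q.2 ∈ U p.2 p.1 :=
      continuous_snd.continuousAt.eventually (hU p.2 p.1)
    filter_upwards [h1, h2] with q hq hq'
    exact heq p.1 p.2 q.1 hq q.2 hq'
  have hsolp : ∀ p : ↥J × P, C.IsSolAt (fun q => s q.2 q.1 q) r p := fun p =>
    (hs p.2 p.1 p.1 (hOt _ _) p.2 (mem_of_mem_nhds (hU _ _))).congr_of_eventuallyEq (hev p)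
  have hmem : (fun q => s q.2 q.1 q) ∈ W.sections := W.mem_of_locally _ fun p => by
    obtain ⟨S, hS, -⟩ := hsolp p
    exact ⟨S.1, S.2, hS⟩
  refine ⟨⟨_, hmem⟩, Subtype.ext (funext fun p => ?_), fun x => ?_⟩
  · obtain ⟨S, hS, hS'⟩ := hsolp p
    rw [← hS']
    exact C.congr hS
  · exact hs0 x t₀ x (mem_of_mem_nhds (hU _ _))

end LineConnection
end Lines

/-! ### Parallel sections and parallel forms -/

section Slices

variable {EP : Type*} [NormedAddCommGroup EP] [NormedSpace ℝ EP] [FiniteDimensional ℝ EP]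
  {P : Type*} [TopologicalSpace P] [ChartedSpace EP P] [IsManifold 𝓘(ℝ, EP) ∞ P] [T2Space P]
  {J : TopologicalSpace.Opens ℝ}
  {A : ↥J × P → Type*} [∀ p, AddCommGroup (A p)] [∀ p, Module ℝ (A p)]
  {G : ↥J × P → Type*} [∀ p, AddCommGroup (G p)] [∀ p, Module ℝ (G p)]
  {V : SmoothVectorBundle (𝓘(ℝ, ℝ).prod 𝓘(ℝ, EP)) (↥J × P) A}
  {W : SmoothVectorBundle (𝓘(ℝ, ℝ).prod 𝓘(ℝ, EP)) (↥J × P) G}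

/-- The inclusion `x ↦ (t, x)` of a slice. -/
def sliceMap (P : Type*) [TopologicalSpace P] [ChartedSpace EP P] (t : ↥J) :
    C^∞⟮𝓘(ℝ, EP), P; 𝓘(ℝ, ℝ).prod 𝓘(ℝ, EP), ↥J × P⟯ :=
  ⟨fun x => (t, x), contMDiff_const.prodMk contMDiff_id⟩

/-- The time coordinate on `J × P`. -/
def timeFun (J : TopologicalSpace.Opens ℝ) (P : Type*) [TopologicalSpace P] [ChartedSpace EP P] :
    SmoothFun (𝓘(ℝ, ℝ).prod 𝓘(ℝ, EP)) (↥J × P) :=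
  ⟨fun p => (p.1 : ℝ), contMDiff_subtype_val.comp contMDiff_fst⟩

theorem mfderiv_sliceMap (t : ↥J) (x : P) (v : TangentSpace 𝓘(ℝ, EP) x) :
    mfderiv 𝓘(ℝ, EP) (𝓘(ℝ, ℝ).prod 𝓘(ℝ, EP)) (sliceMap (EP := EP) P t) x v =
      ((0 : ℝ), (v : EP)) :=
  congrArg (fun l => l v) (mfderiv_prod_right (𝕜 := ℝ) (I := 𝓘(ℝ, ℝ)) (I' := 𝓘(ℝ, EP))
    (x₀ := t) (y₀ := x))

theorem d_timeFun (p : ↥J × P) (z : TangentSpace (𝓘(ℝ, ℝ).prod 𝓘(ℝ, EP)) p) :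
    (timeFun (EP := EP) J P).d p z = (show ℝ × EP from z).1 := by
  let k : SmoothFun 𝓘(ℝ, ℝ) ↥J := ⟨fun t => (t : ℝ), contMDiff_subtype_val⟩
  have h1 : k.d p.1 (1 : ℝ) = 1 :=
    (SmoothFun.hasDerivAt (k := k) (t := p.1) (u := id) (.of_forall fun _ => rfl)).unique
      (hasDerivAt_id _)
  have h2 := SmoothFun.d_pullback k (⟨Prod.fst, contMDiff_fst⟩ :
    C^∞⟮𝓘(ℝ, ℝ).prod 𝓘(ℝ, EP), ↥J × P; 𝓘(ℝ, ℝ), ↥J⟯) p z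
  have h3 : mfderiv (𝓘(ℝ, ℝ).prod 𝓘(ℝ, EP)) 𝓘(ℝ, ℝ) (Prod.fst : ↥J × P → ↥J) p z =
      (show ℝ × EP from z).1 := congrArg (fun l => l z) mfderiv_fst
  refine h2.trans ((congrArg (k.d p.1) h3).trans ?_)
  have h4 := (k.d p.1).map_smul (show ℝ × EP from z).1 (1 : ℝ)
  rw [h1] at h4
  refine Eq.trans (congrArg (k.d p.1) ?_) (h4.trans (mul_one _))
  exact (mul_one (show ℝ × EP from z).1).symm

theorem d_timeFun_timeVec (p : ↥J × P) : (timeFun (EP := EP) J P).d p (timeVec p) = 1 :=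
  d_timeFun p _

theorem d_timeFun_sliceMap (t : ↥J) (x : P) (v : TangentSpace 𝓘(ℝ, EP) x) :
    (timeFun (EP := EP) J P).d (t, x)
      (mfderiv 𝓘(ℝ, EP) (𝓘(ℝ, ℝ).prod 𝓘(ℝ, EP)) (sliceMap (EP := EP) P t) x v) = 0 :=
  (d_timeFun _ _).trans (congrArg (fun z : ℝ × EP => z.1) (mfderiv_sliceMap t x v))

/-- The differential of the projection `J × P → P`. -/
def spacePart (p : ↥J × P) :
    TangentSpace (𝓘(ℝ, ℝ).prod 𝓘(ℝ, EP)) p →ₗ[ℝ] TangentSpace 𝓘(ℝ, EP) p.2 :=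
  (mfderiv (𝓘(ℝ, ℝ).prod 𝓘(ℝ, EP)) 𝓘(ℝ, EP) (Prod.snd : ↥J × P → P) p).toLinearMap

theorem spacePart_apply (p : ↥J × P) (z : TangentSpace (𝓘(ℝ, ℝ).prod 𝓘(ℝ, EP)) p) :
    spacePart p z = (show ℝ × EP from z).2 := congrArg (fun l => l z) mfderiv_snd

theorem spacePart_sliceMap (t : ↥J) (x : P) (v : TangentSpace 𝓘(ℝ, EP) x) :
    spacePart (t, x)
      (mfderiv 𝓘(ℝ, EP) (𝓘(ℝ, ℝ).prod 𝓘(ℝ, EP)) (sliceMap (EP := EP) P t) x v) = v :=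
  (spacePart_apply _ _).trans (congrArg (fun z : ℝ × EP => z.2) (mfderiv_sliceMap t x v))

theorem sliceMap_spacePart (t : ↥J) (x : P)
    (z : TangentSpace (𝓘(ℝ, ℝ).prod 𝓘(ℝ, EP)) ((t, x) : ↥J × P)) :
    mfderiv 𝓘(ℝ, EP) (𝓘(ℝ, ℝ).prod 𝓘(ℝ, EP)) (sliceMap (EP := EP) P t) x
      (spacePart (t, x) z) = z - (timeFun (EP := EP) J P).d (t, x) z • timeVec (t, x) := by
  rw [mfderiv_sliceMap, d_timeFun, spacePart_apply]
  refine Prod.ext ?_ ?_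
  · change (0 : ℝ) = (show ℝ × EP from z).1 - (show ℝ × EP from z).1 * 1
    ring
  · change (show ℝ × EP from z).2 = (show ℝ × EP from z).2 - (show ℝ × EP from z).1 • (0 : EP)
    simp

namespace LineConnection

variable (C : LineConnection W) (hJ : (J : Set ℝ).OrdConnected)

/-- Sections with the same derivative that agree on a slice are equal. -/
theorem eq_of_slice (hJ : (J : Set ℝ).OrdConnected) (t₀ : ↥J) {s s' : W.sections}
    (h : C.toFun s = C.toFun s') (h0 : ∀ x, s.1 (t₀, x) = s'.1 (t₀, x)) : s = s' :=
  Subtype.ext (funext fun p => C.line_unique hJ (fun t => by rw [h]) (h0 p.2) p.1)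

/-- Sections on a slice extend locally. -/
theorem exists_local_extension (t₀ : ↥J) (s₀ : (W.pullback (sliceMap P t₀)).sections) (x₁ : P) :
    ∃ w : W.sections, ∀ᶠ x in 𝓝 x₁, s₀.1 x = w.1 (t₀, x) := by
  obtain ⟨τ, hτ⟩ := s₀.2 x₁
  have key : ∃ w : W.sections, ∀ x, W.ev (sliceMap P t₀) x τ = w.1 (t₀, x) := by
    clear hτ
    induction τ with
    | zero => exact ⟨0, fun x => map_zero _⟩
    | tmul h b =>
      let k : SmoothFun (𝓘(ℝ, ℝ).prod 𝓘(ℝ, EP)) (↥J × P) :=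
        ⟨fun p => h p.2, h.contMDiff.comp contMDiff_snd⟩
      refine ⟨k • b, fun x => ?_⟩
      rw [W.ev_tmul, fun_smul_apply]
      rfl
    | add τ τ' h h' =>
      obtain ⟨w, hw⟩ := h
      obtain ⟨w', hw'⟩ := h'
      exact ⟨w + w', fun x => by rw [map_add, hw, hw']; rfl⟩
  obtain ⟨w, hw⟩ := key
  exact ⟨w, hτ.mono fun x hx => hx.trans (hw x)⟩

/-- The parallel section with given values on a slice. -/
def parallel (t₀ : ↥J) : (W.pullback (sliceMap P t₀)).sections →ₗ[ℝ] W.sections :=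
  have h := fun s₀ : (W.pullback (sliceMap P t₀)).sections =>
    C.exists_transport hJ 0 t₀ s₀.1 (exists_local_extension t₀ s₀)
  { toFun := fun s₀ => (h s₀).choose
    map_add' := fun s₀ s₁ => C.eq_of_slice hJ t₀
      (by rw [map_add, (h s₀).choose_spec.1, (h s₁).choose_spec.1,
        (h (s₀ + s₁)).choose_spec.1, add_zero])
      fun x => ((h (s₀ + s₁)).choose_spec.2 x).trans
        (congrArg₂ (· + ·) ((h s₀).choose_spec.2 x) ((h s₁).choose_spec.2 x)).symm
    map_smul' := fun c s₀ => C.eq_of_slice hJ t₀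
      (by rw [map_smul, (h s₀).choose_spec.1, (h (c • s₀)).choose_spec.1, smul_zero])
      fun x => ((h (c • s₀)).choose_spec.2 x).trans
        (congrArg (c • ·) ((h s₀).choose_spec.2 x)).symm }

theorem toFun_parallel (t₀ : ↥J) (s₀ : (W.pullback (sliceMap P t₀)).sections) :
    C.toFun (C.parallel hJ t₀ s₀) = 0 :=
  (C.exists_transport hJ 0 t₀ s₀.1 (exists_local_extension t₀ s₀)).choose_spec.1

theorem parallel_apply (t₀ : ↥J) (s₀ : (W.pullback (sliceMap P t₀)).sections) (x : P) :
    (C.parallel hJ t₀ s₀).1 (t₀, x) = s₀.1 x :=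
  (C.exists_transport hJ 0 t₀ s₀.1 (exists_local_extension t₀ s₀)).choose_spec.2 x

/-- The solution of `∇s = r` that vanishes on a slice. -/
def primitive (t₀ : ↥J) : W.sections →ₗ[ℝ] W.sections :=
  have h := fun r : W.sections =>
    C.exists_transport hJ r t₀ (fun _ => 0) fun _ => ⟨0, .of_forall fun _ => rfl⟩
  { toFun := fun r => (h r).choose
    map_add' := fun r r' => C.eq_of_slice hJ t₀
      (by rw [map_add, (h r).choose_spec.1, (h r').choose_spec.1, (h (r + r')).choose_spec.1])
      fun x => ((h (r + r')).choose_spec.2 x).trans ((congrArg₂ (· + ·)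
        ((h r).choose_spec.2 x) ((h r').choose_spec.2 x)).trans (add_zero _)).symm
    map_smul' := fun c r => C.eq_of_slice hJ t₀
      (by rw [map_smul, (h r).choose_spec.1, (h (c • r)).choose_spec.1, RingHom.id_apply])
      fun x => ((h (c • r)).choose_spec.2 x).trans
        ((congrArg (c • ·) ((h r).choose_spec.2 x)).trans (smul_zero c)).symm }

theorem toFun_primitive (t₀ : ↥J) (r : W.sections) : C.toFun (C.primitive hJ t₀ r) = r :=
  (C.exists_transport hJ r t₀ (fun _ => 0) fun _ => ⟨0, .of_forall fun _ => rfl⟩).choose_spec.1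

theorem primitive_apply (t₀ : ↥J) (r : W.sections) (x : P) :
    (C.primitive hJ t₀ r).1 (t₀, x) = 0 :=
  (C.exists_transport hJ r t₀ (fun _ => 0) fun _ => ⟨0, .of_forall fun _ => rfl⟩).choose_spec.2 x

/-- The parallel section through a given vector; away from the slice of that vector it depends on
choices, but not on the line in time direction through the base point. -/
def through (p : ↥J × P) : G p →ₗ[ℝ] W.sections where
  toFun v := C.parallel hJ p.1 (W.pullSection (sliceMap P p.1) (W.extend p v))
  map_add' u v := by
    rw [← map_add, map_add (W.extend p)]
    rfl
  map_smul' c v := by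
    rw [RingHom.id_apply, ← map_smul, map_smul (W.extend p)]
    rfl

theorem toFun_through (p : ↥J × P) (v : G p) : C.toFun (C.through hJ p v) = 0 :=
  C.toFun_parallel hJ _ _

theorem through_apply (p : ↥J × P) (v : G p) : (C.through hJ p v).1 p = v :=
  (C.parallel_apply hJ p.1 _ p.2).trans (W.extend_apply p v)

/-- Forms are determined by their values on parallel sections. -/
theorem form_ext {C : LineConnection V} {k : ℕ} {μ ν : Form V W k} (hJ : (J : Set ℝ).OrdConnected)
    (h : ∀ e : Fin k → V.sections, (∀ i, C.toFun (e i) = 0) → Form.eval μ e = Form.eval ν e) :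
    μ = ν := by
  ext p v
  have h1 := congrArg (fun s : W.sections => s.1 p)
    (h (fun i => C.through hJ p (v i)) fun i => C.toFun_through hJ p (v i))
  simpa only [Form.eval_apply, C.through_apply] using h1

/-- The values of an alternating map on a line in time direction depend only on the values of the
arguments on that line. -/
def IsLinewise {k : ℕ} (Ψ : V.sections [⋀^Fin k]→ₗ[ℝ] W.sections) : Prop :=
  ∀ (a b : Fin k → V.sections) (x : P), (∀ i t, (a i).1 (t, x) = (b i).1 (t, x)) →
    ∀ t, (Ψ a).1 (t, x) = (Ψ b).1 (t, x)

/-- There is a form with given values on parallel sections. -/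
theorem exists_form (C : LineConnection V) (hJ : (J : Set ℝ).OrdConnected) {k : ℕ}
    {Ψ : V.sections [⋀^Fin k]→ₗ[ℝ] W.sections} (hΨ : IsLinewise Ψ) :
    ∃ μ : Form V W k, ∀ e : Fin k → V.sections, (∀ i, C.toFun (e i) = 0) →
      Form.eval μ e = Ψ e := by
  have hline : ∀ (p : ↥J × P) (v : A p) (e : V.sections), C.toFun e = 0 → e.1 p = v →
      ∀ t, (C.through hJ p v).1 (t, p.2) = e.1 (t, p.2) := fun p v e he hv t =>
    C.line_unique hJ (t₀ := p.1) (fun t => by rw [C.toFun_through, he])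
      ((C.through_apply hJ p v).trans hv.symm) t
  -- evaluate `Ψ` on the parallel sections through the given vectors; it is smooth since, near a
  -- point, these have smooth coefficients in a parallel frame, and the coefficients are constant
  -- along each line
  refine ⟨⟨fun p => ((W.evalAt p).compAlternatingMap Ψ).compLinearMap (C.through hJ p),
    fun a => W.mem_of_locally _ fun p => ?_⟩, fun e he => Subtype.ext (funext fun p => ?_)⟩
  · obtain ⟨n, b, hb, -⟩ := V.frame p
    let e : Fin n → V.sections := fun j => C.through hJ p ((b j).1 p)
    have he : (fun j => (e j).1 p) = fun j => (b j).1 p :=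
      funext fun j => C.through_apply hJ p _
    obtain ⟨-, hco⟩ := V.frame_of_basis e p (he ▸ hb.self_of_nhds.1) (he ▸ hb.self_of_nhds.2)
    choose h hh using fun i => hco (a i)
    refine ⟨_, (∑ K : Fin k → Fin n, (∏ i, h i (K i)) • Ψ fun i => e (K i)).2, ?_⟩
    filter_upwards [eventually_all.2 hh] with q hq
    have h1 : (Ψ fun i => C.through hJ q ((a i).1 q)).1 q =
        (Ψ fun i => ∑ j, h i j q • e j).1 q := by
      refine hΨ _ _ q.2 (fun i t => hline q _ _ ?_ ?_ t) q.1
      · rw [map_sum]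
        exact Finset.sum_eq_zero fun j _ => by rw [map_smul, C.toFun_through, smul_zero]
      · rw [sections_sum_apply, hq i]
        rfl
    refine h1.trans ?_
    have h2 := Ψ.toMultilinearMap.map_sum (fun i j => h i j q • e j)
    rw [show (Ψ fun i => ∑ j, h i j q • e j) = _ from h2, sections_sum_apply, sections_sum_apply]
    refine Finset.sum_congr rfl fun K _ => ?_
    rw [MultilinearMap.map_smul_univ, fun_smul_apply, SmoothFun.prod_apply]
    rfl
  · exact hΨ _ _ p.2 (fun i t => hline p _ _ (he i) rfl t) p.1

end LineConnection

end Slices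

/-! ### The restriction to a slice is a quasi-isomorphism -/

section SliceTheorem

variable {EP : Type*} [NormedAddCommGroup EP] [NormedSpace ℝ EP] [FiniteDimensional ℝ EP]
  {P : Type*} [TopologicalSpace P] [ChartedSpace EP P] [IsManifold 𝓘(ℝ, EP) ∞ P] [T2Space P]
  {J : TopologicalSpace.Opens ℝ}
  {A : ↥J × P → Type*} [∀ p, AddCommGroup (A p)] [∀ p, Module ℝ (A p)]
  {G : ↥J × P → Type*} [∀ p, AddCommGroup (G p)] [∀ p, Module ℝ (G p)]
  {V : SmoothVectorBundle (𝓘(ℝ, ℝ).prod 𝓘(ℝ, EP)) (↥J × P) A}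
  {W : SmoothVectorBundle (𝓘(ℝ, ℝ).prod 𝓘(ℝ, EP)) (↥J × P) G}
  {L : LieAlgebroid V}

namespace LieAlgebroid

/-- The section `σ` lifts the vector field `∂_t`. -/
def LiftsTime (L : LieAlgebroid V) (σ : V.sections) : Prop := ∀ p, L.anchor p (σ.1 p) = timeVec p

variable {σ : V.sections}

/-- The bracket with a lift of `∂_t`. -/
def LiftsTime.bracketLine (hσ : L.LiftsTime σ) : LineConnection V where
  toFun := L.bracket σ
  leibniz h s p := by rw [← hσ p]; exact L.leibniz σ s h p

/-- The covariant derivative along a lift of `∂_t`. -/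
def LiftsTime.connectionLine (hσ : L.LiftsTime σ) (D : AlgebroidConnection L W) :
    LineConnection W where
  toFun := D.toFun σ
  leibniz h s p := by rw [← hσ p]; exact D.leibniz σ s h p

/-- The time component of the anchor. -/
def timeAnchor (L : LieAlgebroid V) (p : ↥J × P) : A p →ₗ[ℝ] ℝ :=
  (timeFun (EP := EP) J P).d p ∘ₗ L.anchor p

theorem LiftsTime.timeAnchor_eq_one (hσ : L.LiftsTime σ) (p : ↥J × P) :
    L.timeAnchor p (σ.1 p) = 1 := by
  refine Eq.trans ?_ (d_timeFun_timeVec (EP := EP) p)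
  rw [← hσ p]
  rfl

/-- The fibre of the restriction to a slice consists of the vectors whose anchor is tangent to the
slice; the first component is redundant. -/
theorem mem_pullbackFiber_slice_iff {t : ↥J} {x : P}
    {q : TangentSpace 𝓘(ℝ, EP) x × A (t, x)} :
    q ∈ L.pullbackFiber (sliceMap (EP := EP) P t) x ↔
      L.timeAnchor (t, x) q.2 = 0 ∧ q.1 = spacePart (t, x) (L.anchor (t, x) q.2) := by
  constructor
  · intro h
    have h' : mfderiv 𝓘(ℝ, EP) (𝓘(ℝ, ℝ).prod 𝓘(ℝ, EP)) (sliceMap (EP := EP) P t) x q.1 =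
      L.anchor (t, x) q.2 := h
    constructor
    · change (timeFun (EP := EP) J P).d (t, x) (L.anchor (t, x) q.2) = 0
      rw [← h', d_timeFun_sliceMap]
    · rw [← h', spacePart_sliceMap]
  · rintro ⟨h1, h2⟩
    have h1' : (timeFun (EP := EP) J P).d (t, x) (L.anchor (t, x) q.2) = 0 := h1
    change mfderiv 𝓘(ℝ, EP) (𝓘(ℝ, ℝ).prod 𝓘(ℝ, EP)) (sliceMap (EP := EP) P t) x q.1 =
      L.anchor (t, x) q.2
    rw [h2, sliceMap_spacePart, h1', zero_smul]
    exact sub_zero _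

/-- A Lie algebroid over `J × P` with a section over `∂_t` can be restricted to slices. -/
theorem LiftsTime.pullbackExists_slice (hσ : L.LiftsTime σ) (t : ↥J) :
    L.PullbackExists (sliceMap (EP := EP) P t) := by
  have key : ∀ x, Module.finrank ℝ (L.pullbackFiber (sliceMap (EP := EP) P t) x) + 1 =
      Module.finrank ℝ (A (t, x)) := by
    intro x
    have := V.finiteDimensional_fiber (t, x)
    obtain ⟨pr, hpr⟩ : ∃ pr : L.pullbackFiber (sliceMap (EP := EP) P t) x →ₗ[ℝ] A (t, x),
      ∀ q, pr q = q.1.2 := ⟨L.projection _ x, fun _ => rfl⟩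
    have hinj : Function.Injective pr := by
      intro q q' h
      rw [hpr, hpr] at h
      refine Subtype.ext (Prod.ext ?_ h)
      exact (mem_pullbackFiber_slice_iff.1 q.2).2.trans ((congrArg (fun v : A (t, x) =>
        spacePart (t, x) (L.anchor (t, x) v)) h).trans (mem_pullbackFiber_slice_iff.1 q'.2).2.symm)
    have hr : LinearMap.range pr = LinearMap.ker (L.timeAnchor (t, x)) := by
      ext v
      constructor
      · rintro ⟨q, rfl⟩
        rw [hpr]
        exact (mem_pullbackFiber_slice_iff.1 q.2).1
      · intro hv
        exact ⟨⟨(spacePart (t, x) (L.anchor (t, x) v), v),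
          mem_pullbackFiber_slice_iff.2 ⟨hv, rfl⟩⟩, hpr _⟩
    have hs : LinearMap.range (L.timeAnchor (t, x)) = ⊤ :=
      LinearMap.range_eq_top.2 fun r => ⟨r • σ.1 (t, x), by
        rw [map_smul, hσ.timeAnchor_eq_one]; simp⟩
    have h1 := (L.timeAnchor (t, x)).finrank_range_add_finrank_ker
    have h2 : Module.finrank ℝ (LinearMap.ker (L.timeAnchor (t, x))) =
        Module.finrank ℝ (L.pullbackFiber (sliceMap (EP := EP) P t) x) := by
      rw [← hr]
      exact LinearMap.finrank_range_of_inj hinj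
    rw [hs, finrank_top, Module.finrank_self, h2] at h1
    omega
  intro x₀
  have h1 : Tendsto (fun x => (t, x)) (𝓝 x₀) (𝓝 (t, x₀)) :=
    (Continuous.prodMk_right t).tendsto x₀
  filter_upwards [h1.eventually (V.eventually_finrank_eq (t, x₀))] with x hx
  have := key x
  have := key x₀
  omega

variable {t : ↥J} (hf : L.PullbackExists (sliceMap (EP := EP) P t))

/-- The projection along `σ` onto the fibre of the restriction to a slice. -/
def LiftsTime.slicePoint (hσ : L.LiftsTime σ) (t : ↥J) (x : P) :
    A (t, x) →ₗ[ℝ] L.pullbackFiber (sliceMap (EP := EP) P t) x :=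
  LinearMap.codRestrict (L.pullbackFiber (sliceMap (EP := EP) P t) x)
    ((spacePart (t, x) ∘ₗ L.anchor (t, x)).prod
      (LinearMap.id - (L.timeAnchor (t, x)).smulRight (σ.1 (t, x)))) fun v => by
    have h1 : spacePart (t, x) (timeVec (EP := EP) (t, x)) = 0 := spacePart_apply _ _
    refine mem_pullbackFiber_slice_iff.2 ⟨?_, ?_⟩
    · change L.timeAnchor (t, x) (v - L.timeAnchor (t, x) v • σ.1 (t, x)) = 0
      rw [map_sub, map_smul, hσ.timeAnchor_eq_one, smul_eq_mul, mul_one, sub_self]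
    · change spacePart (t, x) (L.anchor (t, x) v) =
        spacePart (t, x) (L.anchor (t, x) (v - L.timeAnchor (t, x) v • σ.1 (t, x)))
      rw [map_sub, map_smul, hσ, map_sub, map_smul, h1, smul_zero, sub_zero]

theorem LiftsTime.slicePoint_snd (hσ : L.LiftsTime σ) (x : P) (v : A (t, x)) :
    (hσ.slicePoint t x v).1.2 = v - L.timeAnchor (t, x) v • σ.1 (t, x) := rfl

theorem LiftsTime.slicePoint_fst (hσ : L.LiftsTime σ) (x : P) (v : A (t, x)) :
    (hσ.slicePoint t x v).1.1 = spacePart (t, x) (L.anchor (t, x) v) := rfl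

theorem LiftsTime.slicePoint_self (hσ : L.LiftsTime σ) (t : ↥J) (x : P) :
    hσ.slicePoint t x (σ.1 (t, x)) = 0 := by
  refine Subtype.ext (Prod.ext ?_ ?_)
  · rw [slicePoint_fst, hσ]
    exact spacePart_apply _ _
  · rw [slicePoint_snd, hσ.timeAnchor_eq_one, one_smul, sub_self]
    rfl

theorem LiftsTime.slicePoint_eq (hσ : L.LiftsTime σ) {x : P}
    (q : L.pullbackFiber (sliceMap (EP := EP) P t) x) : hσ.slicePoint t x q.1.2 = q := by
  obtain ⟨h1, h2⟩ := mem_pullbackFiber_slice_iff.1 q.2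
  refine Subtype.ext (Prod.ext ?_ ?_)
  · exact (hσ.slicePoint_fst x q.1.2).trans h2.symm
  · refine (hσ.slicePoint_snd x q.1.2).trans ?_
    rw [h1, zero_smul]
    exact sub_zero _

/-- The projection along `σ` maps smooth sections to smooth sections. -/
theorem LiftsTime.slice_mem (hσ : L.LiftsTime σ) (a : V.sections) :
    (fun x => hσ.slicePoint t x (a.1 (t, x))) ∈ (pullbackBundle hf).sections := by
  constructor
  · have h1 : ContMDiff (𝓘(ℝ, ℝ).prod 𝓘(ℝ, EP)) (𝓘(ℝ, ℝ).prod 𝓘(ℝ, EP)).tangent ∞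
      (fun p => (⟨p, L.anchor p (a.1 p)⟩ : TangentBundle (𝓘(ℝ, ℝ).prod 𝓘(ℝ, EP)) (↥J × P))) :=
      L.anchor_mem a
    have h2 := (contMDiff_snd (I := 𝓘(ℝ, ℝ)) (J := 𝓘(ℝ, EP)) (M := ↥J) (N := P)
      (n := ∞)).contMDiff_tangentMap (m := ∞) (by simp)
    exact (h2.comp h1).comp (sliceMap (EP := EP) P t).contMDiff
  · exact (V.pullSection (sliceMap (EP := EP) P t)
      (a - lieDer (L.anchorSection a) (timeFun J P) • σ)).2

/-- The restriction of `a - dt(ρ(a)) σ` to a slice. -/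
def LiftsTime.slice (hσ : L.LiftsTime σ) : V.sections →ₗ[ℝ] (pullbackBundle hf).sections where
  toFun a := ⟨_, hσ.slice_mem hf a⟩
  map_add' _ _ := Subtype.ext (funext fun x => map_add (hσ.slicePoint t x) _ _)
  map_smul' _ _ := Subtype.ext (funext fun x => map_smul (hσ.slicePoint t x) _ _)

end LieAlgebroid

namespace AlgebroidConnection

open LieAlgebroid

variable {σ : V.sections} (D : AlgebroidConnection L W)

/-- Alternating maps that vanish on a vector are insensitive to adding multiples of it. -/
theorem map_sub_smul {X Y : Type*} [AddCommGroup X] [Module ℝ X] [AddCommGroup Y] [Module ℝ Y]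
    {k : ℕ} (ψ : X [⋀^Fin k]→ₗ[ℝ] Y) {s : X} (hs : ∀ v i, v i = s → ψ v = 0) (v : Fin k → X)
    (c : Fin k → ℝ) : ψ (fun i => v i - c i • s) = ψ v := by
  have key : ∀ T : Finset (Fin k), ψ (T.piecewise (fun i => v i - c i • s) v) = ψ v := by
    intro T
    induction T using Finset.induction_on with
    | empty => simp
    | insert i T hi ih =>
      rw [Finset.piecewise_insert, AlternatingMap.map_update_sub, AlternatingMap.map_update_smul,
        hs (Function.update _ i s) i (by simp), smul_zero, sub_zero, ← ih]
      congr 1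
      rw [Function.update_eq_self_iff]
      simp [hi]
  simpa using key Finset.univ

/-- Covariant differentiation along `σ` commutes with the exterior derivative. -/
theorem toFun_koszul (hD : D.IsFlat) {k : ℕ} {Φ Φ' : V.sections [⋀^Fin k]→ₗ[ℝ] W.sections}
    (h : ∀ e : Fin k → V.sections, (∀ i, L.bracket σ (e i) = 0) → D.toFun σ (Φ e) = Φ' e)
    {e : Fin (k + 1) → V.sections} (he : ∀ i, L.bracket σ (e i) = 0) :
    D.toFun σ (koszul (fun a b => L.bracket a b) (fun a => D.toFun a) Φ e) =
      koszul (fun a b => L.bracket a b) (fun a => D.toFun a) Φ' e := by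
  rw [koszul, koszul, map_add, map_sum]
  congr 1
  · refine Finset.sum_congr rfl fun i _ => ?_
    rw [map_smul, ← h (i.removeNth e) fun j => he _]
    have h1 := hD σ (e i) (Φ (i.removeNth e))
    rw [he i, map_zero, LinearMap.zero_apply, sub_zero, sub_eq_zero] at h1
    rw [h1]
  · cases k with
    | zero => exact map_zero _
    | succ k =>
      simp only [koszulBracket, map_sum]
      refine Finset.sum_congr rfl fun i _ => Finset.sum_congr rfl fun j _ => ?_
      split_ifs
      · rw [map_smul, h]
        intro q
        cases q using Fin.cases with
        | zero => rw [Fin.cons_zero, L.jacobi, he, he, map_zero, map_zero, LinearMap.zero_apply,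
            add_zero]
        | succ q => exact he _
      · exact map_zero _

/-- The forms annihilated by `ι_σ` and by the Lie derivative along `σ`. -/
def IsBasic (σ : V.sections) {k : ℕ} (μ : Form V W k) : Prop :=
  (∀ p v i, v i = σ.1 p → μ.1 p v = 0) ∧
    ∀ e : Fin k → V.sections, (∀ i, L.bracket σ (e i) = 0) → D.toFun σ (Form.eval μ e) = 0

variable {D} in
theorem IsBasic.sub {k : ℕ} {μ ν : Form V W k} (hμ : D.IsBasic σ μ) (hν : D.IsBasic σ ν) :
    D.IsBasic σ (μ - ν) := by
  refine ⟨fun p v i hv => ?_, fun e he => ?_⟩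
  · change μ.1 p v - ν.1 p v = 0
    rw [hμ.1 p v i hv, hν.1 p v i hv, sub_zero]
  · have h1 : Form.eval (μ - ν) e = Form.eval μ e - Form.eval ν e := rfl
    rw [h1, map_sub, hμ.2 e he, hν.2 e he, sub_zero]

/-- It suffices to test on parallel sections whether a form is annihilated by `ι_σ`. -/
theorem horizontal_of_parallel (hJ : (J : Set ℝ).OrdConnected) (hσ : L.LiftsTime σ) {k : ℕ}
    {μ : Form V W k} (h : ∀ e : Fin k → V.sections, (∀ i, L.bracket σ (e i) = 0) →
      ∀ i, e i = σ → Form.eval μ e = 0) (p : ↥J × P) (v : Fin k → A p) (i : Fin k)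
    (hv : v i = σ.1 p) : μ.1 p v = 0 := by
  let e : Fin k → V.sections :=
    Function.update (fun j => hσ.bracketLine.through hJ p (v j)) i σ
  have he : ∀ j, L.bracket σ (e j) = 0 := fun j => by
    rcases eq_or_ne j i with rfl | hj
    · rw [show e j = σ from Function.update_self ..]
      exact L.bracket_self σ
    · rw [show e j = hσ.bracketLine.through hJ p (v j) from Function.update_of_ne hj ..]
      exact hσ.bracketLine.toFun_through hJ p (v j)
  have hev : v = fun j => (e j).1 p := funext fun j => by
    rcases eq_or_ne j i with rfl | hj
    · rw [show e j = σ from Function.update_self .., hv]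
    · rw [show e j = hσ.bracketLine.through hJ p (v j) from Function.update_of_ne hj ..]
      exact (hσ.bracketLine.through_apply hJ p (v j)).symm
  rw [hev, ← Form.eval_apply, h e he i (Function.update_self ..)]
  rfl

/-- By skew symmetry, it suffices to insert `σ` into the first argument. -/
theorem isBasic_of_cons (hJ : (J : Set ℝ).OrdConnected) (hσ : L.LiftsTime σ) {k : ℕ}
    {μ : Form V W (k + 1)}
    (h : ∀ b : Fin k → V.sections, (∀ i, L.bracket σ (b i) = 0) →
      Form.eval μ (Fin.cons σ b) = 0)
    (h' : ∀ e : Fin (k + 1) → V.sections, (∀ i, L.bracket σ (e i) = 0) →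
      D.toFun σ (Form.eval μ e) = 0) : D.IsBasic σ μ := by
  refine ⟨horizontal_of_parallel hJ hσ fun e he i hi => ?_, h'⟩
  have h1 : e = i.insertNth σ (i.removeNth e) := by rw [← hi]; simp
  rw [h1, AlternatingMap.map_insertNth]
  change (-1 : ℤ) ^ i.val • Form.eval μ (Fin.cons σ (i.removeNth e)) = 0
  rw [h (i.removeNth e) fun j => he _, smul_zero]

/-- Cartan's formula on parallel sections. -/
theorem d_cons_of_horizontal {k : ℕ} {μ : Form V W k}
    (h : ∀ p v i, v i = σ.1 p → μ.1 p v = 0) {e : Fin k → V.sections}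
    (he : ∀ i, L.bracket σ (e i) = 0) :
    D.d μ (Fin.cons σ e) = D.toFun σ (Form.eval μ e) := by
  cases k with
  | zero => exact D.d_degree_zero μ _ e
  | succ k =>
    have h1 : Form.contract σ μ = 0 := by
      ext p v
      exact h p (Fin.cons (σ.1 p) v) 0 rfl
    rw [D.d_cons, h1, D.d_zero, sub_zero, lieForm]
    refine sub_eq_self.2 (Finset.sum_eq_zero fun q _ => ?_)
    rw [he q]
    exact (Form.eval μ).map_coord_zero q (Function.update_self ..)

variable {D} in
/-- Basic forms are a subcomplex. -/
theorem IsBasic.dForm (hJ : (J : Set ℝ).OrdConnected) (hσ : L.LiftsTime σ) (hD : D.IsFlat)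
    {k : ℕ} {μ : Form V W k} (h : D.IsBasic σ μ) : D.IsBasic σ (D.dForm μ) := by
  refine isBasic_of_cons D hJ hσ (fun b hb => ?_) fun e he => ?_
  · rw [D.eval_dForm, D.d_cons_of_horizontal h.1 hb, h.2 b hb]
  · rw [D.eval_dForm, d, D.toFun_koszul hD (Φ' := 0) (fun e he => h.2 e he) he]
    exact D.d_zero e

variable {t : ↥J} (hf : L.PullbackExists (sliceMap (EP := EP) P t))

variable {D} in
/-- Basic forms are determined by their restriction to a slice. -/
theorem IsBasic.eq_zero (hJ : (J : Set ℝ).OrdConnected) (hσ : L.LiftsTime σ) {k : ℕ}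
    {μ : Form V W k} (h : D.IsBasic σ μ) (h0 : pullbackForm hf W k μ = 0) : μ = 0 := by
  refine LineConnection.form_ext (C := hσ.bracketLine) hJ fun e he => ?_
  refine (hσ.connectionLine D).eq_of_slice hJ t ?_ fun x => ?_
  · refine (h.2 e he).trans (map_zero _).symm
  · have h1 := congrArg (fun ν : Form (pullbackBundle hf) (W.pullback (sliceMap P t)) k =>
      ν.1 x fun i => hσ.slicePoint t x ((e i).1 (t, x))) h0
    exact (map_sub_smul (μ.1 (t, x)) (h.1 (t, x)) _ _).symm.trans h1

/-- Forms on a slice extend to basic forms. -/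
theorem exists_isBasic (hJ : (J : Set ℝ).OrdConnected) (hσ : L.LiftsTime σ) {k : ℕ}
    (ν : Form (pullbackBundle hf) (W.pullback (sliceMap P t)) k) :
    ∃ μ : Form V W k, D.IsBasic σ μ ∧ pullbackForm hf W k μ = ν := by
  let C := hσ.connectionLine D
  let Ψ : V.sections [⋀^Fin k]→ₗ[ℝ] W.sections :=
    (C.parallel hJ t).compAlternatingMap ((Form.eval ν).compLinearMap (hσ.slice hf))
  have hΨ : ∀ a, Ψ a = C.parallel hJ t (Form.eval ν fun i => hσ.slice hf (a i)) := fun a => rfl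
  have hlin : LineConnection.IsLinewise Ψ := fun a b x hab t' => by
    refine C.line_unique hJ (t₀ := t) (fun t' => ?_) ?_ t'
    · rw [hΨ, hΨ, C.toFun_parallel, C.toFun_parallel]
    · refine (C.parallel_apply hJ t (Form.eval ν fun i => hσ.slice hf (a i)) x).trans
        (Eq.trans ?_ (C.parallel_apply hJ t (Form.eval ν fun i => hσ.slice hf (b i)) x).symm)
      refine Form.isPointwise_eval ν _ _ x fun i => ?_
      exact congrArg (hσ.slicePoint t x) (hab i t)
  obtain ⟨μ, hμ⟩ := hσ.bracketLine.exists_form hJ hlin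
  refine ⟨μ, ⟨horizontal_of_parallel hJ hσ fun e he i hi => ?_, fun e he => ?_⟩, ?_⟩
  · rw [hμ e he, hΨ, (Form.eval ν).map_coord_zero i, map_zero]
    rw [hi]
    exact Subtype.ext (funext fun x => hσ.slicePoint_self t x)
  · rw [hμ e he, hΨ]
    exact C.toFun_parallel hJ t _
  · ext x v
    let e : Fin k → V.sections := fun i => hσ.bracketLine.through hJ (t, x) (v i).1.2
    have h1 := congrArg (fun s : W.sections => s.1 (t, x))
      (hμ e fun i => hσ.bracketLine.toFun_through hJ (t, x) _)
    have h2 : (Form.eval μ e).1 (t, x) = μ.1 (t, x) fun i => (v i).1.2 :=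
      congrArg (μ.1 (t, x)) (funext fun i => hσ.bracketLine.through_apply hJ (t, x) _)
    refine h2.symm.trans (h1.trans ?_)
    rw [hΨ]
    refine (C.parallel_apply hJ t _ x).trans (congrArg (ν.1 x) (funext fun i => ?_))
    refine Eq.trans ?_ (hσ.slicePoint_eq (v i))
    exact congrArg (hσ.slicePoint t x) (hσ.bracketLine.through_apply hJ (t, x) _)

/-- Up to a coboundary that vanishes on a slice, closed forms are basic: integrate `ι_σ μ`. -/
theorem exists_primitive (hJ : (J : Set ℝ).OrdConnected) (hσ : L.LiftsTime σ) (hD : D.IsFlat)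
    {k : ℕ} {μ : Form V W (k + 1)} (hμ : μ ∈ D.closed (k + 1)) :
    ∃ ξ : Form V W k, pullbackForm hf W k ξ = 0 ∧ D.IsBasic σ (μ - D.dForm ξ) := by
  let C := hσ.connectionLine D
  let Ψ : V.sections [⋀^Fin k]→ₗ[ℝ] W.sections :=
    (C.primitive hJ t).compAlternatingMap (Form.eval (Form.contract σ μ))
  have hΨ : ∀ a, Ψ a = C.primitive hJ t (Form.eval (Form.contract σ μ) a) := fun a => rfl
  have hlin : LineConnection.IsLinewise Ψ := fun a b x hab t' => by
    refine C.line_unique hJ (t₀ := t) (fun t' => ?_) ?_ t'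
    · rw [hΨ, hΨ, C.toFun_primitive, C.toFun_primitive]
      exact Form.isPointwise_eval _ _ _ _ fun i => hab i t'
    · rw [hΨ, hΨ, C.primitive_apply, C.primitive_apply]
  -- on parallel sections `e`, the section `ξ(e)` solves `∇_σ (ξ(e)) = (ι_σ μ)(e)` and vanishes on
  -- the slice
  obtain ⟨ξ, hξ⟩ := hσ.bracketLine.exists_form hJ hlin
  have hξ1 : ∀ e : Fin k → V.sections, (∀ i, L.bracket σ (e i) = 0) →
      D.toFun σ (Form.eval ξ e) = Form.eval (Form.contract σ μ) e := fun e he => by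
    rw [hξ e he, hΨ]
    exact C.toFun_primitive hJ t _
  have hξ2 : ∀ p v i, v i = σ.1 p → ξ.1 p v = 0 :=
    horizontal_of_parallel hJ hσ fun e he i hi => by
      have h1 : Form.eval (Form.contract σ μ) e = 0 := by
        rw [Form.eval_contract]
        exact (Form.eval μ).map_eq_zero_of_eq (Fin.cons σ e) (i := 0) (j := i.succ)
          (by simp [hi]) (Fin.succ_ne_zero i).symm
      rw [hξ e he, hΨ, h1, map_zero]
  refine ⟨ξ, ?_, D.isBasic_of_cons hJ hσ (fun b hb => ?_) fun e he => ?_⟩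
  · ext x v
    let e : Fin k → V.sections := fun i => hσ.bracketLine.through hJ (t, x) (v i).1.2
    have h1 := congrArg (fun s : W.sections => s.1 (t, x))
      (hξ e fun i => hσ.bracketLine.toFun_through hJ (t, x) _)
    have h2 : (Form.eval ξ e).1 (t, x) = ξ.1 (t, x) fun i => (v i).1.2 :=
      congrArg (ξ.1 (t, x)) (funext fun i => hσ.bracketLine.through_apply hJ (t, x) _)
    exact h2.symm.trans (h1.trans (C.primitive_apply hJ t _ x))
  · have h1 : Form.eval (μ - D.dForm ξ) (Fin.cons σ b) =
      Form.eval μ (Fin.cons σ b) - Form.eval (D.dForm ξ) (Fin.cons σ b) := rfl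
    rw [h1, D.eval_dForm, D.d_cons_of_horizontal hξ2 hb, hξ1 b hb, Form.eval_contract]
    exact sub_self _
  · have h1 : Form.eval (μ - D.dForm ξ) e = Form.eval μ e - Form.eval (D.dForm ξ) e := rfl
    -- as `μ` is closed, `L_σ μ = d ι_σ μ`, and this is `L_σ dξ` because `∇_σ` commutes with `d`
    have h2 := hμ (Fin.cons σ e)
    rw [D.d_cons, lieForm, Finset.sum_eq_zero, sub_zero, sub_eq_zero] at h2
    · have h3 : D.toFun σ (D.d ξ e) = D.d (Form.contract σ μ) e := D.toFun_koszul hD hξ1 he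
      rw [h1, map_sub, h2, D.eval_dForm, h3, sub_self]
    · intro q _
      rw [he q]
      exact (Form.eval μ).map_coord_zero q (Function.update_self ..)

end AlgebroidConnection
end SliceTheorem

section SliceTheorem

variable {EP : Type*} [NormedAddCommGroup EP] [NormedSpace ℝ EP] [FiniteDimensional ℝ EP]
  {P : Type*} [TopologicalSpace P] [ChartedSpace EP P] [IsManifold 𝓘(ℝ, EP) ∞ P] [T2Space P]
  {J : TopologicalSpace.Opens ℝ}
  {A : ↥J × P → Type*} [∀ p, AddCommGroup (A p)] [∀ p, Module ℝ (A p)]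
  {G : ↥J × P → Type*} [∀ p, AddCommGroup (G p)] [∀ p, Module ℝ (G p)]
  {V : SmoothVectorBundle (𝓘(ℝ, ℝ).prod 𝓘(ℝ, EP)) (↥J × P) A}
  {W : SmoothVectorBundle (𝓘(ℝ, ℝ).prod 𝓘(ℝ, EP)) (↥J × P) G}
  {L : LieAlgebroid V}

namespace AlgebroidConnection

open LieAlgebroid

variable {σ : V.sections} (D : AlgebroidConnection L W)
variable {t : ↥J} (hf : L.PullbackExists (sliceMap (EP := EP) P t))

/-- A closed form of degree `0` is a parallel section. -/
theorem isBasic_of_closed {μ : Form V W 0} (hμ : μ ∈ D.closed 0) : D.IsBasic σ μ := by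
  refine ⟨fun p v i => i.elim0, fun e he => ?_⟩
  rw [← D.d_degree_zero μ (fun _ => σ) e]
  exact hμ _

/-- The restriction to a slice of a Lie algebroid over `J × P` is a quasi-isomorphism if `∂_t` is
the anchor of a section. -/
theorem isQuasiIso_slice (hJ : (J : Set ℝ).OrdConnected) (hσ : L.LiftsTime σ) (hD : D.IsFlat) :
    IsQuasiIso D (D.pullback hf) (pullbackForm hf W) :=
  IsQuasiIso.of_subcomplex (S := fun _ μ => D.IsBasic σ μ)
    (fun _ μ => D.dForm_pullbackForm hf μ) (fun _ _ _ h h' => h.sub h')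
    (fun _ _ h => h.dForm hJ hσ hD) (fun _ _ h h0 => h.eq_zero hf hJ hσ h0)
    (fun _ ν => D.exists_isBasic hf hJ hσ ν) (fun _ hμ => D.isBasic_of_closed hμ)
    fun _ _ hμ => D.exists_primitive hf hJ hσ hD hμ

end AlgebroidConnection
end SliceTheorem

/-! ### Homotopy invariance -/

section Homotopy

theorem AlgebroidConnection.isChainMap_pullback
    {E : Type*} [NormedAddCommGroup E] [NormedSpace ℝ E] [FiniteDimensional ℝ E]
    {H : Type*} [TopologicalSpace H] {I : ModelWithCorners ℝ E H}
    {M : Type*} [TopologicalSpace M] [ChartedSpace H M] [IsManifold I ∞ M] [T2Space M]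
    {E' : Type*} [NormedAddCommGroup E'] [NormedSpace ℝ E'] [FiniteDimensional ℝ E']
    {H' : Type*} [TopologicalSpace H'] {I' : ModelWithCorners ℝ E' H'}
    {N : Type*} [TopologicalSpace N] [ChartedSpace H' N] [IsManifold I' ∞ N] [T2Space N]
    {A : N → Type*} [∀ x, AddCommGroup (A x)] [∀ x, Module ℝ (A x)]
    {G : N → Type*} [∀ x, AddCommGroup (G x)] [∀ x, Module ℝ (G x)]
    {V : SmoothVectorBundle I' N A} {L : LieAlgebroid V} {W : SmoothVectorBundle I' N G}
    {f : C^∞⟮I, M; I', N⟯} (D : AlgebroidConnection L W) (hf : L.PullbackExists f) :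
    IsChainMap D (D.pullback hf) (LieAlgebroid.pullbackForm hf W) :=
  fun _ => D.dForm_pullbackForm hf

namespace AlgebroidConnection

open LieAlgebroid

variable {EP : Type*} [NormedAddCommGroup EP] [NormedSpace ℝ EP] [FiniteDimensional ℝ EP]
  {P : Type*} [TopologicalSpace P] [ChartedSpace EP P] [IsManifold 𝓘(ℝ, EP) ∞ P] [T2Space P]
  {J : TopologicalSpace.Opens ℝ}
  {A : P → Type*} [∀ p, AddCommGroup (A p)] [∀ p, Module ℝ (A p)]
  {G : P → Type*} [∀ p, AddCommGroup (G p)] [∀ p, Module ℝ (G p)]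
  {V : SmoothVectorBundle 𝓘(ℝ, EP) P A} {W : SmoothVectorBundle 𝓘(ℝ, EP) P G}
  {L : LieAlgebroid V}

/-- The pullback along a smooth map that is homotopic to the identity, through a homotopy to which
`∂_t` lifts, is a quasi-isomorphism. -/
theorem exists_isQuasiIso_of_liftsHomotopy (D : AlgebroidConnection L W) (hD : D.IsFlat)
    (hJ : (J : Set ℝ).OrdConnected) {φ : C^∞⟮𝓘(ℝ, ℝ).prod 𝓘(ℝ, EP), ↥J × P; 𝓘(ℝ, EP), P⟯}
    (hφ : L.LiftsHomotopy φ) {t₀ t₁ : ↥J} (h0 : φ.comp (sliceMap P t₀) = ContMDiffMap.id)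
    {k : C^∞⟮𝓘(ℝ, EP), P; 𝓘(ℝ, EP), P⟯} (h1 : φ.comp (sliceMap P t₁) = k) :
    ∃ hk : L.PullbackExists k, IsQuasiIso D (D.pullback hk) (pullbackForm hk W) := by
  obtain ⟨hf, σ, hσ, hσ1⟩ := hφ
  have hs : (LieAlgebroid.pullback hf).LiftsTime ⟨σ, hσ⟩ := hσ1
  have hflat := D.isFlat_pullback hf hD
  have hg0 := hs.pullbackExists_slice t₀
  have hg1 := hs.pullbackExists_slice t₁
  have hid : L.PullbackExists (ContMDiffMap.id : C^∞⟮𝓘(ℝ, EP), P; 𝓘(ℝ, EP), P⟯) :=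
    h0 ▸ (pullbackExists_iterated_iff hf).1 hg0
  have hk : L.PullbackExists k := h1 ▸ (pullbackExists_iterated_iff hf).1 hg1
  have hq0 := (D.isQuasiIso_iterated_iff hf hg0 h0 hid).2 (isQuasiIso_pullback_id D hid)
  have hq : IsQuasiIso D (D.pullback hf) (pullbackForm hf W) :=
    ((D.pullback hf).isQuasiIso_slice hg0 hJ hs hflat).of_comp hq0
      (D.isChainMap_pullback hf)
  exact ⟨hk, (D.isQuasiIso_iterated_iff hf hg1 h1 hk).1
    (((D.pullback hf).isQuasiIso_slice hg1 hJ hs hflat).comp hq)⟩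

variable {E' : Type*} [NormedAddCommGroup E'] [NormedSpace ℝ E'] [FiniteDimensional ℝ E']
  {Q : Type*} [TopologicalSpace Q] [ChartedSpace E' Q] [IsManifold 𝓘(ℝ, E') ∞ Q] [T2Space Q]

/-- If `(f ∘ g)^*` is a quasi-isomorphism, then `f^*` is injective in cohomology. -/
theorem mem_exact_of_comp (D : AlgebroidConnection L W)
    {f : C^∞⟮𝓘(ℝ, E'), Q; 𝓘(ℝ, EP), P⟯} {g : C^∞⟮𝓘(ℝ, EP), P; 𝓘(ℝ, E'), Q⟯}
    (hf : L.PullbackExists f)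
    (h : ∃ hk : L.PullbackExists (f.comp g), IsQuasiIso D (D.pullback hk) (pullbackForm hk W))
    {k : ℕ} {μ : Form V W k} (hμ : μ ∈ D.closed k)
    (hμ' : pullbackForm hf W k μ ∈ (D.pullback hf).exact k) : μ ∈ D.exact k := by
  obtain ⟨hk, hq⟩ := h
  have hg : (LieAlgebroid.pullback hf).PullbackExists g := (pullbackExists_iterated_iff hf).2 hk
  exact ((D.isQuasiIso_iterated_iff hf hg rfl hk).2 hq).injective k μ hμ
    (((D.pullback hf).isChainMap_pullback hg).exact hμ')

/-- Two out of six: a smooth map induces a quasi-isomorphism if its two composites with a homotopy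
inverse do. -/
theorem isQuasiIso_of_homotopyInverse (D : AlgebroidConnection L W)
    {f : C^∞⟮𝓘(ℝ, E'), Q; 𝓘(ℝ, EP), P⟯} {g : C^∞⟮𝓘(ℝ, EP), P; 𝓘(ℝ, E'), Q⟯}
    (hf : L.PullbackExists f)
    (h1 : ∃ hk : L.PullbackExists (f.comp g), IsQuasiIso D (D.pullback hk) (pullbackForm hk W))
    (h2 : ∃ hk : (LieAlgebroid.pullback hf).PullbackExists (g.comp f),
      IsQuasiIso (D.pullback hf) ((D.pullback hf).pullback hk) (pullbackForm hk (W.pullback f))) :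
    IsQuasiIso D (D.pullback hf) (pullbackForm hf W) := by
  obtain ⟨hk, hq⟩ := h1
  have hg : (LieAlgebroid.pullback hf).PullbackExists g := (pullbackExists_iterated_iff hf).2 hk
  exact IsQuasiIso.of_comp_of_injective (D.isChainMap_pullback hf)
    ((D.pullback hf).isChainMap_pullback hg)
    (fun k μ hμ h => (D.pullback hf).mem_exact_of_comp hg h2 hμ h)
    ((D.isQuasiIso_iterated_iff hf hg rfl hk).2 hq)

end AlgebroidConnection
end Homotopy

/-! ### Transitive Lie algebroids -/

section Transitive

variable {E : Type*} [NormedAddCommGroup E] [NormedSpace ℝ E] [FiniteDimensional ℝ E]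
  {H : Type*} [TopologicalSpace H] {I : ModelWithCorners ℝ E H}
  {M : Type*} [TopologicalSpace M] [ChartedSpace H M] [IsManifold I ∞ M] [T2Space M]
  {A : M → Type*} [∀ x, AddCommGroup (A x)] [∀ x, Module ℝ (A x)]
  {V : SmoothVectorBundle I M A} {L : LieAlgebroid V}
  {E' : Type*} [NormedAddCommGroup E'] [NormedSpace ℝ E'] [FiniteDimensional ℝ E']
  {H' : Type*} [TopologicalSpace H'] {I' : ModelWithCorners ℝ E' H'}
  {Q : Type*} [TopologicalSpace Q] [ChartedSpace H' Q] [IsManifold I' ∞ Q] [T2Space Q]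

/-- Local sections glue by a partition of unity, within any convex condition of the form
`T s = z` with `T` linear. -/
theorem SmoothVectorBundle.exists_section_of_local [SigmaCompactSpace M]
    (V : SmoothVectorBundle I M A) {Z : M → Type*} [∀ x, AddCommGroup (Z x)] [∀ x, Module ℝ (Z x)]
    (T : ∀ x, A x →ₗ[ℝ] Z x) (z : ∀ x, Z x)
    (h : ∀ x, ∃ s : V.sections, ∀ᶠ y in 𝓝 x, T y (s.1 y) = z y) :
    ∃ s : V.sections, ∀ x, T x (s.1 x) = z x := by
  choose s hs using h
  choose U hU hUo hxU using fun x => eventually_nhds_iff.1 (hs x)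
  obtain ⟨ρ, hρ⟩ := SmoothPartitionOfUnity.exists_isSubordinate I isClosed_univ U hUo
    fun x _ => mem_iUnion.2 ⟨x, hxU x⟩
  have hmem : (fun x => ∑ i ∈ ρ.finsupport x, ρ i x • (s i).1 x) ∈ V.sections := by
    refine V.mem_of_locally _ fun x => ⟨_, (∑ i ∈ ρ.fintsupport x, ρ i • s i).2, ?_⟩
    filter_upwards [ρ.eventually_finsupport_subset x] with y hy
    rw [sections_sum_apply]
    refine Finset.sum_subset hy fun i _ hi => ?_
    have : ρ i y = 0 := by simpa [ρ.mem_finsupport] using hi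
    rw [this, zero_smul]
  refine ⟨⟨_, hmem⟩, fun x => ?_⟩
  rw [map_sum]
  refine Eq.trans (Finset.sum_congr rfl fun i hi => ?_)
    ((Finset.sum_smul (f := fun i => ρ i x) (x := z x)).symm.trans ?_)
  · rw [map_smul, hU i x (hρ i (subset_tsupport _ ((ρ.mem_finsupport x).1 hi)))]
  · rw [ρ.sum_finsupport x (mem_univ x), one_smul]

namespace LieAlgebroid

/-- Every vector field is the anchor of a section of a transitive Lie algebroid. -/
theorem IsTransitive.exists_lift [SigmaCompactSpace M] (hL : L.IsTransitive)
    (X : (tangent I M).sections) : ∃ a : V.sections, L.anchorSection a = X := by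
  obtain ⟨a, ha⟩ := V.exists_section_of_local L.anchor X.1 fun x => by
    let b : Module.Basis _ ℝ (TangentSpace I x) := Module.finBasis ℝ E
    choose v hv using fun i => hL x (b i)
    choose s hs using fun i => V.exists_section x (v i)
    have hb : (fun i => (L.anchorSection (s i)).1 x) = b := funext fun i => by
      rw [anchorSection_apply, hs, hv]
    obtain ⟨h, hh⟩ := ((tangent I M).frame_of_basis (fun i => L.anchorSection (s i)) x
      (hb ▸ b.linearIndependent) (hb ▸ b.span_eq.ge)).2 X
    refine ⟨∑ i, h i • s i, hh.mono fun y hy => ?_⟩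
    rw [hy, sections_sum_apply, map_sum]
    exact Finset.sum_congr rfl fun i _ => map_smul _ _ _
  exact ⟨a, Subtype.ext (funext ha)⟩

/-- A transitive Lie algebroid can be pulled back along every smooth map. -/
theorem IsTransitive.pullbackExists (hL : L.IsTransitive) (h : C^∞⟮I', Q; I, M⟯) :
    L.PullbackExists h := by
  have hrank : ∀ q, Module.finrank ℝ (L.pullbackFiber h q) + Module.finrank ℝ E =
      Module.finrank ℝ E' + Module.finrank ℝ (A (h q)) := fun q => by
    have hA := V.finiteDimensional_fiber (h q)
    have hT : FiniteDimensional ℝ (TangentSpace I' q) := inferInstanceAs (FiniteDimensional ℝ E')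
    let T : TangentSpace I' q × A (h q) →ₗ[ℝ] TangentSpace I (h q) :=
      LinearMap.coprod (mfderiv I' I h q).toLinearMap (-L.anchor (h q))
    have hker : L.pullbackFiber h q = LinearMap.ker T := by
      ext p
      rw [LinearMap.mem_ker, mem_pullbackFiber]
      exact sub_eq_zero.symm.trans (by rw [sub_eq_add_neg]; rfl)
    have hrange : LinearMap.range T = ⊤ := LinearMap.range_eq_top.2 fun v => by
      obtain ⟨a, ha⟩ := hL (h q) (-v)
      exact ⟨(0, a), by simp [T, ha]⟩
    have := T.finrank_range_add_finrank_ker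
    rw [hrange, finrank_top, Module.finrank_prod, ← hker] at this
    rw [add_comm]
    exact this
  intro q
  filter_upwards [h.contMDiff.continuous.continuousAt.eventually (V.eventually_finrank_eq (h q))]
    with q' hq'
  have h1 := hrank q
  have h2 := hrank q'
  omega

theorem IsTransitive.pullback (hL : L.IsTransitive) {h : C^∞⟮I', Q; I, M⟯}
    (hh : L.PullbackExists h) : (LieAlgebroid.pullback hh).IsTransitive := fun q v => by
  obtain ⟨a, ha⟩ := hL (h q) (mfderiv I' I h q v)
  exact ⟨⟨(v, a), ha.symm⟩, rfl⟩

end LieAlgebroid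
end Transitive

section TimeField

variable {EP : Type*} [NormedAddCommGroup EP] [NormedSpace ℝ EP] [FiniteDimensional ℝ EP]
  {P : Type*} [TopologicalSpace P] [ChartedSpace EP P] [IsManifold 𝓘(ℝ, EP) ∞ P] [T2Space P]
  {J : TopologicalSpace.Opens ℝ}

/-- The unit vector field on `J` is smooth. -/
theorem contMDiff_unitSection (J : TopologicalSpace.Opens ℝ) : ContMDiff 𝓘(ℝ, ℝ) 𝓘(ℝ, ℝ).tangent ∞
    fun t : ↥J => (⟨t, (1 : ℝ)⟩ : TangentBundle 𝓘(ℝ, ℝ) ↥J) := by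
  intro t₀
  refine (Bundle.contMDiffAt_section t₀).2 ?_
  refine (contMDiffAt_const (c := (1 : ℝ))).congr_of_eventuallyEq (.of_forall fun t => ?_)
  -- all charts of `J` are the inclusion into `ℝ`
  have h1 : achart ℝ t = achart ℝ t₀ := rfl
  change (tangentBundleCore 𝓘(ℝ, ℝ) ↥J).coordChange (achart ℝ t) (achart ℝ t₀) t (1 : ℝ) = 1
  rw [h1]
  exact (tangentBundleCore 𝓘(ℝ, ℝ) ↥J).coordChange_self _ _ (mem_chart_source ℝ t) _

/-- The vector field `∂_t` on `J × P` is smooth. -/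
theorem timeVec_mem : (fun p : ↥J × P => timeVec (EP := EP) p) ∈
    (tangent (𝓘(ℝ, ℝ).prod 𝓘(ℝ, EP)) (↥J × P)).sections := by
  have h1 := (contMDiff_unitSection J).comp
    (contMDiff_fst (I := 𝓘(ℝ, ℝ)) (J := 𝓘(ℝ, EP)) (M := ↥J) (N := P))
  have h2 := (Bundle.contMDiff_zeroSection ℝ (fun x : P => TangentSpace 𝓘(ℝ, EP) x)
    (IB := 𝓘(ℝ, EP)) (n := ∞) (F := EP)).comp
    (contMDiff_snd (I := 𝓘(ℝ, ℝ)) (J := 𝓘(ℝ, EP)) (M := ↥J) (N := P))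
  exact (contMDiff_equivTangentBundleProd_symm (n := ∞) (I := 𝓘(ℝ, ℝ)) (M := ↥J)
    (I' := 𝓘(ℝ, EP)) (M' := P)).comp (h1.prodMk h2)

variable {A : P → Type*} [∀ x, AddCommGroup (A x)] [∀ x, Module ℝ (A x)]
  {V : SmoothVectorBundle 𝓘(ℝ, EP) P A} {L : LieAlgebroid V}

/-- Every homotopy is liftable for a transitive Lie algebroid. -/
theorem LieAlgebroid.IsTransitive.liftsHomotopy [SigmaCompactSpace P] (hL : L.IsTransitive)
    (φ : C^∞⟮𝓘(ℝ, ℝ).prod 𝓘(ℝ, EP), ↥J × P; 𝓘(ℝ, EP), P⟯) : L.LiftsHomotopy φ := by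
  have : LocallyCompactSpace ↥J := J.isOpen.locallyCompactSpace
  have : SigmaCompactSpace ↥J := inferInstance
  obtain ⟨a, ha⟩ := (hL.pullback (hL.pullbackExists φ)).exists_lift ⟨_, timeVec_mem⟩
  exact ⟨hL.pullbackExists φ, a.1, a.2, fun p => congrArg (fun X => X.1 p) ha⟩

end TimeField

/-! ### The cohomology ring -/

theorem Form.wedgeAt_compLinearMap {A A' G : Type*} [AddCommGroup A] [Module ℝ A] [AddCommGroup A']
    [Module ℝ A'] [AddCommGroup G] [Module ℝ G] {k l : ℕ} (α : A [⋀^Fin k]→ₗ[ℝ] ℝ)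
    (β : A [⋀^Fin l]→ₗ[ℝ] G) (p : A' →ₗ[ℝ] A) :
    (wedgeAt α β).compLinearMap p = wedgeAt (α.compLinearMap p) (β.compLinearMap p) := by
  ext v
  rw [AlternatingMap.compLinearMap_apply, wedgeAt_apply, wedgeAt_apply]
  rfl

section Cup

variable {E₁ : Type*} [NormedAddCommGroup E₁] [NormedSpace ℝ E₁] [FiniteDimensional ℝ E₁]
  {H₁ : Type*} [TopologicalSpace H₁] {I₁ : ModelWithCorners ℝ E₁ H₁}
  {M₁ : Type*} [TopologicalSpace M₁] [ChartedSpace H₁ M₁] [IsManifold I₁ ∞ M₁] [T2Space M₁]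
  {A₁ : M₁ → Type*} [∀ x, AddCommGroup (A₁ x)] [∀ x, Module ℝ (A₁ x)]
  {G₁ : M₁ → Type*} [∀ x, AddCommGroup (G₁ x)] [∀ x, Module ℝ (G₁ x)]
  {V₁ : SmoothVectorBundle I₁ M₁ A₁} {W₁ : SmoothVectorBundle I₁ M₁ G₁}
  {L₁ : LieAlgebroid V₁} {D₁ : AlgebroidConnection L₁ W₁}
  {E₂ : Type*} [NormedAddCommGroup E₂] [NormedSpace ℝ E₂] [FiniteDimensional ℝ E₂]
  {H₂ : Type*} [TopologicalSpace H₂] {I₂ : ModelWithCorners ℝ E₂ H₂}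
  {M₂ : Type*} [TopologicalSpace M₂] [ChartedSpace H₂ M₂] [IsManifold I₂ ∞ M₂] [T2Space M₂]
  {A₂ : M₂ → Type*} [∀ x, AddCommGroup (A₂ x)] [∀ x, Module ℝ (A₂ x)]
  {G₂ : M₂ → Type*} [∀ x, AddCommGroup (G₂ x)] [∀ x, Module ℝ (G₂ x)]
  {V₂ : SmoothVectorBundle I₂ M₂ A₂} {W₂ : SmoothVectorBundle I₂ M₂ G₂}
  {L₂ : LieAlgebroid V₂} {D₂ : AlgebroidConnection L₂ W₂}

namespace AlgebroidConnection

/-- Maps in cohomology that are induced by maps of forms compatible with the exterior product are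
compatible with the cup product. -/
theorem map_cup {P : ∀ k, Form V₁ (trivialLine I₁ M₁) k →ₗ[ℝ] Form V₂ (trivialLine I₂ M₂) k}
    {Q : ∀ k, Form V₁ W₁ k →ₗ[ℝ] Form V₂ W₂ k}
    {Φ : ∀ k, (canonical L₁).Cohomology k ≃ₗ[ℝ] (canonical L₂).Cohomology k}
    {Ψ : ∀ k, D₁.Cohomology k ≃ₗ[ℝ] D₂.Cohomology k}
    (hΦ : ∀ k (μ : (canonical L₁).closed k), ∃ h : P k μ.1 ∈ (canonical L₂).closed k,
      Φ k ((canonical L₁).toCohomology k μ) = (canonical L₂).toCohomology k ⟨_, h⟩)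
    (hΨ : ∀ k (μ : D₁.closed k), ∃ h : Q k μ.1 ∈ D₂.closed k,
      Ψ k (D₁.toCohomology k μ) = D₂.toCohomology k ⟨_, h⟩)
    (hPQ : ∀ {k l} (μ : Form V₁ (trivialLine I₁ M₁) k) (ν : Form V₁ W₁ l),
      Q (k + l) (Form.wedge μ ν) = Form.wedge (P k μ) (Q l ν)) (k l : ℕ)
    (x : (canonical L₁).Cohomology k) (y : D₁.Cohomology l) :
    Ψ (k + l) (D₁.cup k l x y) = D₂.cup k l (Φ k x) (Ψ l y) := by
  obtain ⟨μ, rfl⟩ := Submodule.Quotient.mk_surjective _ x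
  obtain ⟨ν, rfl⟩ := Submodule.Quotient.mk_surjective _ y
  obtain ⟨a, ea⟩ := hΦ k μ
  obtain ⟨b, eb⟩ := hΨ l ν
  obtain ⟨c, ec⟩ := hΨ (k + l) ⟨_, D₁.wedge_mem_closed μ.2 ν.2⟩
  refine ec.trans (Eq.trans ?_ (congrArg₂ (fun x y => D₂.cup k l x y) ea eb).symm)
  exact congrArg _ (Subtype.ext (hPQ μ.1 ν.1))

end AlgebroidConnection
end Cup

section Scalar

variable {E : Type*} [NormedAddCommGroup E] [NormedSpace ℝ E] [FiniteDimensional ℝ E]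
  {H : Type*} [TopologicalSpace H] {I : ModelWithCorners ℝ E H}
  {M : Type*} [TopologicalSpace M] [ChartedSpace H M] [IsManifold I ∞ M] [T2Space M]
  {E' : Type*} [NormedAddCommGroup E'] [NormedSpace ℝ E'] [FiniteDimensional ℝ E']
  {H' : Type*} [TopologicalSpace H'] {I' : ModelWithCorners ℝ E' H'}
  {N : Type*} [TopologicalSpace N] [ChartedSpace H' N] [IsManifold I' ∞ N] [T2Space N]
  {A : N → Type*} [∀ x, AddCommGroup (A x)] [∀ x, Module ℝ (A x)]
  {G : N → Type*} [∀ x, AddCommGroup (G x)] [∀ x, Module ℝ (G x)]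
  {V : SmoothVectorBundle I' N A} {L : LieAlgebroid V} {W : SmoothVectorBundle I' N G}
  {f : C^∞⟮I, M; I', N⟯}

/-- The constant section `1` of the trivial line bundle. -/
def oneSection (I : ModelWithCorners ℝ E H) (M : Type*) [TopologicalSpace M] [ChartedSpace H M] :
    (trivialLine I M).sections := ⟨fun _ => 1, contMDiff_const⟩

/-- The fibres are definitionally `ℝ` on both sides. -/
theorem trivialLine_pullback_eq (f : C^∞⟮I, M; I', N⟯) :
    trivialLine I M = (trivialLine I' N).pullback f :=
  SmoothVectorBundle.ext_sections (Submodule.ext fun s =>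
    ⟨fun hs _ => ⟨(⟨s, hs⟩ : SmoothFun I M) ⊗ₜ oneSection I' N, .of_forall fun m =>
      (mul_one (s m)).symm⟩, trivialLine_pullback_smooth⟩)

namespace AlgebroidConnection

open LieAlgebroid

theorem canonical_oneSection (a : V.sections) (x : N) :
    ((canonical L).toFun a (oneSection I' N)).1 x = (0 : ℝ) :=
  congrArg (fun l => l (L.anchor x (a.1 x)))
    (SmoothFun.d_const 1 (h := ⟨fun _ => 1, contMDiff_const⟩) (.of_forall fun _ => rfl))

theorem isFlat_canonical (L : LieAlgebroid V) : (canonical L).IsFlat := by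
  intro a b e
  ext x
  exact sub_eq_zero.2 (L.anchor_bracket a b (Form.toFun e) x).symm

/-- The canonical connection of `f^{!!}A` is the pullback of the canonical connection of `A`. -/
theorem canonical_pullback_toFun (hf : L.PullbackExists f) (σ : (pullbackBundle hf).sections)
    (s' : (trivialLine I M).sections) (s : ((trivialLine I' N).pullback f).sections)
    (hs : s'.1 = s.1) (m : M) :
    ((canonical (LieAlgebroid.pullback hf)).toFun σ s').1 m =
      (((canonical L).pullback hf).toFun σ s).1 m := by
  obtain ⟨a, ha⟩ := V.exists_section (f m) (σ.1 m).1.2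
  have h1 : s = Form.toFun s' • (trivialLine I' N).pullSection f (oneSection I' N) :=
    Subtype.ext (hs.symm.trans (funext fun m => (mul_one (s'.1 m)).symm))
  have h2 := ((canonical L).pullback hf).leibniz σ
    ((trivialLine I' N).pullSection f (oneSection I' N)) (Form.toFun s') m
  rw [← h1, (canonical L).pullback_toFun_pullSection hf ha, canonical_oneSection, smul_zero,
    zero_add] at h2
  exact (h2.trans (mul_one _)).symm

/-- `pullbackScalarForm` differs from `pullbackForm` only by the identification of the trivial line
bundle with its pullback. -/
theorem isQuasiIso_pullbackScalarForm (hf : L.PullbackExists f)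
    (h : IsQuasiIso (canonical L) ((canonical L).pullback hf)
      (pullbackForm hf (trivialLine I' N))) :
    IsQuasiIso (canonical L) (canonical (LieAlgebroid.pullback hf)) (pullbackScalarForm hf) := by
  have h1 := isQuasiIso_compMap (D := (canonical L).pullback hf)
    (D' := canonical (LieAlgebroid.pullback hf)) (R := fun m => LinearEquiv.refl ℝ _)
    (fun a => a.2) (trivialLine_pullback_eq f) (fun a b x => rfl)
    (canonical_pullback_toFun hf)
  exact h1.comp h

/-- The pullback of forms is multiplicative. -/
theorem pullbackForm_wedge (hf : L.PullbackExists f) {k l : ℕ} (μ : Form V (trivialLine I' N) k)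
    (ν : Form V W l) : pullbackForm hf W (k + l) (Form.wedge μ ν) =
      Form.wedge (pullbackScalarForm hf k μ) (pullbackForm hf W l ν) :=
  Subtype.ext (funext fun m => Form.wedgeAt_compLinearMap (μ.1 (f m)) (ν.1 (f m))
      (L.projection f m))

theorem pullbackScalarForm_wedge (hf : L.PullbackExists f) {k l : ℕ}
    (μ : Form V (trivialLine I' N) k) (ν : Form V (trivialLine I' N) l) :
    pullbackScalarForm hf (k + l) (Form.wedge μ ν) =
      Form.wedge (pullbackScalarForm hf k μ) (pullbackScalarForm hf l ν) :=
  Subtype.ext (funext fun m => Form.wedgeAt_compLinearMap (μ.1 (f m)) (ν.1 (f m))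
      (L.projection f m))

/-- If the pullback of scalar and of vector valued forms are quasi-isomorphisms, then they induce an
isomorphism of the cohomology rings and a compatible isomorphism of modules. -/
theorem exists_cohomology_equiv (D : AlgebroidConnection L W) (hf : L.PullbackExists f)
    (h1 : IsQuasiIso (canonical L) ((canonical L).pullback hf)
      (pullbackForm hf (trivialLine I' N)))
    (h2 : IsQuasiIso D (D.pullback hf) (pullbackForm hf W)) :
    ∃ (Φ : ∀ k, (canonical L).Cohomology k ≃ₗ[ℝ]
        (canonical (LieAlgebroid.pullback hf)).Cohomology k)
      (Ψ : ∀ k, D.Cohomology k ≃ₗ[ℝ] (D.pullback hf).Cohomology k),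
      (∀ k (μ : (canonical L).closed k),
        ∃ h : pullbackScalarForm hf k μ.1 ∈ (canonical (LieAlgebroid.pullback hf)).closed k,
          Φ k ((canonical L).toCohomology k μ) =
            (canonical (LieAlgebroid.pullback hf)).toCohomology k ⟨_, h⟩) ∧
      (∀ k (μ : D.closed k), ∃ h : pullbackForm hf _ k μ.1 ∈ (D.pullback hf).closed k,
        Ψ k (D.toCohomology k μ) = (D.pullback hf).toCohomology k ⟨_, h⟩) ∧
      Φ 0 (unit L) = unit (LieAlgebroid.pullback hf) ∧
      (∀ k l x y, Φ (k + l) ((canonical L).cup k l x y) =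
        (canonical (LieAlgebroid.pullback hf)).cup k l (Φ k x) (Φ l y)) ∧
      (∀ k l x y, Ψ (k + l) (D.cup k l x y) = (D.pullback hf).cup k l (Φ k x) (Ψ l y)) := by
  obtain ⟨Φ, hΦ⟩ := IsQuasiIso.exists_equiv (isQuasiIso_pullbackScalarForm hf h1)
  have h3 := IsQuasiIso.exists_equiv (D₁ := D) (D₂ := D.pullback hf)
    (P := pullbackForm hf W) h2
  obtain ⟨Ψ, hΨ⟩ := h3
  refine ⟨Φ, Ψ, hΦ, hΨ, ?_, map_cup hΦ hΦ (pullbackScalarForm_wedge hf),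
    map_cup hΦ hΨ (pullbackForm_wedge hf)⟩
  obtain ⟨h, e⟩ := hΦ 0 _
  exact e

end AlgebroidConnection
end Scalar

/-! ### Smooth homotopy equivalences -/

section HomotopyEquivalence

variable {EM : Type*} [NormedAddCommGroup EM] [NormedSpace ℝ EM] [FiniteDimensional ℝ EM]
  {M : Type*} [TopologicalSpace M] [ChartedSpace EM M] [IsManifold 𝓘(ℝ, EM) ∞ M] [T2Space M]
  {EN : Type*} [NormedAddCommGroup EN] [NormedSpace ℝ EN] [FiniteDimensional ℝ EN]
  {N : Type*} [TopologicalSpace N] [ChartedSpace EN N] [IsManifold 𝓘(ℝ, EN) ∞ N] [T2Space N]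
  {J : TopologicalSpace.Opens ℝ}
  {A : N → Type*} [∀ x, AddCommGroup (A x)] [∀ x, Module ℝ (A x)]
  {G : N → Type*} [∀ x, AddCommGroup (G x)] [∀ x, Module ℝ (G x)]
  {V : SmoothVectorBundle 𝓘(ℝ, EN) N A} {W : SmoothVectorBundle 𝓘(ℝ, EN) N G}
  {L : LieAlgebroid V}

/-- The pullback along a smooth homotopy equivalence is a quasi-isomorphism if `∂_t` lifts to the
pullbacks along both homotopies. -/
theorem AlgebroidConnection.isQuasiIso_of_homotopyEquivalence (D : AlgebroidConnection L W)
    (hD : D.IsFlat) (hJ : (J : Set ℝ).OrdConnected)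
    {f : C^∞⟮𝓘(ℝ, EM), M; 𝓘(ℝ, EN), N⟯} {g : C^∞⟮𝓘(ℝ, EN), N; 𝓘(ℝ, EM), M⟯}
    {η : C^∞⟮𝓘(ℝ, ℝ).prod 𝓘(ℝ, EM), ↥J × M; 𝓘(ℝ, EM), M⟯} {t₀ t₁ : ↥J}
    (hη0 : ∀ x : M, η (t₀, x) = x) (hη1 : ∀ x : M, η (t₁, x) = g (f x))
    {φ : C^∞⟮𝓘(ℝ, ℝ).prod 𝓘(ℝ, EN), ↥J × N; 𝓘(ℝ, EN), N⟯}
    (hφ0 : ∀ x : N, φ (t₀, x) = x) (hφ1 : ∀ x : N, φ (t₁, x) = f (g x))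
    (hf : L.PullbackExists f) (hφ : L.LiftsHomotopy φ)
    (hη : (LieAlgebroid.pullback hf).LiftsHomotopy η) :
    IsQuasiIso D (D.pullback hf) (LieAlgebroid.pullbackForm hf W) :=
  D.isQuasiIso_of_homotopyInverse hf
    (D.exists_isQuasiIso_of_liftsHomotopy hD hJ hφ (ContMDiffMap.ext hφ0) (ContMDiffMap.ext hφ1))
    ((D.pullback hf).exists_isQuasiIso_of_liftsHomotopy (D.isFlat_pullback hf hD) hJ hη
      (ContMDiffMap.ext hη0) (ContMDiffMap.ext hη1))

end HomotopyEquivalence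

theorem theorem5p1
    {EM : Type*} [NormedAddCommGroup EM] [NormedSpace ℝ EM] [FiniteDimensional ℝ EM]
    {M : Type*} [TopologicalSpace M] [ChartedSpace EM M] [IsManifold 𝓘(ℝ, EM) ∞ M]
    [T2Space M] [SigmaCompactSpace M]
    {EN : Type*} [NormedAddCommGroup EN] [NormedSpace ℝ EN] [FiniteDimensional ℝ EN]
    {N : Type*} [TopologicalSpace N] [ChartedSpace EN N] [IsManifold 𝓘(ℝ, EN) ∞ N]
    [T2Space N] [SigmaCompactSpace N]
    -- an open interval containing `0` and `1`, and a smooth homotopy equivalence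
    (J : TopologicalSpace.Opens ℝ) (hJ : (J : Set ℝ).OrdConnected)
    (h0 : (0 : ℝ) ∈ J) (h1 : (1 : ℝ) ∈ J)
    (f : C^∞⟮𝓘(ℝ, EM), M; 𝓘(ℝ, EN), N⟯) (g : C^∞⟮𝓘(ℝ, EN), N; 𝓘(ℝ, EM), M⟯)
    (η : C^∞⟮𝓘(ℝ, ℝ).prod 𝓘(ℝ, EM), ↥J × M; 𝓘(ℝ, EM), M⟯)
    (hη0 : ∀ x : M, η (⟨0, h0⟩, x) = x) (hη1 : ∀ x : M, η (⟨1, h1⟩, x) = g (f x))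
    (φ : C^∞⟮𝓘(ℝ, ℝ).prod 𝓘(ℝ, EN), ↥J × N; 𝓘(ℝ, EN), N⟯)
    (hφ0 : ∀ x : N, φ (⟨0, h0⟩, x) = x) (hφ1 : ∀ x : N, φ (⟨1, h1⟩, x) = f (g x))
    -- a Lie algebroid `B → N`
    {FB : Type*} [NormedAddCommGroup FB] [NormedSpace ℝ FB] [FiniteDimensional ℝ FB]
    {B : N → Type*} [∀ x, AddCommGroup (B x)] [∀ x, Module ℝ (B x)]
    [TopologicalSpace (Bundle.TotalSpace FB B)] [∀ x, TopologicalSpace (B x)]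
    [FiberBundle FB B] [VectorBundle ℝ FB B] [ContMDiffVectorBundle ∞ FB B 𝓘(ℝ, EN)]
    (L : LieAlgebroid (SmoothVectorBundle.ofBundle 𝓘(ℝ, EN) FB B))
    -- a representation of `B` on a vector bundle `G → N`
    {FG : Type*} [NormedAddCommGroup FG] [NormedSpace ℝ FG] [FiniteDimensional ℝ FG]
    {G : N → Type*} [∀ x, AddCommGroup (G x)] [∀ x, Module ℝ (G x)]
    [TopologicalSpace (Bundle.TotalSpace FG G)] [∀ x, TopologicalSpace (G x)]
    [FiberBundle FG G] [VectorBundle ℝ FG G] [ContMDiffVectorBundle ∞ FG G 𝓘(ℝ, EN)]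
    (D : AlgebroidConnection L (SmoothVectorBundle.ofBundle 𝓘(ℝ, EN) FG G)) (hD : D.IsFlat) :
    (L.IsTransitive → ∃ hf : L.PullbackExists f,
      L.LiftsHomotopy φ ∧ (LieAlgebroid.pullback hf).LiftsHomotopy η) ∧
    ∀ hf : L.PullbackExists f,
      L.LiftsHomotopy φ → (LieAlgebroid.pullback hf).LiftsHomotopy η →
      (D.pullback hf).IsFlat ∧
      ∃ (Φ : ∀ k, (AlgebroidConnection.canonical L).Cohomology k ≃ₗ[ℝ]
          (AlgebroidConnection.canonical (LieAlgebroid.pullback hf)).Cohomology k)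
        (Ψ : ∀ k, D.Cohomology k ≃ₗ[ℝ] (D.pullback hf).Cohomology k),
        -- `Φ` and `Ψ` are induced by the pullback of forms along `p : f^{!!}B → B`
        (∀ k (μ : (AlgebroidConnection.canonical L).closed k),
          ∃ h : LieAlgebroid.pullbackScalarForm hf k μ.1 ∈
              (AlgebroidConnection.canonical (LieAlgebroid.pullback hf)).closed k,
            Φ k ((AlgebroidConnection.canonical L).toCohomology k μ) =
              (AlgebroidConnection.canonical (LieAlgebroid.pullback hf)).toCohomology k ⟨_, h⟩) ∧
        (∀ k (μ : D.closed k),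
          ∃ h : LieAlgebroid.pullbackForm hf _ k μ.1 ∈ (D.pullback hf).closed k,
            Ψ k (D.toCohomology k μ) = (D.pullback hf).toCohomology k ⟨_, h⟩) ∧
        -- `Φ` is a morphism of rings and `Ψ` is a morphism of modules over `Φ`
        Φ 0 (AlgebroidConnection.unit L) = AlgebroidConnection.unit (LieAlgebroid.pullback hf) ∧
        (∀ k l x y, Φ (k + l) ((AlgebroidConnection.canonical L).cup k l x y) =
          (AlgebroidConnection.canonical (LieAlgebroid.pullback hf)).cup k l (Φ k x) (Φ l y)) ∧
        (∀ k l x y, Ψ (k + l) (D.cup k l x y) = (D.pullback hf).cup k l (Φ k x) (Ψ l y)) := by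
  refine ⟨fun hL => ⟨hL.pullbackExists f, hL.liftsHomotopy φ, (hL.pullback _).liftsHomotopy η⟩,
    fun hf hφ hη => ⟨D.isFlat_pullback hf hD, D.exists_cohomology_equiv hf ?_ ?_⟩⟩
  · exact (AlgebroidConnection.canonical L).isQuasiIso_of_homotopyEquivalence
      (AlgebroidConnection.isFlat_canonical L) hJ hη0 hη1 hφ0 hφ1 hf hφ hη
  · exact D.isQuasiIso_of_homotopyEquivalence hD hJ hη0 hη1 hφ0 hφ1 hf hφ hη

end
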